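/- Let $k$ be a field of characteristic $0$. Let $\mathcal H$ be Khovanov's Heisenberg category: the Karoubi envelope of the additive $k$-linear monoidal category generated by an upward strand $\mathsf P$ and a downward strand $\mathsf Q$, whose morphisms are $k$-linear combinations of oriented planar string diagrams, generated by the crossing of two upward strands and the four oriented cups and caps, modulo planar isotopy and the local relations: two strands of the same orientation that cross twice can be pulled apart; the braid relation for three strands of the same orientation; the double crossing $\mathsf P\mathsf Q\to\mathsf Q\mathsf P\to\mathsf P\mathsf Q$ is the identity; the double crossing $\mathsf Q\mathsf P\to\mathsf P\mathsf Q\to\mathsf Q\mathsf P$ is the identity minus the cap $\mathsf Q\mathsf P\to\mathbf 1$ followed by the cup $\mathbf 1\to\mathsf Q\mathsf P$; a counterclockwise circle equals $1$; a left curl equals $0$. Let $\mathcal K(\mathcal H)$ be the homotopy category of chain complexes over $\mathcal H$. The symmetric group $S_n$ acts on $\mathsf P^{\otimes n}$ and on $\mathsf Q^{\otimes n}$. For a partition $\lambda\vdash n$ let $e_\lambda\in k[S_n]$ be the Young idempotent of the row reading tableau (the row symmetrizer times the column antisymmetrizer, normalized), and let $\mathsf P^\lambda$, $\mathsf Q^\lambda$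 be its images. If $\nu$ is obtained from $\mu$ by adding a box, let $\iota:\mathsf P^{\nu}\to\mathsf P^{\mu}\mathsf P$ and $\iota:\mathsf Q^{\nu}\to\mathsf Q\mathsf Q^{\mu}$ be the maps that apply $e_\nu$, move the strand of the new box past the others to the far right (for $\mathsf P$) or to the far left (for $\mathsf Q$), and apply $e_\mu$ to the other strands; let $\rho:\mathsf P^{\mu}\mathsf P\to\mathsf P^{\nu}$ and $\rho:\mathsf Q\mathsf Q^{\mu}\to\mathsf Q^{\nu}$ be the maps obtained by doing the reverse. For units $\varepsilon(\mu,\nu)\in k^\times$, let $\Sigma^-$ have $\bigoplus_{\lambda\vdash n}\mathsf P^\lambda\mathsf Q^{\lambda^t}$ in homological degree $n\ge 0$ and differential $d^-$ with components $$\mathsf P^{\nu}\mathsf Q^{\nu^t}\xrightarrow{\ \varepsilon(\mu,\nu)\,\iota\otimes\iota\ }\mathsf P^{\mu}\mathsf P\mathsf Q\mathsf Q^{\mu^t}\xrightarrow{\ 1\otimes\mathrm{cap}\otimes 1\ }\mathsf P^{\mu}\mathsf Q^{\mu^t},$$ and let $\Sigma^+$ have $\bigoplus_{\lambda\vdash n}\mathsf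 P^\lambda\mathsf Q^{\lambda^t}$ in homological degree $-n\le 0$ and differential $d^+$ with components $$\mathsf P^{\mu}\mathsf Q^{\mu^t}\xrightarrow{\ 1\otimes\mathrm{cup}\otimes 1\ }\mathsf P^{\mu}\mathsf P\mathsf Q\mathsf Q^{\mu^t}\xrightarrow{\ \varepsilon(\mu,\nu)\,\rho\otimes\rho\ }\mathsf P^{\nu}\mathsf Q^{\nu^t},$$ one component for every $\nu$ obtained by adding a box to $\mu$. **Theorem.** (0) There are signs $\varepsilon(\mu,\nu)\in\{1,-1\}$ for which both $d^-$ and $d^+$ square to zero. (1) For all units $\varepsilon$ with $(d^-)^2=0$, respectively $(d^+)^2=0$, and for every nontrivial partition $\lambda$ (that is, $\lambda\vdash n$ with $n>0$), the complexes $\Sigma^-\mathsf P^\lambda$ and $\mathsf Q^\lambda\Sigma^-$, respectively $\Sigma^+\mathsf P^\lambda$ and $\mathsf Q^\lambda\Sigma^+$, are zero objects of $\mathcal K(\mathcal H)$. (2) For all such $\varepsilon$, $\Sigma^\pm$ are categorical projectors for Fock space, in the following sense. There is a chain map $\eta:\mathbf 1\to\Sigma^-$, respectively $\eta:\Sigma^+\to\mathbf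 1$, where $\mathbf 1$ is concentrated in degree $0$, such that: $\eta$ is an isomorphism in degree $0$; $\eta\otimes\mathrm{id}_\Sigma$ and $\mathrm{id}_\Sigma\otimes\eta$ are isomorphisms in $\mathcal K(\mathcal H)$ for $\Sigma=\Sigma^-$, respectively $\Sigma=\Sigma^+$, so that $\Sigma\otimes\Sigma\cong\Sigma$ in $\mathcal K(\mathcal H)$; and $\eta$ becomes an isomorphism in $\mathcal K(\mathcal H_0)$, where $\mathcal H_0$, the universal categorical Fock space, is the quotient of $\mathcal H$ by the ideal of all morphisms that factor through $M\otimes\mathsf Q$ for some object $M$. -/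

import Mathlib

open CategoryTheory MonoidalCategory Limits

universe u

/-! ### The diagrammatic category on words in two generators -/

/-- Objects: formal tensor words in the upward strand `up` (that is `Q₊`) and the downward
strand `down` (that is `Q₋`). -/
inductive HeisWord : Type
  | unit : HeisWord
  | up : HeisWord
  | down : HeisWord
  | tensor : HeisWord → HeisWord → HeisWord

/-- Formal `k`-linear combinations of string diagrams (read from bottom to top, `comp f g` puts
`g` on top of `f`), generated by the upward crossing and the four oriented cups and caps. -/
inductive HeisDiagram (k : Type u) : HeisWord → HeisWord → Type u
  | id (X : HeisWord) : HeisDiagram k X X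
  | comp {X Y Z : HeisWord} (f : HeisDiagram k X Y) (g : HeisDiagram k Y Z) : HeisDiagram k X Z
  | whiskerLeft (X : HeisWord) {Y Z : HeisWord} (f : HeisDiagram k Y Z) : HeisDiagram k (X.tensor Y) (X.tensor Z)
  | whiskerRight {X Y : HeisWord} (f : HeisDiagram k X Y) (Z : HeisWord) : HeisDiagram k (X.tensor Z) (Y.tensor Z)
  | assocHom (X Y Z : HeisWord) : HeisDiagram k ((HeisWord.tensor X Y).tensor Z) (X.tensor (Y.tensor Z))
  | assocInv (X Y Z : HeisWord) : HeisDiagram k (HeisWord.tensor X (Y.tensor Z)) ((X.tensor Y).tensor Z)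
  | leftHom (X : HeisWord) : HeisDiagram k (HeisWord.unit.tensor X) X
  | leftInv (X : HeisWord) : HeisDiagram k X (HeisWord.unit.tensor X)
  | rightHom (X : HeisWord) : HeisDiagram k (HeisWord.tensor X .unit) X
  | rightInv (X : HeisWord) : HeisDiagram k X (X.tensor .unit)
  | zero (X Y : HeisWord) : HeisDiagram k X Y
  | add {X Y : HeisWord} (f g : HeisDiagram k X Y) : HeisDiagram k X Y
  | smul {X Y : HeisWord} (c : k) (f : HeisDiagram k X Y) : HeisDiagram k X Y
  | cross : HeisDiagram k (HeisWord.up.tensor .up) (HeisWord.up.tensor .up)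
  | capUD : HeisDiagram k (HeisWord.up.tensor .down) .unit
  | capDU : HeisDiagram k (HeisWord.down.tensor .up) .unit
  | cupUD : HeisDiagram k .unit (HeisWord.up.tensor .down)
  | cupDU : HeisDiagram k .unit (HeisWord.down.tensor .up)

namespace HeisDiagram

variable {k : Type u}

/-- The crossing of a downward strand (bottom left) with an upward strand (bottom right),
obtained by rotating the upward crossing. -/
def crossDU : HeisDiagram k (HeisWord.down.tensor .up) (HeisWord.up.tensor .down) :=
  (rightInv _).comp <| (whiskerLeft _ cupUD).comp <|
    (assocHom _ _ _).comp <| (whiskerLeft _ (assocInv _ _ _)).comp <|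
    (whiskerLeft .down (whiskerRight cross .down)).comp <|
    (whiskerLeft _ (assocHom _ _ _)).comp <| (assocInv _ _ _).comp <|
    (whiskerRight capDU _).comp (leftHom _)

/-- The crossing of an upward strand (bottom left) with a downward strand (bottom right). -/
def crossUD : HeisDiagram k (HeisWord.up.tensor .down) (HeisWord.down.tensor .up) :=
  (leftInv _).comp <| (whiskerRight cupDU _).comp <|
    (assocHom _ _ _).comp <| (whiskerLeft _ (assocInv _ _ _)).comp <|
    (whiskerLeft .down (whiskerRight cross .down)).comp <|
    (whiskerLeft _ (assocHom _ _ _)).comp <| (assocInv _ _ _).comp <|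
    (whiskerLeft _ capUD).comp (rightHom _)

/-- The downward crossing, as the sideways crossing `crossDU` rotated once more. -/
def crossDown : HeisDiagram k (HeisWord.down.tensor .down) (HeisWord.down.tensor .down) :=
  (rightInv _).comp <| (whiskerLeft _ cupUD).comp <|
    (assocHom _ _ _).comp <| (whiskerLeft _ (assocInv _ _ _)).comp <|
    (whiskerLeft .down (whiskerRight crossDU .down)).comp <|
    (whiskerLeft _ (assocHom _ _ _)).comp <| (assocInv _ _ _).comp <|
    (whiskerRight capDU _).comp (leftHom _)

/-- The downward crossing, obtained by rotating in the other direction. -/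
def crossDown' : HeisDiagram k (HeisWord.down.tensor .down) (HeisWord.down.tensor .down) :=
  (leftInv _).comp <| (whiskerRight cupDU _).comp <|
    (assocHom _ _ _).comp <| (whiskerLeft _ (assocInv _ _ _)).comp <|
    (whiskerLeft .down (whiskerRight crossUD .down)).comp <|
    (whiskerLeft _ (assocHom _ _ _)).comp <| (assocInv _ _ _).comp <|
    (whiskerLeft _ capUD).comp (rightHom _)

/-- An upward strand with a curl to its left. -/
def curl : HeisDiagram k HeisWord.up .up :=
  (leftInv _).comp <| (whiskerRight cupDU _).comp <| (assocHom _ _ _).comp <|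
    (whiskerLeft .down cross).comp <| (assocInv _ _ _).comp <|
    (whiskerRight capDU _).comp (leftHom _)

/-- The relations between diagrams: those of a `k`-linear monoidal category, isotopy invariance,
and the local relations of Khovanov's Heisenberg category. -/
inductive Rel [CommRing k] : ∀ {X Y : HeisWord}, HeisDiagram k X Y → HeisDiagram k X Y → Prop
  -- congruence
  | refl {X Y : HeisWord} (f : HeisDiagram k X Y) : Rel f f
  | symm {X Y : HeisWord} {f g : HeisDiagram k X Y} : Rel f g → Rel g f
  | trans {X Y : HeisWord} {f g h : HeisDiagram k X Y} : Rel f g → Rel g h → Rel f h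
  | comp {X Y Z : HeisWord} {f f' : HeisDiagram k X Y} {g g' : HeisDiagram k Y Z} :
      Rel f f' → Rel g g' → Rel (f.comp g) (f'.comp g')
  | whiskerLeft (X : HeisWord) {Y Z : HeisWord} {f f' : HeisDiagram k Y Z} :
      Rel f f' → Rel (f.whiskerLeft X) (f'.whiskerLeft X)
  | whiskerRight {X Y : HeisWord} {f f' : HeisDiagram k X Y} (Z : HeisWord) :
      Rel f f' → Rel (f.whiskerRight Z) (f'.whiskerRight Z)
  | add {X Y : HeisWord} {f f' g g' : HeisDiagram k X Y} :
      Rel f f' → Rel g g' → Rel (f.add g) (f'.add g')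
  | smul {X Y : HeisWord} (c : k) {f f' : HeisDiagram k X Y} : Rel f f' → Rel (f.smul c) (f'.smul c)
  -- category
  | id_comp {X Y : HeisWord} (f : HeisDiagram k X Y) : Rel ((id X).comp f) f
  | comp_id {X Y : HeisWord} (f : HeisDiagram k X Y) : Rel (f.comp (id Y)) f
  | assoc {W X Y Z : HeisWord} (f : HeisDiagram k W X) (g : HeisDiagram k X Y) (h : HeisDiagram k Y Z) :
      Rel ((f.comp g).comp h) (f.comp (g.comp h))
  -- monoidal category
  | whiskerLeft_id (X Y : HeisWord) : Rel ((id Y).whiskerLeft X) (id (X.tensor Y))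
  | id_whiskerRight (X Y : HeisWord) : Rel ((id X).whiskerRight Y) (id (X.tensor Y))
  | whiskerLeft_comp (W : HeisWord) {X Y Z : HeisWord} (f : HeisDiagram k X Y) (g : HeisDiagram k Y Z) :
      Rel ((f.comp g).whiskerLeft W) ((f.whiskerLeft W).comp (g.whiskerLeft W))
  | comp_whiskerRight {X Y Z : HeisWord} (f : HeisDiagram k X Y) (g : HeisDiagram k Y Z) (W : HeisWord) :
      Rel ((f.comp g).whiskerRight W) ((f.whiskerRight W).comp (g.whiskerRight W))
  | exchange {W X Y Z : HeisWord} (f : HeisDiagram k W X) (g : HeisDiagram k Y Z) :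
      Rel ((g.whiskerLeft W).comp (f.whiskerRight Z)) ((f.whiskerRight Y).comp (g.whiskerLeft X))
  | assoc_left {X X' : HeisWord} (f : HeisDiagram k X X') (Y Z : HeisWord) :
      Rel (((f.whiskerRight Y).whiskerRight Z).comp (assocHom X' Y Z))
        ((assocHom X Y Z).comp (f.whiskerRight (Y.tensor Z)))
  | assoc_mid (X : HeisWord) {Y Y' : HeisWord} (f : HeisDiagram k Y Y') (Z : HeisWord) :
      Rel (((f.whiskerLeft X).whiskerRight Z).comp (assocHom X Y' Z))
        ((assocHom X Y Z).comp ((f.whiskerRight Z).whiskerLeft X))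
  | assoc_right (X Y : HeisWord) {Z Z' : HeisWord} (f : HeisDiagram k Z Z') :
      Rel ((f.whiskerLeft (X.tensor Y)).comp (assocHom X Y Z'))
        ((assocHom X Y Z).comp ((f.whiskerLeft Y).whiskerLeft X))
  | left_nat {X Y : HeisWord} (f : HeisDiagram k X Y) :
      Rel ((f.whiskerLeft .unit).comp (leftHom Y)) ((leftHom X).comp f)
  | right_nat {X Y : HeisWord} (f : HeisDiagram k X Y) :
      Rel ((f.whiskerRight .unit).comp (rightHom Y)) ((rightHom X).comp f)
  | assoc_hom_inv (X Y Z : HeisWord) : Rel ((assocHom X Y Z).comp (assocInv X Y Z)) (id _)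
  | assoc_inv_hom (X Y Z : HeisWord) : Rel ((assocInv X Y Z).comp (assocHom X Y Z)) (id _)
  | left_hom_inv (X : HeisWord) : Rel ((leftHom X).comp (leftInv X)) (id _)
  | left_inv_hom (X : HeisWord) : Rel ((leftInv X).comp (leftHom X)) (id _)
  | right_hom_inv (X : HeisWord) : Rel ((rightHom X).comp (rightInv X)) (id _)
  | right_inv_hom (X : HeisWord) : Rel ((rightInv X).comp (rightHom X)) (id _)
  | pentagon (W X Y Z : HeisWord) :
      Rel (((assocHom W X Y).whiskerRight Z).comp
          ((assocHom W (X.tensor Y) Z).comp ((assocHom X Y Z).whiskerLeft W)))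
        ((assocHom (W.tensor X) Y Z).comp (assocHom W X (Y.tensor Z)))
  | triangle (X Y : HeisWord) :
      Rel ((assocHom X .unit Y).comp ((leftHom Y).whiskerLeft X)) ((rightHom X).whiskerRight Y)
  -- `k`-modules
  | add_assoc {X Y : HeisWord} (f g h : HeisDiagram k X Y) : Rel ((f.add g).add h) (f.add (g.add h))
  | add_comm {X Y : HeisWord} (f g : HeisDiagram k X Y) : Rel (f.add g) (g.add f)
  | zero_add {X Y : HeisWord} (f : HeisDiagram k X Y) : Rel ((zero X Y).add f) f
  | one_smul {X Y : HeisWord} (f : HeisDiagram k X Y) : Rel (f.smul 1) f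
  | mul_smul {X Y : HeisWord} (c d : k) (f : HeisDiagram k X Y) : Rel (f.smul (c * d)) ((f.smul d).smul c)
  | smul_add {X Y : HeisWord} (c : k) (f g : HeisDiagram k X Y) :
      Rel ((f.add g).smul c) ((f.smul c).add (g.smul c))
  | add_smul {X Y : HeisWord} (c d : k) (f : HeisDiagram k X Y) :
      Rel (f.smul (c + d)) ((f.smul c).add (f.smul d))
  | zero_smul {X Y : HeisWord} (f : HeisDiagram k X Y) : Rel (f.smul 0) (zero X Y)
  -- bilinearity
  | add_comp {X Y Z : HeisWord} (f f' : HeisDiagram k X Y) (g : HeisDiagram k Y Z) :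
      Rel ((f.add f').comp g) ((f.comp g).add (f'.comp g))
  | comp_add {X Y Z : HeisWord} (f : HeisDiagram k X Y) (g g' : HeisDiagram k Y Z) :
      Rel (f.comp (g.add g')) ((f.comp g).add (f.comp g'))
  | smul_comp {X Y Z : HeisWord} (c : k) (f : HeisDiagram k X Y) (g : HeisDiagram k Y Z) :
      Rel ((f.smul c).comp g) ((f.comp g).smul c)
  | comp_smul {X Y Z : HeisWord} (c : k) (f : HeisDiagram k X Y) (g : HeisDiagram k Y Z) :
      Rel (f.comp (g.smul c)) ((f.comp g).smul c)
  | whiskerLeft_add (X : HeisWord) {Y Z : HeisWord} (f g : HeisDiagram k Y Z) :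
      Rel ((f.add g).whiskerLeft X) ((f.whiskerLeft X).add (g.whiskerLeft X))
  | whiskerLeft_smul (X : HeisWord) {Y Z : HeisWord} (c : k) (f : HeisDiagram k Y Z) :
      Rel ((f.smul c).whiskerLeft X) ((f.whiskerLeft X).smul c)
  | add_whiskerRight {X Y : HeisWord} (f g : HeisDiagram k X Y) (Z : HeisWord) :
      Rel ((f.add g).whiskerRight Z) ((f.whiskerRight Z).add (g.whiskerRight Z))
  | smul_whiskerRight {X Y : HeisWord} (c : k) (f : HeisDiagram k X Y) (Z : HeisWord) :
      Rel ((f.smul c).whiskerRight Z) ((f.whiskerRight Z).smul c)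
  -- isotopy invariance: straightening of strands, cyclicity of the crossing
  | zigzag_up_left : Rel ((leftInv _).comp <| (cupUD.whiskerRight .up).comp <|
      (assocHom _ _ _).comp <| (capDU.whiskerLeft .up).comp (rightHom _)) (id .up)
  | zigzag_up_right : Rel ((rightInv _).comp <| (cupDU.whiskerLeft .up).comp <|
      (assocInv _ _ _).comp <| (capUD.whiskerRight .up).comp (leftHom _)) (id .up)
  | zigzag_down_left : Rel ((leftInv _).comp <| (cupDU.whiskerRight .down).comp <|
      (assocHom _ _ _).comp <| (capUD.whiskerLeft .down).comp (rightHom _)) (id .down)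
  | zigzag_down_right : Rel ((rightInv _).comp <| (cupUD.whiskerLeft .down).comp <|
      (assocInv _ _ _).comp <| (capDU.whiskerRight .down).comp (leftHom _)) (id .down)
  | cyclic : Rel crossDown crossDown'
  -- local relations
  | up_double : Rel (cross.comp cross) (id _)
  | up_triple :
      Rel ((cross.whiskerRight .up).comp <| (assocHom _ _ _).comp <|
          (cross.whiskerLeft .up).comp <| (assocInv _ _ _).comp (cross.whiskerRight .up))
        ((assocHom _ _ _).comp <| (cross.whiskerLeft .up).comp <| (assocInv _ _ _).comp <|
          (cross.whiskerRight .up).comp <| (assocHom _ _ _).comp <|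
          (cross.whiskerLeft .up).comp (assocInv _ _ _))
  | down_double : Rel (crossDown.comp crossDown) (id _)
  | down_triple :
      Rel ((crossDown.whiskerRight .down).comp <| (assocHom _ _ _).comp <|
          (crossDown.whiskerLeft .down).comp <| (assocInv _ _ _).comp (crossDown.whiskerRight .down))
        ((assocHom _ _ _).comp <| (crossDown.whiskerLeft .down).comp <| (assocInv _ _ _).comp <|
          (crossDown.whiskerRight .down).comp <| (assocHom _ _ _).comp <|
          (crossDown.whiskerLeft .down).comp (assocInv _ _ _))
  | down_up : Rel (crossDU.comp crossUD) ((id _).add ((capDU.comp cupDU).smul (-1)))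
  | up_down : Rel (crossUD.comp crossDU) (id _)
  | bubble : Rel (cupDU.comp capDU) (id .unit)
  | curl_zero : Rel curl (zero _ _)

instance setoid (k : Type u) [CommRing k] (X Y : HeisWord) : Setoid (HeisDiagram k X Y) :=
  ⟨Rel, ⟨Rel.refl, Rel.symm, Rel.trans⟩⟩

end HeisDiagram

/-- The category of diagrams on tensor words: morphisms are linear combinations of diagrams
modulo the relations. -/
structure HeisDiag (k : Type u) : Type where
  /-- the underlying word -/
  word : HeisWord

namespace HeisDiag

open HeisDiagram

variable {k : Type u} [CommRing k]

instance : Category.{u} (HeisDiag k) where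
  Hom X Y := Quotient (HeisDiagram.setoid k X.word Y.word)
  id X := ⟦.id X.word⟧
  comp f g := Quotient.map₂ HeisDiagram.comp (fun _ _ hf _ _ hg ↦ Rel.comp hf hg) f g
  id_comp := by rintro X Y ⟨f⟩; exact Quotient.sound (Rel.id_comp f)
  comp_id := by rintro X Y ⟨f⟩; exact Quotient.sound (Rel.comp_id f)
  assoc := by rintro W X Y Z ⟨f⟩ ⟨g⟩ ⟨h⟩; exact Quotient.sound (Rel.assoc f g h)

/-- The morphism represented by a diagram. -/
def ofDiagram {X Y : HeisWord} (f : HeisDiagram k X Y) : (⟨X⟩ : HeisDiag k) ⟶ ⟨Y⟩ :=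
  Quotient.mk (HeisDiagram.setoid k X Y) f

instance (X Y : HeisDiag k) : Zero (X ⟶ Y) := ⟨ofDiagram (HeisDiagram.zero _ _)⟩

instance (X Y : HeisDiag k) : Add (X ⟶ Y) :=
  ⟨Quotient.map₂ HeisDiagram.add (fun _ _ hf _ _ hg ↦ Rel.add hf hg)⟩

instance (X Y : HeisDiag k) : AddCommMonoid (X ⟶ Y) where
  add_assoc := by rintro ⟨f⟩ ⟨g⟩ ⟨h⟩; exact Quotient.sound (Rel.add_assoc f g h)
  add_comm := by rintro ⟨f⟩ ⟨g⟩; exact Quotient.sound (Rel.add_comm f g)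
  zero_add := by rintro ⟨f⟩; exact Quotient.sound (Rel.zero_add f)
  add_zero := by
    rintro ⟨f⟩; exact Quotient.sound ((Rel.add_comm _ _).trans (Rel.zero_add f))
  nsmul := nsmulRec

instance moduleHom (X Y : HeisDiag k) : Module k (X ⟶ Y) where
  smul c f := Quotient.map (HeisDiagram.smul c) (fun _ _ h ↦ Rel.smul c h) f
  one_smul := by rintro ⟨f⟩; exact Quotient.sound (Rel.one_smul f)
  mul_smul := by rintro c d ⟨f⟩; exact Quotient.sound (Rel.mul_smul c d f)
  smul_add := by rintro c ⟨f⟩ ⟨g⟩; exact Quotient.sound (Rel.smul_add c f g)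
  add_smul := by rintro c d ⟨f⟩; exact Quotient.sound (Rel.add_smul c d f)
  zero_smul := by rintro ⟨f⟩; exact Quotient.sound (Rel.zero_smul f)
  smul_zero := by
    intro c
    refine Quotient.sound (Rel.trans (Rel.smul c (Rel.symm (Rel.zero_smul (.zero _ _)))) ?_)
    refine Rel.trans (Rel.symm (Rel.mul_smul c 0 _)) ?_
    rw [mul_zero]
    exact Rel.zero_smul _

instance (X Y : HeisDiag k) : AddCommGroup (X ⟶ Y) := Module.addCommMonoidToAddCommGroup k

instance : Preadditive (HeisDiag k) where
  add_comp := by rintro X Y Z ⟨f⟩ ⟨f'⟩ ⟨g⟩; exact Quotient.sound (Rel.add_comp f f' g)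
  comp_add := by rintro X Y Z ⟨f⟩ ⟨g⟩ ⟨g'⟩; exact Quotient.sound (Rel.comp_add f g g')

instance : Linear k (HeisDiag k) where
  homModule := moduleHom
  smul_comp := by rintro X Y Z c ⟨f⟩ ⟨g⟩; exact Quotient.sound (Rel.smul_comp c f g)
  comp_smul := by rintro X Y Z ⟨f⟩ c ⟨g⟩; exact Quotient.sound (Rel.comp_smul c f g)

instance : MonoidalCategoryStruct (HeisDiag k) where
  tensorObj X Y := ⟨X.word.tensor Y.word⟩
  tensorUnit := ⟨.unit⟩
  whiskerLeft X _ _ f :=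
    Quotient.map (HeisDiagram.whiskerLeft X.word) (fun _ _ h ↦ Rel.whiskerLeft _ h) f
  whiskerRight f Y :=
    Quotient.map (fun f ↦ HeisDiagram.whiskerRight f Y.word) (fun _ _ h ↦ Rel.whiskerRight _ h) f
  associator _ _ _ := ⟨ofDiagram (HeisDiagram.assocHom _ _ _), ofDiagram (HeisDiagram.assocInv _ _ _),
    Quotient.sound (Rel.assoc_hom_inv _ _ _), Quotient.sound (Rel.assoc_inv_hom _ _ _)⟩
  leftUnitor _ := ⟨ofDiagram (HeisDiagram.leftHom _), ofDiagram (HeisDiagram.leftInv _),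
    Quotient.sound (Rel.left_hom_inv _), Quotient.sound (Rel.left_inv_hom _)⟩
  rightUnitor _ := ⟨ofDiagram (HeisDiagram.rightHom _), ofDiagram (HeisDiagram.rightInv _),
    Quotient.sound (Rel.right_hom_inv _), Quotient.sound (Rel.right_inv_hom _)⟩

theorem whiskerLeft_comp' (W : HeisDiag k) {X Y Z : HeisDiag k} (f : X ⟶ Y) (g : Y ⟶ Z) :
    W ◁ (f ≫ g) = W ◁ f ≫ W ◁ g := by
  revert f g; rintro ⟨f⟩ ⟨g⟩; exact Quotient.sound (Rel.whiskerLeft_comp _ f g)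

theorem comp_whiskerRight' {X Y Z : HeisDiag k} (f : X ⟶ Y) (g : Y ⟶ Z) (W : HeisDiag k) :
    (f ≫ g) ▷ W = f ▷ W ≫ g ▷ W := by
  revert f g; rintro ⟨f⟩ ⟨g⟩; exact Quotient.sound (Rel.comp_whiskerRight f g _)

theorem exchange' {W X Y Z : HeisDiag k} (f : W ⟶ X) (g : Y ⟶ Z) :
    W ◁ g ≫ f ▷ Z = f ▷ Y ≫ X ◁ g := by
  revert f g; rintro ⟨f⟩ ⟨g⟩; exact Quotient.sound (Rel.exchange f g)

instance : MonoidalCategory (HeisDiag k) where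
  id_tensorHom_id X Y := by
    change 𝟙 X ▷ Y ≫ X ◁ 𝟙 Y = 𝟙 _
    rw [show 𝟙 X ▷ Y = 𝟙 _ from Quotient.sound (Rel.id_whiskerRight _ _),
      show X ◁ 𝟙 Y = 𝟙 _ from Quotient.sound (Rel.whiskerLeft_id _ _), Category.comp_id]
  tensorHom_comp_tensorHom {X₁ Y₁ Z₁ X₂ Y₂ Z₂} f₁ f₂ g₁ g₂ := by
    change (f₁ ▷ X₂ ≫ Y₁ ◁ f₂) ≫ (g₁ ▷ Y₂ ≫ Z₁ ◁ g₂) = (f₁ ≫ g₁) ▷ X₂ ≫ Z₁ ◁ (f₂ ≫ g₂)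
    rw [comp_whiskerRight', whiskerLeft_comp', Category.assoc, Category.assoc,
      ← Category.assoc (Y₁ ◁ f₂), exchange', Category.assoc]
  whiskerLeft_id X Y := Quotient.sound (Rel.whiskerLeft_id _ _)
  id_whiskerRight X Y := Quotient.sound (Rel.id_whiskerRight _ _)
  associator_naturality {X₁ X₂ X₃ Y₁ Y₂ Y₃} f₁ f₂ f₃ := by
    change ((f₁ ▷ X₂ ≫ Y₁ ◁ f₂) ▷ X₃ ≫ (Y₁ ⊗ Y₂) ◁ f₃) ≫ (α_ Y₁ Y₂ Y₃).hom =
      (α_ X₁ X₂ X₃).hom ≫ f₁ ▷ (X₂ ⊗ X₃) ≫ Y₁ ◁ (f₂ ▷ X₃ ≫ Y₂ ◁ f₃)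
    have h1 : f₁ ▷ X₂ ▷ X₃ ≫ (α_ Y₁ X₂ X₃).hom = (α_ X₁ X₂ X₃).hom ≫ f₁ ▷ (X₂ ⊗ X₃) := by
      revert f₁; rintro ⟨f⟩; exact Quotient.sound (Rel.assoc_left f _ _)
    have h2 : (Y₁ ◁ f₂) ▷ X₃ ≫ (α_ Y₁ Y₂ X₃).hom = (α_ Y₁ X₂ X₃).hom ≫ Y₁ ◁ (f₂ ▷ X₃) := by
      revert f₂; rintro ⟨f⟩; exact Quotient.sound (Rel.assoc_mid _ f _)
    have h3 : (Y₁ ⊗ Y₂) ◁ f₃ ≫ (α_ Y₁ Y₂ Y₃).hom = (α_ Y₁ Y₂ X₃).hom ≫ Y₁ ◁ (Y₂ ◁ f₃) := by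
      revert f₃; rintro ⟨f⟩; exact Quotient.sound (Rel.assoc_right _ _ f)
    rw [comp_whiskerRight', whiskerLeft_comp']
    simp only [Category.assoc]
    rw [h3, ← Category.assoc ((Y₁ ◁ f₂) ▷ X₃), h2, Category.assoc, ← Category.assoc, h1,
      Category.assoc]
  leftUnitor_naturality {X Y} f := by
    revert f; rintro ⟨f⟩; exact Quotient.sound (Rel.left_nat f)
  rightUnitor_naturality {X Y} f := by
    revert f; rintro ⟨f⟩; exact Quotient.sound (Rel.right_nat f)
  pentagon _ _ _ _ := Quotient.sound (Rel.pentagon _ _ _ _)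
  triangle _ _ := Quotient.sound (Rel.triangle _ _)

instance : MonoidalPreadditive (HeisDiag k) where
  whiskerLeft_zero {X Y Z} := by
    have h := Rel.trans (Rel.symm (Rel.whiskerLeft_smul X.word (0 : k)
      (HeisDiagram.zero (k := k) Y.word Z.word))) (Rel.whiskerLeft _ (Rel.zero_smul _))
    exact Quotient.sound (Rel.trans (Rel.symm h) (Rel.zero_smul _))
  zero_whiskerRight {X Y Z} := by
    have h := Rel.trans (Rel.symm (Rel.smul_whiskerRight (0 : k)
      (HeisDiagram.zero (k := k) Y.word Z.word) X.word)) (Rel.whiskerRight _ (Rel.zero_smul _))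
    exact Quotient.sound (Rel.trans (Rel.symm h) (Rel.zero_smul _))
  whiskerLeft_add := by
    rintro X Y Z ⟨f⟩ ⟨g⟩; exact Quotient.sound (Rel.whiskerLeft_add _ f g)
  add_whiskerRight := by
    rintro X Y Z ⟨f⟩ ⟨g⟩; exact Quotient.sound (Rel.add_whiskerRight f g _)

instance : MonoidalLinear k (HeisDiag k) where
  whiskerLeft_smul := by
    rintro X Y Z c ⟨f⟩; exact Quotient.sound (Rel.whiskerLeft_smul _ c f)
  smul_whiskerRight := by
    rintro c Y Z ⟨f⟩ X; exact Quotient.sound (Rel.smul_whiskerRight c f _)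

end HeisDiag

/-! ### Tensor products on the additive envelope and on the Karoubi envelope -/

namespace CategoryTheory.Mat_

universe v₁ u₁

variable {C : Type u₁} [Category.{v₁} C] [Preadditive C]

open scoped Classical in
/-- The monomial matrix whose only nonzero entries are the `φ i` in position `(i, e i)`. -/
noncomputable def monomial {M N : Mat_ C} (e : M.ι ≃ N.ι) (φ : ∀ i, M.X i ⟶ N.X (e i)) : M ⟶ N :=
  fun i j ↦ if h : e i = j then φ i ≫ eqToHom (congrArg N.X h) else 0

theorem monomial_apply {M N : Mat_ C} (e : M.ι ≃ N.ι) (φ : ∀ i, M.X i ⟶ N.X (e i)) (i : M.ι) :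
    monomial e φ i (e i) = φ i := by
  simp [monomial]

theorem monomial_apply_ne {M N : Mat_ C} (e : M.ι ≃ N.ι) (φ : ∀ i, M.X i ⟶ N.X (e i)) {i : M.ι}
    {j : N.ι} (h : e i ≠ j) : monomial e φ i j = 0 := by
  simp [monomial, h]

theorem monomial_comp {M N K : Mat_ C} (e : M.ι ≃ N.ι) (φ : ∀ i, M.X i ⟶ N.X (e i)) (g : N ⟶ K)
    (i : M.ι) (l : K.ι) : (monomial e φ ≫ g) i l = φ i ≫ g (e i) l := by
  rw [comp_apply, Finset.sum_eq_single (e i), monomial_apply]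
  · intro j _ hj
    rw [monomial_apply_ne e φ hj.symm, zero_comp]
  · simp

theorem comp_monomial {M N K : Mat_ C} (f : M ⟶ N) (e : N.ι ≃ K.ι) (φ : ∀ i, N.X i ⟶ K.X (e i))
    (i : M.ι) (j : N.ι) : (f ≫ monomial e φ) i (e j) = f i j ≫ φ j := by
  rw [comp_apply, Finset.sum_eq_single j, monomial_apply]
  · intro j' _ hj
    rw [monomial_apply_ne e φ (fun h ↦ hj (e.injective h)), comp_zero]
  · simp

theorem eq_monomial {M N : Mat_ C} (f : M ⟶ N) (e : M.ι ≃ N.ι) (φ : ∀ i, M.X i ⟶ N.X (e i))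
    (h : ∀ i, f i (e i) = φ i) (h' : ∀ i j, e i ≠ j → f i j = 0) : f = monomial e φ := by
  ext i j
  by_cases hj : e i = j
  · subst hj; rw [h, monomial_apply]
  · rw [h' i j hj, monomial_apply_ne e φ hj]

theorem id_eq_monomial (M : Mat_ C) : 𝟙 M = monomial (Equiv.refl _) (fun i ↦ 𝟙 (M.X i)) :=
  eq_monomial _ _ _ (fun i ↦ id_apply_self M i) (fun i j h ↦ id_apply_of_ne M i j h)

theorem monomial_congr {M N : Mat_ C} (e e' : M.ι ≃ N.ι) (φ : ∀ i, M.X i ⟶ N.X (e i))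
    (φ' : ∀ i, M.X i ⟶ N.X (e' i))
    (h : ∀ i, ∃ h : e i = e' i, φ i ≫ eqToHom (congrArg N.X h) = φ' i) :
    monomial e φ = monomial e' φ' := by
  obtain rfl : e = e' := Equiv.ext fun i ↦ (h i).1
  congr 1
  funext i
  obtain ⟨_, h⟩ := h i
  rw [← h, eqToHom_refl, Category.comp_id]

theorem monomial_comp_monomial {M N K : Mat_ C} (e : M.ι ≃ N.ι) (φ : ∀ i, M.X i ⟶ N.X (e i))
    (e' : N.ι ≃ K.ι) (φ' : ∀ i, N.X i ⟶ K.X (e' i)) :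
    monomial e φ ≫ monomial e' φ' = monomial (e.trans e') (fun i ↦ φ i ≫ φ' (e i)) :=
  eq_monomial _ _ _
    (fun i ↦ (monomial_comp e φ _ i _).trans (by rw [← monomial_apply e' φ' (e i)]; rfl))
    (fun i j h ↦ by rw [monomial_comp, monomial_apply_ne e' φ' h, comp_zero])

variable [MonoidalCategory C] [MonoidalPreadditive C]

/-- The tensor product of matrices, on products of index types. -/
noncomputable instance : MonoidalCategoryStruct (Mat_ C) where
  tensorObj M N := ⟨M.ι × N.ι, fun p ↦ M.X p.1 ⊗ N.X p.2⟩
  tensorHom f g := fun p q ↦ f p.1 q.1 ⊗ₘ g p.2 q.2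
  whiskerLeft M _ _ g := fun p q ↦ (𝟙 M : M ⟶ M) p.1 q.1 ⊗ₘ g p.2 q.2
  whiskerRight f N := fun p q ↦ f p.1 q.1 ⊗ₘ (𝟙 N : N ⟶ N) p.2 q.2
  tensorUnit := ⟨PUnit, fun _ ↦ 𝟙_ C⟩
  associator M N K :=
    ⟨monomial (Equiv.prodAssoc _ _ _) (fun _ ↦ (α_ _ _ _).hom),
      monomial (Equiv.prodAssoc _ _ _).symm (fun _ ↦ (α_ _ _ _).inv),
      (monomial_comp_monomial _ _ _ _).trans (by
        rw [id_eq_monomial]; congr 1; funext i; exact (α_ _ _ _).hom_inv_id),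
      (monomial_comp_monomial _ _ _ _).trans (by
        rw [id_eq_monomial]; congr 1; funext i; exact (α_ _ _ _).inv_hom_id)⟩
  leftUnitor M :=
    ⟨monomial (Equiv.punitProd _) (fun _ ↦ (λ_ _).hom),
      monomial (Equiv.punitProd _).symm (fun _ ↦ (λ_ _).inv),
      (monomial_comp_monomial _ _ _ _).trans (by
        rw [id_eq_monomial]; congr 1; funext i; exact (λ_ _).hom_inv_id),
      (monomial_comp_monomial _ _ _ _).trans (by
        rw [id_eq_monomial]; congr 1; funext i; exact (λ_ _).inv_hom_id)⟩
  rightUnitor M :=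
    ⟨monomial (Equiv.prodPUnit _) (fun _ ↦ (ρ_ _).hom),
      monomial (Equiv.prodPUnit _).symm (fun _ ↦ (ρ_ _).inv),
      (monomial_comp_monomial _ _ _ _).trans (by
        rw [id_eq_monomial]; congr 1; funext i; exact (ρ_ _).hom_inv_id),
      (monomial_comp_monomial _ _ _ _).trans (by
        rw [id_eq_monomial]; congr 1; funext i; exact (ρ_ _).inv_hom_id)⟩

theorem monomial_tensorHom {M N M' N' : Mat_ C} (e : M.ι ≃ N.ι) (φ : ∀ i, M.X i ⟶ N.X (e i))
    (e' : M'.ι ≃ N'.ι) (φ' : ∀ i, M'.X i ⟶ N'.X (e' i)) :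
    monomial e φ ⊗ₘ monomial e' φ' =
      (monomial (e.prodCongr e') (fun p ↦ φ p.1 ⊗ₘ φ' p.2) : M ⊗ M' ⟶ N ⊗ N') := by
  refine eq_monomial _ _ _ (fun p ↦ ?_) (fun p q h ↦ ?_)
  · change monomial e φ p.1 (e p.1) ⊗ₘ monomial e' φ' p.2 (e' p.2) = _
    rw [monomial_apply, monomial_apply]
    rfl
  · change monomial e φ p.1 q.1 ⊗ₘ monomial e' φ' p.2 q.2 = 0
    by_cases h1 : e p.1 = q.1
    · have h2 : e' p.2 ≠ q.2 := fun h2 ↦ h (Prod.ext h1 h2)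
      rw [monomial_apply_ne _ _ h2, MonoidalPreadditive.tensor_zero]
    · rw [monomial_apply_ne _ _ h1, MonoidalPreadditive.zero_tensor]

theorem monomial_tensorHom_id {M N : Mat_ C} (e : M.ι ≃ N.ι) (φ : ∀ i, M.X i ⟶ N.X (e i))
    (K : Mat_ C) :
    monomial e φ ⊗ₘ 𝟙 K =
      (monomial (e.prodCongr (Equiv.refl K.ι)) (fun p ↦ φ p.1 ▷ K.X p.2) : M ⊗ K ⟶ N ⊗ K) := by
  rw [id_eq_monomial]
  refine (monomial_tensorHom _ _ _ _).trans ?_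
  congr 1
  funext p
  exact tensorHom_id _ _

theorem id_tensorHom_monomial {M N : Mat_ C} (e : M.ι ≃ N.ι) (φ : ∀ i, M.X i ⟶ N.X (e i))
    (K : Mat_ C) :
    𝟙 K ⊗ₘ monomial e φ =
      (monomial ((Equiv.refl K.ι).prodCongr e) (fun p ↦ K.X p.1 ◁ φ p.2) : K ⊗ M ⟶ K ⊗ N) := by
  rw [id_eq_monomial]
  refine (monomial_tensorHom _ _ _ _).trans ?_
  congr 1
  funext p
  exact id_tensorHom _ _

noncomputable instance : MonoidalCategory (Mat_ C) :=
  MonoidalCategory.ofTensorHom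
    (id_tensorHom_id := fun M N ↦ by
      rw [id_eq_monomial M]
      refine (monomial_tensorHom_id _ _ _).trans (Eq.trans ?_ (id_eq_monomial (M ⊗ N)).symm)
      exact monomial_congr _ _ _ _ (fun p ↦ ⟨rfl, (Category.comp_id _).trans
        (id_whiskerRight _ _)⟩))
    (tensorHom_comp_tensorHom := fun {M₁ N₁ K₁ M₂ N₂ K₂} f₁ f₂ g₁ g₂ ↦ by
      ext p q
      change ∑ r : N₁.ι × N₂.ι, (f₁ p.1 r.1 ⊗ₘ f₂ p.2 r.2) ≫ (g₁ r.1 q.1 ⊗ₘ g₂ r.2 q.2) =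
        (∑ r, f₁ p.1 r ≫ g₁ r q.1) ⊗ₘ (∑ r, f₂ p.2 r ≫ g₂ r q.2)
      simp only [tensor_sum, sum_tensor, tensorHom_comp_tensorHom]
      rw [Fintype.sum_prod_type_right])
    (associator_naturality := fun {M₁ M₂ M₃ N₁ N₂ N₃} f₁ f₂ f₃ ↦ by
      refine hom_ext _ _ (fun p q ↦ ?_)
      exact ((comp_monomial (N := (N₁ ⊗ N₂) ⊗ N₃) (K := N₁ ⊗ N₂ ⊗ N₃) _
        (Equiv.prodAssoc N₁.ι N₂.ι N₃.ι) _ p ⟨⟨q.1, q.2.1⟩, q.2.2⟩).trans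
        (associator_naturality _ _ _)).trans
        (monomial_comp (M := (M₁ ⊗ M₂) ⊗ M₃) (N := M₁ ⊗ M₂ ⊗ M₃)
          (Equiv.prodAssoc M₁.ι M₂.ι M₃.ι) _ _ p q).symm)
    (leftUnitor_naturality := fun {M N} f ↦ by
      refine hom_ext _ _ (fun p j ↦ ?_)
      refine (comp_monomial (N := 𝟙_ (Mat_ C) ⊗ N) (K := N) _ (Equiv.punitProd N.ι) _ p
        ⟨⟨⟩, j⟩).trans (Eq.trans ?_ (monomial_comp (M := 𝟙_ (Mat_ C) ⊗ M) (N := M)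
          (Equiv.punitProd M.ι) _ _ p j).symm)
      change ((𝟙 (𝟙_ (Mat_ C)) : 𝟙_ (Mat_ C) ⟶ _) PUnit.unit PUnit.unit ⊗ₘ f p.2 j) ≫ _ = _
      rw [id_apply_self]
      refine Eq.trans (congrArg (· ≫ _) (id_tensorHom _ _)) ?_
      exact leftUnitor_naturality _)
    (rightUnitor_naturality := fun {M N} f ↦ by
      refine hom_ext _ _ (fun p j ↦ ?_)
      refine (comp_monomial (N := N ⊗ 𝟙_ (Mat_ C)) (K := N) _ (Equiv.prodPUnit N.ι) _ p
        ⟨j, ⟨⟩⟩).trans (Eq.trans ?_ (monomial_comp (M := M ⊗ 𝟙_ (Mat_ C)) (N := M)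
          (Equiv.prodPUnit M.ι) _ _ p j).symm)
      change (f p.1 j ⊗ₘ (𝟙 (𝟙_ (Mat_ C)) : 𝟙_ (Mat_ C) ⟶ _) PUnit.unit PUnit.unit) ≫ _ = _
      rw [id_apply_self]
      refine Eq.trans (congrArg (· ≫ _) (tensorHom_id _ _)) ?_
      exact rightUnitor_naturality _)
    (pentagon := fun W X Y Z ↦ by
      refine Eq.trans (congr (congrArg _ (monomial_tensorHom_id _ _ Z))
        (congrArg _ (id_tensorHom_monomial _ _ W))) ?_
      refine Eq.trans (congrArg _ (monomial_comp_monomial _ _ _ _)) ?_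
      refine Eq.trans (monomial_comp_monomial _ _ _ _) (Eq.trans ?_
        (monomial_comp_monomial _ _ _ _).symm)
      exact monomial_congr _ _ _ _ (fun p ↦ ⟨rfl, (Category.comp_id _).trans
        (MonoidalCategory.pentagon _ _ _ _)⟩))
    (triangle := fun X Y ↦ by
      refine Eq.trans (congrArg _ (id_tensorHom_monomial _ _ X)) (Eq.trans ?_
        (monomial_tensorHom_id _ _ Y).symm)
      refine Eq.trans (monomial_comp_monomial _ _ _ _) ?_
      exact monomial_congr _ _ _ _ (fun p ↦ ⟨rfl, (Category.comp_id _).trans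
        (MonoidalCategory.triangle _ _)⟩))

instance : MonoidalPreadditive (Mat_ C) where
  whiskerLeft_zero := by
    intros; ext p q; exact MonoidalPreadditive.tensor_zero _
  zero_whiskerRight := by
    intros; ext p q; exact MonoidalPreadditive.zero_tensor _
  whiskerLeft_add := by
    intros; ext p q; exact MonoidalPreadditive.tensor_add _ _ _
  add_whiskerRight := by
    intros; ext p q; exact MonoidalPreadditive.add_tensor _ _ _

instance linear (k : Type u) [CommRing k] [Linear k C] : Linear k (Mat_ C) where
  homModule M N := inferInstanceAs (Module k (∀ (i : M.ι) (j : N.ι), M.X i ⟶ N.X j))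
  smul_comp := by
    intro M N K c f g
    ext i j
    change ∑ l, (c • f i l) ≫ g l j = c • ∑ l, f i l ≫ g l j
    simp [Finset.smul_sum]
  comp_smul := by
    intro M N K f c g
    ext i j
    change ∑ l, f i l ≫ (c • g l j) = c • ∑ l, f i l ≫ g l j
    simp [Finset.smul_sum]

end CategoryTheory.Mat_

namespace CategoryTheory.Idempotents.Karoubi

universe v₁ u₁

variable {C : Type u₁} [Category.{v₁} C]

/-- `f` is the restriction of a morphism `a` that commutes with the idempotents. -/
def IsRestriction {P Q : Karoubi C} (f : P ⟶ Q) (a : P.X ⟶ Q.X) : Prop :=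
  f.f = P.p ≫ a ∧ P.p ≫ a = a ≫ Q.p

namespace IsRestriction

theorem comp {P Q R : Karoubi C} {f : P ⟶ Q} {a : P.X ⟶ Q.X} {g : Q ⟶ R} {b : Q.X ⟶ R.X}
    (hf : IsRestriction f a) (hg : IsRestriction g b) : IsRestriction (f ≫ g) (a ≫ b) :=
  ⟨by rw [comp_f, hf.1, hg.1, hf.2, Category.assoc, Q.idem_assoc, ← Category.assoc, ← hf.2,
      Category.assoc],
    by rw [← Category.assoc, hf.2, Category.assoc, hg.2, Category.assoc]⟩

theorem eq {P Q : Karoubi C} {f g : P ⟶ Q} {a : P.X ⟶ Q.X} (hf : IsRestriction f a)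
    (hg : IsRestriction g a) : f = g :=
  hom_ext _ _ (hf.1.trans hg.1.symm)

theorem natural {P Q P' Q' : Karoubi C} {f : P ⟶ Q} {a : P.X ⟶ Q.X} {f' : P' ⟶ Q'}
    {a' : P'.X ⟶ Q'.X} {g : P ⟶ P'} {h : Q ⟶ Q'} (hf : IsRestriction f a)
    (hf' : IsRestriction f' a') (w : g.f ≫ a' = a ≫ h.f) : g ≫ f' = f ≫ h :=
  hom_ext _ _ (by
    rw [comp_f, comp_f, hf.1, hf'.1, comp_p_assoc, Category.assoc, ← w, p_comp_assoc])

end IsRestriction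

/-- The isomorphism induced by an isomorphism that commutes with the idempotents. -/
def isoOfComm {P Q : Karoubi C} (a : P.X ≅ Q.X) (h : P.p ≫ a.hom = a.hom ≫ Q.p) : P ≅ Q where
  hom := ⟨P.p ≫ a.hom, by rw [Category.assoc, ← h, P.idem_assoc, P.idem_assoc]⟩
  inv := ⟨Q.p ≫ a.inv, by
    have h2 : a.inv ≫ P.p = Q.p ≫ a.inv := by
      rw [Iso.inv_comp_eq, ← Category.assoc, ← h, Category.assoc, a.hom_inv_id, Category.comp_id]
    rw [Category.assoc, Q.idem_assoc, h2, Q.idem_assoc]⟩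
  hom_inv_id := hom_ext _ _ (by
    change (P.p ≫ a.hom) ≫ Q.p ≫ a.inv = P.p
    rw [h, Category.assoc, Q.idem_assoc, ← Category.assoc, ← h, Category.assoc, a.hom_inv_id,
      Category.comp_id])
  inv_hom_id := hom_ext _ _ (by
    change (Q.p ≫ a.inv) ≫ P.p ≫ a.hom = Q.p
    rw [h, Category.assoc, a.inv_hom_id_assoc, Q.idem])

theorem isRestriction_isoOfComm {P Q : Karoubi C} (a : P.X ≅ Q.X)
    (h : P.p ≫ a.hom = a.hom ≫ Q.p) : IsRestriction (isoOfComm a h).hom a.hom :=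
  ⟨rfl, h⟩

section Monoidal

variable [MonoidalCategory C]

theorem tensorHom_comm {X₁ Y₁ X₂ Y₂ : C} {p : X₁ ⟶ X₁} {f : X₁ ⟶ Y₁} {q : Y₁ ⟶ Y₁} {p' : X₂ ⟶ X₂}
    {f' : X₂ ⟶ Y₂} {q' : Y₂ ⟶ Y₂} (h : p ≫ f ≫ q = f) (h' : p' ≫ f' ≫ q' = f') :
    (p ⊗ₘ p') ≫ (f ⊗ₘ f') ≫ (q ⊗ₘ q') = f ⊗ₘ f' := by
  rw [tensorHom_comp_tensorHom, tensorHom_comp_tensorHom, h, h']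

theorem leftUnitor_comm (P : Karoubi C) :
    (𝟙 (𝟙_ C) ⊗ₘ P.p) ≫ (λ_ P.X).hom = (λ_ P.X).hom ≫ P.p := by
  rw [id_tensorHom, leftUnitor_naturality]

theorem rightUnitor_comm (P : Karoubi C) :
    (P.p ⊗ₘ 𝟙 (𝟙_ C)) ≫ (ρ_ P.X).hom = (ρ_ P.X).hom ≫ P.p := by
  rw [tensorHom_id, rightUnitor_naturality]

/-- The tensor product of two idempotents. -/
instance : MonoidalCategoryStruct (Karoubi C) where
  tensorObj P Q := ⟨P.X ⊗ Q.X, P.p ⊗ₘ Q.p, by rw [tensorHom_comp_tensorHom, P.idem, Q.idem]⟩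
  tensorHom f g := ⟨f.f ⊗ₘ g.f, tensorHom_comm f.comm g.comm⟩
  whiskerLeft P _ _ f := ⟨P.p ⊗ₘ f.f, tensorHom_comm (𝟙 P : P ⟶ P).comm f.comm⟩
  whiskerRight f Q := ⟨f.f ⊗ₘ Q.p, tensorHom_comm f.comm (𝟙 Q : Q ⟶ Q).comm⟩
  tensorUnit := ⟨𝟙_ C, 𝟙 _, Category.comp_id _⟩
  associator P Q R := isoOfComm (α_ P.X Q.X R.X) (associator_naturality _ _ _)
  leftUnitor P := isoOfComm (λ_ P.X) (leftUnitor_comm P)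
  rightUnitor P := isoOfComm (ρ_ P.X) (rightUnitor_comm P)

theorem isRestriction_associator (P Q R : Karoubi C) :
    IsRestriction (α_ P Q R).hom (α_ P.X Q.X R.X).hom :=
  isRestriction_isoOfComm _ _

theorem isRestriction_leftUnitor (P : Karoubi C) : IsRestriction (λ_ P).hom (λ_ P.X).hom :=
  isRestriction_isoOfComm _ _

theorem isRestriction_rightUnitor (P : Karoubi C) : IsRestriction (ρ_ P).hom (ρ_ P.X).hom :=
  isRestriction_isoOfComm _ _

theorem IsRestriction.tensor_id {P Q : Karoubi C} {f : P ⟶ Q} {a : P.X ⟶ Q.X}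
    (h : IsRestriction f a) (R : Karoubi C) : IsRestriction (f ⊗ₘ 𝟙 R) (a ▷ R.X) := by
  constructor
  · change f.f ⊗ₘ R.p = (P.p ⊗ₘ R.p) ≫ a ▷ R.X
    rw [h.1, ← tensorHom_id, tensorHom_comp_tensorHom, Category.comp_id]
  · change (P.p ⊗ₘ R.p) ≫ a ▷ R.X = a ▷ R.X ≫ (Q.p ⊗ₘ R.p)
    rw [← tensorHom_id, tensorHom_comp_tensorHom, tensorHom_comp_tensorHom, h.2, Category.comp_id,
      Category.id_comp]

theorem IsRestriction.id_tensor {P Q : Karoubi C} {f : P ⟶ Q} {a : P.X ⟶ Q.X}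
    (h : IsRestriction f a) (R : Karoubi C) : IsRestriction (𝟙 R ⊗ₘ f) (R.X ◁ a) := by
  constructor
  · change R.p ⊗ₘ f.f = (R.p ⊗ₘ P.p) ≫ R.X ◁ a
    rw [h.1, ← id_tensorHom, tensorHom_comp_tensorHom, Category.comp_id]
  · change (R.p ⊗ₘ P.p) ≫ R.X ◁ a = R.X ◁ a ≫ (R.p ⊗ₘ Q.p)
    rw [← id_tensorHom, tensorHom_comp_tensorHom, tensorHom_comp_tensorHom, h.2, Category.comp_id,
      Category.id_comp]

instance : MonoidalCategory (Karoubi C) :=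
  MonoidalCategory.ofTensorHom
    (id_tensorHom_id := fun _ _ ↦ rfl)
    (tensorHom_comp_tensorHom := fun _ _ _ _ ↦ hom_ext _ _ (tensorHom_comp_tensorHom _ _ _ _))
    (associator_naturality := fun _ _ _ ↦ (isRestriction_associator _ _ _).natural
      (isRestriction_associator _ _ _) (associator_naturality _ _ _))
    (leftUnitor_naturality := fun f ↦ (isRestriction_leftUnitor _).natural
      (isRestriction_leftUnitor _)
      ((congrArg (· ≫ _) (id_tensorHom _ _)).trans (leftUnitor_naturality f.f)))
    (rightUnitor_naturality := fun f ↦ (isRestriction_rightUnitor _).natural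
      (isRestriction_rightUnitor _)
      ((congrArg (· ≫ _) (tensorHom_id _ _)).trans (rightUnitor_naturality f.f)))
    (pentagon := fun W X Y Z ↦ by
      have h := ((isRestriction_associator W X Y).tensor_id Z).comp
        ((isRestriction_associator W (X ⊗ Y) Z).comp ((isRestriction_associator X Y Z).id_tensor W))
      have h' := (isRestriction_associator (W ⊗ X) Y Z).comp
        (isRestriction_associator W X (Y ⊗ Z))
      exact h.eq (MonoidalCategory.pentagon W.X X.X Y.X Z.X ▸ h'))
    (triangle := fun X Y ↦ by
      have h := (isRestriction_associator X (𝟙_ _) Y).comp ((isRestriction_leftUnitor Y).id_tensor X)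
      have h' := (isRestriction_rightUnitor X).tensor_id Y
      exact h.eq (MonoidalCategory.triangle X.X Y.X ▸ h'))

end Monoidal

instance [Preadditive C] [MonoidalCategory C] [MonoidalPreadditive C] :
    MonoidalPreadditive (Karoubi C) where
  whiskerLeft_zero {P _ _} := hom_ext _ _ (MonoidalPreadditive.tensor_zero P.p)
  zero_whiskerRight {P _ _} := hom_ext _ _ (MonoidalPreadditive.zero_tensor P.p)
  whiskerLeft_add {P _ _} f g := hom_ext _ _ (MonoidalPreadditive.tensor_add P.p f.f g.f)
  add_whiskerRight {P _ _} f g := hom_ext _ _ (MonoidalPreadditive.add_tensor f.f g.f P.p)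

instance linear (k : Type u) [CommRing k] [Preadditive C] [Linear k C] :
    Linear k (Karoubi C) where
  homModule P Q :=
    { smul := fun c f ↦ ⟨c • f.f, by simp⟩
      one_smul := fun f ↦ hom_ext _ _ (one_smul k f.f)
      mul_smul := fun c d f ↦ hom_ext _ _ (mul_smul c d f.f)
      smul_zero := fun c ↦ hom_ext _ _ (smul_zero c)
      smul_add := fun c f g ↦ hom_ext _ _ (smul_add c f.f g.f)
      add_smul := fun c d f ↦ hom_ext _ _ (add_smul c d f.f)
      zero_smul := fun f ↦ hom_ext _ _ (zero_smul k f.f) }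
  smul_comp := fun _ _ _ c f g ↦ hom_ext _ _ (Linear.smul_comp _ _ _ c f.f g.f)
  comp_smul := fun _ _ _ f c g ↦ hom_ext _ _ (Linear.comp_smul _ _ _ f.f c g.f)

end CategoryTheory.Idempotents.Karoubi

/-! ### The action of the symmetric group on tensor powers -/

/-- The relations of the simple transpositions of the symmetric group on `n` letters. -/
structure CoxeterRelations {M : Type*} [Monoid M] (n : ℕ) (t : ℕ → M) : Prop where
  sq (i : ℕ) (h : i + 1 < n) : t i * t i = 1
  braid (i : ℕ) (h : i + 2 < n) : t i * t (i + 1) * t i = t (i + 1) * t i * t (i + 1)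
  comm (i j : ℕ) (h : i + 1 < j) (h' : j + 1 < n) : t i * t j = t j * t i

namespace CoxeterRelations

variable {G : Type*} [Monoid G]

/-- `cycleWord t j k = t (k + j - 1) * ⋯ * t (k + 1) * t k`. -/
def cycleWord (t : ℕ → G) : ℕ → ℕ → G
  | 0, _ => 1
  | j + 1, k => cycleWord t j (k + 1) * t k

theorem cycleWord_succ' (t : ℕ → G) (j k : ℕ) :
    cycleWord t (j + 1) k = t (k + j) * cycleWord t j k := by
  induction j generalizing k with
  | zero => simp [cycleWord]
  | succ j ih =>
    rw [cycleWord, ih, cycleWord, mul_assoc, show k + 1 + j = k + (j + 1) by omega]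

theorem cycleWord_comm {n : ℕ} {t : ℕ → G} (h : CoxeterRelations n t) (j k i : ℕ) (hi : i + 1 < k)
    (hn : k + j < n) : cycleWord t j k * t i = t i * cycleWord t j k := by
  induction j generalizing k with
  | zero => simp [cycleWord]
  | succ j ih =>
    rw [cycleWord, mul_assoc, ← h.comm i k hi (by omega), ← mul_assoc, ih (k + 1) (by omega)
      (by omega), mul_assoc]

theorem cycleWord_shift {n : ℕ} {t : ℕ → G} (h : CoxeterRelations n t) (j k i : ℕ) (hi : k ≤ i)
    (hj : i + 1 < k + j) (hn : k + j < n) :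
    cycleWord t j k * t (i + 1) = t i * cycleWord t j k := by
  induction j generalizing k with
  | zero => omega
  | succ j ih =>
    rcases hi.eq_or_lt with rfl | hi
    · obtain ⟨j, rfl⟩ : ∃ j', j = j' + 1 := ⟨j - 1, by omega⟩
      rw [cycleWord, cycleWord, mul_assoc, mul_assoc, ← mul_assoc (t (k + 1)),
        ← h.braid k (by omega), ← mul_assoc, ← mul_assoc,
        cycleWord_comm h j (k + 1 + 1) k (by omega) (by omega)]
      simp only [mul_assoc]
    · rw [cycleWord, mul_assoc, h.comm k (i + 1) (by omega) (by omega), ← mul_assoc,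
        ih (k + 1) (by omega) (by omega) (by omega), mul_assoc]

/-- Normal forms for words in the simple transpositions. -/
def normalForms (t : ℕ → G) : ℕ → Set G
  | 0 => {1}
  | n + 1 => (fun p : G × ℕ ↦ p.1 * cycleWord t p.2 (n - p.2)) '' (normalForms t n ×ˢ Set.Iic n)

theorem normalForms_ncard (t : ℕ → G) (n : ℕ) :
    (normalForms t n).Finite ∧ (normalForms t n).ncard ≤ n.factorial := by
  induction n with
  | zero => simp [normalForms]
  | succ n ih =>
    have hf : (normalForms t n ×ˢ Set.Iic n).Finite := ih.1.prod (Set.finite_Iic n)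
    refine ⟨hf.image _, (Set.ncard_image_le hf).trans ?_⟩
    rw [Set.ncard_prod, Nat.factorial_succ, mul_comm]
    have : (Set.Iic n).ncard = n + 1 := by
      rw [← Finset.coe_Iic, Set.ncard_coe_finset, Nat.card_Iic]
    rw [this]
    exact Nat.mul_le_mul_left _ ih.2

theorem one_mem_normalForms (t : ℕ → G) (n : ℕ) : 1 ∈ normalForms t n := by
  induction n with
  | zero => simp [normalForms]
  | succ n ih => exact ⟨(1, 0), ⟨ih, Nat.zero_le _⟩, by simp [cycleWord]⟩

theorem mul_mem_normalForms {n : ℕ} {t : ℕ → G} (h : CoxeterRelations n t) {m : ℕ} (hm : m ≤ n)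
    {x : G} (hx : x ∈ normalForms t m) {i : ℕ} (hi : i + 1 < m) : x * t i ∈ normalForms t m := by
  induction m generalizing x i with
  | zero => omega
  | succ m ih =>
    obtain ⟨⟨y, j⟩, ⟨hy, hj⟩, rfl⟩ := hx
    simp only [Set.mem_Iic] at hj hy
    obtain ⟨k, rfl⟩ : ∃ k, m = k + j := ⟨m - j, by omega⟩
    simp only [Nat.add_sub_cancel]
    rcases lt_trichotomy (i + 1) k with hik | hik | hik
    · refine ⟨(y * t i, j), ⟨ih (by omega) hy (by omega), hj⟩, ?_⟩
      simp only [Nat.add_sub_cancel]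
      rw [mul_assoc, mul_assoc, cycleWord_comm h j k i hik (by omega)]
    · subst hik
      refine ⟨(y, j + 1), ⟨hy, Set.mem_Iic.2 (by omega)⟩, ?_⟩
      simp only [show i + 1 + j - (j + 1) = i by omega]
      rw [mul_assoc, cycleWord]
    · rcases Nat.eq_or_lt_of_le (show k ≤ i by omega) with rfl | hik'
      · obtain ⟨j, rfl⟩ : ∃ j', j = j' + 1 := ⟨j - 1, by omega⟩
        refine ⟨(y, j), ⟨hy, Set.mem_Iic.2 (by omega)⟩, ?_⟩
        simp only [show k + (j + 1) - j = k + 1 by omega]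
        rw [cycleWord, mul_assoc, mul_assoc, h.sq k (by omega), mul_one]
      · obtain ⟨i, rfl⟩ : ∃ i', i = i' + 1 := ⟨i - 1, by omega⟩
        refine ⟨(y * t i, j), ⟨ih (by omega) hy (by omega), hj⟩, ?_⟩
        simp only [Nat.add_sub_cancel]
        rw [mul_assoc, mul_assoc, cycleWord_shift h j k i (by omega) (by omega) (by omega)]

/-- The `i`-th simple transposition of `Fin n`. -/
def simpleSwap (n i : ℕ) : Equiv.Perm (Fin n) :=
  if h : i + 1 < n then Equiv.swap ⟨i, by omega⟩ ⟨i + 1, h⟩ else 1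

theorem simpleSwap_apply_val (n i : ℕ) (h : i + 1 < n) (x : Fin n) :
    (simpleSwap n i x : ℕ) = if (x : ℕ) = i then i + 1 else if (x : ℕ) = i + 1 then i else x := by
  rw [simpleSwap, dif_pos h, Equiv.swap_apply_def]
  simp only [Fin.ext_iff]
  split_ifs <;> rfl

theorem simpleSwap_relations (n : ℕ) : CoxeterRelations n (simpleSwap n) where
  sq i h := by rw [simpleSwap, dif_pos h, Equiv.swap_mul_self]
  braid i h := by
    ext x
    simp only [Equiv.Perm.mul_apply, simpleSwap_apply_val n i (by omega),
      simpleSwap_apply_val n (i + 1) (by omega)]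
    split_ifs <;> omega
  comm i j h h' := by
    ext x
    simp only [Equiv.Perm.mul_apply, simpleSwap_apply_val n i (by omega),
      simpleSwap_apply_val n j (by omega)]
    split_ifs <;> omega

theorem prod {M N : Type*} [Monoid M] [Monoid N] {n : ℕ} {t : ℕ → M} {t' : ℕ → N}
    (h : CoxeterRelations n t) (h' : CoxeterRelations n t') :
    CoxeterRelations n (fun i ↦ (t i, t' i)) where
  sq i hi := Prod.ext (h.sq i hi) (h'.sq i hi)
  braid i hi := Prod.ext (h.braid i hi) (h'.braid i hi)
  comm i j hi hj := Prod.ext (h.comm i j hi hj) (h'.comm i j hi hj)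

variable {M : Type*} [Monoid M] {n : ℕ} {t : ℕ → M}

/-- The graph of the action of the symmetric group. -/
def graph (n : ℕ) (t : ℕ → M) : Submonoid (Equiv.Perm (Fin n) × M) :=
  Submonoid.closure {x | ∃ i, i + 1 < n ∧ x = (simpleSwap n i, t i)}

theorem graph_subset (h : CoxeterRelations n t) :
    (graph n t : Set (Equiv.Perm (Fin n) × M)) ⊆
      normalForms (fun i ↦ (simpleSwap n i, t i)) n := by
  intro x hx
  induction hx using Submonoid.closure_induction_right with
  | one => exact one_mem_normalForms _ _
  | mul_right x _ y hy ih =>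
    obtain ⟨i, hi, rfl⟩ := hy
    exact mul_mem_normalForms ((simpleSwap_relations n).prod h) le_rfl ih hi

/-- The projection from the graph to the symmetric group. -/
def graphFst (n : ℕ) (t : ℕ → M) : graph n t →* Equiv.Perm (Fin n) :=
  (MonoidHom.fst _ _).comp (graph n t).subtype

theorem graphFst_surjective (n : ℕ) (t : ℕ → M) : Function.Surjective (graphFst n t) := by
  rw [← MonoidHom.mrange_eq_top, eq_top_iff]
  cases n with
  | zero =>
    intro σ _
    exact ⟨1, Subsingleton.elim _ _⟩
  | succ n =>
    rw [← Equiv.Perm.mclosure_swap_castSucc_succ, Submonoid.closure_le]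
    rintro _ ⟨i, rfl⟩
    refine ⟨⟨(simpleSwap (n + 1) i, t i), Submonoid.subset_closure ⟨i, by omega, rfl⟩⟩, ?_⟩
    change simpleSwap (n + 1) i = _
    rw [simpleSwap, dif_pos (by omega)]
    rfl

theorem graphFst_bijective (h : CoxeterRelations n t) : Function.Bijective (graphFst n t) := by
  have hn := normalForms_ncard (fun i ↦ (simpleSwap n i, t i)) n
  have hfin : (graph n t : Set (Equiv.Perm (Fin n) × M)).Finite := hn.1.subset (graph_subset h)
  have : Finite (graph n t) := hfin
  refine ((graphFst_surjective n t).bijective_of_nat_card_le ?_)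
  rw [Nat.card_perm, Nat.card_fin]
  exact (Set.ncard_le_ncard (graph_subset h) hn.1).trans hn.2

/-- The action of the symmetric group in which the `i`-th simple transposition acts as `t i`. -/
noncomputable def lift (h : CoxeterRelations n t) : Equiv.Perm (Fin n) →* M :=
  ((MonoidHom.snd _ _).comp (graph n t).subtype).comp
    (MulEquiv.ofBijective (graphFst n t) (graphFst_bijective h)).symm.toMonoidHom

theorem lift_simpleSwap (h : CoxeterRelations n t) (i : ℕ) (hi : i + 1 < n) :
    h.lift (simpleSwap n i) = t i := by
  have hx : (simpleSwap n i, t i) ∈ graph n t := Submonoid.subset_closure ⟨i, hi, rfl⟩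
  have : (MulEquiv.ofBijective (graphFst n t) (graphFst_bijective h)).symm (simpleSwap n i) =
      ⟨(simpleSwap n i, t i), hx⟩ := by
    rw [MulEquiv.symm_apply_eq]
    rfl
  change ((MulEquiv.ofBijective (graphFst n t) (graphFst_bijective h)).symm
    (simpleSwap n i)).1.2 = t i
  rw [this]

end CoxeterRelations

namespace CategoryTheory.MonoidalCategory

universe v₁ u₁

variable {C : Type u₁} [Category.{v₁} C] [MonoidalCategory C]

/-- The tensor power `X ⊗ ⋯ ⊗ X` with `n` factors. -/
def tensorPow (X : C) : ℕ → C
  | 0 => 𝟙_ C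
  | n + 1 => tensorPow X n ⊗ X

/-- Moving the last factor to the front (without permuting factors). -/
def tensorPowShift (X : C) : ∀ n : ℕ, tensorPow X (n + 1) ≅ X ⊗ tensorPow X n
  | 0 => λ_ X ≪≫ (ρ_ X).symm
  | n + 1 => whiskerRightIso (tensorPowShift X n) X ≪≫ α_ X (tensorPow X n) X

variable {X : C} (c : X ⊗ X ⟶ X ⊗ X)

/-- The crossing `c` of the last two factors. -/
def lastCross (W : C) : (W ⊗ X) ⊗ X ⟶ (W ⊗ X) ⊗ X :=
  (α_ W X X).hom ≫ W ◁ c ≫ (α_ W X X).inv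

/-- The crossing `c` of the factors in positions `i` and `i + 1` (counted from `0`, from left to
right) of the tensor power; the identity if `n ≤ i + 1`. -/
def crossAt : ∀ (n : ℕ) (_ : ℕ), End (tensorPow X n)
  | 0, _ => 𝟙 _
  | 1, _ => 𝟙 _
  | n + 2, i => if i = n then (lastCross c (tensorPow X n) :) else (crossAt (n + 1) i ▷ X :)

theorem crossAt_last (n : ℕ) : crossAt c (n + 2) n = lastCross c (tensorPow X n) :=
  if_pos rfl

theorem crossAt_succ (n i : ℕ) (h : i + 1 < n) : crossAt c (n + 1) i = crossAt c n i ▷ X := by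
  obtain ⟨n, rfl⟩ : ∃ m, n = m + 1 := ⟨n - 1, by omega⟩
  exact if_neg (by omega)

/-- `c` is an involution that satisfies the braid relation. -/
structure IsSymmetry (c : X ⊗ X ⟶ X ⊗ X) : Prop where
  sq : c ≫ c = 𝟙 _
  braid : c ▷ X ≫ (α_ X X X).hom ≫ X ◁ c ≫ (α_ X X X).inv ≫ c ▷ X =
    (α_ X X X).hom ≫ X ◁ c ≫ (α_ X X X).inv ≫ c ▷ X ≫ (α_ X X X).hom ≫ X ◁ c ≫ (α_ X X X).inv

variable {c}

theorem IsSymmetry.lastCross_sq (h : IsSymmetry c) (W : C) :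
    lastCross c W ≫ lastCross c W = 𝟙 _ := by
  simp only [lastCross, Category.assoc, Iso.inv_hom_id_assoc]
  rw [← whiskerLeft_comp_assoc, h.sq]
  simp

theorem IsSymmetry.lastCross_braid (h : IsSymmetry c) (W : C) :
    lastCross c W ▷ X ≫ lastCross c (W ⊗ X) ≫ lastCross c W ▷ X =
      lastCross c (W ⊗ X) ≫ lastCross c W ▷ X ≫ lastCross c (W ⊗ X) := by
  let e : ((W ⊗ X) ⊗ X) ⊗ X ≅ W ⊗ ((X ⊗ X) ⊗ X) :=
    whiskerRightIso (α_ W X X) X ≪≫ α_ W (X ⊗ X) X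
  have h1 : lastCross c W ▷ X = e.hom ≫ W ◁ (c ▷ X) ≫ e.inv := by
    simp [lastCross, e]
  have h2 : lastCross c (W ⊗ X) =
      e.hom ≫ W ◁ ((α_ X X X).hom ≫ X ◁ c ≫ (α_ X X X).inv) ≫ e.inv := by
    simp [lastCross, e]
  rw [h1, h2]
  simp only [Category.assoc, Iso.inv_hom_id_assoc]
  rw [← whiskerLeft_comp_assoc, ← whiskerLeft_comp_assoc, ← whiskerLeft_comp_assoc,
    ← whiskerLeft_comp_assoc]
  congr 2
  have := h.braid
  simp only [Category.assoc] at this ⊢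
  rw [this]

theorem lastCross_comm (c : X ⊗ X ⟶ X ⊗ X) {W : C} (f : W ⟶ W) :
    f ▷ X ▷ X ≫ lastCross c W = lastCross c W ≫ f ▷ X ▷ X := by
  simp only [lastCross, associator_naturality_left_assoc, Category.assoc,
    ← whisker_exchange_assoc, associator_inv_naturality_left]

theorem IsSymmetry.crossAt_relations (h : IsSymmetry c) (n : ℕ) :
    CoxeterRelations n (crossAt c n) := by
  induction n with
  | zero => exact ⟨fun i h ↦ by omega, fun i h ↦ by omega, fun i j h h' ↦ by omega⟩
  | succ n ih =>
    refine ⟨fun i hi ↦ ?_, fun i hi ↦ ?_, fun i j hi hj ↦ ?_⟩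
    · rcases Nat.lt_or_ge (i + 1) n with h' | h'
      · rw [crossAt_succ c n i h']
        exact (comp_whiskerRight _ _ _).symm.trans
          ((congrArg (· ▷ X) (ih.sq i h')).trans (id_whiskerRight _ _))
      · obtain rfl : n = i + 1 := by omega
        rw [crossAt_last]
        exact h.lastCross_sq _
    · rcases Nat.lt_or_ge (i + 2) n with h' | h'
      · rw [crossAt_succ c n i (by omega), crossAt_succ c n (i + 1) (by omega)]
        have := congrArg (· ▷ X) (ih.braid i h')
        simp only [End.mul_def, comp_whiskerRight] at this
        exact this
      · obtain rfl : n = i + 2 := by omega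
        rw [crossAt_succ c (i + 2) i (by omega), crossAt_last c (i + 1), crossAt_last]
        exact h.lastCross_braid (tensorPow X i)
    · rcases Nat.lt_or_ge (j + 1) n with h' | h'
      · rw [crossAt_succ c n i (by omega), crossAt_succ c n j h']
        have := congrArg (· ▷ X) (ih.comm i j hi h')
        simp only [End.mul_def, comp_whiskerRight] at this
        exact this
      · obtain rfl : n = j + 1 := by omega
        rw [crossAt_succ c (j + 1) i (by omega), crossAt_succ c j i (by omega), crossAt_last]
        exact (lastCross_comm c _).symm

/-- The action of the symmetric group on a tensor power: `σ` acts as the permutation diagram whose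
strand starting in position `i` at the bottom ends in position `σ i` at the top. -/
noncomputable def permHom (h : IsSymmetry c) (n : ℕ) :
    Equiv.Perm (Fin n) →* End (tensorPow X n) :=
  (h.crossAt_relations n).lift

end CategoryTheory.MonoidalCategory

/-! ### Young idempotents -/

/-- The partitions of `n`, as Young diagrams with `n` cells; the cell `(i, j)` lies in row `i` and
column `j`. -/
abbrev YoungDiagram.OfSize (n : ℕ) : Type := {μ : YoungDiagram // μ.card = n}

namespace YoungDiagram.OfSize

variable {n : ℕ}

/-- The cell in position `m` of the row reading order: the first row from left to right, then the
second row, and so on. Cells are pairs (row, column). -/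
def cellAt (μ : OfSize n) (m : Fin n) : ℕ × ℕ :=
  ofLex ((μ.1.cells.map toLex.toEmbedding).orderEmbOfFin ((Finset.card_map _).trans μ.2) m)

theorem cellAt_injective (μ : OfSize n) : Function.Injective μ.cellAt :=
  fun _ _ h ↦ (Finset.orderEmbOfFin _ _).injective (ofLex.injective h)

theorem cellAt_mem (μ : OfSize n) (m : Fin n) : μ.cellAt m ∈ μ.1 := by
  have := Finset.orderEmbOfFin_mem (μ.1.cells.map toLex.toEmbedding) ((Finset.card_map _).trans μ.2) m
  obtain ⟨c, hc, h⟩ := Finset.mem_map.1 this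
  rw [cellAt, ← h]
  exact hc

theorem exists_cellAt_eq (μ : OfSize n) {c : ℕ × ℕ} (hc : c ∈ μ.1) : ∃ m, μ.cellAt m = c := by
  have := Finset.range_orderEmbOfFin (μ.1.cells.map toLex.toEmbedding) ((Finset.card_map _).trans μ.2)
  have hm : toLex c ∈ Set.range ((μ.1.cells.map toLex.toEmbedding).orderEmbOfFin
      ((Finset.card_map _).trans μ.2)) := by
    rw [this]
    exact Finset.mem_coe.2 (Finset.mem_map_of_mem _ hc)
  obtain ⟨m, hm⟩ := hm
  exact ⟨m, congrArg ofLex hm⟩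

/-- The permutations of the positions that preserve the rows. -/
def rowGroup (μ : OfSize n) : Subgroup (Equiv.Perm (Fin n)) where
  carrier := {σ | ∀ m, (μ.cellAt (σ m)).1 = (μ.cellAt m).1}
  one_mem' _ := rfl
  mul_mem' hσ hτ m := (hσ _).trans (hτ m)
  inv_mem' {σ} hσ m := by
    have := hσ (σ⁻¹ m)
    rwa [show σ (σ⁻¹ m) = m from σ.apply_symm_apply m, eq_comm] at this

/-- The permutations of the positions that preserve the columns. -/
def colGroup (μ : OfSize n) : Subgroup (Equiv.Perm (Fin n)) where
  carrier := {σ | ∀ m, (μ.cellAt (σ m)).2 = (μ.cellAt m).2}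
  one_mem' _ := rfl
  mul_mem' hσ hτ m := (hσ _).trans (hτ m)
  inv_mem' {σ} hσ m := by
    have := hσ (σ⁻¹ m)
    rwa [show σ (σ⁻¹ m) = m from σ.apply_symm_apply m, eq_comm] at this

instance (μ : OfSize n) : DecidablePred (· ∈ μ.rowGroup) := fun σ ↦
  inferInstanceAs (Decidable (∀ m, (μ.cellAt (σ m)).1 = (μ.cellAt m).1))

instance (μ : OfSize n) : DecidablePred (· ∈ μ.colGroup) := fun σ ↦
  inferInstanceAs (Decidable (∀ m, (μ.cellAt (σ m)).2 = (μ.cellAt m).2))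

theorem sum_range_card_le (S : Finset ℕ) : ∑ i ∈ Finset.range S.card, i ≤ ∑ x ∈ S, x ∧
    (∑ i ∈ Finset.range S.card, i = ∑ x ∈ S, x → S = Finset.range S.card) := by
  have h1 : ∑ x ∈ S, x = ∑ i : Fin S.card, S.orderEmbOfFin rfl i := by
    conv_lhs => rw [← Finset.image_orderEmbOfFin_univ S rfl]
    exact Finset.sum_image (fun _ _ _ _ h ↦ (S.orderEmbOfFin rfl).injective h)
  have h2 : ∑ i ∈ Finset.range S.card, i = ∑ i : Fin S.card, (i : ℕ) :=
    Finset.sum_range (fun i ↦ i)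
  have h3 (i : Fin S.card) : (i : ℕ) ≤ S.orderEmbOfFin rfl i := by
    obtain ⟨i, hi⟩ := i
    induction i with
    | zero => exact Nat.zero_le _
    | succ i ih =>
      have := ih (by omega)
      have h4 : S.orderEmbOfFin rfl ⟨i, by omega⟩ < S.orderEmbOfFin rfl ⟨i + 1, hi⟩ :=
        (S.orderEmbOfFin rfl).strictMono (by simp)
      simp only at this ⊢
      omega
  rw [h1, h2]
  refine ⟨Finset.sum_le_sum fun i _ ↦ h3 i, fun h ↦ ?_⟩
  have h4 := (Finset.sum_eq_sum_iff_of_le fun i _ ↦ h3 i).1 h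
  ext x
  rw [← Finset.mem_coe, ← Finset.range_orderEmbOfFin S rfl, Set.mem_range, Finset.mem_range]
  constructor
  · rintro ⟨i, rfl⟩
    rw [← h4 i (Finset.mem_univ _)]
    exact i.2
  · intro hx
    exact ⟨⟨x, hx⟩, (h4 ⟨x, hx⟩ (Finset.mem_univ _)).symm⟩

/-- A permutation is a product of a row permutation and a column permutation as soon as no two
positions in the same row are moved from the same column. -/
theorem exists_rowGroup_mul_colGroup (μ : OfSize n) (g : Equiv.Perm (Fin n))
    (hg : ∀ x y, x ≠ y → (μ.cellAt x).1 = (μ.cellAt y).1 →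
      (μ.cellAt (g⁻¹ x)).2 ≠ (μ.cellAt (g⁻¹ y)).2) :
    ∃ r ∈ μ.rowGroup, ∃ s ∈ μ.colGroup, g = r * s := by
  let F (i : ℕ) : Finset (Fin n) := Finset.univ.filter fun x ↦ (μ.cellAt x).1 = i
  let f (x : Fin n) : ℕ := (μ.cellAt (g⁻¹ x)).2
  have hmemF (i : ℕ) (x : Fin n) : x ∈ F i ↔ (μ.cellAt x).1 = i := by simp [F]
  have hf (i : ℕ) : Set.InjOn f (F i) := by
    intro x hx y hy hxy
    by_contra hne
    rw [Finset.mem_coe, hmemF] at hx hy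
    exact hg x y hne (hx.trans hy.symm) hxy
  have hc (i : ℕ) : Set.InjOn (fun x ↦ (μ.cellAt x).2) (F i : Set (Fin n)) := by
    intro x hx y hy hxy
    rw [Finset.mem_coe, hmemF] at hx hy
    exact μ.cellAt_injective (Prod.ext (hx.trans hy.symm) hxy)
  have hrange (i : ℕ) : (F i).image (fun x ↦ (μ.cellAt x).2) = Finset.range (μ.1.rowLen i) := by
    ext j
    simp only [Finset.mem_image, Finset.mem_range, hmemF]
    rw [← mem_iff_lt_rowLen]
    constructor
    · rintro ⟨x, rfl, rfl⟩
      exact μ.cellAt_mem x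
    · intro h
      obtain ⟨x, hx⟩ := μ.exists_cellAt_eq h
      exact ⟨x, by rw [hx], by rw [hx]⟩
  have hcard (i : ℕ) : (F i).card = μ.1.rowLen i := by
    rw [← Finset.card_image_of_injOn (hc i), hrange, Finset.card_range]
  have hcard' (i : ℕ) : ((F i).image f).card = μ.1.rowLen i := by
    rw [Finset.card_image_of_injOn (hf i), hcard]
  let I : Finset ℕ := Finset.univ.image fun x ↦ (μ.cellAt x).1
  have hI (h : Fin n → ℕ) : ∑ i ∈ I, ∑ x ∈ F i, h x = ∑ x, h x :=
    Finset.sum_fiberwise_of_maps_to (fun x hx ↦ Finset.mem_image_of_mem _ hx) h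
  have hle (i : ℕ) : ∑ x ∈ F i, (μ.cellAt x).2 ≤ ∑ x ∈ F i, f x := by
    have h := (sum_range_card_le ((F i).image f)).1
    rw [hcard', ← hrange, Finset.sum_image (hc i), Finset.sum_image (hf i)] at h
    exact h
  have heq : ∑ i ∈ I, ∑ x ∈ F i, (μ.cellAt x).2 = ∑ i ∈ I, ∑ x ∈ F i, f x := by
    rw [hI, hI]
    exact (Equiv.sum_comp g⁻¹ fun x ↦ (μ.cellAt x).2).symm
  have heq' := (Finset.sum_eq_sum_iff_of_le fun i _ ↦ hle i).1 heq
  have hmem (x : Fin n) : ((μ.cellAt x).1, f x) ∈ μ.1 := by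
    rw [mem_iff_lt_rowLen]
    have hi := heq' (μ.cellAt x).1 (Finset.mem_image_of_mem _ (Finset.mem_univ x))
    have h := (sum_range_card_le ((F (μ.cellAt x).1).image f)).2
    rw [hcard', ← hrange, Finset.sum_image (hc _), Finset.sum_image (hf _), hrange] at h
    rw [← Finset.mem_range, ← h hi]
    exact Finset.mem_image_of_mem _ ((hmemF _ _).2 rfl)
  choose w hw using fun x ↦ μ.exists_cellAt_eq (hmem x)
  have hinj : Function.Injective w := by
    intro x y hxy
    have h := (hw x).symm.trans ((congrArg μ.cellAt hxy).trans (hw y))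
    by_contra hne
    exact hg x y hne (Prod.ext_iff.1 h).1 (Prod.ext_iff.1 h).2
  let W : Equiv.Perm (Fin n) := Equiv.ofBijective w (Finite.injective_iff_bijective.1 hinj)
  have hW : W ∈ μ.rowGroup := fun x ↦ (Prod.ext_iff.1 (hw x)).1
  refine ⟨W⁻¹, μ.rowGroup.inv_mem hW, W * g, fun m ↦ ?_, by rw [inv_mul_cancel_left]⟩
  refine (congrArg Prod.snd (hw (g m))).trans ?_
  change (μ.cellAt (g⁻¹ (g m))).2 = _
  rw [show g⁻¹ (g m) = m from g.symm_apply_apply m]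

/-- The transposed partition. -/
def transpose (μ : OfSize n) : OfSize n :=
  ⟨μ.1.transpose, by
    refine Eq.trans ?_ μ.2
    exact (Finset.card_bij (fun c _ ↦ c.swap) (fun c hc ↦ by simpa using hc)
      (fun _ _ _ _ h ↦ Prod.swap_injective h) (fun c hc ↦ ⟨c.swap, by simpa using hc, by simp⟩)).symm⟩

instance : Finite (OfSize n) := by
  have h (μ : OfSize n) : μ.1.cells ⊆ Finset.range n ×ˢ Finset.range n := by
    rintro ⟨i, j⟩ hc
    have h1 : μ.1.rowLen i ≤ n := by
      rw [YoungDiagram.rowLen_eq_card]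
      exact (Finset.card_le_card (Finset.filter_subset _ _)).trans μ.2.le
    have h2 : μ.1.colLen j ≤ n := by
      rw [YoungDiagram.colLen_eq_card]
      exact (Finset.card_le_card (Finset.filter_subset _ _)).trans μ.2.le
    rw [YoungDiagram.mem_cells] at hc
    have h3 := YoungDiagram.mem_iff_lt_rowLen.1 hc
    have h4 := YoungDiagram.mem_iff_lt_colLen.1 hc
    simp only [Finset.mem_product, Finset.mem_range]
    omega
  refine Finite.of_injective (β := (Finset.range n ×ˢ Finset.range n).powerset)
    (fun μ ↦ ⟨μ.1.cells, Finset.mem_powerset.2 (h μ)⟩) (fun μ ν hμν ↦ ?_)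
  exact Subtype.ext (YoungDiagram.ext (Subtype.ext_iff.1 hμν))

theorem exists_newBox (μ : OfSize n) (ν : OfSize (n + 1)) : ∃ p, ν.cellAt p ∉ μ.1 := by
  obtain ⟨c, hc, hc'⟩ := Finset.exists_mem_notMem_of_card_lt_card
    (s := μ.1.cells) (t := ν.1.cells) (by
      have h1 : μ.1.cells.card = n := μ.2
      have h2 : ν.1.cells.card = n + 1 := ν.2
      omega)
  obtain ⟨p, hp⟩ := ν.exists_cellAt_eq ((YoungDiagram.mem_cells c).1 hc)
  exact ⟨p, hp ▸ fun h ↦ hc' ((YoungDiagram.mem_cells c).2 h)⟩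

/-- If `ν` is obtained from `μ` by adding a box, the position of this box in the row reading of
`ν`. -/
noncomputable def newBox (μ : OfSize n) (ν : OfSize (n + 1)) : Fin (n + 1) :=
  (exists_newBox μ ν).choose

section Field

variable (k : Type u) [Field k] (μ : OfSize n)

/-- The sum of all row permutations. -/
noncomputable def rowSymmetrizer : MonoidAlgebra k (Equiv.Perm (Fin n)) :=
  ∑ σ ∈ Finset.univ.filter (· ∈ μ.rowGroup), MonoidAlgebra.single σ 1

/-- The signed sum of all column permutations. -/
noncomputable def colAntisymmetrizer : MonoidAlgebra k (Equiv.Perm (Fin n)) :=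
  ∑ σ ∈ Finset.univ.filter (· ∈ μ.colGroup), MonoidAlgebra.single σ ((Equiv.Perm.sign σ : ℤ) : k)

/-- The Young symmetrizer of the row reading tableau. -/
noncomputable def youngSymmetrizer : MonoidAlgebra k (Equiv.Perm (Fin n)) :=
  μ.rowSymmetrizer k * μ.colAntisymmetrizer k

theorem rowSymmetrizer_mul {r : Equiv.Perm (Fin n)} (hr : r ∈ μ.rowGroup) :
    μ.rowSymmetrizer k * MonoidAlgebra.single r 1 = μ.rowSymmetrizer k := by
  rw [rowSymmetrizer, Finset.sum_mul]
  refine Finset.sum_equiv (Equiv.mulRight r) (fun σ ↦ ?_) (fun σ _ ↦ ?_)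
  · simpa using (μ.rowGroup.mul_mem_cancel_right hr).symm
  · simp [MonoidAlgebra.single_mul_single]

theorem mul_colAntisymmetrizer {s : Equiv.Perm (Fin n)} (hs : s ∈ μ.colGroup) :
    MonoidAlgebra.single s 1 * μ.colAntisymmetrizer k =
      ((Equiv.Perm.sign s : ℤ) : k) • μ.colAntisymmetrizer k := by
  rw [colAntisymmetrizer, Finset.mul_sum, Finset.smul_sum]
  refine Finset.sum_equiv (Equiv.mulLeft s) (fun σ ↦ ?_) (fun σ _ ↦ ?_)
  · simpa using (μ.colGroup.mul_mem_cancel_left hs).symm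
  · have : ((Equiv.Perm.sign s : ℤ) : k) * ((Equiv.Perm.sign s : ℤ) : k) = 1 := by
      rw [← Int.cast_mul, ← Units.val_mul, Int.units_mul_self, Units.val_one, Int.cast_one]
    simp [MonoidAlgebra.single_mul_single, ← mul_assoc, this]

theorem rowSymmetrizer_mul_mul [CharZero k] (x : MonoidAlgebra k (Equiv.Perm (Fin n))) :
    ∃ c : k, μ.rowSymmetrizer k * x * μ.colAntisymmetrizer k = c • μ.youngSymmetrizer k := by
  induction x using MonoidAlgebra.induction_linear with
  | zero => exact ⟨0, by simp⟩
  | add x y hx hy =>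
    obtain ⟨c, hc⟩ := hx
    obtain ⟨d, hd⟩ := hy
    exact ⟨c + d, by rw [mul_add, add_mul, hc, hd, add_smul]⟩
  | single g z =>
    suffices h : ∃ c : k, μ.rowSymmetrizer k * MonoidAlgebra.single g 1 * μ.colAntisymmetrizer k =
        c • μ.youngSymmetrizer k by
      obtain ⟨c, hc⟩ := h
      refine ⟨z * c, ?_⟩
      have : MonoidAlgebra.single g z = z • MonoidAlgebra.single g (1 : k) := by simp
      rw [this, mul_smul_comm, smul_mul_assoc, hc, smul_smul]
    by_cases hg : ∀ x y, x ≠ y → (μ.cellAt x).1 = (μ.cellAt y).1 →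
      (μ.cellAt (g⁻¹ x)).2 ≠ (μ.cellAt (g⁻¹ y)).2
    · obtain ⟨r, hr, s, hs, rfl⟩ := μ.exists_rowGroup_mul_colGroup g hg
      refine ⟨((Equiv.Perm.sign s : ℤ) : k), ?_⟩
      have : MonoidAlgebra.single (r * s) (1 : k) =
          MonoidAlgebra.single r 1 * MonoidAlgebra.single s 1 := by
        rw [MonoidAlgebra.single_mul_single, one_mul]
      rw [this, ← mul_assoc, rowSymmetrizer_mul k μ hr, mul_assoc, mul_colAntisymmetrizer k μ hs,
        mul_smul_comm, youngSymmetrizer]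
    · push Not at hg
      obtain ⟨x, y, hne, hrow, hcol⟩ := hg
      refine ⟨0, ?_⟩
      have hr : Equiv.swap x y ∈ μ.rowGroup := by
        intro m
        rw [Equiv.swap_apply_def]
        split_ifs with h h
        · rw [h, hrow]
        · rw [h, hrow]
        · rfl
      have hs : Equiv.swap (g⁻¹ x) (g⁻¹ y) ∈ μ.colGroup := by
        intro m
        rw [Equiv.swap_apply_def]
        split_ifs with h h
        · rw [h, hcol]
        · rw [h, hcol]
        · rfl
      have hconj : Equiv.swap x y * g = g * Equiv.swap (g⁻¹ x) (g⁻¹ y) := by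
        rw [Equiv.swap_apply_apply, inv_inv]
        group
      have h1 : μ.rowSymmetrizer k * MonoidAlgebra.single g 1 * μ.colAntisymmetrizer k =
          -(μ.rowSymmetrizer k * MonoidAlgebra.single g 1 * μ.colAntisymmetrizer k) := by
        conv_lhs => rw [← rowSymmetrizer_mul k μ hr]
        rw [mul_assoc (μ.rowSymmetrizer k), MonoidAlgebra.single_mul_single, hconj,
          ← MonoidAlgebra.single_mul_single, ← mul_assoc, mul_assoc _ _ (μ.colAntisymmetrizer k),
          mul_colAntisymmetrizer k μ hs, Equiv.Perm.sign_swap]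
        · simp
        · exact fun h ↦ hne (g⁻¹.injective h)
      rw [zero_smul]
      have h2 : (2 : k) • (μ.rowSymmetrizer k * MonoidAlgebra.single g 1 *
          μ.colAntisymmetrizer k) = 0 := by
        rw [two_smul]
        nth_rw 1 [h1]
        exact neg_add_cancel _
      exact (smul_eq_zero.1 h2).resolve_left two_ne_zero

theorem youngSymmetrizer_coeff_one : (μ.youngSymmetrizer k).coeff 1 = 1 := by
  rw [youngSymmetrizer, rowSymmetrizer, colAntisymmetrizer, Finset.sum_mul_sum,
    MonoidAlgebra.coeff_sum, Finsupp.finsetSum_apply]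
  rw [Finset.sum_eq_single 1, MonoidAlgebra.coeff_sum, Finsupp.finsetSum_apply,
    Finset.sum_eq_single 1]
  · simp [MonoidAlgebra.single_mul_single]
  · intro s _ hs
    rw [MonoidAlgebra.single_mul_single, one_mul, MonoidAlgebra.coeff_single,
      Finsupp.single_eq_of_ne hs.symm]
  · simp [μ.colGroup.one_mem]
  · intro r hr hr1
    rw [MonoidAlgebra.coeff_sum, Finsupp.finsetSum_apply]
    refine Finset.sum_eq_zero fun s hs ↦ ?_
    rw [MonoidAlgebra.single_mul_single, MonoidAlgebra.coeff_single, Finsupp.single_eq_of_ne]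
    intro h
    simp only [Finset.mem_filter, Finset.mem_univ, true_and] at hr hs
    apply hr1
    have hrs : r = s⁻¹ := eq_inv_of_mul_eq_one_left h.symm
    ext m : 1
    refine μ.cellAt_injective (Prod.ext (hr m) ?_)
    rw [hrs]
    exact μ.colGroup.inv_mem hs m
  · simp [μ.rowGroup.one_mem]

/-- The scalar `κ` with `c * c = κ • c` for the Young symmetrizer `c`. -/
noncomputable def youngScalar : k := (μ.youngSymmetrizer k * μ.youngSymmetrizer k).coeff 1

theorem youngSymmetrizer_mul_self [CharZero k] :
    μ.youngSymmetrizer k * μ.youngSymmetrizer k = μ.youngScalar k • μ.youngSymmetrizer k := by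
  obtain ⟨c, hc⟩ := μ.rowSymmetrizer_mul_mul k (μ.colAntisymmetrizer k * μ.rowSymmetrizer k)
  have h : μ.youngSymmetrizer k * μ.youngSymmetrizer k = c • μ.youngSymmetrizer k := by
    rw [← hc, youngSymmetrizer]
    simp only [mul_assoc]
  rw [youngScalar, h, MonoidAlgebra.coeff_smul_apply, youngSymmetrizer_coeff_one, smul_eq_mul,
    mul_one]

theorem youngScalar_ne_zero [CharZero k] : μ.youngScalar k ≠ 0 := by
  intro h0
  have hsq : μ.youngSymmetrizer k * μ.youngSymmetrizer k = 0 := by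
    rw [youngSymmetrizer_mul_self, h0, zero_smul]
  have hnil : IsNilpotent (LinearMap.mulLeft k (μ.youngSymmetrizer k)) :=
    ⟨2, by rw [LinearMap.pow_mulLeft, pow_two, hsq, LinearMap.mulLeft_zero_eq_zero]⟩
  have htr := (LinearMap.isNilpotent_trace_of_isNilpotent hnil).eq_zero
  rw [LinearMap.trace_eq_matrix_trace k (MonoidAlgebra.basis _ k), Matrix.trace] at htr
  have hdiag (g : Equiv.Perm (Fin n)) :
      (LinearMap.toMatrix (MonoidAlgebra.basis _ k) (MonoidAlgebra.basis _ k)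
        (LinearMap.mulLeft k (μ.youngSymmetrizer k))).diag g = 1 := by
    rw [Matrix.diag_apply, LinearMap.toMatrix_apply, LinearMap.mulLeft_apply,
      MonoidAlgebra.basis_apply]
    change (μ.youngSymmetrizer k * MonoidAlgebra.single g 1).coeff g = 1
    rw [MonoidAlgebra.coeff_mul_single_apply, mul_inv_cancel, youngSymmetrizer_coeff_one, mul_one]
  simp only [hdiag, Finset.sum_const, Finset.card_univ, nsmul_eq_mul, mul_one] at htr
  exact (Nat.cast_ne_zero.2 Fintype.card_ne_zero) htr

/-- The Young idempotent of the row reading tableau. -/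
noncomputable def youngIdempotent : MonoidAlgebra k (Equiv.Perm (Fin n)) :=
  (μ.youngScalar k)⁻¹ • μ.youngSymmetrizer k

theorem youngIdempotent_mul_self [CharZero k] :
    μ.youngIdempotent k * μ.youngIdempotent k = μ.youngIdempotent k := by
  rw [youngIdempotent, smul_mul_smul_comm, youngSymmetrizer_mul_self, smul_smul, mul_assoc,
    inv_mul_cancel₀ (μ.youngScalar_ne_zero k), mul_one]

end Field

end YoungDiagram.OfSize

/-! ### The Heisenberg category and its Young idempotents -/

namespace Heis

open Idempotents

section Ring

variable (k : Type u) [CommRing k]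

/-- The Karoubi envelope of the additive `k`-linear monoidal category of diagrams. -/
abbrev HeisCat : Type (max 1 u) := Karoubi (Mat_ (HeisDiag k))

/-- The functor that sends a word to itself. -/
noncomputable def incl : HeisDiag k ⥤ HeisCat k := Mat_.embedding _ ⋙ toKaroubi _

/-- On words, the tensor product of `HeisCat k` is that of `HeisDiag k`. -/
noncomputable def inclTensor (X Y : HeisDiag k) :
    (incl k).obj (X ⊗ Y) ≅ (incl k).obj X ⊗ (incl k).obj Y :=
  Karoubi.isoOfComm
    ⟨Mat_.monomial (N := (Mat_.embedding _).obj X ⊗ (Mat_.embedding _).obj Y)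
        (Equiv.prodPUnit PUnit).symm (fun _ ↦ 𝟙 (X ⊗ Y)),
      Mat_.monomial (M := (Mat_.embedding _).obj X ⊗ (Mat_.embedding _).obj Y)
        (Equiv.prodPUnit PUnit) (fun _ ↦ 𝟙 (X ⊗ Y)),
      (Mat_.monomial_comp_monomial _ _ _ _).trans (by
        rw [Mat_.id_eq_monomial]; congr 1; funext i; exact Category.comp_id _),
      (Mat_.monomial_comp_monomial _ _ _ _).trans (by
        rw [Mat_.id_eq_monomial]; congr 1; funext i; exact Category.comp_id _)⟩
    (by
      have h : ((incl k).obj X ⊗ (incl k).obj Y).p = 𝟙 _ := id_tensorHom_id _ _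
      rw [h, Category.comp_id]
      exact Category.id_comp _)

/-- The word `Q₊` of length one. -/
def up : HeisDiag k := ⟨.up⟩

/-- The word `Q₋` of length one. -/
def down : HeisDiag k := ⟨.down⟩

/-- The crossing of two upward strands. -/
def crossUp : up k ⊗ up k ⟶ up k ⊗ up k := HeisDiag.ofDiagram .cross

/-- The crossing of two downward strands. -/
def crossDown : down k ⊗ down k ⟶ down k ⊗ down k := HeisDiag.ofDiagram HeisDiagram.crossDown

theorem isSymmetry_crossUp : IsSymmetry (crossUp k) :=
  ⟨Quotient.sound HeisDiagram.Rel.up_double, Quotient.sound HeisDiagram.Rel.up_triple⟩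

theorem isSymmetry_crossDown : IsSymmetry (crossDown k) :=
  ⟨Quotient.sound HeisDiagram.Rel.down_double, Quotient.sound HeisDiagram.Rel.down_triple⟩

/-- The generator `P`, an upward strand. -/
noncomputable abbrev P : HeisCat k := (incl k).obj (up k)

/-- The generator `Q`, a downward strand. -/
noncomputable abbrev Q : HeisCat k := (incl k).obj (down k)

/-- The cap `P ⊗ Q ⟶ 𝟙`. -/
noncomputable def cap : P k ⊗ Q k ⟶ 𝟙_ (HeisCat k) :=
  (inclTensor k _ _).inv ≫ (incl k).map
    (HeisDiag.ofDiagram .capUD : up k ⊗ down k ⟶ 𝟙_ (HeisDiag k))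

/-- The cup `𝟙 ⟶ P ⊗ Q`. -/
noncomputable def cup : 𝟙_ (HeisCat k) ⟶ P k ⊗ Q k :=
  (incl k).map (HeisDiag.ofDiagram .cupUD : 𝟙_ (HeisDiag k) ⟶ up k ⊗ down k) ≫
    (inclTensor k _ _).hom

end Ring

open YoungDiagram YoungDiagram.OfSize

variable (k : Type u) [Field k]

section Symmetry

variable {k} {X : HeisDiag k} {c : X ⊗ X ⟶ X ⊗ X} (h : IsSymmetry c)

/-- The endomorphism of a tensor power given by the Young idempotent. -/
noncomputable def youngEnd {n : ℕ} (μ : OfSize n) : End (tensorPow X n) :=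
  MonoidAlgebra.lift k (End (tensorPow X n)) (Equiv.Perm (Fin n)) (permHom h n)
    (μ.youngIdempotent k)

variable [CharZero k]

theorem youngEnd_idem {n : ℕ} (μ : OfSize n) :
    (youngEnd h μ : tensorPow X n ⟶ tensorPow X n) ≫ youngEnd h μ = youngEnd h μ := by
  change youngEnd h μ * youngEnd h μ = youngEnd h μ
  rw [youngEnd, ← map_mul, youngIdempotent_mul_self]

/-- The image of the Young idempotent, a direct summand of a tensor power. -/
noncomputable def youngObj {n : ℕ} (μ : OfSize n) : HeisCat k where
  X := (Mat_.embedding _).obj (tensorPow X n)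
  p := (Mat_.embedding _).map (youngEnd h μ)
  idem := by rw [← Functor.map_comp, youngEnd_idem]

/-- The inclusion of the direct summand. -/
noncomputable def youngIncl {n : ℕ} (μ : OfSize n) :
    youngObj h μ ⟶ (incl k).obj (tensorPow X n) :=
  Karoubi.decompId_i (youngObj h μ)

/-- The projection to the direct summand. -/
noncomputable def youngProj {n : ℕ} (μ : OfSize n) :
    (incl k).obj (tensorPow X n) ⟶ youngObj h μ :=
  Karoubi.decompId_p (youngObj h μ)

/-- The diagram of a permutation of the strands. -/
noncomputable def permMap {n : ℕ} (σ : Equiv.Perm (Fin n)) :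
    (incl k).obj (tensorPow X n) ⟶ (incl k).obj (tensorPow X n) :=
  (incl k).map (permHom h n σ)

end Symmetry

/-- The permutation that moves position `p` to the last position and keeps the order of the other
positions. -/
def moveLast {n : ℕ} (p : Fin (n + 1)) : Equiv.Perm (Fin (n + 1)) :=
  (finSuccEquiv' p).trans (finSuccEquiv' (Fin.last n)).symm

/-- The permutation that moves position `p` to the first position and keeps the order of the other
positions. -/
def moveFirst {n : ℕ} (p : Fin (n + 1)) : Equiv.Perm (Fin (n + 1)) :=
  (finSuccEquiv' p).trans (finSuccEquiv' 0).symm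

variable [CharZero k]

/-- The direct summand `P^μ` of `P ⊗ ⋯ ⊗ P`. -/
noncomputable def PObj {n : ℕ} (μ : OfSize n) : HeisCat k := youngObj (isSymmetry_crossUp k) μ

/-- The direct summand `Q^μ` of `Q ⊗ ⋯ ⊗ Q`. -/
noncomputable def QObj {n : ℕ} (μ : OfSize n) : HeisCat k := youngObj (isSymmetry_crossDown k) μ

variable {n : ℕ} (μ : OfSize n) (ν : OfSize (n + 1))

/-- The map `P^ν ⟶ P^μ ⊗ P`, where `ν` is obtained by adding a box to `μ`. -/
noncomputable def iotaP : PObj k ν ⟶ PObj k μ ⊗ P k :=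
  youngIncl _ ν ≫ permMap (isSymmetry_crossUp k) (moveLast (newBox μ ν)) ≫
    (inclTensor k (tensorPow (up k) n) (up k)).hom ≫ youngProj _ μ ▷ P k

/-- The map `P^μ ⊗ P ⟶ P^ν`, where `ν` is obtained by adding a box to `μ`. -/
noncomputable def rhoP : PObj k μ ⊗ P k ⟶ PObj k ν :=
  youngIncl _ μ ▷ P k ≫ (inclTensor k (tensorPow (up k) n) (up k)).inv ≫
    permMap (isSymmetry_crossUp k) (moveLast (newBox μ ν))⁻¹ ≫ youngProj _ ν

/-- The map `Q^ν ⟶ Q ⊗ Q^μ`, where `ν` is obtained by adding a box to `μ`. -/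
noncomputable def iotaQ : QObj k ν ⟶ Q k ⊗ QObj k μ :=
  youngIncl _ ν ≫ permMap (isSymmetry_crossDown k) (moveFirst (newBox μ ν)) ≫
    (incl k).map (tensorPowShift (down k) n).hom ≫
    (inclTensor k (down k) (tensorPow (down k) n)).hom ≫ Q k ◁ youngProj _ μ

/-- The map `Q ⊗ Q^μ ⟶ Q^ν`, where `ν` is obtained by adding a box to `μ`. -/
noncomputable def rhoQ : Q k ⊗ QObj k μ ⟶ QObj k ν :=
  Q k ◁ youngIncl _ μ ≫ (inclTensor k (down k) (tensorPow (down k) n)).inv ≫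
    (incl k).map (tensorPowShift (down k) n).inv ≫
    permMap (isSymmetry_crossDown k) (moveFirst (newBox μ ν))⁻¹ ≫ youngProj _ ν

/-- The object `P^μ ⊗ Q^(μᵗ)`. -/
noncomputable def PQ : HeisCat k := PObj k μ ⊗ QObj k μ.transpose

/-- The map `P^ν ⊗ Q^(νᵗ) ⟶ P^μ ⊗ Q^(μᵗ)` that splits off the new box on both sides and closes the
two strands by a cap. -/
noncomputable def lower : PQ k ν ⟶ PQ k μ :=
  (iotaP k μ ν ⊗ₘ iotaQ k μ.transpose ν.transpose) ≫
    (α_ (PObj k μ) (P k) (Q k ⊗ QObj k μ.transpose)).hom ≫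
    PObj k μ ◁ ((α_ (P k) (Q k) (QObj k μ.transpose)).inv ≫ cap k ▷ _ ≫ (λ_ _).hom)

/-- The map `P^μ ⊗ Q^(μᵗ) ⟶ P^ν ⊗ Q^(νᵗ)` that creates two strands by a cup and merges them with the
two sides. -/
noncomputable def raise : PQ k μ ⟶ PQ k ν :=
  PObj k μ ◁ ((λ_ _).inv ≫ cup k ▷ _ ≫ (α_ (P k) (Q k) (QObj k μ.transpose)).hom) ≫
    (α_ (PObj k μ) (P k) (Q k ⊗ QObj k μ.transpose)).inv ≫
    (rhoP k μ ν ⊗ₘ rhoQ k μ.transpose ν.transpose)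

/-- The direct sum of the `P^μ ⊗ Q^(μᵗ)` over the partitions `μ` of `n`. -/
noncomputable def sigmaObj (n : ℕ) : HeisCat k := ⨁ fun μ : OfSize n ↦ PQ k μ

variable (ε : YoungDiagram → YoungDiagram → kˣ)

open scoped Classical in
/-- The differential of `Σ⁻`, with coefficient `ε μ ν` when `ν` is obtained by adding a box to
`μ`. -/
noncomputable def dMinus (n : ℕ) : sigmaObj k (n + 1) ⟶ sigmaObj k n :=
  biproduct.matrix fun (ν : OfSize (n + 1)) (μ : OfSize n) ↦
    if μ.1 ≤ ν.1 then (ε μ.1 ν.1 : k) • lower k μ ν else 0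

open scoped Classical in
/-- The differential of `Σ⁺`, with coefficient `ε μ ν` when `ν` is obtained by adding a box to
`μ`. -/
noncomputable def dPlus (n : ℕ) : sigmaObj k n ⟶ sigmaObj k (n + 1) :=
  biproduct.matrix fun (μ : OfSize n) (ν : OfSize (n + 1)) ↦
    if μ.1 ≤ ν.1 then (ε μ.1 ν.1 : k) • raise k μ ν else 0

end Heis

/-! ### Complexes, their tensor products, and the Fock category -/

namespace Heis

section Complexes

universe v₁ u₁

variable {C : Type u₁} [Category.{v₁} C]

section

variable [HasZeroMorphisms C] [HasZeroObject C]

open ZeroObject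

/-- The objects `X n` in degree `n ≥ 0` and zero in the other degrees. -/
noncomputable def nonnegObj (X : ℕ → C) : ℤ → C
  | .ofNat n => X n
  | .negSucc _ => 0

/-- The differentials `d n` from degree `n + 1` to degree `n ≥ 0`. -/
noncomputable def nonnegMap (X : ℕ → C) (d : ∀ n, X (n + 1) ⟶ X n) :
    ∀ i : ℤ, nonnegObj X (i + 1) ⟶ nonnegObj X i
  | .ofNat n => d n
  | .negSucc _ => 0

/-- The complex `⋯ ⟶ X 2 ⟶ X 1 ⟶ X 0 ⟶ 0 ⟶ ⋯` with `X n` in homological degree `n`. -/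
noncomputable def nonnegComplex (X : ℕ → C) (d : ∀ n, X (n + 1) ⟶ X n)
    (h : ∀ n, d (n + 1) ≫ d n = 0) : HomologicalComplex C (ComplexShape.down ℤ) :=
  ChainComplex.of (nonnegObj X) (nonnegMap X d) (by
    rintro (n | n)
    · exact h n
    · exact comp_zero)

/-- The objects `X n` in degree `-n ≤ 0` and zero in the other degrees. -/
noncomputable def nonposObj (X : ℕ → C) : ℤ → C
  | .ofNat 0 => X 0
  | .ofNat (_ + 1) => 0
  | .negSucc n => X (n + 1)

/-- The differentials `d n` from degree `-n` to degree `-(n + 1)`. -/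
noncomputable def nonposMap (X : ℕ → C) (d : ∀ n, X n ⟶ X (n + 1)) :
    ∀ i : ℤ, nonposObj X (i + 1) ⟶ nonposObj X i
  | .ofNat _ => 0
  | .negSucc 0 => d 0
  | .negSucc (n + 1) => d (n + 1)

/-- The complex `⋯ ⟶ 0 ⟶ X 0 ⟶ X 1 ⟶ X 2 ⟶ ⋯` with `X n` in homological degree `-n`. -/
noncomputable def nonposComplex (X : ℕ → C) (d : ∀ n, X n ⟶ X (n + 1))
    (h : ∀ n, d n ≫ d (n + 1) = 0) : HomologicalComplex C (ComplexShape.down ℤ) :=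
  ChainComplex.of (nonposObj X) (nonposMap X d) (by
    rintro (n | _ | _ | n)
    · exact zero_comp
    · exact zero_comp
    · exact h 0
    · exact h (n + 1))

/-- The complex vanishes in negative homological degrees. -/
class IsNonneg (K : HomologicalComplex C (ComplexShape.down ℤ)) : Prop where
  isZero (i : ℤ) (h : i < 0) : IsZero (K.X i)

/-- The complex vanishes in positive homological degrees. -/
class IsNonpos (K : HomologicalComplex C (ComplexShape.down ℤ)) : Prop where
  isZero (i : ℤ) (h : 0 < i) : IsZero (K.X i)

instance (X : ℕ → C) (d : ∀ n, X (n + 1) ⟶ X n) (h : ∀ n, d (n + 1) ≫ d n = 0) :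
    IsNonneg (nonnegComplex X d h) where
  isZero i hi := by
    obtain n | n := i
    · exact absurd hi (not_lt.2 (Int.natCast_nonneg n))
    · exact isZero_zero C

instance (X : ℕ → C) (d : ∀ n, X n ⟶ X (n + 1)) (h : ∀ n, d n ≫ d (n + 1) = 0) :
    IsNonpos (nonposComplex X d h) where
  isZero i hi := by
    obtain (_ | n) | n := i
    · exact absurd hi (lt_irrefl _)
    · exact isZero_zero C
    · exact absurd hi (not_lt.2 (Int.negSucc_lt_zero n).le)

end

theorem hasCoproduct_of_finite [HasZeroMorphisms C] [HasFiniteCoproducts C] {J : Type*} (f : J → C)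
    (s : Set J) (hs : s.Finite) (h : ∀ j, j ∉ s → IsZero (f j)) : HasCoproduct f := by
  classical
  have : Finite s := hs
  let c : Cofan f := Cofan.mk (∐ fun j : s ↦ f j) fun j ↦
    if hj : j ∈ s then Limits.Sigma.ι (fun j : s ↦ f j) ⟨j, hj⟩ else 0
  have hc (j : s) : c.inj j = Limits.Sigma.ι (fun j : s ↦ f j) j := dif_pos j.2
  refine ⟨⟨⟨c, Cofan.IsColimit.mk c
    (fun t ↦ Limits.Sigma.desc (f := fun j : s ↦ f j) fun j ↦ t.inj j) (fun t j ↦ ?_) (fun t m hm ↦ ?_)⟩⟩⟩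
  · by_cases hj : j ∈ s
    · rw [hc ⟨j, hj⟩]
      exact Limits.Sigma.ι_desc (f := fun j : s ↦ f j) _ (⟨j, hj⟩ : s)
    · exact (h j hj).eq_of_src _ _
  · refine Limits.Sigma.hom_ext (f := fun j : s ↦ f j) _ _ fun j ↦ ?_
    rw [← hc j, hm j, hc j]
    exact (Limits.Sigma.ι_desc (f := fun j : s ↦ f j) (fun j ↦ t.inj j) j).symm

end Complexes

/-- The signs of the tensor product of complexes in homological grading. -/
instance : (ComplexShape.down ℤ).TensorSigns where
  ε' := AddMonoidHom.toMultiplicativeLeft ⟨⟨fun n ↦ Additive.ofMul n.negOnePow, rfl⟩,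
    fun m n ↦ Int.negOnePow_add m n⟩
  rel_add p q r (hpq : q + 1 = p) := by
    change q + r + 1 = p + r
    lia
  add_rel p q r (hpq : q + 1 = p) := by
    change r + q + 1 = r + p
    lia
  ε'_succ p q (hpq : q + 1 = p) := by
    subst hpq
    change q.negOnePow = - (q + 1).negOnePow
    rw [Int.negOnePow_succ, neg_neg]

section Tensor

universe v₁ u₁

variable {C : Type u₁} [Category.{v₁} C] [Preadditive C] [MonoidalCategory C]
  [MonoidalPreadditive C]

theorem isZero_tensor (X Y : C) (h : IsZero X ∨ IsZero Y) : IsZero (X ⊗ Y) := by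
  obtain h | h := h
  · exact (tensorRight Y).map_isZero h
  · exact (tensorLeft X).map_isZero h

theorem hasTensor_of_finite [HasFiniteBiproducts C] (K L : HomologicalComplex C (ComplexShape.down ℤ))
    (h : ∀ j : ℤ, {p : ℤ × ℤ | p.1 + p.2 = j ∧ ¬ IsZero (K.X p.1) ∧ ¬ IsZero (L.X p.2)}.Finite) :
    HomologicalComplex.HasTensor K L := by
  intro j
  refine hasCoproduct_of_finite _ (Subtype.val ⁻¹'
    {p : ℤ × ℤ | p.1 + p.2 = j ∧ ¬ IsZero (K.X p.1) ∧ ¬ IsZero (L.X p.2)})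
    ((h j).preimage Subtype.val_injective.injOn) ?_
  rintro ⟨⟨p, q⟩, hpq⟩ hz
  refine isZero_tensor _ _ ?_
  by_contra hn
  rw [not_or] at hn
  exact hz ⟨hpq, hn⟩

instance [HasFiniteBiproducts C] (K L : HomologicalComplex C (ComplexShape.down ℤ)) [IsNonneg K] [IsNonneg L] :
    HomologicalComplex.HasTensor K L := by
  refine hasTensor_of_finite K L fun j ↦ ((Set.finite_Icc 0 j).prod (Set.finite_Icc 0 j)).subset ?_
  rintro ⟨p, q⟩ ⟨rfl, hp, hq⟩
  have h1 : 0 ≤ p := le_of_not_gt fun h ↦ hp (IsNonneg.isZero p h)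
  have h2 : 0 ≤ q := le_of_not_gt fun h ↦ hq (IsNonneg.isZero q h)
  simp only [Set.mem_prod, Set.mem_Icc]
  omega

instance [HasFiniteBiproducts C] (K L : HomologicalComplex C (ComplexShape.down ℤ)) [IsNonpos K] [IsNonpos L] :
    HomologicalComplex.HasTensor K L := by
  refine hasTensor_of_finite K L fun j ↦ ((Set.finite_Icc j 0).prod (Set.finite_Icc j 0)).subset ?_
  rintro ⟨p, q⟩ ⟨rfl, hp, hq⟩
  have h1 : p ≤ 0 := le_of_not_gt fun h ↦ hp (IsNonpos.isZero p h)
  have h2 : q ≤ 0 := le_of_not_gt fun h ↦ hq (IsNonpos.isZero q h)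
  simp only [Set.mem_prod, Set.mem_Icc]
  omega

variable [HasZeroObject C]

instance : IsNonneg (HomologicalComplex.tensorUnit C (ComplexShape.down ℤ)) where
  isZero _ h := HomologicalComplex.isZero_single_obj_X _ _ _ _ h.ne

instance : IsNonpos (HomologicalComplex.tensorUnit C (ComplexShape.down ℤ)) where
  isZero _ h := HomologicalComplex.isZero_single_obj_X _ _ _ _ h.ne'

end Tensor

section Sigma

open Idempotents

variable (k : Type u) [Field k]

/-- Two morphisms are identified when their difference factors through `M ⊗ Q` for some `M`. -/
def fockRel : HomRel (HeisCat k) := fun X Y f g ↦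
  ∃ (M : HeisCat k) (a : X ⟶ M ⊗ Q k) (b : M ⊗ Q k ⟶ Y), f - g = a ≫ b

theorem fockRel_add {X Y : HeisCat k} (f₁ f₂ g₁ g₂ : X ⟶ Y) (hf : fockRel k f₁ f₂)
    (hg : fockRel k g₁ g₂) : fockRel k (f₁ + g₁) (f₂ + g₂) := by
  have := hasBinaryBiproducts_of_finite_biproducts (HeisCat k)
  obtain ⟨M, a, b, h⟩ := hf
  obtain ⟨N, a', b', h'⟩ := hg
  refine ⟨M ⊞ N, a ≫ biprod.inl ▷ Q k + a' ≫ biprod.inr ▷ Q k,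
    biprod.fst ▷ Q k ≫ b + biprod.snd ▷ Q k ≫ b', ?_⟩
  have h1 : (biprod.inl : M ⟶ M ⊞ N) ▷ Q k ≫ (biprod.fst : M ⊞ N ⟶ M) ▷ Q k = 𝟙 _ := by
    rw [← comp_whiskerRight, biprod.inl_fst, id_whiskerRight]
  have h2 : (biprod.inr : N ⟶ M ⊞ N) ▷ Q k ≫ (biprod.snd : M ⊞ N ⟶ N) ▷ Q k = 𝟙 _ := by
    rw [← comp_whiskerRight, biprod.inr_snd, id_whiskerRight]
  have h3 : (biprod.inl : M ⟶ M ⊞ N) ▷ Q k ≫ (biprod.snd : M ⊞ N ⟶ N) ▷ Q k = 0 := by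
    rw [← comp_whiskerRight, biprod.inl_snd, MonoidalPreadditive.zero_whiskerRight]
  have h4 : (biprod.inr : N ⟶ M ⊞ N) ▷ Q k ≫ (biprod.fst : M ⊞ N ⟶ M) ▷ Q k = 0 := by
    rw [← comp_whiskerRight, biprod.inr_fst, MonoidalPreadditive.zero_whiskerRight]
  rw [Preadditive.add_comp, Preadditive.comp_add, Preadditive.comp_add, Category.assoc,
    Category.assoc, Category.assoc, Category.assoc, reassoc_of% h1, reassoc_of% h2, reassoc_of% h3,
    reassoc_of% h4, zero_comp, zero_comp, comp_zero, comp_zero, add_zero, zero_add, ← h, ← h']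
  abel

instance : Congruence (fockRel k) where
  comp_left f _ _ h := by
    obtain ⟨M, a, b, h⟩ := h
    exact ⟨M, f ≫ a, b, by rw [← Preadditive.comp_sub, h, Category.assoc]⟩
  comp_right g h := by
    obtain ⟨M, a, b, h⟩ := h
    exact ⟨M, a, b ≫ g, by rw [← Preadditive.sub_comp, h, Category.assoc]⟩
  equivalence :=
    { refl := fun f ↦ ⟨𝟙_ _, 0, 0, by rw [sub_self, zero_comp]⟩
      symm := fun {f g} h ↦ by
        obtain ⟨M, a, b, h⟩ := h
        exact ⟨M, a, -b, by rw [Preadditive.comp_neg, ← h, neg_sub]⟩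
      trans := fun {f g e} h h' ↦ by
        obtain ⟨M, a, b, h⟩ := fockRel_add k _ _ _ _ h h'
        exact ⟨M, a, b, by rw [← h]; abel⟩ }

/-- The category `ℋ₀`: the quotient of the Heisenberg category by the ideal of all morphisms that
factor through `M ⊗ Q` for some `M`. -/
abbrev FockCat : Type (max 1 u) := Quotient (fockRel k)

noncomputable instance : Preadditive (FockCat k) :=
  Quotient.preadditive (fockRel k) fun _ _ ↦ fockRel_add k

/-- The projection to `ℋ₀`. -/
noncomputable def fock : HeisCat k ⥤ FockCat k := Quotient.functor (fockRel k)

instance : (fock k).Additive := Quotient.functor_additive (fockRel k) fun _ _ ↦ fockRel_add k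

/-- Complexes in the Heisenberg category, in homological grading. -/
abbrev Complex : Type (max 1 u) := HomologicalComplex (HeisCat k) (ComplexShape.down ℤ)

/-- The homotopy category of complexes. -/
noncomputable abbrev toHomotopy : Complex k ⥤ HomotopyCategory (HeisCat k) (ComplexShape.down ℤ) :=
  HomotopyCategory.quotient _ _

/-- The monoidal unit, as a complex in degree zero. -/
noncomputable abbrev unitComplex : Complex k :=
  HomologicalComplex.tensorUnit (HeisCat k) (ComplexShape.down ℤ)

variable {k}

/-- The complex `K ⊗ X`. -/
noncomputable def tensorObjRight (K : Complex k) (X : HeisCat k) : Complex k :=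
  ((tensorRight X).mapHomologicalComplex _).obj K

/-- The complex `X ⊗ K`. -/
noncomputable def tensorObjLeft (X : HeisCat k) (K : Complex k) : Complex k :=
  ((tensorLeft X).mapHomologicalComplex _).obj K

/-- The complex becomes zero in the homotopy category. -/
def IsContractible (K : Complex k) : Prop := IsZero ((toHomotopy k).obj K)

/-- The morphism of complexes becomes invertible in the homotopy category. -/
def IsHomotopyEquivalence {K L : Complex k} (f : K ⟶ L) : Prop := IsIso ((toHomotopy k).map f)

/-- The morphism of complexes becomes invertible in the homotopy category of `ℋ₀`. -/
def IsFockEquivalence {K L : Complex k} (f : K ⟶ L) : Prop :=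
  IsIso (((fock k).mapHomotopyCategory _).map ((toHomotopy k).map f))

variable (k) [CharZero k] (ε : YoungDiagram → YoungDiagram → kˣ)

/-- The complex `Σ⁻`, with the direct sum over the partitions of `n` in homological degree `n`. -/
noncomputable def sigmaMinus (h : ∀ n, dMinus k ε (n + 1) ≫ dMinus k ε n = 0) : Complex k :=
  nonnegComplex (sigmaObj k) (dMinus k ε) h

/-- The complex `Σ⁺`, with the direct sum over the partitions of `n` in homological degree `-n`. -/
noncomputable def sigmaPlus (h : ∀ n, dPlus k ε n ≫ dPlus k ε (n + 1) = 0) : Complex k :=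
  nonposComplex (sigmaObj k) (dPlus k ε) h

instance (h : ∀ n, dMinus k ε (n + 1) ≫ dMinus k ε n = 0) : IsNonneg (sigmaMinus k ε h) :=
  inferInstanceAs (IsNonneg (nonnegComplex _ _ _))

instance (h : ∀ n, dPlus k ε n ≫ dPlus k ε (n + 1) = 0) : IsNonpos (sigmaPlus k ε h) :=
  inferInstanceAs (IsNonpos (nonposComplex _ _ _))

end Sigma

end Heis

open Heis

namespace Heis

open YoungDiagram YoungDiagram.OfSize CoxeterRelations

/-! ### Embeddings of symmetric groups -/

/-- The permutation of `Fin (n + 1)` that fixes `p` and permutes the other positions by `σ`. -/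
def fixAt {n : ℕ} (p : Fin (n + 1)) : Equiv.Perm (Fin n) →* Equiv.Perm (Fin (n + 1)) where
  toFun σ := (finSuccEquiv' p).trans ((Equiv.optionCongr σ).trans (finSuccEquiv' p).symm)
  map_one' := by ext x; simp
  map_mul' σ τ := by
    ext x
    simp only [Equiv.trans_apply, Equiv.Perm.mul_apply, Equiv.apply_symm_apply]
    congr 2
    cases finSuccEquiv' p x <;> rfl

theorem fixAt_self {n : ℕ} (p : Fin (n + 1)) (σ : Equiv.Perm (Fin n)) : fixAt p σ p = p := by
  simp [fixAt]

theorem fixAt_succAbove {n : ℕ} (p : Fin (n + 1)) (σ : Equiv.Perm (Fin n)) (i : Fin n) :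
    fixAt p σ (p.succAbove i) = p.succAbove (σ i) := by
  simp [fixAt]

/-- Permutations of the first `n` positions. -/
abbrev fixLast (n : ℕ) : Equiv.Perm (Fin n) →* Equiv.Perm (Fin (n + 1)) := fixAt (Fin.last n)

/-- Permutations of the last `n` positions. -/
abbrev fixFirst (n : ℕ) : Equiv.Perm (Fin n) →* Equiv.Perm (Fin (n + 1)) := fixAt 0

theorem fixLast_last {n : ℕ} (σ : Equiv.Perm (Fin n)) :
    fixLast n σ (Fin.last n) = Fin.last n := fixAt_self _ _

theorem fixLast_castSucc {n : ℕ} (σ : Equiv.Perm (Fin n)) (i : Fin n) :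
    fixLast n σ i.castSucc = (σ i).castSucc := by
  simpa using fixAt_succAbove (Fin.last n) σ i

theorem fixFirst_zero {n : ℕ} (σ : Equiv.Perm (Fin n)) : fixFirst n σ 0 = 0 := fixAt_self _ _

theorem fixFirst_succ {n : ℕ} (σ : Equiv.Perm (Fin n)) (i : Fin n) :
    fixFirst n σ i.succ = (σ i).succ := by
  simpa using fixAt_succAbove 0 σ i

theorem moveLast_self {n : ℕ} (p : Fin (n + 1)) : moveLast p p = Fin.last n := by
  simp [moveLast]

theorem moveLast_succAbove {n : ℕ} (p : Fin (n + 1)) (i : Fin n) :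
    moveLast p (p.succAbove i) = i.castSucc := by
  simp [moveLast]

theorem moveFirst_self {n : ℕ} (p : Fin (n + 1)) : moveFirst p p = 0 := by
  simp [moveFirst]

theorem moveFirst_succAbove {n : ℕ} (p : Fin (n + 1)) (i : Fin n) :
    moveFirst p (p.succAbove i) = i.succ := by
  simp [moveFirst]

/-- The cycle that moves the last position to the front. -/
def lastToFirst (n : ℕ) : Equiv.Perm (Fin (n + 1)) := moveFirst (Fin.last n)

theorem lastToFirst_last (n : ℕ) : lastToFirst n (Fin.last n) = 0 := moveFirst_self _

theorem lastToFirst_castSucc {n : ℕ} (i : Fin n) : lastToFirst n i.castSucc = i.succ := by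
  simpa [lastToFirst] using moveFirst_succAbove (Fin.last n) i

theorem moveFirst_eq {n : ℕ} (p : Fin (n + 1)) : moveFirst p = lastToFirst n * moveLast p := by
  ext x
  refine p.succAboveCases ?_ (fun i ↦ ?_) x
  · rw [Equiv.Perm.mul_apply, moveLast_self, moveFirst_self, lastToFirst_last]
  · rw [Equiv.Perm.mul_apply, moveLast_succAbove, moveFirst_succAbove, lastToFirst_castSucc]

theorem fixFirst_mul_lastToFirst {n : ℕ} (σ : Equiv.Perm (Fin n)) :
    fixFirst n σ * lastToFirst n = lastToFirst n * fixLast n σ := by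
  ext x
  refine Fin.lastCases ?_ (fun i ↦ ?_) x
  · rw [Equiv.Perm.mul_apply, Equiv.Perm.mul_apply, lastToFirst_last, fixFirst_zero, fixLast_last,
      lastToFirst_last]
  · rw [Equiv.Perm.mul_apply, Equiv.Perm.mul_apply, lastToFirst_castSucc, fixFirst_succ,
      fixLast_castSucc, lastToFirst_castSucc]

/-- The transposition of the last two positions. -/
abbrev swapLast (n : ℕ) : Equiv.Perm (Fin (n + 2)) := simpleSwap (n + 2) n

theorem swapLast_eq (n : ℕ) :
    swapLast n = Equiv.swap (Fin.castSucc (Fin.last n)) (Fin.last (n + 1)) := by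
  rw [swapLast, simpleSwap, dif_pos (by omega)]
  rfl

theorem swapLast_mul_self (n : ℕ) : swapLast n * swapLast n = 1 :=
  (simpleSwap_relations (n + 2)).sq n (by omega)

theorem swapLast_last (n : ℕ) : swapLast n (Fin.last (n + 1)) = (Fin.last n).castSucc := by
  rw [swapLast_eq, Equiv.swap_apply_right]

theorem swapLast_castSucc_last (n : ℕ) : swapLast n (Fin.last n).castSucc = Fin.last (n + 1) := by
  rw [swapLast_eq, Equiv.swap_apply_left]

theorem swapLast_castSucc_castSucc {n : ℕ} (i : Fin n) :
    swapLast n i.castSucc.castSucc = i.castSucc.castSucc := by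
  rw [swapLast_eq, Equiv.swap_apply_of_ne_of_ne]
  · exact fun h ↦ (Fin.castSucc_lt_last i).ne (Fin.castSucc_injective _ h)
  · exact (Fin.castSucc_lt_last _).ne

theorem lastToFirst_succ (n : ℕ) :
    lastToFirst (n + 1) = fixLast (n + 1) (lastToFirst n) * swapLast n := by
  ext x
  refine Fin.lastCases ?_ (fun i ↦ Fin.lastCases ?_ (fun i ↦ ?_) i) x
  · rw [Equiv.Perm.mul_apply, swapLast_last, fixLast_castSucc, lastToFirst_last, lastToFirst_last]
    rfl
  · rw [Equiv.Perm.mul_apply, swapLast_castSucc_last, fixLast_last, lastToFirst_castSucc]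
    rfl
  · rw [Equiv.Perm.mul_apply, swapLast_castSucc_castSucc, fixLast_castSucc, lastToFirst_castSucc,
      lastToFirst_castSucc]
    rfl

theorem swapLast_comm {n : ℕ} (σ : Equiv.Perm (Fin n)) :
    swapLast n * fixLast (n + 1) (fixLast n σ) = fixLast (n + 1) (fixLast n σ) * swapLast n := by
  ext x
  refine Fin.lastCases ?_ (fun i ↦ Fin.lastCases ?_ (fun i ↦ ?_) i) x
  · simp only [Equiv.Perm.mul_apply, fixLast_last, fixLast_castSucc, swapLast_last]
  · simp only [Equiv.Perm.mul_apply, fixLast_last, fixLast_castSucc, swapLast_castSucc_last]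
  · simp only [Equiv.Perm.mul_apply, fixLast_castSucc, swapLast_castSucc_castSucc]

theorem exists_fixLast {n : ℕ} (g : Equiv.Perm (Fin (n + 1))) (hg : g (Fin.last n) = Fin.last n) :
    ∃ σ, fixLast n σ = g := by
  have h (i : Fin n) : g i.castSucc ≠ Fin.last n := fun h ↦
    (Fin.castSucc_lt_last i).ne (g.injective (h.trans hg.symm))
  let f (i : Fin n) : Fin n := (g i.castSucc).castPred (h i)
  have hf : Function.Injective f := fun i j hij ↦ by
    have := congrArg Fin.castSucc hij
    simp only [f, Fin.castSucc_castPred] at this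
    exact Fin.castSucc_injective _ (g.injective this)
  refine ⟨Equiv.ofBijective f (Finite.injective_iff_bijective.1 hf), ?_⟩
  ext x
  refine Fin.lastCases ?_ (fun i ↦ ?_) x
  · rw [fixLast_last, hg]
  · rw [fixLast_castSucc]
    simp [f]

theorem fixLast_injective (n : ℕ) : Function.Injective (fixLast n) := by
  intro σ τ h
  ext i
  have := congrArg (fun g : Equiv.Perm (Fin (n + 1)) ↦ (g i.castSucc : ℕ)) h
  simpa [fixLast_castSucc] using this

theorem exists_fixLast_swap_fixLast {n : ℕ} (g : Equiv.Perm (Fin (n + 2)))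
    (hg : g (Fin.last (n + 1)) ≠ Fin.last (n + 1)) :
    ∃ σ τ, g = fixLast (n + 1) σ * swapLast n * fixLast (n + 1) τ := by
  let a : Fin (n + 1) := (g (Fin.last (n + 1))).castPred hg
  let σ : Equiv.Perm (Fin (n + 1)) := Equiv.swap (Fin.last n) a
  have h : (swapLast n * (fixLast (n + 1) σ)⁻¹ * g) (Fin.last (n + 1)) = Fin.last (n + 1) := by
    rw [← map_inv, Equiv.Perm.mul_apply, Equiv.Perm.mul_apply]
    have : g (Fin.last (n + 1)) = a.castSucc := (Fin.castSucc_castPred _ _).symm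
    rw [this, fixLast_castSucc, show σ⁻¹ a = Fin.last n by simp [σ], swapLast_castSucc_last]
  obtain ⟨τ, hτ⟩ := exists_fixLast _ h
  refine ⟨σ, τ, ?_⟩
  rw [hτ, mul_assoc, mul_assoc (swapLast n), ← mul_assoc (swapLast n) (swapLast n),
    swapLast_mul_self]
  group

/-! ### Group algebras of symmetric groups -/

/-- The group algebra of the symmetric group on `n` letters. -/
abbrev SymAlg (k : Type u) [Field k] (n : ℕ) : Type u := MonoidAlgebra k (Equiv.Perm (Fin n))

section GroupAlgebra

variable {k : Type u} [Field k]

/-- The group element `σ`, as an element of the group algebra. -/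
noncomputable abbrev pm {n : ℕ} (σ : Equiv.Perm (Fin n)) : SymAlg k n := MonoidAlgebra.single σ 1

theorem pm_mul {n : ℕ} (σ τ : Equiv.Perm (Fin n)) : (pm (σ * τ) : SymAlg k n) = pm σ * pm τ := by
  rw [MonoidAlgebra.single_mul_single, one_mul]

theorem pm_one {n : ℕ} : (pm 1 : SymAlg k n) = 1 := rfl

theorem single_eq_smul_pm {n : ℕ} (σ : Equiv.Perm (Fin n)) (r : k) :
    MonoidAlgebra.single σ r = r • pm σ := by
  simp

/-- The linear extension of a property from permutations to the group algebra. -/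
@[elab_as_elim]
theorem symAlg_induction {n : ℕ} {motive : SymAlg k n → Prop} (a : SymAlg k n) (zero : motive 0)
    (add : ∀ a b, motive a → motive b → motive (a + b))
    (smul : ∀ (r : k) a, motive a → motive (r • a)) (perm : ∀ σ, motive (pm σ)) : motive a := by
  induction a using MonoidAlgebra.induction_linear with
  | zero => exact zero
  | add a b ha hb => exact add a b ha hb
  | single σ r => rw [single_eq_smul_pm]; exact smul _ _ (perm σ)

/-- The embedding of group algebras given by the first `n` positions. -/
noncomputable def embLast (n : ℕ) : SymAlg k n →ₐ[k] SymAlg k (n + 1) :=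
  MonoidAlgebra.mapDomainAlgHom k k (fixLast n)

/-- The embedding of group algebras given by the last `n` positions. -/
noncomputable def embFirst (n : ℕ) : SymAlg k n →ₐ[k] SymAlg k (n + 1) :=
  MonoidAlgebra.mapDomainAlgHom k k (fixFirst n)

theorem embLast_pm {n : ℕ} (σ : Equiv.Perm (Fin n)) :
    embLast n (pm σ : SymAlg k n) = pm (fixLast n σ) := by
  simp [embLast, pm]

theorem embFirst_pm {n : ℕ} (σ : Equiv.Perm (Fin n)) :
    embFirst n (pm σ : SymAlg k n) = pm (fixFirst n σ) := by
  simp [embFirst, pm]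

theorem embFirst_mul_lastToFirst {n : ℕ} (a : SymAlg k n) :
    embFirst n a * pm (lastToFirst n) = pm (lastToFirst n) * embLast n a := by
  induction a using symAlg_induction with
  | zero => simp
  | add a b ha hb => rw [map_add, map_add, add_mul, ha, hb, mul_add]
  | smul r a ha => rw [map_smul, map_smul, smul_mul_assoc, ha, mul_smul_comm]
  | perm σ => rw [embFirst_pm, embLast_pm, ← pm_mul, ← pm_mul, fixFirst_mul_lastToFirst]

theorem swapLast_mul_embLast_embLast {n : ℕ} (a : SymAlg k n) :
    pm (swapLast n) * embLast (n + 1) (embLast n a) =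
      embLast (n + 1) (embLast n a) * pm (swapLast n) := by
  induction a using symAlg_induction with
  | zero => simp
  | add a b ha hb => rw [map_add, map_add, add_mul, ← ha, ← hb, mul_add]
  | smul r a ha => rw [map_smul, map_smul, smul_mul_assoc, ← ha, mul_smul_comm]
  | perm σ => rw [embLast_pm, embLast_pm, ← pm_mul, ← pm_mul, swapLast_comm]

/-- The projection of the group algebra to the span of the permutations that fix the last
position. -/
noncomputable def condExp (n : ℕ) : SymAlg k (n + 1) →ₗ[k] SymAlg k n where
  toFun a := .ofCoeff (a.coeff.comapDomain (fixLast n) (fixLast_injective n).injOn)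
  map_add' a b := by ext σ; rfl
  map_smul' r a := by ext σ; rfl

theorem condExp_coeff {n : ℕ} (a : SymAlg k (n + 1)) (σ : Equiv.Perm (Fin n)) :
    (condExp n a).coeff σ = a.coeff (fixLast n σ) := rfl

theorem condExp_pm_fixLast {n : ℕ} (σ : Equiv.Perm (Fin n)) :
    condExp n (pm (fixLast n σ) : SymAlg k (n + 1)) = pm σ := by
  ext τ
  rw [condExp_coeff, MonoidAlgebra.coeff_single, MonoidAlgebra.coeff_single]
  by_cases h : σ = τ
  · rw [h, Finsupp.single_eq_same, Finsupp.single_eq_same]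
  · rw [Finsupp.single_eq_of_ne (Ne.symm h), Finsupp.single_eq_of_ne]
    exact fun h' ↦ h (fixLast_injective n h'.symm)

theorem condExp_pm_of_ne {n : ℕ} (g : Equiv.Perm (Fin (n + 1)))
    (hg : g (Fin.last n) ≠ Fin.last n) : condExp n (pm g : SymAlg k (n + 1)) = 0 := by
  ext τ
  rw [condExp_coeff, MonoidAlgebra.coeff_single, Finsupp.single_eq_of_ne]
  · rfl
  · rintro rfl
    exact hg (fixLast_last τ)

theorem condExp_embLast_mul {n : ℕ} (a : SymAlg k n) (b : SymAlg k (n + 1)) :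
    condExp n (embLast n a * b) = a * condExp n b := by
  induction a using symAlg_induction with
  | zero => simp
  | add a b ha hb => simp [ha, hb, add_mul]
  | smul r a ha => rw [map_smul, smul_mul_assoc, map_smul, ha, smul_mul_assoc]
  | perm σ =>
    ext τ
    rw [embLast_pm, condExp_coeff, MonoidAlgebra.coeff_single_mul_apply,
      MonoidAlgebra.coeff_single_mul_apply, condExp_coeff, map_mul (fixLast n),
      map_inv (fixLast n)]

theorem condExp_mul_embLast {n : ℕ} (a : SymAlg k n) (b : SymAlg k (n + 1)) :
    condExp n (b * embLast n a) = condExp n b * a := by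
  induction a using symAlg_induction with
  | zero => simp
  | add a b ha hb => simp [ha, hb, mul_add]
  | smul r a ha => rw [map_smul, mul_smul_comm, map_smul, ha, mul_smul_comm]
  | perm σ =>
    ext τ
    rw [embLast_pm, condExp_coeff, MonoidAlgebra.coeff_mul_single_apply,
      MonoidAlgebra.coeff_mul_single_apply, condExp_coeff, map_mul (fixLast n),
      map_inv (fixLast n)]

theorem coeff_one_mul_comm {n : ℕ} (a b : SymAlg k n) : (a * b).coeff 1 = (b * a).coeff 1 := by
  refine symAlg_induction a (by simp)
    (fun x y hx hy ↦ by
      rw [add_mul, mul_add, MonoidAlgebra.coeff_add, MonoidAlgebra.coeff_add, Finsupp.add_apply,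
        Finsupp.add_apply, hx, hy])
    (fun r x hx ↦ by
      rw [smul_mul_assoc, mul_smul_comm, MonoidAlgebra.coeff_smul_apply,
        MonoidAlgebra.coeff_smul_apply, hx]) (fun σ ↦ ?_)
  rw [MonoidAlgebra.coeff_single_mul_apply, MonoidAlgebra.coeff_mul_single_apply]
  simp

end GroupAlgebra

end Heis

namespace YoungDiagram.OfSize

open Heis

variable {n : ℕ}

/-! ### Orthogonality of Young idempotents -/

section Orthogonality

variable (k : Type u) [Field k]

theorem colAntisymmetrizer_mul (μ : OfSize n) {s : Equiv.Perm (Fin n)} (hs : s ∈ μ.colGroup) :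
    μ.colAntisymmetrizer k * pm s = ((Equiv.Perm.sign s : ℤ) : k) • μ.colAntisymmetrizer k := by
  rw [colAntisymmetrizer, Finset.sum_mul, Finset.smul_sum]
  refine Finset.sum_equiv (Equiv.mulRight s) (fun σ ↦ ?_) (fun σ _ ↦ ?_)
  · simpa using (μ.colGroup.mul_mem_cancel_right hs).symm
  · have : ((Equiv.Perm.sign s : ℤ) : k) * ((Equiv.Perm.sign s : ℤ) : k) = 1 := by
      rw [← Int.cast_mul, ← Units.val_mul, Int.units_mul_self, Units.val_one, Int.cast_one]
    simp only [MonoidAlgebra.single_mul_single, mul_one, Equiv.coe_mulRight, Equiv.Perm.sign_mul,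
      Units.val_mul, Int.cast_mul, MonoidAlgebra.smul_single, smul_eq_mul]
    rw [mul_comm, mul_assoc, this, mul_one]

theorem mul_rowSymmetrizer (μ : OfSize n) {r : Equiv.Perm (Fin n)} (hr : r ∈ μ.rowGroup) :
    pm r * μ.rowSymmetrizer k = μ.rowSymmetrizer k := by
  rw [rowSymmetrizer, Finset.mul_sum]
  refine Finset.sum_equiv (Equiv.mulLeft r) (fun σ ↦ ?_) (fun σ _ ↦ ?_)
  · simpa using (μ.rowGroup.mul_mem_cancel_left hr).symm
  · simp [MonoidAlgebra.single_mul_single]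

theorem swap_mem_rowGroup (μ : OfSize n) {x y : Fin n}
    (h : (μ.cellAt x).1 = (μ.cellAt y).1) : Equiv.swap x y ∈ μ.rowGroup := by
  intro m
  rw [Equiv.swap_apply_def]
  split_ifs with h1 h1
  · rw [h1, h]
  · rw [h1, h]
  · rfl

theorem swap_mem_colGroup (μ : OfSize n) {x y : Fin n}
    (h : (μ.cellAt x).2 = (μ.cellAt y).2) : Equiv.swap x y ∈ μ.colGroup := by
  intro m
  rw [Equiv.swap_apply_def]
  split_ifs with h1 h1
  · rw [h1, h]
  · rw [h1, h]
  · rfl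

theorem swap_mul_eq (g : Equiv.Perm (Fin n)) (x y : Fin n) :
    Equiv.swap x y * g = g * Equiv.swap (g⁻¹ x) (g⁻¹ y) := by
  rw [Equiv.swap_apply_apply, inv_inv]
  group

variable [CharZero k]

theorem eq_zero_of_eq_neg {M : Type*} [AddCommGroup M] [Module k M] {a : M} (h : a = -a) :
    a = 0 := by
  have h2 : (2 : k) • a = 0 := by
    rw [two_smul]
    nth_rw 1 [h]
    exact neg_add_cancel _
  exact (smul_eq_zero.1 h2).resolve_left two_ne_zero

theorem row_mul_col_eq_zero (μ ν : OfSize n) {g : Equiv.Perm (Fin n)} {x y : Fin n} (hne : x ≠ y)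
    (hrow : (μ.cellAt x).1 = (μ.cellAt y).1)
    (hcol : (ν.cellAt (g⁻¹ x)).2 = (ν.cellAt (g⁻¹ y)).2) :
    μ.rowSymmetrizer k * pm g * ν.colAntisymmetrizer k = 0 := by
  refine eq_zero_of_eq_neg k ?_
  conv_lhs => rw [← rowSymmetrizer_mul k μ (μ.swap_mem_rowGroup hrow)]
  rw [mul_assoc (μ.rowSymmetrizer k), ← pm_mul, swap_mul_eq, pm_mul, ← mul_assoc,
    mul_assoc _ _ (ν.colAntisymmetrizer k), mul_colAntisymmetrizer k ν (ν.swap_mem_colGroup hcol),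
    Equiv.Perm.sign_swap (fun h ↦ hne (g⁻¹.injective h))]
  simp

theorem col_mul_row_eq_zero (μ ν : OfSize n) {g : Equiv.Perm (Fin n)} {x y : Fin n} (hne : x ≠ y)
    (hcol : (μ.cellAt x).2 = (μ.cellAt y).2)
    (hrow : (ν.cellAt (g⁻¹ x)).1 = (ν.cellAt (g⁻¹ y)).1) :
    μ.colAntisymmetrizer k * pm g * ν.rowSymmetrizer k = 0 := by
  refine eq_zero_of_eq_neg k ?_
  conv_lhs => rw [← mul_rowSymmetrizer k ν (ν.swap_mem_rowGroup hrow)]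
  rw [← mul_assoc, mul_assoc (μ.colAntisymmetrizer k), ← pm_mul, ← swap_mul_eq, pm_mul, ← mul_assoc,
    colAntisymmetrizer_mul k μ (μ.swap_mem_colGroup hcol), Equiv.Perm.sign_swap hne]
  simp

end Orthogonality

section Dominance

/-- The number of cells in the first `j` rows. -/
def rowCount (μ : OfSize n) (j : ℕ) : ℕ := (Finset.univ.filter fun x ↦ (μ.cellAt x).1 < j).card

theorem card_col_lt (ν : OfSize n) (j c : ℕ) :
    (Finset.univ.filter fun x ↦ (ν.cellAt x).1 < j ∧ (ν.cellAt x).2 = c).card =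
      min j (ν.1.colLen c) := by
  rw [← Finset.card_range (min j (ν.1.colLen c))]
  refine Finset.card_bij (fun x _ ↦ (ν.cellAt x).1) (fun x hx ↦ ?_) (fun x hx y hy h ↦ ?_)
    (fun i hi ↦ ?_)
  · simp only [Finset.mem_filter, Finset.mem_univ, true_and] at hx
    have := ν.cellAt_mem x
    rw [← Prod.mk.eta (p := ν.cellAt x), hx.2, mem_iff_lt_colLen] at this
    simp [hx.1, this]
  · simp only [Finset.mem_filter, Finset.mem_univ, true_and] at hx hy
    exact ν.cellAt_injective (Prod.ext h (hx.2.trans hy.2.symm))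
  · simp only [Finset.mem_range, lt_min_iff] at hi
    obtain ⟨x, hx⟩ := ν.exists_cellAt_eq (mem_iff_lt_colLen.2 hi.2)
    exact ⟨x, by simp [hx, hi.1], by rw [hx]⟩

theorem rowCount_le (μ ν : OfSize n) (g : Equiv.Perm (Fin n))
    (hg : ∀ x y, x ≠ y → (μ.cellAt x).1 = (μ.cellAt y).1 →
      (ν.cellAt (g⁻¹ x)).2 ≠ (ν.cellAt (g⁻¹ y)).2) (j : ℕ) : μ.rowCount j ≤ ν.rowCount j := by
  let S : Finset ℕ := Finset.univ.image fun x ↦ (ν.cellAt x).2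
  rw [rowCount, rowCount,
    Finset.card_eq_sum_card_fiberwise (f := fun x ↦ (ν.cellAt (g⁻¹ x)).2) (t := S)
      (fun x _ ↦ Finset.mem_coe.2 (Finset.mem_image_of_mem _ (Finset.mem_univ _))),
    Finset.card_eq_sum_card_fiberwise (f := fun x ↦ (ν.cellAt x).2) (t := S)
      (fun x _ ↦ Finset.mem_coe.2 (Finset.mem_image_of_mem _ (Finset.mem_univ _)))]
  refine Finset.sum_le_sum fun c _ ↦ ?_
  rw [Finset.filter_filter, Finset.filter_filter, card_col_lt]
  refine le_min ?_ ?_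
  · rw [← Finset.card_range j]
    refine Finset.card_le_card_of_injOn (fun x ↦ (μ.cellAt x).1) (fun x hx ↦ ?_)
      (fun x hx y hy h ↦ ?_)
    · simp only [Finset.coe_filter, Finset.mem_univ, true_and, Set.mem_ofPred_eq] at hx
      simpa using hx.1
    · simp only [Finset.coe_filter, Finset.mem_univ, true_and, Set.mem_ofPred_eq] at hx hy
      by_contra hne
      exact hg x y hne h (hx.2.trans hy.2.symm)
  · have h := ν.card_col_lt (ν.1.colLen c) c
    rw [min_self] at h
    rw [← h]
    refine Finset.card_le_card_of_injOn (fun x ↦ g⁻¹ x) (fun x hx ↦ ?_) g⁻¹.injective.injOn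
    simp only [Finset.coe_filter, Finset.mem_univ, true_and, Set.mem_ofPred_eq] at hx ⊢
    refine ⟨?_, hx.2⟩
    have := ν.cellAt_mem (g⁻¹ x)
    rwa [← Prod.mk.eta (p := ν.cellAt (g⁻¹ x)), hx.2, mem_iff_lt_colLen] at this

theorem card_row_eq (μ : OfSize n) (i : ℕ) :
    (Finset.univ.filter fun x ↦ (μ.cellAt x).1 = i).card = μ.1.rowLen i := by
  rw [← Finset.card_range (μ.1.rowLen i)]
  refine Finset.card_bij (fun x _ ↦ (μ.cellAt x).2) (fun x hx ↦ ?_) (fun x hx y hy h ↦ ?_)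
    (fun j hj ↦ ?_)
  · simp only [Finset.mem_filter, Finset.mem_univ, true_and] at hx
    have := μ.cellAt_mem x
    rw [← Prod.mk.eta (p := μ.cellAt x), hx, mem_iff_lt_rowLen] at this
    simpa using this
  · simp only [Finset.mem_filter, Finset.mem_univ, true_and] at hx hy
    exact μ.cellAt_injective (Prod.ext (hx.trans hy.symm) h)
  · obtain ⟨x, hx⟩ := μ.exists_cellAt_eq (mem_iff_lt_rowLen.2 (Finset.mem_range.1 hj))
    exact ⟨x, by simp [hx], by rw [hx]⟩

theorem rowCount_succ (μ : OfSize n) (j : ℕ) : μ.rowCount (j + 1) = μ.rowCount j + μ.1.rowLen j := by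
  rw [rowCount, rowCount, ← card_row_eq, ← Finset.card_union_of_disjoint]
  · congr 1
    ext x
    simp only [Finset.mem_filter, Finset.mem_univ, true_and, Finset.mem_union]
    omega
  · rw [Finset.disjoint_filter]
    intro x _ h
    omega

theorem eq_of_rowCount_eq {μ ν : OfSize n} (h : ∀ j, μ.rowCount j = ν.rowCount j) : μ = ν := by
  refine Subtype.ext (YoungDiagram.ext ?_)
  ext ⟨i, j⟩
  have h1 := μ.rowCount_succ i
  have h2 := ν.rowCount_succ i
  rw [h, h] at h1
  rw [mem_cells, mem_cells, mem_iff_lt_rowLen, mem_iff_lt_rowLen]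
  omega

end Dominance

section Schur

variable (k : Type u) [Field k]

theorem youngIdempotent_coeff_one (μ : OfSize n) :
    (μ.youngIdempotent k).coeff 1 = (μ.youngScalar k)⁻¹ := by
  rw [youngIdempotent, MonoidAlgebra.coeff_smul_apply, youngSymmetrizer_coeff_one, smul_eq_mul,
    mul_one]

variable [CharZero k]

theorem youngIdempotent_mul_mul_of_ne {μ ν : OfSize n} (hne : μ ≠ ν) (a : SymAlg k n) :
    μ.youngIdempotent k * a * ν.youngIdempotent k = 0 := by
  have key : (∀ g, μ.rowSymmetrizer k * pm g * ν.colAntisymmetrizer k = 0) ∨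
      ∀ g, μ.colAntisymmetrizer k * pm g * ν.rowSymmetrizer k = 0 := by
    by_contra! h
    obtain ⟨⟨g, hg⟩, ⟨g', hg'⟩⟩ := h
    refine hne (eq_of_rowCount_eq fun j ↦ le_antisymm (rowCount_le μ ν g ?_ j)
      (rowCount_le ν μ g'⁻¹ ?_ j))
    · intro x y hxy h h'
      exact hg (row_mul_col_eq_zero k μ ν hxy h h')
    · intro x y hxy h h'
      refine hg' (col_mul_row_eq_zero k μ ν (x := g' x) (y := g' y)
        (fun h ↦ hxy (g'.injective h)) ?_ ?_)
      · simpa using h'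
      · simpa using h
  have lin {b c : SymAlg k n} (h : ∀ g, b * pm g * c = 0) (a : SymAlg k n) : b * a * c = 0 := by
    induction a using symAlg_induction with
    | zero => simp
    | add x y hx hy => rw [mul_add, add_mul, hx, hy, add_zero]
    | smul r x hx => rw [mul_smul_comm, smul_mul_assoc, hx, smul_zero]
    | perm g => exact h g
  rw [youngIdempotent, youngIdempotent, smul_mul_assoc, smul_mul_assoc, mul_smul_comm]
  refine (congrArg _ (congrArg _ ?_)).trans ((congrArg _ (smul_zero _)).trans (smul_zero _))
  rw [youngSymmetrizer, youngSymmetrizer]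
  rcases key with h | h
  · have := lin h (μ.colAntisymmetrizer k * a * ν.rowSymmetrizer k)
    simpa only [mul_assoc] using this
  · have := lin h a
    rw [mul_assoc (μ.rowSymmetrizer k), mul_assoc (μ.rowSymmetrizer k), ← mul_assoc _ _ (ν.colAntisymmetrizer k),
      this, zero_mul, mul_zero]

theorem exists_youngIdempotent_mul_mul (μ : OfSize n) (a : SymAlg k n) :
    ∃ c : k, μ.youngIdempotent k * a * μ.youngIdempotent k = c • μ.youngIdempotent k := by
  obtain ⟨c, hc⟩ := μ.rowSymmetrizer_mul_mul k (μ.colAntisymmetrizer k * a * μ.rowSymmetrizer k)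
  refine ⟨(μ.youngScalar k)⁻¹ * c, ?_⟩
  have h : μ.youngSymmetrizer k * a * μ.youngSymmetrizer k = c • μ.youngSymmetrizer k := by
    rw [← hc, youngSymmetrizer]
    simp only [mul_assoc]
  rw [youngIdempotent, smul_mul_assoc, smul_mul_assoc, mul_smul_comm, h, smul_smul, smul_smul,
    smul_smul]
  congr 1
  ring

theorem youngIdempotent_ne_zero (μ : OfSize n) : μ.youngIdempotent k ≠ 0 := by
  intro h
  have := μ.youngIdempotent_coeff_one k
  rw [h] at this
  exact inv_ne_zero (μ.youngScalar_ne_zero k) this.symm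

theorem youngIdempotent_mul_mul (μ : OfSize n) (a : SymAlg k n) :
    μ.youngIdempotent k * a * μ.youngIdempotent k =
      (μ.youngScalar k * (μ.youngIdempotent k * a * μ.youngIdempotent k).coeff 1) •
        μ.youngIdempotent k := by
  obtain ⟨c, hc⟩ := μ.exists_youngIdempotent_mul_mul k a
  rw [hc, MonoidAlgebra.coeff_smul_apply, youngIdempotent_coeff_one, smul_eq_mul, mul_comm c,
    ← mul_assoc, mul_inv_cancel₀ (μ.youngScalar_ne_zero k), one_mul]

end Schur

/-! ### Adding a box -/

section NewBox

variable {μ : OfSize n} {ν : OfSize (n + 1)}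

theorem cellAt_newBox_notMem (μ : OfSize n) (ν : OfSize (n + 1)) :
    ν.cellAt (newBox μ ν) ∉ μ.1 := (exists_newBox μ ν).choose_spec

theorem mem_iff_ne_newBox (h : μ.1 ≤ ν.1) (x : Fin (n + 1)) :
    ν.cellAt x ∈ μ.1 ↔ x ≠ newBox μ ν := by
  constructor
  · rintro hx rfl
    exact cellAt_newBox_notMem μ ν hx
  · intro hx
    by_contra hx'
    have hsub : μ.1.cells ⊆ (ν.1.cells.erase (ν.cellAt x)).erase (ν.cellAt (newBox μ ν)) := by
      intro c hc
      refine Finset.mem_erase.2 ⟨?_, Finset.mem_erase.2 ⟨?_, h hc⟩⟩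
      · rintro rfl
        exact cellAt_newBox_notMem μ ν hc
      · rintro rfl
        exact hx' hc
    have := Finset.card_le_card hsub
    rw [Finset.card_erase_of_mem, Finset.card_erase_of_mem] at this
    · have h1 : μ.1.cells.card = n := μ.2
      have h2 : ν.1.cells.card = n + 1 := ν.2
      have h3 := (newBox μ ν).2
      have h4 : n ≠ 0 := by
        rintro rfl
        exact hx (Fin.ext (by omega))
      omega
    · exact ν.cellAt_mem _
    · refine Finset.mem_erase.2 ⟨fun h ↦ hx (ν.cellAt_injective h.symm), ν.cellAt_mem _⟩

theorem cellAt_succAbove (h : μ.1 ≤ ν.1) (i : Fin n) :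
    ν.cellAt ((newBox μ ν).succAbove i) = μ.cellAt i := by
  have := Finset.orderEmbOfFin_unique (s := μ.1.cells.map toLex.toEmbedding)
    (f := fun i ↦ toLex (ν.cellAt ((newBox μ ν).succAbove i))) ((Finset.card_map _).trans μ.2)
    (fun i ↦ Finset.mem_map_of_mem _
      ((mem_iff_ne_newBox h _).2 (Fin.succAbove_ne _ _)))
    (fun i j hij ↦ (Finset.orderEmbOfFin _ ((Finset.card_map _).trans ν.2)).strictMono
      (Fin.strictMono_succAbove (newBox μ ν) hij))
  exact congrArg ofLex (congrFun this i)

theorem cellAt_moveLast_inv_castSucc (h : μ.1 ≤ ν.1) (i : Fin n) :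
    ν.cellAt ((moveLast (newBox μ ν))⁻¹ i.castSucc) = μ.cellAt i := by
  rw [← moveLast_succAbove (newBox μ ν) i, ← cellAt_succAbove h]
  congr 1
  exact Equiv.symm_apply_apply _ _

theorem cellAt_moveLast_symm_castSucc (h : μ.1 ≤ ν.1) (i : Fin n) :
    ν.cellAt ((moveLast (newBox μ ν)).symm i.castSucc) = μ.cellAt i :=
  cellAt_moveLast_inv_castSucc h i

theorem moveLast_inv_last (p : Fin (n + 1)) : (moveLast p)⁻¹ (Fin.last n) = p := by
  rw [← moveLast_self p]
  exact Equiv.symm_apply_apply _ _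

end NewBox

end YoungDiagram.OfSize

namespace YoungDiagram.OfSize

open Heis

variable {n : ℕ}

/-! ### Branching -/

section Branching

variable (k : Type u) [Field k]

theorem rowGroup_conj {μ : OfSize n} {ν : OfSize (n + 1)} (h : μ.1 ≤ ν.1) (σ : Equiv.Perm (Fin n)) :
    (moveLast (newBox μ ν))⁻¹ * fixLast n σ * moveLast (newBox μ ν) ∈ ν.rowGroup ↔
      σ ∈ μ.rowGroup := by
  constructor
  · intro hσ i
    have := hσ ((moveLast (newBox μ ν))⁻¹ i.castSucc)
    simpa [fixLast_castSucc, cellAt_moveLast_symm_castSucc h] using this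
  · intro hσ x
    obtain ⟨y, rfl⟩ := (moveLast (newBox μ ν))⁻¹.surjective x
    refine Fin.lastCases ?_ (fun i ↦ ?_) y
    · simp [fixLast_last]
    · simpa [fixLast_castSucc, cellAt_moveLast_symm_castSucc h] using hσ i

theorem colGroup_conj {μ : OfSize n} {ν : OfSize (n + 1)} (h : μ.1 ≤ ν.1) (σ : Equiv.Perm (Fin n)) :
    (moveLast (newBox μ ν))⁻¹ * fixLast n σ * moveLast (newBox μ ν) ∈ ν.colGroup ↔
      σ ∈ μ.colGroup := by
  constructor
  · intro hσ i
    have := hσ ((moveLast (newBox μ ν))⁻¹ i.castSucc)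
    simpa [fixLast_castSucc, cellAt_moveLast_symm_castSucc h] using this
  · intro hσ x
    obtain ⟨y, rfl⟩ := (moveLast (newBox μ ν))⁻¹.surjective x
    refine Fin.lastCases ?_ (fun i ↦ ?_) y
    · simp [fixLast_last]
    · simpa [fixLast_castSucc, cellAt_moveLast_symm_castSucc h] using hσ i

theorem sign_fixLast (σ : Equiv.Perm (Fin n)) :
    Equiv.Perm.sign (fixLast n σ) = Equiv.Perm.sign σ := by
  change Equiv.Perm.sign (((finSuccEquiv' (Fin.last n)).symm.permCongr) (Equiv.optionCongr σ)) = _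
  rw [Equiv.Perm.sign_permCongr, Equiv.optionCongr_sign]

open scoped Classical in
theorem rowSymmetrizer_eq (μ : OfSize n) :
    μ.rowSymmetrizer k = ∑ σ, (if σ ∈ μ.rowGroup then 1 else 0 : k) • pm σ := by
  rw [rowSymmetrizer, Finset.sum_filter]
  refine Finset.sum_congr rfl fun σ _ ↦ ?_
  split_ifs <;> simp

open scoped Classical in
theorem colAntisymmetrizer_eq (μ : OfSize n) :
    μ.colAntisymmetrizer k =
      ∑ σ, (if σ ∈ μ.colGroup then ((Equiv.Perm.sign σ : ℤ) : k) else 0) • pm σ := by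
  rw [colAntisymmetrizer, Finset.sum_filter]
  refine Finset.sum_congr rfl fun σ _ ↦ ?_
  split_ifs <;> simp

/-- Both a row permutation and a column permutation whose product fixes the new box do so. -/
theorem moveLast_conj_last {μ : OfSize n} {ν : OfSize (n + 1)} {r s : Equiv.Perm (Fin (n + 1))} (hr : r ∈ ν.rowGroup) (hs : s ∈ ν.colGroup)
    (hrs : r (s (newBox μ ν)) = newBox μ ν) : s (newBox μ ν) = newBox μ ν := by
  by_contra hne
  have h1 := hr (s (newBox μ ν))
  rw [hrs] at h1
  have h2 := hs (newBox μ ν)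
  have h3 : ν.cellAt (s (newBox μ ν)) = ν.cellAt (newBox μ ν) := Prod.ext h1.symm h2
  exact hne (ν.cellAt_injective h3)

open scoped Classical in
theorem condExp_conj_youngSymmetrizer {μ : OfSize n} {ν : OfSize (n + 1)} (h : μ.1 ≤ ν.1) :
    condExp n (pm (moveLast (newBox μ ν)) * ν.youngSymmetrizer k *
      pm (moveLast (newBox μ ν))⁻¹) = μ.youngSymmetrizer k := by
  set m := moveLast (newBox μ ν) with hm
  have hml (g : Equiv.Perm (Fin (n + 1))) (hg : g (newBox μ ν) = newBox μ ν) :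
      ∃ σ, g = m⁻¹ * fixLast n σ * m := by
    obtain ⟨σ, hσ⟩ := exists_fixLast (m * g * m⁻¹) (by
      rw [Equiv.Perm.mul_apply, Equiv.Perm.mul_apply, moveLast_inv_last, hg, hm, moveLast_self])
    exact ⟨σ, by rw [hσ]; group⟩
  rw [youngSymmetrizer, youngSymmetrizer, rowSymmetrizer_eq, rowSymmetrizer_eq,
    colAntisymmetrizer_eq, colAntisymmetrizer_eq, Finset.sum_mul_sum, Finset.sum_mul_sum]
  simp only [Finset.mul_sum, Finset.sum_mul, map_sum, mul_smul_comm,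
    smul_mul_assoc, map_smul, ← pm_mul]
  symm
  have hinj : Function.Injective fun σ ↦ m⁻¹ * fixLast n σ * m := fun σ τ h ↦
    fixLast_injective n (by simpa using h)
  refine Fintype.sum_of_injective (fun σ ↦ m⁻¹ * fixLast n σ * m) hinj _ _ (fun r hr ↦ ?_)
    (fun σ ↦ ?_)
  · refine Finset.sum_eq_zero fun s _ ↦ ?_
    split_ifs with h2 h1
    · rw [condExp_pm_of_ne, smul_zero, smul_zero]
      intro h3
      rw [Equiv.Perm.mul_apply, moveLast_inv_last, Equiv.Perm.mul_apply] at h3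
      have h4 : r (s (newBox μ ν)) = newBox μ ν := by
        apply m.injective
        exact h3.trans (moveLast_self _).symm
      have h5 := moveLast_conj_last h1 h2 h4
      rw [h5] at h4
      obtain ⟨σ, hσ⟩ := hml r h4
      exact hr ⟨σ, hσ.symm⟩
    all_goals simp
  · refine Fintype.sum_of_injective (fun σ ↦ m⁻¹ * fixLast n σ * m) hinj _ _ (fun s hs ↦ ?_)
      (fun τ ↦ ?_)
    · split_ifs with h2 h1
      · rw [condExp_pm_of_ne, smul_zero, smul_zero]
        intro h3
        rw [Equiv.Perm.mul_apply, moveLast_inv_last, Equiv.Perm.mul_apply] at h3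
        have h4 : (m⁻¹ * fixLast n σ * m) (s (newBox μ ν)) = newBox μ ν := by
          apply m.injective
          exact h3.trans (moveLast_self _).symm
        have h5 := moveLast_conj_last h1 h2 h4
        obtain ⟨σ, hσ⟩ := hml s h5
        exact hs ⟨σ, hσ.symm⟩
      all_goals simp
    · have h6 : m * (m⁻¹ * fixLast n σ * m * (m⁻¹ * fixLast n τ * m)) * m⁻¹ =
          fixLast n (σ * τ) := by
        rw [map_mul (fixLast n)]
        group
      have h7 : Equiv.Perm.sign (m⁻¹ * fixLast n τ * m) = Equiv.Perm.sign τ := by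
        rw [Equiv.Perm.sign_mul, Equiv.Perm.sign_mul, mul_right_comm, ← Equiv.Perm.sign_mul,
          inv_mul_cancel, Equiv.Perm.sign_one, one_mul, sign_fixLast]
      simp only [hm, rowGroup_conj h, colGroup_conj h]
      simp only [← hm]
      rw [h6, h7, condExp_pm_fixLast]

/-- The element of the group algebra that gives the inclusion of `ν` into the induction of `μ`. -/
noncomputable def branchIn (μ : OfSize n) (ν : OfSize (n + 1)) : SymAlg k (n + 1) :=
  embLast n (μ.youngIdempotent k) * pm (moveLast (newBox μ ν)) * ν.youngIdempotent k

/-- The element of the group algebra that gives the projection from the induction of `μ` to `ν`. -/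
noncomputable def branchOut (μ : OfSize n) (ν : OfSize (n + 1)) : SymAlg k (n + 1) :=
  ν.youngIdempotent k * pm (moveLast (newBox μ ν))⁻¹ * embLast n (μ.youngIdempotent k)

variable [CharZero k]

theorem emb_mul_branchIn (μ : OfSize n) (ν : OfSize (n + 1)) :
    embLast n (μ.youngIdempotent k) * branchIn k μ ν = branchIn k μ ν := by
  rw [branchIn, ← mul_assoc, ← mul_assoc, ← map_mul, youngIdempotent_mul_self]

theorem branchIn_mul (μ : OfSize n) (ν : OfSize (n + 1)) :
    branchIn k μ ν * ν.youngIdempotent k = branchIn k μ ν := by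
  rw [branchIn, mul_assoc, youngIdempotent_mul_self]

theorem branchOut_mul_emb (μ : OfSize n) (ν : OfSize (n + 1)) :
    branchOut k μ ν * embLast n (μ.youngIdempotent k) = branchOut k μ ν := by
  rw [branchOut, mul_assoc, ← map_mul, youngIdempotent_mul_self]

theorem mul_branchOut (μ : OfSize n) (ν : OfSize (n + 1)) :
    ν.youngIdempotent k * branchOut k μ ν = branchOut k μ ν := by
  rw [branchOut, ← mul_assoc, ← mul_assoc, youngIdempotent_mul_self]

theorem branchOut_mul_branchIn_of_ne (μ : OfSize n) {ν ν' : OfSize (n + 1)} (h : ν ≠ ν') :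
    branchOut k μ ν * branchIn k μ ν' = 0 := by
  rw [← mul_branchOut, ← branchIn_mul, mul_assoc, ← mul_assoc (branchOut k μ ν), ← mul_assoc,
    youngIdempotent_mul_mul_of_ne k h]

theorem branchOut_mul_branchIn {μ : OfSize n} {ν : OfSize (n + 1)} (h : μ.1 ≤ ν.1) :
    branchOut k μ ν * branchIn k μ ν = ν.youngIdempotent k := by
  have h1 : branchOut k μ ν * branchIn k μ ν = ν.youngIdempotent k *
      (pm (moveLast (newBox μ ν))⁻¹ * embLast n (μ.youngIdempotent k) *
        pm (moveLast (newBox μ ν))) * ν.youngIdempotent k := by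
    rw [← branchOut_mul_emb, mul_assoc, emb_mul_branchIn, branchOut, branchIn]
    have : embLast n (μ.youngIdempotent k) * embLast n (μ.youngIdempotent k) =
      embLast n (μ.youngIdempotent k) := by rw [← map_mul, youngIdempotent_mul_self]
    simp only [mul_assoc]
    rw [← mul_assoc (embLast n _) (embLast n _), this]
  have h2 : (branchOut k μ ν * branchIn k μ ν).coeff 1 = (ν.youngScalar k)⁻¹ := by
    rw [h1, coeff_one_mul_comm, ← mul_assoc, youngIdempotent_mul_self, ← mul_assoc,
      coeff_one_mul_comm, ← mul_assoc, ← mul_assoc, ← map_one (fixLast n), ← condExp_coeff,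
      condExp_mul_embLast, youngIdempotent, mul_smul_comm, smul_mul_assoc, map_smul,
      condExp_conj_youngSymmetrizer k h, smul_mul_assoc, youngIdempotent, mul_smul_comm,
      youngSymmetrizer_mul_self, inv_smul_smul₀ (μ.youngScalar_ne_zero k),
      MonoidAlgebra.coeff_smul_apply, youngSymmetrizer_coeff_one, smul_eq_mul, mul_one]
  rw [h1, youngIdempotent_mul_mul, ← h1, h2, mul_inv_cancel₀ (ν.youngScalar_ne_zero k), one_smul]

end Branching

end YoungDiagram.OfSize

namespace YoungDiagram

/-- Adding a box at the end of row `i`. -/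
def addBox (μ : YoungDiagram) (i : ℕ) (h : ∀ i' < i, μ.rowLen i < μ.rowLen i') : YoungDiagram where
  cells := insert (i, μ.rowLen i) μ.cells
  isLowerSet := by
    rintro ⟨a, b⟩ ⟨a', b'⟩ ⟨h1, h2⟩ hab
    simp only [Finset.coe_insert, Set.mem_insert_iff, Finset.mem_coe, mem_cells, Prod.mk.injEq]
      at hab h1 h2 ⊢
    rcases hab with ⟨rfl, rfl⟩ | hab
    · rcases h1.eq_or_lt with rfl | h1
      · rcases h2.eq_or_lt with rfl | h2
        · exact Or.inl ⟨rfl, rfl⟩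
        · exact Or.inr (mem_iff_lt_rowLen.2 h2)
      · exact Or.inr (mem_iff_lt_rowLen.2 (h2.trans_lt (h a' h1)))
    · exact Or.inr (μ.up_left_mem h1 h2 hab)

theorem mem_addBox {μ : YoungDiagram} {i : ℕ} {h : ∀ i' < i, μ.rowLen i < μ.rowLen i'}
    {c : ℕ × ℕ} : c ∈ μ.addBox i h ↔ c = (i, μ.rowLen i) ∨ c ∈ μ := by
  rw [← mem_cells, addBox, Finset.mem_insert, mem_cells]

theorem card_addBox (μ : YoungDiagram) (i : ℕ) (h : ∀ i' < i, μ.rowLen i < μ.rowLen i') :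
    (μ.addBox i h).card = μ.card + 1 :=
  Finset.card_insert_of_notMem (by rw [mem_cells, mem_iff_lt_rowLen]; exact lt_irrefl _)

theorem le_addBox (μ : YoungDiagram) (i : ℕ) (h : ∀ i' < i, μ.rowLen i < μ.rowLen i') :
    μ ≤ μ.addBox i h := fun _ hc ↦ Finset.mem_insert_of_mem hc

theorem addBox_inj {μ : YoungDiagram} {i j : ℕ} {h : ∀ i' < i, μ.rowLen i < μ.rowLen i'}
    {h' : ∀ i' < j, μ.rowLen j < μ.rowLen i'} (e : μ.addBox i h = μ.addBox j h') : i = j := by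
  have h1 : (i, μ.rowLen i) ∈ μ.addBox j h' := e ▸ mem_addBox.2 (Or.inl rfl)
  rcases mem_addBox.1 h1 with h1 | h1
  · exact (Prod.ext_iff.1 h1).1
  · exact absurd (mem_iff_lt_rowLen.1 h1) (lt_irrefl _)

end YoungDiagram

namespace YoungDiagram.OfSize

open Heis

variable {n : ℕ}

section Corners

variable {κ : OfSize n} {μ : OfSize (n + 1)}

/-- The removed box. -/
theorem cellAt_newBox_snd (h : κ.1 ≤ μ.1) :
    (μ.cellAt (newBox κ μ)).2 + 1 = μ.1.rowLen (μ.cellAt (newBox κ μ)).1 := by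
  have h1 := mem_iff_lt_rowLen.1 (μ.cellAt_mem (newBox κ μ))
  refine le_antisymm h1 ?_
  by_contra! h2
  obtain ⟨x, hx⟩ := μ.exists_cellAt_eq (mem_iff_lt_rowLen.2 h2)
  have hne : x ≠ newBox κ μ := by
    rintro rfl
    have := congrArg Prod.snd hx
    simp at this
  have h3 := (mem_iff_ne_newBox h x).2 hne
  rw [hx] at h3
  exact cellAt_newBox_notMem κ μ (κ.1.up_left_mem le_rfl (Nat.le_succ _) h3)

theorem rowLen_succ_newBox (h : κ.1 ≤ μ.1) :
    μ.1.rowLen ((μ.cellAt (newBox κ μ)).1 + 1) < μ.1.rowLen (μ.cellAt (newBox κ μ)).1 := by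
  rw [← cellAt_newBox_snd h]
  by_contra! h2
  obtain ⟨x, hx⟩ := μ.exists_cellAt_eq (mem_iff_lt_rowLen.2 (Nat.lt_of_succ_le h2))
  have hne : x ≠ newBox κ μ := by
    rintro rfl
    have := congrArg Prod.fst hx
    simp at this
  have h3 := (mem_iff_ne_newBox h x).2 hne
  rw [hx] at h3
  exact cellAt_newBox_notMem κ μ (κ.1.up_left_mem (Nat.le_succ _) le_rfl h3)

theorem eq_of_newBox_row {κ κ' : OfSize n} (h : κ.1 ≤ μ.1) (h' : κ'.1 ≤ μ.1)
    (e : (μ.cellAt (newBox κ μ)).1 = (μ.cellAt (newBox κ' μ)).1) : κ = κ' := by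
  have h1 : newBox κ μ = newBox κ' μ := by
    refine μ.cellAt_injective (Prod.ext e ?_)
    have h2 := cellAt_newBox_snd h
    have h3 := cellAt_newBox_snd h'
    rw [e] at h2
    omega
  refine Subtype.ext (YoungDiagram.ext ?_)
  ext c
  rw [mem_cells, mem_cells]
  constructor
  · intro hc
    obtain ⟨x, rfl⟩ := μ.exists_cellAt_eq (h hc)
    rw [mem_iff_ne_newBox h] at hc
    rwa [mem_iff_ne_newBox h', ← h1]
  · intro hc
    obtain ⟨x, rfl⟩ := μ.exists_cellAt_eq (h' hc)
    rw [mem_iff_ne_newBox h'] at hc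
    rwa [mem_iff_ne_newBox h, h1]

theorem card_removable_lt_card_addable (μ : OfSize (n + 1)) :
    Nat.card {κ : OfSize n // κ.1 ≤ μ.1} + 1 ≤ Nat.card {ν : OfSize (n + 2) // μ.1 ≤ ν.1} := by
  rw [← Finite.card_option]
  have hrow (κ : {κ : OfSize n // κ.1 ≤ μ.1}) :
      ∀ i' < (μ.cellAt (newBox κ.1 μ)).1 + 1,
        μ.1.rowLen ((μ.cellAt (newBox κ.1 μ)).1 + 1) < μ.1.rowLen i' := fun i' hi' ↦
    (rowLen_succ_newBox κ.2).trans_le (μ.1.rowLen_anti _ _ (Nat.lt_succ_iff.1 hi'))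
  have h0 : ∀ i' < 0, μ.1.rowLen 0 < μ.1.rowLen i' := fun i' hi' ↦ absurd hi' (Nat.not_lt_zero _)
  let f : Option {κ : OfSize n // κ.1 ≤ μ.1} → {ν : OfSize (n + 2) // μ.1 ≤ ν.1}
    | none => ⟨⟨μ.1.addBox 0 h0, by rw [card_addBox, μ.2]⟩, le_addBox _ _ h0⟩
    | some κ => ⟨⟨μ.1.addBox _ (hrow κ), by rw [card_addBox, μ.2]⟩, le_addBox _ _ (hrow κ)⟩
  refine Nat.card_le_card_of_injective f ?_
  have hf (a b) (h : f a = f b) : (f a).1.1 = (f b).1.1 := by rw [h]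
  rintro (_ | κ) (_ | κ') h
  · rfl
  · exact absurd (addBox_inj (h := h0) (h' := hrow κ') (hf none (some κ') h)) (Nat.succ_ne_zero _).symm
  · exact absurd (addBox_inj (h := hrow κ) (h' := h0) (hf (some κ) none h)) (Nat.succ_ne_zero _)
  · exact congrArg some (Subtype.ext (eq_of_newBox_row κ.2 κ'.2 (Nat.succ_injective
      (addBox_inj (h := hrow κ) (h' := hrow κ') (hf (some κ) (some κ') h)))))

end Corners

section Completeness

variable (k : Type u) [Field k] [CharZero k]

noncomputable instance : Fintype (OfSize n) := Fintype.ofFinite _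

open scoped Classical in
/-- The branching rule: the induction of `μ` is the direct sum of the `ν ⊇ μ`. -/
def Branching (n : ℕ) : Prop := ∀ μ : OfSize n,
  embLast n (μ.youngIdempotent k) =
    ∑ ν : OfSize (n + 1), if μ.1 ≤ ν.1 then branchIn k μ ν * branchOut k μ ν else 0

/-- The two-sided ideal generated by the Young idempotents is the whole group algebra. -/
def IsGenerated (n : ℕ) : Prop := (1 : SymAlg k n) ∈
  Submodule.span k {x | ∃ (κ : OfSize n) (a b : SymAlg k n), x = a * κ.youngIdempotent k * b}

variable {k}

theorem branchOut_mul_mul {μ : OfSize n} {ν : OfSize (n + 1)} (a : SymAlg k (n + 1)) :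
    ∃ c : k, branchOut k μ ν * a * ν.youngIdempotent k = c • ν.youngIdempotent k := by
  obtain ⟨c, hc⟩ := ν.exists_youngIdempotent_mul_mul k (branchOut k μ ν * a)
  exact ⟨c, by rw [← hc, ← mul_assoc, mul_branchOut]⟩

theorem mul_mul_branchIn {μ : OfSize n} {ν : OfSize (n + 1)} (a : SymAlg k (n + 1)) :
    ∃ c : k, ν.youngIdempotent k * a * branchIn k μ ν = c • ν.youngIdempotent k := by
  obtain ⟨c, hc⟩ := ν.exists_youngIdempotent_mul_mul k (a * branchIn k μ ν)
  exact ⟨c, by rw [← hc, mul_assoc, mul_assoc, mul_assoc, branchIn_mul]⟩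

theorem Branching.emb_mul_mul (hB : Branching k n) {μ : OfSize n} {ν : OfSize (n + 1)}
    (a : SymAlg k (n + 1)) :
    ∃ c : k, embLast n (μ.youngIdempotent k) * a * ν.youngIdempotent k = c • branchIn k μ ν ∧
      (¬ μ.1 ≤ ν.1 → c = 0) := by
  obtain ⟨c, hc⟩ := branchOut_mul_mul (μ := μ) (ν := ν) a
  classical
  have h (ν' : OfSize (n + 1)) (hne : ν' ≠ ν) :
      branchIn k μ ν' * branchOut k μ ν' * a * ν.youngIdempotent k = 0 := by
    have h1 := youngIdempotent_mul_mul_of_ne k hne (branchOut k μ ν' * a)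
    rw [← mul_assoc (ν'.youngIdempotent k), mul_branchOut] at h1
    rw [mul_assoc (branchIn k μ ν'), mul_assoc, h1, mul_zero]
  rw [hB, Finset.sum_mul, Finset.sum_mul, Finset.sum_eq_single ν]
  · split_ifs with h1
    · refine ⟨c, ?_, fun h ↦ absurd h1 h⟩
      rw [mul_assoc, mul_assoc, ← mul_assoc (branchOut k μ ν), hc, mul_smul_comm, branchIn_mul]
    · exact ⟨0, by simp, fun _ ↦ rfl⟩
  · intro ν' _ hne
    split_ifs
    · exact h ν' hne
    · simp
  · simp

theorem Branching.mul_mul_emb (hB : Branching k n) {μ : OfSize n} {ν : OfSize (n + 1)}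
    (a : SymAlg k (n + 1)) :
    ∃ c : k, ν.youngIdempotent k * a * embLast n (μ.youngIdempotent k) = c • branchOut k μ ν ∧
      (¬ μ.1 ≤ ν.1 → c = 0) := by
  obtain ⟨c, hc⟩ := mul_mul_branchIn (μ := μ) (ν := ν) a
  classical
  have h (ν' : OfSize (n + 1)) (hne : ν' ≠ ν) :
      ν.youngIdempotent k * a * (branchIn k μ ν' * branchOut k μ ν') = 0 := by
    rw [← branchIn_mul, ← mul_assoc, ← mul_assoc, mul_assoc (ν.youngIdempotent k),
      youngIdempotent_mul_mul_of_ne k hne.symm, zero_mul]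
  rw [hB, Finset.mul_sum, Finset.sum_eq_single ν]
  · split_ifs with h1
    · refine ⟨c, ?_, fun h ↦ absurd h1 h⟩
      rw [← mul_assoc, hc, smul_mul_assoc, mul_branchOut]
    · exact ⟨0, by simp, fun _ ↦ rfl⟩
  · intro ν' _ hne
    split_ifs
    · exact h ν' hne
    · simp
  · simp

theorem IsGenerated.succ (hG : IsGenerated k n) (hB : Branching k n) : IsGenerated k (n + 1) := by
  rw [IsGenerated]
  rw [IsGenerated] at hG
  have h := Submodule.mem_map_of_mem (f := (embLast n).toLinearMap) hG
  rw [Submodule.map_span] at h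
  change embLast n 1 ∈ _ at h
  rw [map_one] at h
  refine Submodule.span_le.2 ?_ h
  rintro _ ⟨_, ⟨κ, a, b, rfl⟩, rfl⟩
  change embLast n _ ∈ _
  classical
  rw [map_mul, map_mul, hB, Finset.mul_sum, Finset.sum_mul]
  refine Submodule.sum_mem _ fun ν _ ↦ ?_
  split_ifs
  · refine Submodule.subset_span ⟨ν, embLast n a * branchIn k κ ν, branchOut k κ ν * embLast n b, ?_⟩
    rw [mul_assoc _ (branchIn k κ ν), branchIn_mul]
    simp only [mul_assoc]
  · simp

/-- An endomorphism of the induction of `μ` is a combination of finitely many given elements. -/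
theorem Branching.finite_span (hG : IsGenerated k n) (hB : Branching k n) (μ : OfSize (n + 1))
    (a : SymAlg k (n + 2)) :
    embLast (n + 1) (μ.youngIdempotent k) * a * embLast (n + 1) (μ.youngIdempotent k) ∈
      Submodule.span k (Set.range fun o : Option {κ : OfSize n // κ.1 ≤ μ.1} ↦
        o.elim (embLast (n + 1) (μ.youngIdempotent k)) fun κ ↦
          embLast (n + 1) (branchOut k κ.1 μ) * pm (swapLast n) *
            embLast (n + 1) (branchIn k κ.1 μ)) := by
  induction a using symAlg_induction with
  | zero => simp
  | add a b ha hb => rw [mul_add, add_mul]; exact Submodule.add_mem _ ha hb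
  | smul r a ha => rw [mul_smul_comm, smul_mul_assoc]; exact Submodule.smul_mem _ _ ha
  | perm g =>
    by_cases hg : g (Fin.last _) = Fin.last _
    · obtain ⟨σ, rfl⟩ := exists_fixLast g hg
      obtain ⟨c, hc⟩ := μ.exists_youngIdempotent_mul_mul k (pm σ)
      rw [← embLast_pm, ← map_mul, ← map_mul, hc, map_smul]
      exact Submodule.smul_mem _ _ (Submodule.subset_span ⟨none, rfl⟩)
    · obtain ⟨σ, τ, rfl⟩ := exists_fixLast_swap_fixLast g hg
      rw [pm_mul, pm_mul, ← embLast_pm, ← embLast_pm]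
      let φ : SymAlg k n →ₗ[k] SymAlg k (n + 2) :=
        (LinearMap.mulRight k (pm (swapLast n) * embLast (n + 1) (pm τ) *
            embLast (n + 1) (μ.youngIdempotent k))) ∘ₗ
          (LinearMap.mulLeft k (embLast (n + 1) (μ.youngIdempotent k) * embLast (n + 1) (pm σ))) ∘ₗ
          ((embLast (n + 1)).comp (embLast n)).toLinearMap
      have hφ (x : SymAlg k n) : φ x = embLast (n + 1) (μ.youngIdempotent k) *
          embLast (n + 1) (pm σ) * embLast (n + 1) (embLast n x) * (pm (swapLast n) *
            embLast (n + 1) (pm τ) * embLast (n + 1) (μ.youngIdempotent k)) := rfl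
      have h1 : embLast (n + 1) (μ.youngIdempotent k) *
          (embLast (n + 1) (pm σ) * pm (swapLast n) * embLast (n + 1) (pm τ)) *
            embLast (n + 1) (μ.youngIdempotent k) = φ 1 := by
        rw [hφ, map_one, map_one, mul_one]
        simp only [mul_assoc]
      rw [h1]
      have h2 := Submodule.mem_map_of_mem (f := φ) hG
      rw [Submodule.map_span] at h2
      refine Submodule.span_le.2 ?_ h2
      rintro _ ⟨_, ⟨κ, a, b, rfl⟩, rfl⟩
      obtain ⟨c, hc, hc0⟩ := hB.mul_mul_emb (μ := κ) (ν := μ) (pm σ * embLast n a)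
      obtain ⟨d, hd, -⟩ := hB.emb_mul_mul (μ := κ) (ν := μ) (embLast n b * pm τ)
      have h3 : φ (a * κ.youngIdempotent k * b) =
          embLast (n + 1) (μ.youngIdempotent k * (pm σ * embLast n a) *
            embLast n (κ.youngIdempotent k)) * pm (swapLast n) *
          embLast (n + 1) (embLast n (κ.youngIdempotent k) * (embLast n b * pm τ) *
            μ.youngIdempotent k) := by
        have h4 := youngIdempotent_mul_self k κ
        have h5 : a * κ.youngIdempotent k * b =
            a * κ.youngIdempotent k * (κ.youngIdempotent k * b) := by
          rw [← mul_assoc, mul_assoc a (κ.youngIdempotent k) (κ.youngIdempotent k), h4]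
        have h6 (z : SymAlg k (n + 2)) := congrArg (· * z)
          (swapLast_mul_embLast_embLast (κ.youngIdempotent k * b)).symm
        rw [h5, hφ]
        simp only [map_mul, mul_assoc] at h6 ⊢
        rw [h6]
      rw [SetLike.mem_coe, h3, hc, hd, map_smul, map_smul, mul_smul_comm, smul_mul_assoc,
        smul_mul_assoc]
      by_cases hκ : κ.1 ≤ μ.1
      · exact Submodule.smul_mem _ _ (Submodule.smul_mem _ _
          (Submodule.subset_span ⟨some ⟨κ, hκ⟩, rfl⟩))
      · rw [hc0 hκ, zero_smul, smul_zero]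
        exact Submodule.zero_mem _

theorem linearIndependent_branch (μ : OfSize n) :
    LinearIndependent k fun ν : {ν : OfSize (n + 1) // μ.1 ≤ ν.1} ↦
      branchIn k μ ν.1 * branchOut k μ ν.1 := by
  classical
  have : Fintype {ν : OfSize (n + 1) // μ.1 ≤ ν.1} := Fintype.ofFinite _
  rw [Fintype.linearIndependent_iff]
  intro c hc ν
  have h := congrArg (fun x ↦ branchOut k μ ν.1 * x * branchIn k μ ν.1) hc
  simp only [Finset.mul_sum, Finset.sum_mul, mul_zero, zero_mul] at h
  rw [Finset.sum_eq_single ν] at h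
  · rw [mul_smul_comm, smul_mul_assoc, ← mul_assoc, branchOut_mul_branchIn k ν.2, mul_branchOut,
      branchOut_mul_branchIn k ν.2] at h
    exact (smul_eq_zero.1 h).resolve_right (youngIdempotent_ne_zero k ν.1)
  · intro ν' _ hne
    rw [mul_smul_comm, ← mul_assoc,
      branchOut_mul_branchIn_of_ne k μ (fun h ↦ hne (Subtype.ext h.symm)), zero_mul, smul_zero,
      zero_mul]
  · simp

/-- If the endomorphisms of the induction of `μ` are a combination of at most as many elements as
there are diagrams `ν ⊇ μ`, then the branching rule holds. -/
theorem branching_of_mem_span (μ : OfSize n) {ι : Type*} [Finite ι] (v : ι → SymAlg k (n + 1))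
    (hcard : Nat.card ι ≤ Nat.card {ν : OfSize (n + 1) // μ.1 ≤ ν.1})
    (hv : ∀ a : SymAlg k (n + 1), embLast n (μ.youngIdempotent k) * a *
      embLast n (μ.youngIdempotent k) ∈ Submodule.span k (Set.range v)) :
    ∃ c : {ν : OfSize (n + 1) // μ.1 ≤ ν.1} → k,
      embLast n (μ.youngIdempotent k) = ∑ᶠ ν, c ν • (branchIn k μ ν.1 * branchOut k μ ν.1) := by
  have : Fintype {ν : OfSize (n + 1) // μ.1 ≤ ν.1} := Fintype.ofFinite _
  have : Fintype ι := Fintype.ofFinite _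
  have hle : Submodule.span k (Set.range fun ν : {ν : OfSize (n + 1) // μ.1 ≤ ν.1} ↦
      branchIn k μ ν.1 * branchOut k μ ν.1) ≤ Submodule.span k (Set.range v) := by
    rw [Submodule.span_le]
    rintro _ ⟨ν, rfl⟩
    have := hv (branchIn k μ ν.1 * branchOut k μ ν.1)
    rwa [← mul_assoc, emb_mul_branchIn, mul_assoc, branchOut_mul_emb] at this
  have heq := Submodule.eq_of_le_of_finrank_le hle (by
    rw [finrank_span_eq_card (linearIndependent_branch μ)]
    refine (finrank_range_le_card v).trans ?_
    rwa [Nat.card_eq_fintype_card, Nat.card_eq_fintype_card] at hcard)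
  have hmem := hv 1
  rw [mul_one, ← map_mul, youngIdempotent_mul_self, ← heq, Submodule.mem_span_range_iff_exists_fun]
    at hmem
  obtain ⟨c, hc⟩ := hmem
  exact ⟨c, by rw [← hc, finsum_eq_sum_of_fintype]⟩

theorem branching_of_card (hspan : ∀ μ : OfSize n, ∃ (ι : Type) (_ : Finite ι)
    (v : ι → SymAlg k (n + 1)), Nat.card ι ≤ Nat.card {ν : OfSize (n + 1) // μ.1 ≤ ν.1} ∧
      ∀ a : SymAlg k (n + 1), embLast n (μ.youngIdempotent k) * a *
        embLast n (μ.youngIdempotent k) ∈ Submodule.span k (Set.range v)) : Branching k n := by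
  intro μ
  obtain ⟨ι, _, v, hcard, hv⟩ := hspan μ
  obtain ⟨c, hc⟩ := branching_of_mem_span μ v hcard hv
  classical
  have : Fintype {ν : OfSize (n + 1) // μ.1 ≤ ν.1} := Fintype.ofFinite _
  rw [finsum_eq_sum_of_fintype] at hc
  have hc1 (ν : {ν : OfSize (n + 1) // μ.1 ≤ ν.1}) : c ν = 1 := by
    have h := congrArg (fun x ↦ branchOut k μ ν.1 * x * branchIn k μ ν.1) hc
    simp only [Finset.mul_sum, Finset.sum_mul] at h
    rw [Finset.sum_eq_single ν, branchOut_mul_emb, branchOut_mul_branchIn k ν.2, mul_smul_comm,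
      smul_mul_assoc, ← mul_assoc, branchOut_mul_branchIn k ν.2, mul_branchOut,
      branchOut_mul_branchIn k ν.2] at h
    · have h2 : (1 - c ν) • ν.1.youngIdempotent k = 0 := by
        rw [sub_smul, one_smul, ← h, sub_self]
      have h3 := (smul_eq_zero.1 h2).resolve_right (youngIdempotent_ne_zero k ν.1)
      exact (sub_eq_zero.1 h3).symm
    · intro ν' _ hne
      rw [mul_smul_comm, ← mul_assoc,
        branchOut_mul_branchIn_of_ne k μ (fun h ↦ hne (Subtype.ext h.symm)), zero_mul, smul_zero,
        zero_mul]
    · simp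
  rw [hc, ← Finset.sum_filter]
  simp only [hc1, one_smul]
  exact (Finset.sum_subtype (Finset.univ.filter fun ν : OfSize (n + 1) ↦ μ.1 ≤ ν.1)
    (by simp) (fun ν ↦ branchIn k μ ν * branchOut k μ ν)).symm

theorem youngIdempotent_zero (μ : OfSize 0) : μ.youngIdempotent k = 1 := by
  have h (a : SymAlg k 0) : a = a.coeff 1 • 1 := by
    refine MonoidAlgebra.ext (Finsupp.ext fun σ ↦ ?_)
    rw [Subsingleton.elim σ 1, MonoidAlgebra.coeff_smul_apply, MonoidAlgebra.coeff_one_one]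
    simp
  have h2 := youngIdempotent_mul_self k μ
  have h3 := youngIdempotent_ne_zero k μ
  rw [h (μ.youngIdempotent k)] at h2 h3 ⊢
  set c := (μ.youngIdempotent k).coeff 1
  have hc : c ≠ 0 := by
    rintro h0
    rw [h0, zero_smul] at h3
    exact h3 rfl
  rw [smul_mul_smul_comm, mul_one] at h2
  have h4 := congrArg (fun x : SymAlg k 0 ↦ x.coeff 1) h2
  simp only [MonoidAlgebra.coeff_smul_apply, MonoidAlgebra.coeff_one_one, smul_eq_mul, mul_one] at h4
  rw [mul_right_eq_self₀.1 h4 |>.resolve_right hc, one_smul]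

/-- The empty partition. -/
def empty : OfSize 0 := ⟨⊥, rfl⟩

theorem eq_empty (μ : OfSize 0) : μ = empty := by
  refine Subtype.ext (YoungDiagram.ext ?_)
  have := Finset.card_eq_zero.1 μ.2
  rw [this]
  rfl

theorem isGenerated_zero : IsGenerated k 0 :=
  Submodule.subset_span ⟨empty, 1, 1, by rw [youngIdempotent_zero, one_mul, one_mul]⟩

theorem branching_zero : Branching k 0 := by
  refine branching_of_card fun μ ↦ ⟨Unit, inferInstance, fun _ ↦ 1, ?_, fun a ↦ ?_⟩
  · rw [Nat.card_unique, Nat.one_le_iff_ne_zero, Nat.card_ne_zero]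
    refine ⟨⟨⟨⟨μ.1.addBox 0 (fun i hi ↦ absurd hi (Nat.not_lt_zero _)), ?_⟩,
      le_addBox _ _ (fun i hi ↦ absurd hi (Nat.not_lt_zero _))⟩⟩,
      inferInstance⟩
    rw [card_addBox, μ.2]
  · rw [youngIdempotent_zero, map_one, one_mul, mul_one]
    have : a = a.coeff 1 • 1 := by
      have : Subsingleton (Equiv.Perm (Fin (0 + 1))) := inferInstanceAs (Subsingleton (Equiv.Perm (Fin 1)))
      refine MonoidAlgebra.ext (Finsupp.ext fun σ ↦ ?_)
      rw [Subsingleton.elim σ 1, MonoidAlgebra.coeff_smul_apply, MonoidAlgebra.coeff_one_one]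
      simp
    rw [this]
    exact Submodule.smul_mem _ _ (Submodule.subset_span ⟨(), rfl⟩)

theorem isGenerated_and_branching (n : ℕ) : IsGenerated k n ∧ Branching k n := by
  induction n with
  | zero => exact ⟨isGenerated_zero, branching_zero⟩
  | succ n ih =>
    refine ⟨ih.1.succ ih.2, branching_of_card fun μ ↦
      ⟨Option {κ : OfSize n // κ.1 ≤ μ.1}, inferInstance, _, ?_, ih.2.finite_span ih.1 μ⟩⟩
    rw [Finite.card_option]
    exact card_removable_lt_card_addable μ

variable (k)

theorem branching (n : ℕ) : Branching k n := (isGenerated_and_branching n).2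

theorem isGenerated (n : ℕ) : IsGenerated k n := (isGenerated_and_branching n).1

theorem condExp_branchIn_mul_branchOut_of_ne {μ μ' : OfSize n} (ν : OfSize (n + 1)) (h : μ ≠ μ') :
    condExp n (branchIn k μ ν * branchOut k μ' ν) = 0 := by
  rw [← emb_mul_branchIn, ← branchOut_mul_emb, mul_assoc, condExp_embLast_mul, ← mul_assoc,
    condExp_mul_embLast, ← mul_assoc, youngIdempotent_mul_mul_of_ne k h]

theorem condExp_branchIn_mul_branchOut {μ : OfSize n} {ν : OfSize (n + 1)} (h : μ.1 ≤ ν.1) :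
    condExp n (branchIn k μ ν * branchOut k μ ν) =
      (μ.youngScalar k * (ν.youngScalar k)⁻¹) • μ.youngIdempotent k := by
  have h1 : condExp n (branchIn k μ ν * branchOut k μ ν) = μ.youngIdempotent k *
      condExp n (branchIn k μ ν * branchOut k μ ν) * μ.youngIdempotent k := by
    rw [← condExp_embLast_mul, ← condExp_mul_embLast, ← mul_assoc, emb_mul_branchIn, mul_assoc,
      branchOut_mul_emb]
  rw [h1, youngIdempotent_mul_mul, ← h1, condExp_coeff, map_one, coeff_one_mul_comm,
    branchOut_mul_branchIn k h, youngIdempotent_coeff_one]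

end Completeness

end YoungDiagram.OfSize

namespace Heis

open YoungDiagram YoungDiagram.OfSize CoxeterRelations

/-! ### Actions of the Heisenberg relations on a category -/

section Action

universe v₁ u₁

/-- The iterates of an endofunctor. -/
def powFunctor {D : Type u₁} [Category.{v₁} D] (X : D ⥤ D) : ℕ → D ⥤ D
  | 0 => 𝟭 D
  | n + 1 => X ⋙ powFunctor X n

/-- Moving the innermost factor of an iterate to the outside. -/
def powShift {D : Type u₁} [Category.{v₁} D] (X : D ⥤ D) :
    ∀ (n : ℕ) (Z : D), (powFunctor X n).obj (X.obj Z) ≅ X.obj ((powFunctor X n).obj Z)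
  | 0, _ => Iso.refl _
  | n + 1, Z => powShift X n (X.obj Z)

theorem powShift_naturality {D : Type u₁} [Category.{v₁} D] (X : D ⥤ D) (n : ℕ) {Z W : D}
    (f : Z ⟶ W) : (powFunctor X n).map (X.map f) ≫ (powShift X n W).hom =
      (powShift X n Z).hom ≫ X.map ((powFunctor X n).map f) := by
  induction n generalizing Z W with
  | zero => exact (Category.comp_id _).trans (Category.id_comp _).symm
  | succ n ih => exact ih (X.map f)

instance powFunctor_additive {D : Type u₁} [Category.{v₁} D] [Preadditive D] (X : D ⥤ D)
    [X.Additive] (n : ℕ) : (powFunctor X n).Additive := by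
  induction n with
  | zero => exact inferInstanceAs (𝟭 D).Additive
  | succ n ih => exact inferInstanceAs (X ⋙ powFunctor X n).Additive

/-- Two endofunctors `X` and `Y` that satisfy the relations of the two strands of opposite
orientation in the Heisenberg category. -/
structure HeisAction (k : Type u) [Field k] (D : Type u₁) [Category.{v₁} D] [Preadditive D]
    [Linear k D] where
  /-- the strand whose powers are studied -/
  X : D ⥤ D
  /-- the strand of the opposite orientation -/
  Y : D ⥤ D
  [additiveX : X.Additive]
  [linearX : X.Linear k]
  [additiveY : Y.Additive]
  [linearY : Y.Linear k]
  /-- the crossing of two strands of the same orientation -/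
  c (Z : D) : X.obj (X.obj Z) ⟶ X.obj (X.obj Z)
  /-- a sideways crossing -/
  us (Z : D) : Y.obj (X.obj Z) ⟶ X.obj (Y.obj Z)
  /-- a sideways crossing -/
  sw (Z : D) : X.obj (Y.obj Z) ⟶ Y.obj (X.obj Z)
  /-- a cup -/
  cu (Z : D) : Z ⟶ X.obj (Y.obj Z)
  /-- a cap -/
  ca (Z : D) : X.obj (Y.obj Z) ⟶ Z
  /-- a cap -/
  ln (Z : D) : Y.obj (X.obj Z) ⟶ Z
  /-- a cup -/
  cl (Z : D) : Z ⟶ Y.obj (X.obj Z)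
  ln_naturality {Z W : D} (f : Z ⟶ W) : Y.map (X.map f) ≫ ln W = ln Z ≫ f
  cl_naturality {Z W : D} (f : Z ⟶ W) : f ≫ cl W = cl Z ≫ Y.map (X.map f)
  us_sw (Z : D) : us Z ≫ sw Z = 𝟙 _
  sw_us (Z : D) : sw Z ≫ us Z = 𝟙 _ - ca Z ≫ cu Z
  cu_ca (Z : D) : cu Z ≫ ca Z = 𝟙 _
  cu_us (Z : D) : cu (X.obj Z) ≫ X.map (us Z) = X.map (cu Z) ≫ c (Y.obj Z)
  sw_ca (Z : D) : X.map (sw Z) ≫ ca (X.obj Z) = c (Y.obj Z) ≫ X.map (ca Z)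
  cu_ln (Z : D) : Y.map (cu Z) ≫ ln (Y.obj Z) = 𝟙 _
  cl_ca (Z : D) : cl (Y.obj Z) ≫ Y.map (ca Z) = 𝟙 _
  /-- the action of the symmetric group -/
  act (n : ℕ) (Z : D) : SymAlg k n →ₐ[k] End ((powFunctor X n).obj Z)
  act_naturality {n : ℕ} (a : SymAlg k n) {Z W : D} (f : Z ⟶ W) :
    (powFunctor X n).map f ≫ act n W a = act n Z a ≫ (powFunctor X n).map f
  act_embLast {n : ℕ} (a : SymAlg k n) (Z : D) : act (n + 1) Z (embLast n a) = act n (X.obj Z) a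
  act_swapLast {n : ℕ} (Z : D) : act (n + 2) Z (pm (swapLast n)) = (powFunctor X n).map (c Z)

namespace HeisAction

variable {k : Type u} [Field k] {D : Type u₁} [Category.{v₁} D] [Preadditive D] [Linear k D]
  (S : HeisAction k D)

attribute [instance] additiveX linearX additiveY linearY

/-- The powers of `X`. -/
abbrev T (n : ℕ) : D ⥤ D := powFunctor S.X n

/-- The action of an element of the group algebra on the power of degree `n + 1`. -/
noncomputable def actS {n : ℕ} (a : SymAlg k (n + 1)) (Z : D) :
    (S.T n).obj (S.X.obj Z) ⟶ (S.T n).obj (S.X.obj Z) :=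
  S.act (n + 1) Z a

theorem act_mul {n : ℕ} (a b : SymAlg k n) (Z : D) :
    (S.act n Z (a * b) : _ ⟶ _) = S.act n Z b ≫ S.act n Z a := map_mul _ _ _

theorem act_one {n : ℕ} (Z : D) : (S.act n Z 1 : _ ⟶ _) = 𝟙 _ := map_one _

theorem actS_mul {n : ℕ} (a b : SymAlg k (n + 1)) (Z : D) :
    S.actS (a * b) Z = S.actS b Z ≫ S.actS a Z := S.act_mul a b Z

theorem actS_one {n : ℕ} (Z : D) : S.actS (1 : SymAlg k (n + 1)) Z = 𝟙 _ := S.act_one Z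

theorem actS_add {n : ℕ} (a b : SymAlg k (n + 1)) (Z : D) :
    S.actS (a + b) Z = S.actS a Z + S.actS b Z := map_add (S.act (n + 1) Z) a b

theorem actS_smul {n : ℕ} (r : k) (a : SymAlg k (n + 1)) (Z : D) :
    S.actS (r • a) Z = r • S.actS a Z := map_smul (S.act (n + 1) Z) r a

theorem actS_zero {n : ℕ} (Z : D) : S.actS (0 : SymAlg k (n + 1)) Z = 0 :=
  map_zero (S.act (n + 1) Z)

theorem actS_naturality {n : ℕ} (a : SymAlg k (n + 1)) {Z W : D} (f : Z ⟶ W) :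
    (S.T n).map (S.X.map f) ≫ S.actS a W = S.actS a Z ≫ (S.T n).map (S.X.map f) :=
  S.act_naturality a f

theorem actS_embLast {n : ℕ} (a : SymAlg k n) (Z : D) :
    S.actS (embLast n a) Z = S.act n (S.X.obj Z) a := S.act_embLast a Z

theorem actS_embLast' {n : ℕ} (a : SymAlg k (n + 1)) (Z : D) :
    S.actS (embLast (n + 1) a) Z = S.actS a (S.X.obj Z) := S.act_embLast a Z

theorem actS_swapLast {n : ℕ} (Z : D) :
    S.actS (pm (swapLast n)) Z = (S.T n).map (S.c Z) := S.act_swapLast Z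

theorem actS_cycle_succ {n : ℕ} (Z : D) : S.actS (pm (lastToFirst (n + 1))) Z =
    (S.T n).map (S.c Z) ≫ S.actS (pm (lastToFirst n)) (S.X.obj Z) := by
  rw [lastToFirst_succ, pm_mul, ← embLast_pm, actS_mul, actS_swapLast, actS_embLast']
  rfl

/-- The shift of a power. -/
abbrev l (n : ℕ) (Z : D) : (S.T n).obj (S.X.obj Z) ≅ S.X.obj ((S.T n).obj Z) := powShift S.X n Z

theorem l_naturality (n : ℕ) {Z W : D} (f : Z ⟶ W) :
    (S.T n).map (S.X.map f) ≫ (S.l n W).hom = (S.l n Z).hom ≫ S.X.map ((S.T n).map f) :=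
  powShift_naturality S.X n f

theorem cu_sw (Z : D) : S.cu Z ≫ S.sw Z = 0 := by
  have h : S.cu Z ≫ (S.sw Z ≫ S.us Z) ≫ S.sw Z = 0 := by
    rw [sw_us, Preadditive.sub_comp, Preadditive.comp_sub, Category.id_comp, Category.assoc,
      ← Category.assoc (S.cu Z) (S.ca Z), cu_ca, Category.id_comp, sub_self]
  rwa [Category.assoc, us_sw, Category.comp_id] at h

theorem us_ca (Z : D) : S.us Z ≫ S.ca Z = 0 := by
  have h : S.us Z ≫ (S.sw Z ≫ S.us Z) ≫ S.ca Z = 0 := by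
    rw [sw_us, Preadditive.sub_comp, Preadditive.comp_sub, Category.id_comp, Category.assoc,
      cu_ca, Category.comp_id, sub_self]
  rwa [Category.assoc, ← Category.assoc, us_sw, Category.id_comp] at h

/-- Two permutations of the first factors commute with the shift. -/
theorem actS_embFirst_pm {n : ℕ} (σ : Equiv.Perm (Fin n)) (Z : D) :
    S.actS (pm (fixFirst n σ)) Z ≫ (S.l n Z).hom =
      (S.l n Z).hom ≫ S.X.map (S.act n Z (pm σ)) := by
  have hone (n : ℕ) (Z : D) : S.actS (pm (fixFirst n 1)) Z ≫ (S.l n Z).hom =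
      (S.l n Z).hom ≫ S.X.map (S.act n Z (pm 1)) := by
    rw [map_one, pm_one, pm_one, actS_one, act_one, CategoryTheory.Functor.map_id, Category.id_comp,
      Category.comp_id]
  induction n generalizing Z with
  | zero => rw [Subsingleton.elim σ 1]; exact hone 0 Z
  | succ n ih =>
    have hlast (τ : Equiv.Perm (Fin n)) : S.actS (pm (fixFirst (n + 1) (fixLast n τ))) Z ≫
        (S.l (n + 1) Z).hom = (S.l (n + 1) Z).hom ≫ S.X.map (S.act (n + 1) Z (pm (fixLast n τ))) := by
      have h : fixFirst (n + 1) (fixLast n τ) = fixLast (n + 1) (fixFirst n τ) := by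
        ext x
        refine Fin.cases ?_ (fun i ↦ ?_) x
        · have : (0 : Fin (n + 2)) = Fin.castSucc (0 : Fin (n + 1)) := rfl
          rw [fixFirst_zero, this, fixLast_castSucc, fixFirst_zero]
        · refine Fin.lastCases ?_ (fun j ↦ ?_) i
          · rw [fixFirst_succ, fixLast_last, Fin.succ_last, fixLast_last]
          · rw [fixFirst_succ, fixLast_castSucc, Fin.succ_castSucc, Fin.succ_castSucc,
              fixLast_castSucc, fixFirst_succ]
      have h2 := ih τ (S.X.obj Z)
      rw [h, ← embLast_pm, ← embLast_pm, actS_embLast', act_embLast]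
      exact h2
    cases n with
    | zero =>
      rw [Subsingleton.elim (α := Equiv.Perm (Fin 1)) σ 1]
      exact hone 1 Z
    | succ n =>
      by_cases hσ : σ (Fin.last _) = Fin.last _
      · obtain ⟨τ, rfl⟩ := exists_fixLast σ hσ
        exact hlast τ
      · obtain ⟨τ, τ', rfl⟩ := exists_fixLast_swap_fixLast σ hσ
        have hs : S.actS (pm (fixFirst (n + 2) (swapLast n))) Z ≫ (S.l (n + 2) Z).hom =
            (S.l (n + 2) Z).hom ≫ S.X.map (S.act (n + 2) Z (pm (swapLast n))) := by
          have h : fixFirst (n + 2) (swapLast n) = swapLast (n + 1) := by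
            ext x
            refine Fin.cases ?_ (fun i ↦ ?_) x
            · rw [fixFirst_zero, simpleSwap_apply_val _ _ (by omega)]
              simp
            · rw [fixFirst_succ, simpleSwap_apply_val _ _ (by omega), Fin.val_succ,
                simpleSwap_apply_val _ _ (by omega)]
              simp only [Fin.val_succ]
              split_ifs <;> omega
          rw [h, actS_swapLast, act_swapLast]
          exact S.l_naturality n (S.c Z)
        rw [map_mul, map_mul, pm_mul, pm_mul, pm_mul, pm_mul, actS_mul, actS_mul, act_mul, act_mul,
          Functor.map_comp, Functor.map_comp, Category.assoc, Category.assoc, hlast τ]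
        rw [← Category.assoc (S.actS (pm (fixFirst (n + 2) (swapLast n))) Z), hs, Category.assoc,
          ← Category.assoc, hlast τ', Category.assoc]

theorem actS_embFirst {n : ℕ} (a : SymAlg k n) (Z : D) :
    S.actS (embFirst n a) Z ≫ (S.l n Z).hom = (S.l n Z).hom ≫ S.X.map (S.act n Z a) := by
  induction a using symAlg_induction with
  | zero =>
    rw [map_zero, map_zero, actS_zero, zero_comp]
    exact ((congrArg _ (S.X.map_zero _ _)).trans comp_zero).symm
  | add a b ha hb =>
    rw [map_add, map_add, actS_add, Preadditive.add_comp, ha, hb]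
    exact ((congrArg _ S.X.map_add).trans (Preadditive.comp_add ..)).symm
  | smul r a ha =>
    rw [map_smul, map_smul, actS_smul, Linear.smul_comp, ha]
    exact ((congrArg _ (S.X.map_smul _ _)).trans (Linear.comp_smul ..)).symm
  | perm σ => rw [embFirst_pm]; exact S.actS_embFirst_pm σ Z

/-! #### Moving a strand through a power -/

/-- The crossing of a strand with a power. -/
def Us : ∀ (n : ℕ) (Z : D), S.Y.obj ((S.T n).obj Z) ⟶ (S.T n).obj (S.Y.obj Z)
  | 0, _ => 𝟙 _
  | n + 1, Z => Us n (S.X.obj Z) ≫ (S.T n).map (S.us Z)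

/-- The crossing of a power with a strand. -/
def Sw : ∀ (n : ℕ) (Z : D), (S.T n).obj (S.Y.obj Z) ⟶ S.Y.obj ((S.T n).obj Z)
  | 0, _ => 𝟙 _
  | n + 1, Z => (S.T n).map (S.sw Z) ≫ Sw n (S.X.obj Z)

/-- Closing the outermost strand of a power. -/
def link (n : ℕ) (Z : D) : S.Y.obj ((S.T n).obj (S.X.obj Z)) ⟶ (S.T n).obj Z :=
  S.Y.map (S.l n Z).hom ≫ S.ln _

/-- Creating the outermost strand of a power. -/
def colink (n : ℕ) (Z : D) : (S.T n).obj Z ⟶ S.Y.obj ((S.T n).obj (S.X.obj Z)) :=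
  S.cl _ ≫ S.Y.map (S.l n Z).inv

theorem Us_Sw (n : ℕ) (Z : D) : S.Us n Z ≫ S.Sw n Z = 𝟙 _ := by
  induction n generalizing Z with
  | zero => exact Category.comp_id _
  | succ n ih =>
    change (S.Us n (S.X.obj Z) ≫ (S.T n).map (S.us Z)) ≫ (S.T n).map (S.sw Z) ≫
      S.Sw n (S.X.obj Z) = 𝟙 _
    rw [Category.assoc, ← Category.assoc ((S.T n).map (S.us Z)), ← Functor.map_comp, us_sw,
      CategoryTheory.Functor.map_id, Category.id_comp, ih]

/-- The crossing of a strand with a power of positive degree. -/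
def UsS (n : ℕ) (Z : D) :
    S.Y.obj ((S.T n).obj (S.X.obj Z)) ⟶ (S.T n).obj (S.X.obj (S.Y.obj Z)) :=
  S.Us n (S.X.obj Z) ≫ (S.T n).map (S.us Z)

/-- The crossing of a power of positive degree with a strand. -/
def SwS (n : ℕ) (Z : D) :
    (S.T n).obj (S.X.obj (S.Y.obj Z)) ⟶ S.Y.obj ((S.T n).obj (S.X.obj Z)) :=
  (S.T n).map (S.sw Z) ≫ S.Sw n (S.X.obj Z)

theorem cup_SwS (n : ℕ) (Z : D) : (S.T n).map (S.cu Z) ≫ S.SwS n Z = 0 := by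
  rw [SwS, ← Category.assoc, ← Functor.map_comp, cu_sw, Functor.map_zero, zero_comp]

theorem UsS_cap (n : ℕ) (Z : D) : S.UsS n Z ≫ (S.T n).map (S.ca Z) = 0 := by
  rw [UsS, Category.assoc, ← Functor.map_comp, us_ca, Functor.map_zero, comp_zero]

theorem link_naturality (n : ℕ) {Z W : D} (f : Z ⟶ W) :
    S.Y.map ((S.T n).map (S.X.map f)) ≫ S.link n W = S.link n Z ≫ (S.T n).map f := by
  rw [link, link, ← Category.assoc, ← Functor.map_comp, l_naturality, Functor.map_comp,
    Category.assoc, ln_naturality, Category.assoc]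

theorem colink_naturality (n : ℕ) {Z W : D} (f : Z ⟶ W) :
    (S.T n).map f ≫ S.colink n W = S.colink n Z ≫ S.Y.map ((S.T n).map (S.X.map f)) := by
  have h : S.X.map ((S.T n).map f) ≫ (S.l n W).inv = (S.l n Z).inv ≫ (S.T n).map (S.X.map f) := by
    rw [Iso.comp_inv_eq, Category.assoc, l_naturality, Iso.inv_hom_id_assoc]
  rw [colink, colink, ← Category.assoc, cl_naturality, Category.assoc, ← Functor.map_comp, h,
    Functor.map_comp, Category.assoc]

theorem Us_eq (n : ℕ) (Z : D) : S.Us n Z = S.Y.map ((S.T n).map (S.cu Z)) ≫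
    S.Y.map (S.actS (pm (lastToFirst n)) (S.Y.obj Z)) ≫ S.link n (S.Y.obj Z) := by
  induction n generalizing Z with
  | zero =>
    have : lastToFirst 0 = 1 := Subsingleton.elim (α := Equiv.Perm (Fin 1)) _ _
    rw [this, pm_one, actS_one, CategoryTheory.Functor.map_id, Category.id_comp]
    change 𝟙 _ = S.Y.map (S.cu Z) ≫ S.Y.map (𝟙 _) ≫ S.ln _
    rw [CategoryTheory.Functor.map_id, Category.id_comp]
    exact (S.cu_ln Z).symm
  | succ n ih =>
    have hc : S.Y.map (S.actS (pm (lastToFirst (n + 1))) (S.Y.obj Z)) =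
        S.Y.map ((S.T n).map (S.c (S.Y.obj Z))) ≫
          S.Y.map (S.actS (pm (lastToFirst n)) (S.X.obj (S.Y.obj Z))) :=
      (congrArg S.Y.map (S.actS_cycle_succ (S.Y.obj Z))).trans (S.Y.map_comp _ _)
    change S.Us n (S.X.obj Z) ≫ (S.T n).map (S.us Z) =
      S.Y.map ((S.T n).map (S.X.map (S.cu Z))) ≫
        S.Y.map (S.actS (pm (lastToFirst (n + 1))) (S.Y.obj Z)) ≫ S.link n (S.X.obj (S.Y.obj Z))
    have key : (S.T n).map (S.cu (S.X.obj Z)) ≫ S.actS (pm (lastToFirst n)) (S.Y.obj (S.X.obj Z)) ≫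
        (S.T n).map (S.X.map (S.us Z)) = (S.T n).map (S.X.map (S.cu Z)) ≫
          (S.T n).map (S.c (S.Y.obj Z)) ≫ S.actS (pm (lastToFirst n)) (S.X.obj (S.Y.obj Z)) := by
      rw [← actS_naturality, ← Category.assoc, ← Functor.map_comp, cu_us, Functor.map_comp,
        Category.assoc]
    rw [ih, Category.assoc, Category.assoc, ← link_naturality]
    refine Eq.trans ?_ (congrArg (fun f ↦ S.Y.map ((S.T n).map (S.X.map (S.cu Z))) ≫ f ≫
      S.link n (S.X.obj (S.Y.obj Z))) hc).symm
    simp only [← Category.assoc, ← Functor.map_comp] at key ⊢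
    rw [key]

theorem Sw_eq (n : ℕ) (Z : D) : S.Sw n Z = S.colink n (S.Y.obj Z) ≫
    S.Y.map (S.actS (pm (lastToFirst n)⁻¹) (S.Y.obj Z)) ≫ S.Y.map ((S.T n).map (S.ca Z)) := by
  induction n generalizing Z with
  | zero =>
    have : (lastToFirst 0)⁻¹ = 1 := Subsingleton.elim (α := Equiv.Perm (Fin 1)) _ _
    rw [this, pm_one, actS_one, CategoryTheory.Functor.map_id, Category.id_comp]
    change 𝟙 _ = (S.cl _ ≫ S.Y.map (𝟙 _)) ≫ S.Y.map (S.ca Z)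
    rw [CategoryTheory.Functor.map_id, Category.comp_id]
    exact (S.cl_ca Z).symm
  | succ n ih =>
    have hc : S.Y.map (S.actS (pm (lastToFirst (n + 1))⁻¹) (S.Y.obj Z)) =
        S.Y.map (S.actS (pm (lastToFirst n)⁻¹) (S.X.obj (S.Y.obj Z))) ≫
          S.Y.map ((S.T n).map (S.c (S.Y.obj Z))) := by
      have h : (swapLast n)⁻¹ = swapLast n := inv_eq_of_mul_eq_one_left (swapLast_mul_self n)
      have h' : S.actS (pm (lastToFirst (n + 1))⁻¹) (S.Y.obj Z) =
          S.actS (pm (lastToFirst n)⁻¹) (S.X.obj (S.Y.obj Z)) ≫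
            (S.T n).map (S.c (S.Y.obj Z)) := by
        rw [lastToFirst_succ, mul_inv_rev, h, ← map_inv, pm_mul, ← embLast_pm, actS_mul,
          actS_swapLast, actS_embLast']
        rfl
      exact (congrArg S.Y.map h').trans (S.Y.map_comp _ _)
    change (S.T n).map (S.sw Z) ≫ S.Sw n (S.X.obj Z) = S.colink n (S.X.obj (S.Y.obj Z)) ≫
      S.Y.map (S.actS (pm (lastToFirst (n + 1))⁻¹) (S.Y.obj Z)) ≫
        S.Y.map ((S.T n).map (S.X.map (S.ca Z)))
    have key : (S.T n).map (S.X.map (S.sw Z)) ≫ S.actS (pm (lastToFirst n)⁻¹) (S.Y.obj (S.X.obj Z)) ≫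
        (S.T n).map (S.ca (S.X.obj Z)) = S.actS (pm (lastToFirst n)⁻¹) (S.X.obj (S.Y.obj Z)) ≫
          (S.T n).map (S.c (S.Y.obj Z)) ≫ (S.T n).map (S.X.map (S.ca Z)) := by
      rw [← Category.assoc, actS_naturality, Category.assoc, ← Functor.map_comp, sw_ca,
        Functor.map_comp]
    rw [ih, ← Category.assoc, colink_naturality, Category.assoc]
    refine Eq.trans ?_ (congrArg (fun f ↦ S.colink n (S.X.obj (S.Y.obj Z)) ≫ f ≫
      S.Y.map ((S.T n).map (S.X.map (S.ca Z)))) hc).symm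
    simp only [Category.assoc, ← Functor.map_comp] at key ⊢
    rw [key]

theorem link_act {n : ℕ} (a : SymAlg k n) (Z : D) : S.link n Z ≫ S.act n Z a =
    S.Y.map (S.actS (embFirst n a) Z) ≫ S.link n Z := by
  rw [link, Category.assoc, ← ln_naturality, ← Category.assoc, ← Category.assoc,
    ← Functor.map_comp, ← Functor.map_comp, actS_embFirst]

theorem cup_act {n : ℕ} (a : SymAlg k n) (Z : D) :
    (S.T n).map (S.cu Z) ≫ S.actS (embLast n a) (S.Y.obj Z) =
      S.act n Z a ≫ (S.T n).map (S.cu Z) := by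
  rw [actS_embLast]
  exact S.act_naturality a (S.cu Z)

theorem act_colink {n : ℕ} (a : SymAlg k n) (Z : D) : S.act n Z a ≫ S.colink n Z =
    S.colink n Z ≫ S.Y.map (S.actS (embFirst n a) Z) := by
  have h : S.X.map (S.act n Z a) ≫ (S.l n Z).inv = (S.l n Z).inv ≫ S.actS (embFirst n a) Z := by
    rw [Iso.comp_inv_eq, Category.assoc, actS_embFirst, Iso.inv_hom_id_assoc]
  rw [colink, ← Category.assoc, cl_naturality, Category.assoc, Category.assoc, ← Functor.map_comp,
    ← Functor.map_comp, h]

theorem act_cap {n : ℕ} (a : SymAlg k n) (Z : D) :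
    S.actS (embLast n a) (S.Y.obj Z) ≫ (S.T n).map (S.ca Z) =
      (S.T n).map (S.ca Z) ≫ S.act n Z a := by
  rw [actS_embLast]
  exact (S.act_naturality a (S.ca Z)).symm

theorem Us_comp_act {n : ℕ} (a : SymAlg k n) (Z : D) :
    S.Us n Z ≫ S.act n (S.Y.obj Z) a = S.Y.map (S.act n Z a) ≫ S.Us n Z := by
  rw [Us_eq, Category.assoc, Category.assoc, link_act]
  simp only [← Category.assoc, ← Functor.map_comp]
  rw [Category.assoc, ← actS_mul, embFirst_mul_lastToFirst, actS_mul, ← Category.assoc, cup_act]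

theorem lastToFirst_inv_mul_embFirst {n : ℕ} (a : SymAlg k n) :
    pm (lastToFirst n)⁻¹ * embFirst n a = embLast n a * pm (lastToFirst n)⁻¹ := by
  have h4 : (pm (lastToFirst n) * pm (lastToFirst n)⁻¹ : SymAlg k (n + 1)) = 1 := by
    rw [← pm_mul, mul_inv_cancel, pm_one]
  have h5 : (pm (lastToFirst n)⁻¹ * pm (lastToFirst n) : SymAlg k (n + 1)) = 1 := by
    rw [← pm_mul, inv_mul_cancel, pm_one]
  calc _ = pm (lastToFirst n)⁻¹ * (embFirst n a * pm (lastToFirst n)) * pm (lastToFirst n)⁻¹ := by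
        rw [mul_assoc, mul_assoc, h4, mul_one]
    _ = _ := by
        rw [embFirst_mul_lastToFirst, ← mul_assoc, h5, one_mul]

theorem Sw_comp_act {n : ℕ} (a : SymAlg k n) (Z : D) :
    S.Sw n Z ≫ S.Y.map (S.act n Z a) = S.act n (S.Y.obj Z) a ≫ S.Sw n Z := by
  rw [Sw_eq, ← Category.assoc (S.act n (S.Y.obj Z) a), act_colink]
  simp only [Category.assoc, ← Functor.map_comp]
  rw [← Category.assoc (S.actS (embFirst n a) _), ← actS_mul, lastToFirst_inv_mul_embFirst,
    actS_mul, Category.assoc, act_cap]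

theorem condExp_fixLast_swap_fixLast {n : ℕ} (σ τ : Equiv.Perm (Fin (n + 1))) :
    condExp (n + 1) (pm (fixLast (n + 1) σ * swapLast n * fixLast (n + 1) τ) :
      SymAlg k (n + 2)) = 0 := by
  rw [pm_mul, pm_mul, ← embLast_pm, ← embLast_pm, condExp_mul_embLast, condExp_embLast_mul,
    condExp_pm_of_ne, mul_zero, zero_mul]
  rw [swapLast_last]
  exact (Fin.castSucc_lt_last _).ne

/-- The partial trace of an element of the group algebra, in terms of diagrams. -/
theorem cup_act_link_Sw {n : ℕ} (a : SymAlg k (n + 1)) (Z : D) :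
    S.Y.map ((S.T n).map (S.cu Z)) ≫ S.Y.map (S.actS (pm (lastToFirst n) * a) (S.Y.obj Z)) ≫
      S.link n (S.Y.obj Z) ≫ S.Sw n Z = S.Y.map (S.act n Z (condExp n a)) := by
  induction a using symAlg_induction with
  | zero =>
    rw [mul_zero, actS_zero, Functor.map_zero, zero_comp, comp_zero, map_zero, map_zero]
    exact (S.Y.map_zero _ _).symm
  | add a b ha hb =>
    rw [mul_add, actS_add, Functor.map_add, Preadditive.add_comp, Preadditive.comp_add, ha, hb,
      map_add, map_add]
    exact S.Y.map_add.symm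
  | smul r a ha =>
    rw [mul_smul_comm, actS_smul, Functor.map_smul, Linear.smul_comp, Linear.comp_smul, ha,
      map_smul, map_smul]
    exact (S.Y.map_smul _ _).symm
  | perm g =>
    by_cases hg : g (Fin.last _) = Fin.last _
    · obtain ⟨σ, rfl⟩ := exists_fixLast g hg
      have h := S.Us_eq n Z
      rw [condExp_pm_fixLast, ← embLast_pm, actS_mul, Functor.map_comp, Category.assoc,
        ← Category.assoc, ← Functor.map_comp, cup_act, Functor.map_comp, Category.assoc,
        ← Category.assoc (S.Y.map (S.actS _ _)), ← Category.assoc (S.Y.map ((S.T n).map _)),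
        ← h, Us_Sw, Category.comp_id]
    · cases n with
      | zero => exact absurd (Subsingleton.elim (α := Fin 1) _ _) hg
      | succ m =>
        obtain ⟨σ, τ, rfl⟩ := exists_fixLast_swap_fixLast g hg
        have h1 : (pm (lastToFirst (m + 1)) * pm (fixLast (m + 1) σ * swapLast m *
            fixLast (m + 1) τ) : SymAlg k (m + 2)) =
            embFirst (m + 1) (pm σ) * embLast (m + 1) (pm (lastToFirst m)) *
              embLast (m + 1) (pm τ) := by
          rw [pm_mul, pm_mul, ← embLast_pm σ, ← mul_assoc, ← mul_assoc, ← embFirst_mul_lastToFirst,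
            mul_assoc (embFirst (m + 1) (pm σ)), ← pm_mul, lastToFirst_succ, mul_assoc (fixLast _ _),
            swapLast_mul_self, mul_one, embLast_pm, embLast_pm]
        have h2 : S.Y.map ((S.T m).map (S.X.map (S.cu Z))) ≫
            S.Y.map (S.actS (pm (lastToFirst m)) (S.X.obj (S.Y.obj Z))) ≫
              S.link m (S.X.obj (S.Y.obj Z)) ≫ S.SwS m Z = 0 := by
          rw [← Category.assoc, ← Functor.map_comp, actS_naturality, Functor.map_comp,
            Category.assoc, ← Category.assoc (S.Y.map ((S.T m).map _)), link_naturality,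
            Category.assoc, cup_SwS, comp_zero, comp_zero]
        rw [condExp_fixLast_swap_fixLast, map_zero, h1, actS_mul, actS_mul, Functor.map_comp,
          Functor.map_comp, Category.assoc, Category.assoc, ← Category.assoc, ← Functor.map_comp,
          cup_act, Functor.map_comp, Category.assoc,
          ← Category.assoc (S.Y.map (S.actS (embFirst (m + 1) (pm σ)) _)), ← link_act,
          Category.assoc, ← Sw_comp_act, actS_embLast']
        refine Eq.trans ?_ (S.Y.map_zero _ _).symm
        have h3 {W : D} (g : S.Y.obj ((S.T m).obj (S.X.obj Z)) ⟶ W) :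
            S.Y.map ((S.T m).map (S.X.map (S.cu Z))) ≫
              S.Y.map (S.actS (pm (lastToFirst m)) (S.X.obj (S.Y.obj Z))) ≫
                S.link m (S.X.obj (S.Y.obj Z)) ≫ S.SwS m Z ≫ g = 0 := by
          have := congrArg (· ≫ g) h2
          simpa only [zero_comp, Category.assoc] using this
        exact (congrArg (fun f ↦ S.Y.map (S.act (m + 1) Z (pm τ)) ≫ f) (h3 _)).trans comp_zero

theorem Us_colink_act_cap {n : ℕ} (a : SymAlg k (n + 1)) (Z : D) :
    S.Us n Z ≫ S.colink n (S.Y.obj Z) ≫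
      S.Y.map (S.actS (a * pm (lastToFirst n)⁻¹) (S.Y.obj Z)) ≫ S.Y.map ((S.T n).map (S.ca Z)) =
        S.Y.map (S.act n Z (condExp n a)) := by
  induction a using symAlg_induction with
  | zero =>
    rw [zero_mul, actS_zero, Functor.map_zero, zero_comp, comp_zero, comp_zero, map_zero, map_zero]
    exact (S.Y.map_zero _ _).symm
  | add a b ha hb =>
    rw [add_mul, actS_add, Functor.map_add, Preadditive.add_comp, Preadditive.comp_add,
      Preadditive.comp_add, ha, hb, map_add, map_add]
    exact S.Y.map_add.symm
  | smul r a ha =>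
    rw [smul_mul_assoc, actS_smul, Functor.map_smul, Linear.smul_comp, Linear.comp_smul,
      Linear.comp_smul, ha, map_smul, map_smul]
    exact (S.Y.map_smul _ _).symm
  | perm g =>
    by_cases hg : g (Fin.last _) = Fin.last _
    · obtain ⟨σ, rfl⟩ := exists_fixLast g hg
      have h := S.Sw_eq n Z
      rw [condExp_pm_fixLast, ← embLast_pm, actS_mul, Functor.map_comp, Category.assoc,
        ← Functor.map_comp, act_cap, Functor.map_comp, ← Category.assoc (S.Y.map (S.actS _ _)),
        ← Category.assoc (S.colink _ _), ← h, ← Category.assoc, Us_Sw, Category.id_comp]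
    · cases n with
      | zero => exact absurd (Subsingleton.elim (α := Fin 1) _ _) hg
      | succ m =>
        obtain ⟨σ, τ, rfl⟩ := exists_fixLast_swap_fixLast g hg
        have h0 : (swapLast m)⁻¹ = swapLast m := inv_eq_of_mul_eq_one_left (swapLast_mul_self m)
        have h1 : (pm (fixLast (m + 1) σ * swapLast m * fixLast (m + 1) τ) *
            pm (lastToFirst (m + 1))⁻¹ : SymAlg k (m + 2)) =
            embLast (m + 1) (pm σ) * (embLast (m + 1) (pm (lastToFirst m)⁻¹) *
              embFirst (m + 1) (pm τ)) := by
          rw [pm_mul, pm_mul, ← embLast_pm τ, mul_assoc, ← lastToFirst_inv_mul_embFirst, mul_assoc,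
            ← mul_assoc (pm (swapLast m)), ← pm_mul, lastToFirst_succ, mul_inv_rev, h0,
            ← mul_assoc (swapLast m), swapLast_mul_self, one_mul, embLast_pm, embLast_pm, map_inv]
        have h2 : S.UsS m Z ≫ S.colink m (S.X.obj (S.Y.obj Z)) ≫
            S.Y.map (S.actS (pm (lastToFirst m)⁻¹) (S.X.obj (S.Y.obj Z))) ≫
              S.Y.map ((S.T m).map (S.X.map (S.ca Z))) = 0 := by
          rw [← Functor.map_comp, ← actS_naturality, Functor.map_comp,
            ← Category.assoc (S.colink m _), ← colink_naturality, Category.assoc,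
            ← Category.assoc (S.UsS m Z), UsS_cap, zero_comp]
        rw [condExp_fixLast_swap_fixLast, map_zero, h1, actS_mul, actS_mul, Functor.map_comp,
          Functor.map_comp, Category.assoc, Category.assoc, ← Functor.map_comp S.Y (S.actS _ _),
          act_cap, Functor.map_comp, ← Category.assoc (S.colink _ _), ← act_colink, Category.assoc,
          ← Category.assoc (S.Us _ _), Us_comp_act, actS_embLast', Category.assoc]
        refine Eq.trans ?_ (S.Y.map_zero _ _).symm
        have h3 {W : D} (g : S.Y.obj ((S.T m).obj (S.X.obj Z)) ⟶ W) :
            S.UsS m Z ≫ S.colink m (S.X.obj (S.Y.obj Z)) ≫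
              S.Y.map (S.actS (pm (lastToFirst m)⁻¹) (S.X.obj (S.Y.obj Z))) ≫
                S.Y.map ((S.T m).map (S.X.map (S.ca Z))) ≫ g = 0 := by
          have := congrArg (· ≫ g) h2
          simpa only [zero_comp, Category.assoc] using this
        exact (congrArg (fun f ↦ S.Y.map (S.act (m + 1) Z (pm τ)) ≫ f) (h3 _)).trans comp_zero

/-- The defect of the crossing factors through lower powers. -/
theorem one_sub_Sw_Us_mem (n : ℕ) (Z : D) : 𝟙 _ - S.SwS n Z ≫ S.UsS n Z ∈
    Submodule.span k {f | ∃ a b : SymAlg k (n + 1), f = S.actS a (S.Y.obj Z) ≫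
      (S.T n).map (S.ca Z) ≫ (S.T n).map (S.cu Z) ≫ S.actS b (S.Y.obj Z)} := by
  have hstep (n : ℕ) (Z : D) : 𝟙 _ - S.SwS n Z ≫ S.UsS n Z =
      (S.T n).map (S.ca Z) ≫ (S.T n).map (S.cu Z) + (S.T n).map (S.sw Z) ≫
        (𝟙 _ - S.Sw n (S.X.obj Z) ≫ S.Us n (S.X.obj Z)) ≫ (S.T n).map (S.us Z) := by
    have h := congrArg (S.T n).map (S.sw_us Z)
    rw [Functor.map_sub, CategoryTheory.Functor.map_id, Functor.map_comp, Functor.map_comp] at h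
    rw [Preadditive.sub_comp, Preadditive.comp_sub, Category.id_comp, h, SwS, UsS]
    simp only [Category.assoc]
    abel
  induction n generalizing Z with
  | zero =>
    have h : S.Sw 0 (S.X.obj Z) ≫ S.Us 0 (S.X.obj Z) = 𝟙 _ := Category.id_comp _
    rw [hstep, h, sub_self, zero_comp, comp_zero, add_zero]
    refine Submodule.subset_span ⟨1, 1, ?_⟩
    rw [actS_one, Category.id_comp, Category.comp_id]
  | succ n ih =>
    rw [hstep]
    refine Submodule.add_mem _ (Submodule.subset_span ⟨1, 1, ?_⟩) ?_
    · rw [actS_one, Category.id_comp, Category.comp_id]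
    · have key (f) (hf : f ∈ Submodule.span k {f | ∃ a b : SymAlg k (n + 1), f =
          S.actS a (S.Y.obj (S.X.obj Z)) ≫ (S.T n).map (S.ca (S.X.obj Z)) ≫
            (S.T n).map (S.cu (S.X.obj Z)) ≫ S.actS b (S.Y.obj (S.X.obj Z))}) :
          (S.T n).map (S.X.map (S.sw Z)) ≫ f ≫ (S.T n).map (S.X.map (S.us Z)) ∈
            Submodule.span k {f | ∃ a b : SymAlg k (n + 2), f = S.actS a (S.Y.obj Z) ≫
              (S.T n).map (S.X.map (S.ca Z)) ≫ (S.T n).map (S.X.map (S.cu Z)) ≫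
                S.actS b (S.Y.obj Z)} := ?_
      · exact key _ (ih (S.X.obj Z))
      induction hf using Submodule.span_induction with
      | zero =>
        rw [zero_comp, comp_zero]
        exact Submodule.zero_mem _
      | add f g _ _ hf hg =>
        rw [Preadditive.add_comp, Preadditive.comp_add]
        exact Submodule.add_mem _ hf hg
      | smul r f _ hf =>
        rw [Linear.smul_comp, Linear.comp_smul]
        exact Submodule.smul_mem _ _ hf
      | mem f hf =>
        obtain ⟨a, b, rfl⟩ := hf
        refine Submodule.subset_span
          ⟨pm (swapLast n) * embLast (n + 1) a, embLast (n + 1) b * pm (swapLast n), ?_⟩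
        rw [actS_mul, actS_mul, actS_swapLast, actS_embLast', actS_embLast']
        have h1 : (S.T n).map (S.X.map (S.sw Z)) ≫ (S.T n).map (S.ca (S.X.obj Z)) =
            (S.T n).map (S.c (S.Y.obj Z)) ≫ (S.T n).map (S.X.map (S.ca Z)) := by
          rw [← Functor.map_comp, sw_ca, Functor.map_comp]
        have h2 : (S.T n).map (S.cu (S.X.obj Z)) ≫ (S.T n).map (S.X.map (S.us Z)) =
            (S.T n).map (S.X.map (S.cu Z)) ≫ (S.T n).map (S.c (S.Y.obj Z)) := by
          rw [← Functor.map_comp, cu_us, Functor.map_comp]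
        change (S.T n).map (S.X.map (S.sw Z)) ≫ (S.actS a (S.Y.obj (S.X.obj Z)) ≫
            (S.T n).map (S.ca (S.X.obj Z)) ≫ (S.T n).map (S.cu (S.X.obj Z)) ≫
            S.actS b (S.Y.obj (S.X.obj Z))) ≫ (S.T n).map (S.X.map (S.us Z)) =
          (S.actS a (S.X.obj (S.Y.obj Z)) ≫ (S.T n).map (S.c (S.Y.obj Z))) ≫
            (S.T n).map (S.X.map (S.ca Z)) ≫ (S.T n).map (S.X.map (S.cu Z)) ≫
            (S.T n).map (S.c (S.Y.obj Z)) ≫ S.actS b (S.X.obj (S.Y.obj Z))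
        simp only [Category.assoc]
        rw [← actS_naturality, ← Category.assoc, actS_naturality, Category.assoc,
          ← Category.assoc ((S.T n).map (S.X.map (S.sw Z))), h1,
          ← Category.assoc ((S.T n).map (S.cu (S.X.obj Z))), h2]
        simp only [Category.assoc]

end HeisAction

end Action

end Heis

namespace Heis

open YoungDiagram YoungDiagram.OfSize CoxeterRelations

universe v₁ u₁

namespace HeisAction

variable {k : Type u} [Field k] {D : Type u₁} [Category.{v₁} D] [Preadditive D] [Linear k D]

/-- The images of the Young idempotents, as direct summands of powers. -/
structure YoungSplitting (S : HeisAction k D) where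
  /-- the direct summand -/
  E {n : ℕ} (μ : OfSize n) (Z : D) : D
  /-- the inclusion -/
  inc {n : ℕ} (μ : OfSize n) (Z : D) : E μ Z ⟶ (S.T n).obj Z
  /-- the projection -/
  prj {n : ℕ} (μ : OfSize n) (Z : D) : (S.T n).obj Z ⟶ E μ Z
  inc_prj {n : ℕ} (μ : OfSize n) (Z : D) : inc μ Z ≫ prj μ Z = 𝟙 _
  prj_inc {n : ℕ} (μ : OfSize n) (Z : D) :
    prj μ Z ≫ inc μ Z = S.act n Z (μ.youngIdempotent k)

namespace YoungSplitting

variable {S : HeisAction k D} (Y : YoungSplitting S) {n : ℕ} (μ μ' : OfSize n) (ν : OfSize (n + 1))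
  (Z : D)

/-- The inclusion of a direct summand of a power of positive degree. -/
def incS : Y.E ν Z ⟶ (S.T n).obj (S.X.obj Z) := Y.inc ν Z

/-- The projection to a direct summand of a power of positive degree. -/
def prjS : (S.T n).obj (S.X.obj Z) ⟶ Y.E ν Z := Y.prj ν Z

theorem incS_prjS : Y.incS ν Z ≫ Y.prjS ν Z = 𝟙 _ := Y.inc_prj ν Z

theorem prjS_incS : Y.prjS ν Z ≫ Y.incS ν Z = S.actS (ν.youngIdempotent k) Z := Y.prj_inc ν Z

theorem inc_act : Y.inc μ Z ≫ S.act n Z (μ.youngIdempotent k) = Y.inc μ Z := by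
  rw [← prj_inc, ← Category.assoc, inc_prj, Category.id_comp]

theorem act_prj : S.act n Z (μ.youngIdempotent k) ≫ Y.prj μ Z = Y.prj μ Z := by
  rw [← prj_inc, Category.assoc, inc_prj, Category.comp_id]

theorem incS_actS : Y.incS ν Z ≫ S.actS (ν.youngIdempotent k) Z = Y.incS ν Z := Y.inc_act ν Z

theorem actS_prjS : S.actS (ν.youngIdempotent k) Z ≫ Y.prjS ν Z = Y.prjS ν Z := Y.act_prj ν Z

/-- The crossing of a strand with a summand. -/
def us : S.Y.obj (Y.E μ Z) ⟶ Y.E μ (S.Y.obj Z) :=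
  S.Y.map (Y.inc μ Z) ≫ S.Us n Z ≫ Y.prj μ (S.Y.obj Z)

/-- The crossing of a summand with a strand. -/
def sw : Y.E μ (S.Y.obj Z) ⟶ S.Y.obj (Y.E μ Z) :=
  Y.inc μ (S.Y.obj Z) ≫ S.Sw n Z ≫ S.Y.map (Y.prj μ Z)

/-- Adding a box with a cup. -/
noncomputable def addCup : Y.E μ Z ⟶ Y.E ν (S.Y.obj Z) :=
  Y.inc μ Z ≫ (S.T n).map (S.cu Z) ≫ S.actS (branchOut k μ ν) (S.Y.obj Z) ≫ Y.prjS ν (S.Y.obj Z)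

/-- Removing a box with a cap. -/
noncomputable def removeCap : Y.E ν (S.Y.obj Z) ⟶ Y.E μ Z :=
  Y.incS ν (S.Y.obj Z) ≫ S.actS (branchIn k μ ν) (S.Y.obj Z) ≫ (S.T n).map (S.ca Z) ≫ Y.prj μ Z

/-- Removing a box on the outside. -/
noncomputable def link : S.Y.obj (Y.E ν Z) ⟶ Y.E μ Z :=
  S.Y.map (Y.incS ν Z) ≫ S.Y.map (S.actS (pm (lastToFirst n) * branchIn k μ ν) Z) ≫ S.link n Z ≫
    Y.prj μ Z

/-- Adding a box on the outside. -/
noncomputable def colink : Y.E μ Z ⟶ S.Y.obj (Y.E ν Z) :=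
  Y.inc μ Z ≫ S.colink n Z ≫ S.Y.map (S.actS (branchOut k μ ν * pm (lastToFirst n)⁻¹) Z) ≫
    S.Y.map (Y.prjS ν Z)

theorem us_sw : Y.us μ Z ≫ Y.sw μ Z = 𝟙 _ := by
  rw [us, sw, Category.assoc, Category.assoc, ← Category.assoc (Y.prj _ _), prj_inc,
    ← Category.assoc (S.act _ _ _), ← Sw_comp_act, Category.assoc, ← Functor.map_comp, act_prj,
    ← Category.assoc (S.Us n Z), Us_Sw, Category.id_comp, ← Functor.map_comp, inc_prj,
    CategoryTheory.Functor.map_id]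

theorem prjS_sw : Y.prjS ν (S.Y.obj Z) ≫ Y.sw ν Z = S.SwS n Z ≫ S.Y.map (Y.prjS ν Z) := by
  have h1 : S.actS (ν.youngIdempotent k) (S.Y.obj Z) ≫ S.SwS n Z =
      S.SwS n Z ≫ S.Y.map (S.actS (ν.youngIdempotent k) Z) :=
    (S.Sw_comp_act (ν.youngIdempotent k) Z).symm
  have h2 : Y.sw ν Z = Y.incS ν (S.Y.obj Z) ≫ S.SwS n Z ≫ S.Y.map (Y.prjS ν Z) := rfl
  rw [h2, ← Category.assoc, prjS_incS, ← Category.assoc, h1, Category.assoc, ← Functor.map_comp,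
    actS_prjS]

theorem us_incS : Y.us ν Z ≫ Y.incS ν (S.Y.obj Z) = S.Y.map (Y.incS ν Z) ≫ S.UsS n Z := by
  have h1 : S.UsS n Z ≫ S.actS (ν.youngIdempotent k) (S.Y.obj Z) =
      S.Y.map (S.actS (ν.youngIdempotent k) Z) ≫ S.UsS n Z :=
    S.Us_comp_act (ν.youngIdempotent k) Z
  have h2 : Y.us ν Z = S.Y.map (Y.incS ν Z) ≫ S.UsS n Z ≫ Y.prjS ν (S.Y.obj Z) := rfl
  rw [h2, Category.assoc, Category.assoc, prjS_incS, h1, ← Category.assoc, ← Functor.map_comp,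
    incS_actS]

theorem addCup_sw : Y.addCup μ ν Z ≫ Y.sw ν Z = 0 := by
  have h1 : S.actS (branchOut k μ ν) (S.Y.obj Z) ≫ S.SwS n Z =
      S.SwS n Z ≫ S.Y.map (S.actS (branchOut k μ ν) Z) :=
    (S.Sw_comp_act (branchOut k μ ν) Z).symm
  rw [addCup, Category.assoc, Category.assoc, Category.assoc, prjS_sw,
    ← Category.assoc (S.actS _ _), h1, Category.assoc, ← Category.assoc ((S.T n).map _), cup_SwS,
    zero_comp, comp_zero]

theorem us_removeCap : Y.us ν Z ≫ Y.removeCap μ ν Z = 0 := by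
  have h1 : S.UsS n Z ≫ S.actS (branchIn k μ ν) (S.Y.obj Z) =
      S.Y.map (S.actS (branchIn k μ ν) Z) ≫ S.UsS n Z :=
    S.Us_comp_act (branchIn k μ ν) Z
  rw [removeCap, ← Category.assoc, us_incS, Category.assoc, ← Category.assoc (S.UsS n Z), h1,
    Category.assoc, ← Category.assoc (S.UsS n Z), UsS_cap, zero_comp, comp_zero, comp_zero]

theorem addCup_link_sw_aux [CharZero k] :
    S.Y.map (Y.addCup μ ν Z) ≫ Y.link μ' ν (S.Y.obj Z) ≫ Y.sw μ' Z = S.Y.map (Y.inc μ Z) ≫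
      S.Y.map (S.act n Z (condExp n (branchIn k μ' ν * branchOut k μ ν))) ≫
        S.Y.map (Y.prj μ' Z) := by
  have h1 : Y.prj μ' (S.Y.obj Z) ≫ Y.sw μ' Z = S.Sw n Z ≫ S.Y.map (Y.prj μ' Z) := by
    rw [sw, ← Category.assoc, prj_inc, ← Category.assoc, ← Sw_comp_act, Category.assoc,
      ← Functor.map_comp, act_prj]
  have h2 : S.actS (branchOut k μ ν) (S.Y.obj Z) ≫ S.actS (ν.youngIdempotent k) (S.Y.obj Z) ≫
      S.actS (pm (lastToFirst n) * branchIn k μ' ν) (S.Y.obj Z) =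
        S.actS (pm (lastToFirst n) * (branchIn k μ' ν * branchOut k μ ν)) (S.Y.obj Z) := by
    rw [← Category.assoc, ← actS_mul, mul_branchOut, ← actS_mul, mul_assoc]
  rw [addCup, link, Category.assoc, Category.assoc, Category.assoc, h1]
  have h3 := S.cup_act_link_Sw (branchIn k μ' ν * branchOut k μ ν) Z
  rw [← h2] at h3
  simp only [Functor.map_comp, Category.assoc] at h3 ⊢
  rw [← Functor.map_comp_assoc S.Y (Y.prjS ν _), prjS_incS, ← reassoc_of% h3]

theorem us_colink_removeCap_aux [CharZero k] :
    Y.us μ Z ≫ Y.colink μ ν (S.Y.obj Z) ≫ S.Y.map (Y.removeCap μ' ν Z) = S.Y.map (Y.inc μ Z) ≫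
      S.Y.map (S.act n Z (condExp n (branchIn k μ' ν * branchOut k μ ν))) ≫
        S.Y.map (Y.prj μ' Z) := by
  have h1 : Y.us μ Z ≫ Y.inc μ (S.Y.obj Z) = S.Y.map (Y.inc μ Z) ≫ S.Us n Z := by
    rw [us, Category.assoc, Category.assoc, prj_inc, Us_comp_act, ← Category.assoc,
      ← Functor.map_comp, inc_act]
  have h2 : S.actS (branchOut k μ ν * pm (lastToFirst n)⁻¹) (S.Y.obj Z) ≫
      S.actS (ν.youngIdempotent k) (S.Y.obj Z) ≫ S.actS (branchIn k μ' ν) (S.Y.obj Z) =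
        S.actS (branchIn k μ' ν * branchOut k μ ν * pm (lastToFirst n)⁻¹) (S.Y.obj Z) := by
    rw [← actS_mul, branchIn_mul, ← actS_mul, mul_assoc]
  rw [colink, removeCap, Category.assoc, Category.assoc, Category.assoc, ← Category.assoc, h1]
  have h3 := S.Us_colink_act_cap (branchIn k μ' ν * branchOut k μ ν) Z
  rw [← h2] at h3
  simp only [Functor.map_comp, Category.assoc] at h3 ⊢
  rw [← Functor.map_comp_assoc S.Y (Y.prjS ν _), prjS_incS, ← reassoc_of% h3]

variable {μ μ' ν}

theorem inc_scalar_prj (r : k) : S.Y.map (Y.inc μ Z) ≫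
    S.Y.map (S.act n Z (r • μ.youngIdempotent k)) ≫ S.Y.map (Y.prj μ Z) = r • 𝟙 _ := by
  have h : (S.act n Z (r • μ.youngIdempotent k) : _ ⟶ _) = r • S.act n Z (μ.youngIdempotent k) :=
    map_smul (S.act n Z) _ _
  rw [h, Functor.map_smul, Linear.smul_comp, Linear.comp_smul, ← Functor.map_comp, act_prj,
    ← Functor.map_comp, inc_prj, CategoryTheory.Functor.map_id]

theorem addCup_link_sw [CharZero k] (h : μ.1 ≤ ν.1) :
    S.Y.map (Y.addCup μ ν Z) ≫ Y.link μ ν (S.Y.obj Z) ≫ Y.sw μ Z =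
      (μ.youngScalar k * (ν.youngScalar k)⁻¹) • 𝟙 _ := by
  rw [addCup_link_sw_aux, condExp_branchIn_mul_branchOut k h, inc_scalar_prj]

theorem us_colink_removeCap [CharZero k] (h : μ.1 ≤ ν.1) :
    Y.us μ Z ≫ Y.colink μ ν (S.Y.obj Z) ≫ S.Y.map (Y.removeCap μ ν Z) =
      (μ.youngScalar k * (ν.youngScalar k)⁻¹) • 𝟙 _ := by
  rw [us_colink_removeCap_aux, condExp_branchIn_mul_branchOut k h, inc_scalar_prj]

theorem addCup_link_sw_of_ne [CharZero k] (ν : OfSize (n + 1)) (h : μ ≠ μ') :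
    S.Y.map (Y.addCup μ ν Z) ≫ Y.link μ' ν (S.Y.obj Z) ≫ Y.sw μ' Z = 0 := by
  rw [addCup_link_sw_aux, condExp_branchIn_mul_branchOut_of_ne k ν h.symm, map_zero]
  exact (congrArg (fun f ↦ _ ≫ f ≫ _) (S.Y.map_zero _ _)).trans (by rw [zero_comp, comp_zero])

theorem us_colink_removeCap_of_ne [CharZero k] (ν : OfSize (n + 1)) (h : μ ≠ μ') :
    Y.us μ Z ≫ Y.colink μ ν (S.Y.obj Z) ≫ S.Y.map (Y.removeCap μ' ν Z) = 0 := by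
  rw [us_colink_removeCap_aux, condExp_branchIn_mul_branchOut_of_ne k ν h.symm, map_zero]
  exact (congrArg (fun f ↦ _ ≫ f ≫ _) (S.Y.map_zero _ _)).trans (by rw [zero_comp, comp_zero])

theorem sw_us_zero [CharZero k] (μ : OfSize 0) : Y.sw μ Z ≫ Y.us μ Z = 𝟙 _ := by
  have h1 : Y.prj μ Z ≫ Y.inc μ Z = 𝟙 _ := by
    rw [prj_inc, youngIdempotent_zero, act_one]
  have h2 : S.Sw 0 Z ≫ S.Us 0 Z = 𝟙 _ := Category.id_comp _
  rw [sw, us, Category.assoc, Category.assoc, ← Functor.map_comp_assoc, h1,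
    CategoryTheory.Functor.map_id, Category.id_comp, reassoc_of% h2, inc_prj]

theorem incS_actS_cap (a : SymAlg k (n + 1)) [CharZero k] (μ : OfSize n) (ν : OfSize (n + 1)) :
    ∃ c : k, (¬ μ.1 ≤ ν.1 → c = 0) ∧ Y.incS ν (S.Y.obj Z) ≫ S.actS a (S.Y.obj Z) ≫
      (S.T n).map (S.ca Z) ≫ S.act n Z (μ.youngIdempotent k) =
        c • Y.removeCap μ ν Z ≫ Y.inc μ Z := by
  obtain ⟨c, hc, hc0⟩ := (branching k n).emb_mul_mul (μ := μ) (ν := ν) a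
  refine ⟨c, hc0, ?_⟩
  have h1 : S.actS (branchIn k μ ν) (S.Y.obj Z) ≫ (S.T n).map (S.ca Z) ≫
      S.act n Z (μ.youngIdempotent k) =
        S.actS (branchIn k μ ν) (S.Y.obj Z) ≫ (S.T n).map (S.ca Z) := by
    rw [← act_cap, ← Category.assoc, ← actS_mul, emb_mul_branchIn]
  rw [← act_cap, ← incS_actS, Category.assoc, ← Category.assoc (S.actS a _), ← actS_mul,
    ← Category.assoc (S.actS (ν.youngIdempotent k) _), ← actS_mul, hc, actS_smul,
    Linear.smul_comp, Linear.comp_smul, removeCap, Category.assoc, Category.assoc, Category.assoc,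
    prj_inc, h1]

theorem act_cup_prjS (b : SymAlg k (n + 1)) [CharZero k] (μ : OfSize n) (ν : OfSize (n + 1)) :
    ∃ c : k, (¬ μ.1 ≤ ν.1 → c = 0) ∧ S.act n Z (μ.youngIdempotent k) ≫ (S.T n).map (S.cu Z) ≫
      S.actS b (S.Y.obj Z) ≫ Y.prjS ν (S.Y.obj Z) = c • Y.prj μ Z ≫ Y.addCup μ ν Z := by
  obtain ⟨c, hc, hc0⟩ := (branching k n).mul_mul_emb (μ := μ) (ν := ν) b
  refine ⟨c, hc0, ?_⟩
  have h1 : S.act n Z (μ.youngIdempotent k) ≫ (S.T n).map (S.cu Z) ≫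
      S.actS (branchOut k μ ν) (S.Y.obj Z) =
        (S.T n).map (S.cu Z) ≫ S.actS (branchOut k μ ν) (S.Y.obj Z) := by
    rw [← Category.assoc, ← cup_act, Category.assoc, ← actS_mul, branchOut_mul_emb]
  rw [← actS_prjS, ← Category.assoc (S.act _ _ _), ← cup_act, Category.assoc,
    ← Category.assoc (S.actS b _), ← actS_mul, ← Category.assoc (S.actS (embLast _ _) _),
    ← actS_mul, hc, actS_smul, Linear.smul_comp, Linear.comp_smul, addCup,
    ← Category.assoc (Y.prj μ Z), prj_inc, reassoc_of% h1]

open scoped Classical in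
/-- The defect of the crossing is a combination of maps through smaller partitions. -/
theorem exists_one_sub_sw_us [CharZero k] (ν : OfSize (n + 1)) : ∃ t : OfSize n → k,
    𝟙 _ - Y.sw ν Z ≫ Y.us ν Z =
      ∑ μ : OfSize n, if μ.1 ≤ ν.1 then t μ • Y.removeCap μ ν Z ≫ Y.addCup μ ν Z else 0 := by
  let W : Submodule k (Y.E ν (S.Y.obj Z) ⟶ Y.E ν (S.Y.obj Z)) := Submodule.span k (Set.range
    fun μ : OfSize n ↦ if μ.1 ≤ ν.1 then Y.removeCap μ ν Z ≫ Y.addCup μ ν Z else 0)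
  suffices h : 𝟙 _ - Y.sw ν Z ≫ Y.us ν Z ∈ W by
    obtain ⟨t, ht⟩ := (Submodule.mem_span_range_iff_exists_fun k).1 h
    refine ⟨t, ht.symm.trans (Finset.sum_congr rfl fun μ _ ↦ ?_)⟩
    split_ifs <;> simp
  have h1 : 𝟙 _ - Y.sw ν Z ≫ Y.us ν Z = Y.incS ν (S.Y.obj Z) ≫ (𝟙 _ - S.SwS n Z ≫ S.UsS n Z) ≫
      Y.prjS ν (S.Y.obj Z) := by
    have h2 : Y.us ν Z = S.Y.map (Y.incS ν Z) ≫ S.UsS n Z ≫ Y.prjS ν (S.Y.obj Z) := rfl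
    have h3 : Y.sw ν Z = Y.incS ν (S.Y.obj Z) ≫ S.SwS n Z ≫ S.Y.map (Y.prjS ν Z) := rfl
    have h4 : S.UsS n Z ≫ S.actS (ν.youngIdempotent k) (S.Y.obj Z) =
        S.Y.map (S.actS (ν.youngIdempotent k) Z) ≫ S.UsS n Z :=
      S.Us_comp_act (ν.youngIdempotent k) Z
    have h5 : S.UsS n Z ≫ Y.prjS ν (S.Y.obj Z) = S.Y.map (Y.prjS ν Z) ≫ Y.us ν Z := by
      rw [h2, ← Functor.map_comp_assoc, prjS_incS, ← reassoc_of% h4, actS_prjS]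
    rw [Preadditive.sub_comp, Preadditive.comp_sub, Category.id_comp, incS_prjS, Category.assoc,
      h5, h3]
    simp only [Category.assoc]
  have key (f) (hf : f ∈ Submodule.span k {f | ∃ a b : SymAlg k (n + 1), f =
      S.actS a (S.Y.obj Z) ≫ (S.T n).map (S.ca Z) ≫ (S.T n).map (S.cu Z) ≫
        S.actS b (S.Y.obj Z)}) : Y.incS ν (S.Y.obj Z) ≫ f ≫ Y.prjS ν (S.Y.obj Z) ∈ W := by
    induction hf using Submodule.span_induction with
    | zero =>
      rw [zero_comp, comp_zero]
      exact Submodule.zero_mem _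
    | add f g _ _ hf hg =>
      rw [Preadditive.add_comp, Preadditive.comp_add]
      exact Submodule.add_mem _ hf hg
    | smul r f _ hf =>
      rw [Linear.smul_comp, Linear.comp_smul]
      exact Submodule.smul_mem _ _ hf
    | mem f hf =>
      obtain ⟨a, b, rfl⟩ := hf
      have hx (x : SymAlg k n) (hx : x ∈ Submodule.span k
          {x | ∃ (κ : OfSize n) (a b : SymAlg k n), x = a * κ.youngIdempotent k * b}) :
          Y.incS ν (S.Y.obj Z) ≫ S.actS a (S.Y.obj Z) ≫ (S.T n).map (S.ca Z) ≫ S.act n Z x ≫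
            (S.T n).map (S.cu Z) ≫ S.actS b (S.Y.obj Z) ≫ Y.prjS ν (S.Y.obj Z) ∈ W := by
        induction hx using Submodule.span_induction with
        | zero =>
          rw [map_zero]
          simp only [zero_comp, comp_zero]
          exact Submodule.zero_mem _
        | add x y _ _ hx hy =>
          obtain ⟨f, hf⟩ : ∃ f : (S.T n).obj Z ⟶ (S.T n).obj Z, f = S.act n Z x := ⟨_, rfl⟩
          obtain ⟨g, hg⟩ : ∃ g : (S.T n).obj Z ⟶ (S.T n).obj Z, g = S.act n Z y := ⟨_, rfl⟩
          have : S.act n Z (x + y) = f + g := by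
            rw [hf, hg]
            exact map_add _ _ _
          rw [← hf] at hx
          rw [← hg] at hy
          rw [this]
          simp only [Preadditive.add_comp, Preadditive.comp_add]
          exact Submodule.add_mem _ hx hy
        | smul r x _ hx =>
          obtain ⟨f, hf⟩ : ∃ f : (S.T n).obj Z ⟶ (S.T n).obj Z, f = S.act n Z x := ⟨_, rfl⟩
          have : S.act n Z (r • x) = r • f := by
            rw [hf]
            exact map_smul (S.act n Z) _ _
          rw [← hf] at hx
          rw [this]
          simp only [Linear.smul_comp, Linear.comp_smul]
          exact Submodule.smul_mem _ _ hx
        | mem x hx =>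
          obtain ⟨κ, p, q, rfl⟩ := hx
          obtain ⟨c, hc0, hc⟩ := Y.incS_actS_cap Z (embLast n q * a) κ ν
          obtain ⟨d, -, hd⟩ := Y.act_cup_prjS Z (b * embLast n p) κ ν
          have h2 : Y.incS ν (S.Y.obj Z) ≫ S.actS a (S.Y.obj Z) ≫ (S.T n).map (S.ca Z) ≫
              S.act n Z (p * κ.youngIdempotent k * q) ≫ (S.T n).map (S.cu Z) ≫
                S.actS b (S.Y.obj Z) ≫ Y.prjS ν (S.Y.obj Z) =
              (Y.incS ν (S.Y.obj Z) ≫ S.actS (embLast n q * a) (S.Y.obj Z) ≫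
                (S.T n).map (S.ca Z) ≫ S.act n Z (κ.youngIdempotent k)) ≫
              (S.act n Z (κ.youngIdempotent k) ≫ (S.T n).map (S.cu Z) ≫
                S.actS (b * embLast n p) (S.Y.obj Z) ≫ Y.prjS ν (S.Y.obj Z)) := by
            have h3 : p * κ.youngIdempotent k * q =
                p * (κ.youngIdempotent k * (κ.youngIdempotent k * q)) := by
              rw [← mul_assoc (κ.youngIdempotent k), youngIdempotent_mul_self, mul_assoc]
            rw [h3, act_mul, act_mul, act_mul, actS_mul, actS_mul]
            simp only [Category.assoc]
            rw [reassoc_of% (S.act_cap q Z), reassoc_of% (S.cup_act p Z)]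
          rw [h2, hc, hd]
          simp only [Linear.smul_comp, Linear.comp_smul, Category.assoc]
          rw [reassoc_of% (Y.inc_prj κ Z)]
          by_cases h : κ.1 ≤ ν.1
          · exact Submodule.smul_mem _ _ (Submodule.smul_mem _ _
              (Submodule.subset_span ⟨κ, if_pos h⟩))
          · rw [hc0 h, zero_smul, smul_zero]
            exact Submodule.zero_mem _
      have h2 := hx 1 (isGenerated k n)
      rw [act_one, Category.id_comp] at h2
      simpa only [Category.assoc] using h2
  rw [h1]
  exact key _ (S.one_sub_Sw_Us_mem n Z)

end YoungSplitting

end HeisAction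

end Heis

namespace Heis

open YoungDiagram YoungDiagram.OfSize

universe v₁ u₁

namespace HeisAction

variable {k : Type u} [Field k] {D : Type u₁} [Category.{v₁} D] [Preadditive D] [Linear k D]

/-- Functors indexed by partitions that absorb the strand `Y` according to the branching rule. -/
structure OuterFunctors (S : HeisAction k D) where
  /-- the partition of the summand to which a functor is applied -/
  t {n : ℕ} : OfSize n ≃ OfSize n
  t_le {n : ℕ} (μ : OfSize n) (ν : OfSize (n + 1)) : (t μ).1 ≤ (t ν).1 ↔ μ.1 ≤ ν.1
  /-- the functor -/
  L {n : ℕ} (μ : OfSize n) : D ⥤ D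
  [additiveL {n : ℕ} (μ : OfSize n) : (L μ).Additive]
  [linearL {n : ℕ} (μ : OfSize n) : (L μ).Linear k]
  /-- splitting off a strand -/
  io {n : ℕ} (μ : OfSize n) (ν : OfSize (n + 1)) (Z : D) : (L ν).obj Z ⟶ (L μ).obj (S.Y.obj Z)
  /-- absorbing a strand -/
  ro {n : ℕ} (μ : OfSize n) (ν : OfSize (n + 1)) (Z : D) : (L μ).obj (S.Y.obj Z) ⟶ (L ν).obj Z
  io_naturality {n : ℕ} (μ : OfSize n) (ν : OfSize (n + 1)) {Z W : D} (f : Z ⟶ W) :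
    (L ν).map f ≫ io μ ν W = io μ ν Z ≫ (L μ).map (S.Y.map f)
  ro_naturality {n : ℕ} (μ : OfSize n) (ν : OfSize (n + 1)) {Z W : D} (f : Z ⟶ W) :
    (L μ).map (S.Y.map f) ≫ ro μ ν W = ro μ ν Z ≫ (L ν).map f
  io_ro {n : ℕ} {μ : OfSize n} {ν : OfSize (n + 1)} (h : μ.1 ≤ ν.1) (Z : D) :
    io μ ν Z ≫ ro μ ν Z = 𝟙 _
  io_ro_of_ne {n : ℕ} (μ : OfSize n) {ν ν' : OfSize (n + 1)} (h : ν ≠ ν') (Z : D) :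
    io μ ν Z ≫ ro μ ν' Z = 0
  sum_ro_io {n : ℕ} (μ : OfSize n) (Z : D) :
    open scoped Classical in
    ∑ ν : OfSize (n + 1), (if μ.1 ≤ ν.1 then ro μ ν Z ≫ io μ ν Z else 0) = 𝟙 _

attribute [instance] OuterFunctors.additiveL OuterFunctors.linearL

variable {S : HeisAction k D} (Y : S.YoungSplitting) (O : S.OuterFunctors) {n : ℕ}
  (μ μ' : OfSize n) (ν ν' : OfSize (n + 1)) (Z : D)

/-- The terms of the complexes. -/
abbrev term {n : ℕ} (μ : OfSize n) : D := (O.L μ).obj (Y.E (O.t μ) (S.Y.obj Z))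

/-- The idempotent of a term given by the strand that passes through. -/
def pass {n : ℕ} (μ : OfSize n) : term Y O Z μ ⟶ term Y O Z μ :=
  (O.L μ).map (Y.sw (O.t μ) Z ≫ Y.us (O.t μ) Z)

/-- The lowering component of the differential. -/
noncomputable def down : term Y O Z ν ⟶ term Y O Z μ :=
  O.io μ ν _ ≫ (O.L μ).map (Y.link (O.t μ) (O.t ν) (S.Y.obj Z))

/-- The component of the homotopy for the lowering differential. -/
noncomputable def hup : term Y O Z μ ⟶ term Y O Z ν :=
  (O.L μ).map (Y.sw (O.t μ) Z) ≫ O.ro μ ν _ ≫ (O.L ν).map (Y.addCup (O.t μ) (O.t ν) Z)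

/-- The raising component of the differential. -/
noncomputable def raising : term Y O Z μ ⟶ term Y O Z ν :=
  (O.L μ).map (Y.colink (O.t μ) (O.t ν) (S.Y.obj Z)) ≫ O.ro μ ν _

/-- The component of the homotopy for the raising differential. -/
noncomputable def hdown : term Y O Z ν ⟶ term Y O Z μ :=
  (O.L ν).map (Y.removeCap (O.t μ) (O.t ν) Z) ≫ O.io μ ν _ ≫ (O.L μ).map (Y.us (O.t μ) Z)

theorem pass_hup : pass Y O Z μ ≫ hup Y O μ ν Z = hup Y O μ ν Z := by
  rw [pass, hup, ← Functor.map_comp_assoc, Category.assoc, YoungSplitting.us_sw, Category.comp_id]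

theorem hup_pass : hup Y O μ ν Z ≫ pass Y O Z ν = 0 := by
  rw [pass, hup, Category.assoc, Category.assoc, ← Functor.map_comp,
    ← Category.assoc (Y.addCup (O.t μ) (O.t ν) Z), YoungSplitting.addCup_sw, zero_comp, Functor.map_zero,
    comp_zero, comp_zero]

theorem hdown_pass : hdown Y O μ ν Z ≫ pass Y O Z μ = hdown Y O μ ν Z := by
  rw [pass, hdown, Category.assoc, Category.assoc, ← Functor.map_comp,
    ← Category.assoc (Y.us (O.t μ) Z), YoungSplitting.us_sw, Category.id_comp]

theorem pass_hdown : pass Y O Z ν ≫ hdown Y O μ ν Z = 0 := by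
  rw [pass, hdown, ← Functor.map_comp_assoc, Category.assoc, YoungSplitting.us_removeCap,
    comp_zero, Functor.map_zero, zero_comp]

variable [CharZero k]

theorem pass_zero (μ : OfSize 0) : pass Y O Z μ = 𝟙 _ := by
  rw [pass, YoungSplitting.sw_us_zero, CategoryTheory.Functor.map_id]

/-- The scalar that normalizes the homotopy. -/
noncomputable def OuterFunctors.scal (O : S.OuterFunctors) {n : ℕ} (μ : OfSize n)
    (ν : OfSize (n + 1)) : k :=
  (O.t μ).youngScalar k * ((O.t ν).youngScalar k)⁻¹

theorem scal_ne_zero (μ : OfSize n) (ν : OfSize (n + 1)) : O.scal μ ν ≠ 0 :=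
  mul_ne_zero ((O.t μ).youngScalar_ne_zero k) (inv_ne_zero ((O.t ν).youngScalar_ne_zero k))

variable {μ ν}

theorem hup_down_pass (h : μ.1 ≤ ν.1) :
    hup Y O μ ν Z ≫ down Y O μ ν Z ≫ pass Y O Z μ =
      O.scal μ ν • (O.L μ).map (Y.sw (O.t μ) Z) ≫ (O.ro μ ν _ ≫ O.io μ ν _) ≫ (O.L μ).map (Y.us (O.t μ) Z) := by
  have h1 := Y.addCup_link_sw Z ((O.t_le _ _).2 h)
  rw [hup, down, pass]
  simp only [Category.assoc]
  rw [reassoc_of% (O.io_naturality μ ν (Y.addCup (O.t μ) (O.t ν) Z)), ← Functor.map_comp, ← Functor.map_comp,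
    reassoc_of% h1, Linear.smul_comp, Functor.map_smul, Linear.comp_smul, Linear.comp_smul,
    Linear.comp_smul, Category.id_comp, OuterFunctors.scal]

theorem hup_down_pass_of_ne (ν : OfSize (n + 1)) (h : μ ≠ μ') :
    hup Y O μ ν Z ≫ down Y O μ' ν Z ≫ pass Y O Z μ' = 0 := by
  have h1 := Y.addCup_link_sw_of_ne Z (O.t ν) (O.t.injective.ne h)
  rw [hup, down, pass]
  simp only [Category.assoc]
  rw [reassoc_of% (O.io_naturality μ' ν (Y.addCup (O.t μ) (O.t ν) Z)), ← Functor.map_comp, ← Functor.map_comp,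
    reassoc_of% h1, zero_comp, Functor.map_zero, comp_zero, comp_zero, comp_zero]

theorem pass_raising_hdown (h : μ.1 ≤ ν.1) :
    pass Y O Z μ ≫ raising Y O μ ν Z ≫ hdown Y O μ ν Z =
      O.scal μ ν • (O.L μ).map (Y.sw (O.t μ) Z) ≫ (O.ro μ ν _ ≫ O.io μ ν _) ≫ (O.L μ).map (Y.us (O.t μ) Z) := by
  have h1 := Y.us_colink_removeCap Z ((O.t_le _ _).2 h)
  rw [hdown, raising, pass]
  simp only [Category.assoc]
  rw [← reassoc_of% (O.ro_naturality μ ν (Y.removeCap (O.t μ) (O.t ν) Z)), ← Functor.map_comp_assoc,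
    ← Functor.map_comp_assoc, Category.assoc, Category.assoc, h1, Linear.comp_smul,
    Functor.map_smul, Linear.smul_comp, Category.comp_id, OuterFunctors.scal]

theorem pass_raising_hdown_of_ne (ν : OfSize (n + 1)) (h : μ ≠ μ') :
    pass Y O Z μ ≫ raising Y O μ ν Z ≫ hdown Y O μ' ν Z = 0 := by
  have h1 := Y.us_colink_removeCap_of_ne Z (O.t ν) (O.t.injective.ne h)
  rw [hdown, raising, pass]
  simp only [Category.assoc]
  rw [← reassoc_of% (O.ro_naturality μ ν (Y.removeCap (O.t μ') (O.t ν) Z)), ← Functor.map_comp_assoc,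
    ← Functor.map_comp_assoc, Category.assoc, Category.assoc, h1, comp_zero,
    Functor.map_zero, zero_comp]

theorem removeCap_addCup_down_hup (κ : OfSize n) (h : κ.1 ≤ ν.1) :
    (O.L ν).map (Y.removeCap (O.t κ) (O.t ν) Z ≫ Y.addCup (O.t κ) (O.t ν) Z) ≫ down Y O κ ν Z ≫ hup Y O κ ν' Z =
      O.scal κ ν • (O.L ν).map (Y.removeCap (O.t κ) (O.t ν) Z) ≫ (O.io κ ν _ ≫ O.ro κ ν' _) ≫
        (O.L ν').map (Y.addCup (O.t κ) (O.t ν') Z) := by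
  have h1 := Y.addCup_link_sw Z ((O.t_le _ _).2 h)
  rw [hup, down, Functor.map_comp]
  simp only [Category.assoc]
  rw [reassoc_of% (O.io_naturality κ ν (Y.addCup (O.t κ) (O.t ν) Z)), ← Functor.map_comp_assoc,
    ← Functor.map_comp_assoc, Category.assoc, h1, Functor.map_smul, Linear.smul_comp, Linear.comp_smul,
    Linear.comp_smul, CategoryTheory.Functor.map_id, Category.id_comp, OuterFunctors.scal]

theorem removeCap_addCup_down_hup_of_ne (κ : OfSize n) (h : κ ≠ μ) :
    (O.L ν).map (Y.removeCap (O.t κ) (O.t ν) Z ≫ Y.addCup (O.t κ) (O.t ν) Z) ≫ down Y O μ ν Z ≫ hup Y O μ ν' Z = 0 := by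
  have h1 := Y.addCup_link_sw_of_ne Z (O.t ν) (O.t.injective.ne h)
  rw [hup, down, Functor.map_comp]
  simp only [Category.assoc]
  rw [reassoc_of% (O.io_naturality μ ν (Y.addCup (O.t κ) (O.t ν) Z)), ← Functor.map_comp_assoc,
    ← Functor.map_comp_assoc, Category.assoc, h1, Functor.map_zero, zero_comp, comp_zero, comp_zero]

theorem hdown_raising_removeCap_addCup (κ : OfSize n) (h : κ.1 ≤ ν'.1) :
    hdown Y O κ ν Z ≫ raising Y O κ ν' Z ≫ (O.L ν').map (Y.removeCap (O.t κ) (O.t ν') Z ≫ Y.addCup (O.t κ) (O.t ν') Z) =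
      O.scal κ ν' • (O.L ν).map (Y.removeCap (O.t κ) (O.t ν) Z) ≫ (O.io κ ν _ ≫ O.ro κ ν' _) ≫
        (O.L ν').map (Y.addCup (O.t κ) (O.t ν') Z) := by
  have h1 := Y.us_colink_removeCap Z ((O.t_le _ _).2 h)
  rw [hdown, raising, Functor.map_comp]
  simp only [Category.assoc]
  rw [← reassoc_of% (O.ro_naturality κ ν' (Y.removeCap (O.t κ) (O.t ν') Z)), ← Functor.map_comp_assoc,
    ← Functor.map_comp_assoc, Category.assoc, h1, Functor.map_smul, Linear.smul_comp,
    Linear.comp_smul, Linear.comp_smul, CategoryTheory.Functor.map_id, Category.id_comp, OuterFunctors.scal]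

theorem hdown_raising_removeCap_addCup_of_ne (κ : OfSize n) (h : μ ≠ κ) :
    hdown Y O μ ν Z ≫ raising Y O μ ν' Z ≫
      (O.L ν').map (Y.removeCap (O.t κ) (O.t ν') Z ≫ Y.addCup (O.t κ) (O.t ν') Z) = 0 := by
  have h1 := Y.us_colink_removeCap_of_ne Z (O.t ν') (O.t.injective.ne h)
  rw [hdown, raising, Functor.map_comp]
  simp only [Category.assoc]
  rw [← reassoc_of% (O.ro_naturality μ ν' (Y.removeCap (O.t κ) (O.t ν') Z)), ← Functor.map_comp_assoc,
    ← Functor.map_comp_assoc, Category.assoc, h1, Functor.map_zero, zero_comp, comp_zero, comp_zero]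

variable (ε : ∀ {n : ℕ}, OfSize n → OfSize (n + 1) → kˣ) (μ ν)

open scoped Classical in
/-- The matrix entries of the lowering differential. -/
noncomputable def downEntry : term Y O Z ν ⟶ term Y O Z μ :=
  if μ.1 ≤ ν.1 then (ε μ ν : k) • down Y O μ ν Z else 0

open scoped Classical in
/-- The matrix entries of the homotopy for the lowering differential. -/
noncomputable def hupEntry : term Y O Z μ ⟶ term Y O Z ν :=
  if μ.1 ≤ ν.1 then ((ε μ ν : k) * O.scal μ ν)⁻¹ • hup Y O μ ν Z else 0

open scoped Classical in
/-- The matrix entries of the raising differential. -/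
noncomputable def raisingEntry : term Y O Z μ ⟶ term Y O Z ν :=
  if μ.1 ≤ ν.1 then (ε μ ν : k) • raising Y O μ ν Z else 0

open scoped Classical in
/-- The matrix entries of the homotopy for the raising differential. -/
noncomputable def hdownEntry : term Y O Z ν ⟶ term Y O Z μ :=
  if μ.1 ≤ ν.1 then ((ε μ ν : k) * O.scal μ ν)⁻¹ • hdown Y O μ ν Z else 0

theorem pass_hupEntry : pass Y O Z μ ≫ hupEntry Y O μ ν Z ε = hupEntry Y O μ ν Z ε := by
  rw [hupEntry]
  split_ifs
  · rw [Linear.comp_smul, pass_hup]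
  · rw [comp_zero]

theorem hupEntry_pass : hupEntry Y O μ ν Z ε ≫ pass Y O Z ν = 0 := by
  rw [hupEntry]
  split_ifs
  · rw [Linear.smul_comp, hup_pass, smul_zero]
  · rw [zero_comp]

theorem hdownEntry_pass : hdownEntry Y O μ ν Z ε ≫ pass Y O Z μ = hdownEntry Y O μ ν Z ε := by
  rw [hdownEntry]
  split_ifs
  · rw [Linear.smul_comp, hdown_pass]
  · rw [zero_comp]

theorem pass_hdownEntry : pass Y O Z ν ≫ hdownEntry Y O μ ν Z ε = 0 := by
  rw [hdownEntry]
  split_ifs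
  · rw [Linear.comp_smul, pass_hdown, smul_zero]
  · rw [comp_zero]

theorem entry_coeff (μ : OfSize n) (ν : OfSize (n + 1)) :
    ((ε μ ν : k) * O.scal μ ν)⁻¹ * ((ε μ ν : k) * O.scal μ ν) = 1 :=
  inv_mul_cancel₀ (mul_ne_zero (ε μ ν).ne_zero (scal_ne_zero O μ ν))

open scoped Classical in
theorem sum_hupEntry_downEntry_pass :
    ∑ ν : OfSize (n + 1), hupEntry Y O μ ν Z ε ≫ downEntry Y O μ' ν Z ε ≫ pass Y O Z μ' =
      if h : μ = μ' then pass Y O Z μ ≫ eqToHom (by rw [h]) else 0 := by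
  split_ifs with h
  · subst h
    have h1 : (O.L μ).map (Y.sw (O.t μ) Z) ≫ (∑ ν : OfSize (n + 1), (if μ.1 ≤ ν.1 then
        O.ro μ ν (Y.E (O.t μ) Z) ≫ O.io μ ν (Y.E (O.t μ) Z) else 0)) ≫ (O.L μ).map (Y.us (O.t μ) Z) =
        pass Y O Z μ := by
      rw [O.sum_ro_io, Category.id_comp, ← Functor.map_comp, pass]
    rw [eqToHom_refl, Category.comp_id]
    refine Eq.trans ?_ h1
    rw [Preadditive.sum_comp, Preadditive.comp_sum]
    refine Finset.sum_congr rfl fun ν _ ↦ ?_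
    rw [hupEntry, downEntry]
    split_ifs with hle
    · rw [Linear.smul_comp, Linear.smul_comp, Linear.comp_smul, hup_down_pass Y O Z hle, smul_smul,
        smul_smul, mul_assoc, entry_coeff O ε, one_smul]
    · rw [zero_comp, zero_comp, comp_zero]
  · refine Finset.sum_eq_zero fun ν _ ↦ ?_
    rw [hupEntry, downEntry]
    split_ifs
    · rw [Linear.smul_comp, Linear.smul_comp, Linear.comp_smul, hup_down_pass_of_ne Y O μ' Z ν h,
        smul_zero, smul_zero]
    all_goals simp

open scoped Classical in
theorem sum_pass_raisingEntry_hdownEntry :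
    ∑ ν : OfSize (n + 1), pass Y O Z μ ≫ raisingEntry Y O μ ν Z ε ≫ hdownEntry Y O μ' ν Z ε =
      if h : μ = μ' then pass Y O Z μ ≫ eqToHom (by rw [h]) else 0 := by
  split_ifs with h
  · subst h
    have h1 : (O.L μ).map (Y.sw (O.t μ) Z) ≫ (∑ ν : OfSize (n + 1), (if μ.1 ≤ ν.1 then
        O.ro μ ν (Y.E (O.t μ) Z) ≫ O.io μ ν (Y.E (O.t μ) Z) else 0)) ≫ (O.L μ).map (Y.us (O.t μ) Z) =
        pass Y O Z μ := by
      rw [O.sum_ro_io, Category.id_comp, ← Functor.map_comp, pass]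
    rw [eqToHom_refl, Category.comp_id]
    refine Eq.trans ?_ h1
    rw [Preadditive.sum_comp, Preadditive.comp_sum]
    refine Finset.sum_congr rfl fun ν _ ↦ ?_
    rw [hdownEntry, raisingEntry]
    split_ifs with hle
    · rw [Linear.smul_comp, Linear.comp_smul, Linear.comp_smul, Linear.comp_smul,
        pass_raising_hdown Y O Z hle, smul_smul, smul_smul, mul_comm (ε μ ν : k), mul_assoc,
        entry_coeff O ε, one_smul]
    · rw [zero_comp, zero_comp, comp_zero, comp_zero]
  · refine Finset.sum_eq_zero fun ν _ ↦ ?_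
    rw [hdownEntry, raisingEntry]
    split_ifs
    · rw [Linear.smul_comp, Linear.comp_smul, Linear.comp_smul, Linear.comp_smul,
        pass_raising_hdown_of_ne Y O μ' Z ν h, smul_zero, smul_zero]
    all_goals simp

open scoped Classical in
theorem exists_one_sub_pass (ν : OfSize (n + 1)) : ∃ t : OfSize n → k,
    𝟙 _ - pass Y O Z ν = ∑ μ : OfSize n, if μ.1 ≤ ν.1 then
      t μ • (O.L ν).map (Y.removeCap (O.t μ) (O.t ν) Z ≫ Y.addCup (O.t μ) (O.t ν) Z) else 0 := by
  obtain ⟨t, ht⟩ := Y.exists_one_sub_sw_us Z (O.t ν)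
  refine ⟨fun μ ↦ t (O.t μ), ?_⟩
  rw [pass, ← (O.L ν).map_id, ← Functor.map_sub, ht, ← O.t.sum_comp, Functor.map_sum]
  refine Finset.sum_congr rfl fun μ _ ↦ ?_
  rw [if_congr (O.t_le μ ν) rfl rfl]
  split_ifs
  · rw [Functor.map_smul]
  · rw [Functor.map_zero]

open scoped Classical in
theorem sum_downEntry_hupEntry :
    ∑ μ : OfSize n, (𝟙 _ - pass Y O Z ν) ≫ downEntry Y O μ ν Z ε ≫ hupEntry Y O μ ν' Z ε =
      if h : ν = ν' then (𝟙 _ - pass Y O Z ν) ≫ eqToHom (by rw [h]) else 0 := by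
  obtain ⟨t, hq⟩ := exists_one_sub_pass Y O Z ν
  have hterm (μ : OfSize n) : (𝟙 _ - pass Y O Z ν) ≫ downEntry Y O μ ν Z ε ≫
      hupEntry Y O μ ν' Z ε = if μ.1 ≤ ν.1 ∧ μ.1 ≤ ν'.1 then
        (t μ * (ε μ ν * O.scal μ ν) * (ε μ ν' * O.scal μ ν')⁻¹) •
          (O.L ν).map (Y.removeCap (O.t μ) (O.t ν) Z) ≫ (O.io μ ν _ ≫ O.ro μ ν' _) ≫
            (O.L ν').map (Y.addCup (O.t μ) (O.t ν') Z) else 0 := by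
    rw [downEntry, hupEntry]
    by_cases h1 : μ.1 ≤ ν.1
    · by_cases h2 : μ.1 ≤ ν'.1
      · rw [if_pos h1, if_pos h2, if_pos ⟨h1, h2⟩, hq, Preadditive.sum_comp, Finset.sum_eq_single μ]
        · rw [if_pos h1]
          simp only [Linear.smul_comp, Linear.comp_smul]
          rw [removeCap_addCup_down_hup Y O ν' Z μ h1]
          simp only [smul_smul]
          congr 1
          ring
        · intro κ _ hκ
          split_ifs
          · simp only [Linear.smul_comp, Linear.comp_smul]
            rw [removeCap_addCup_down_hup_of_ne Y O ν' Z κ hκ]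
            simp
          · rw [zero_comp]
        · simp
      · rw [if_neg h2, if_neg (not_and_of_not_right _ h2), comp_zero, comp_zero]
    · rw [if_neg h1, if_neg (not_and_of_not_left _ h1), zero_comp, comp_zero]
  rw [Finset.sum_congr rfl fun μ _ ↦ hterm μ]
  split_ifs with h
  · subst h
    rw [eqToHom_refl, Category.comp_id, hq]
    refine Finset.sum_congr rfl fun μ _ ↦ ?_
    simp only [and_self]
    split_ifs with hle
    · rw [O.io_ro hle, Category.id_comp, ← Functor.map_comp, mul_assoc,
        mul_comm (_ * _) (_ * _)⁻¹, entry_coeff O ε, mul_one]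
    · rfl
  · refine Finset.sum_eq_zero fun μ _ ↦ ?_
    split_ifs
    · rw [O.io_ro_of_ne μ h, zero_comp, comp_zero, smul_zero]
    · rfl

open scoped Classical in
theorem sum_hdownEntry_raisingEntry :
    ∑ μ : OfSize n, hdownEntry Y O μ ν Z ε ≫ raisingEntry Y O μ ν' Z ε ≫ (𝟙 _ - pass Y O Z ν') =
      if h : ν = ν' then (𝟙 _ - pass Y O Z ν) ≫ eqToHom (by rw [h]) else 0 := by
  obtain ⟨t, hq⟩ := exists_one_sub_pass Y O Z ν'
  have hterm (μ : OfSize n) : hdownEntry Y O μ ν Z ε ≫ raisingEntry Y O μ ν' Z ε ≫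
      (𝟙 _ - pass Y O Z ν') = if μ.1 ≤ ν.1 ∧ μ.1 ≤ ν'.1 then
        (t μ * (ε μ ν' * O.scal μ ν') * (ε μ ν * O.scal μ ν)⁻¹) •
          (O.L ν).map (Y.removeCap (O.t μ) (O.t ν) Z) ≫ (O.io μ ν _ ≫ O.ro μ ν' _) ≫
            (O.L ν').map (Y.addCup (O.t μ) (O.t ν') Z) else 0 := by
    rw [hdownEntry, raisingEntry]
    by_cases h1 : μ.1 ≤ ν.1
    · by_cases h2 : μ.1 ≤ ν'.1
      · rw [if_pos h1, if_pos h2, if_pos ⟨h1, h2⟩, hq, Preadditive.comp_sum, Preadditive.comp_sum,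
          Finset.sum_eq_single μ]
        · rw [if_pos h2]
          simp only [Linear.smul_comp, Linear.comp_smul]
          rw [hdown_raising_removeCap_addCup Y O ν' Z μ h2]
          simp only [smul_smul]
          congr 1
          ring
        · intro κ _ hκ
          split_ifs
          · simp only [Linear.smul_comp, Linear.comp_smul]
            rw [hdown_raising_removeCap_addCup_of_ne Y O ν' Z κ hκ.symm]
            simp
          · rw [comp_zero, comp_zero]
        · simp
      · rw [if_neg h2, if_neg (not_and_of_not_right _ h2), zero_comp, comp_zero]
    · rw [if_neg h1, if_neg (not_and_of_not_left _ h1), zero_comp]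
  rw [Finset.sum_congr rfl fun μ _ ↦ hterm μ]
  split_ifs with h
  · subst h
    rw [eqToHom_refl, Category.comp_id, hq]
    refine Finset.sum_congr rfl fun μ _ ↦ ?_
    simp only [and_self]
    split_ifs with hle
    · rw [O.io_ro hle, Category.id_comp, ← Functor.map_comp, mul_assoc,
        mul_comm (_ * _) (_ * _)⁻¹, entry_coeff O ε, mul_one]
    · rfl
  · refine Finset.sum_eq_zero fun μ _ ↦ ?_
    split_ifs
    · rw [O.io_ro_of_ne μ h, zero_comp, comp_zero, smul_zero]
    · rfl

end HeisAction

end Heis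

namespace CategoryTheory.MonoidalCategory

universe v₁ u₁

variable {k : Type u} [CommRing k] {C : Type u₁} [Category.{v₁} C] [Preadditive C] [Linear k C]
  [MonoidalCategory C] [MonoidalPreadditive C] [MonoidalLinear k C]

theorem tensorHom_smul (r : k) {X Y X' Y' : C} (f : X ⟶ Y) (g : X' ⟶ Y') :
    f ⊗ₘ (r • g) = r • (f ⊗ₘ g) := by
  rw [tensorHom_def, MonoidalLinear.whiskerLeft_smul, Linear.comp_smul, tensorHom_def]

theorem smul_tensorHom (r : k) {X Y X' Y' : C} (f : X ⟶ Y) (g : X' ⟶ Y') :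
    (r • f) ⊗ₘ g = r • (f ⊗ₘ g) := by
  rw [tensorHom_def, MonoidalLinear.smul_whiskerRight, Linear.smul_comp, tensorHom_def]

instance tensorLeft_linear (X : C) : (tensorLeft X).Linear k where
  map_smul _ _ := MonoidalLinear.whiskerLeft_smul ..

instance tensorRight_linear (X : C) : (tensorRight X).Linear k where
  map_smul _ _ := MonoidalLinear.smul_whiskerRight ..

end CategoryTheory.MonoidalCategory

namespace CategoryTheory.Idempotents.Karoubi

universe v₁ u₁

open Mat_

variable {C : Type u₁} [Category.{v₁} C] [Preadditive C]

/-- `f` is the restriction of a monomial matrix. -/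
def IsMonomial {P Q : Karoubi (Mat_ C)} (f : P ⟶ Q) (e : P.X.ι ≃ Q.X.ι)
    (φ : ∀ i, P.X.X i ⟶ Q.X.X (e i)) : Prop :=
  IsRestriction f (monomial e φ)

namespace IsMonomial

theorem comp {P Q R : Karoubi (Mat_ C)} {f : P ⟶ Q} {e : P.X.ι ≃ Q.X.ι}
    {φ : ∀ i, P.X.X i ⟶ Q.X.X (e i)} {g : Q ⟶ R} {e' : Q.X.ι ≃ R.X.ι}
    {φ' : ∀ i, Q.X.X i ⟶ R.X.X (e' i)} (hf : IsMonomial f e φ) (hg : IsMonomial g e' φ') :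
    IsMonomial (f ≫ g) (e.trans e') (fun i ↦ φ i ≫ φ' (e i)) := by
  rw [IsMonomial, ← monomial_comp_monomial]
  exact IsRestriction.comp hf hg

theorem ext {P Q : Karoubi (Mat_ C)} {f g : P ⟶ Q} {e e' : P.X.ι ≃ Q.X.ι}
    {φ : ∀ i, P.X.X i ⟶ Q.X.X (e i)} {φ' : ∀ i, P.X.X i ⟶ Q.X.X (e' i)} (hf : IsMonomial f e φ)
    (hg : IsMonomial g e' φ')
    (h : ∀ i, ∃ h : e i = e' i, φ i ≫ eqToHom (congrArg Q.X.X h) = φ' i) : f = g := by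
  rw [IsMonomial, monomial_congr _ _ _ _ h] at hf
  exact hf.eq hg

variable [MonoidalCategory C] [MonoidalPreadditive C]

theorem whiskerRight {P Q : Karoubi (Mat_ C)} {f : P ⟶ Q} {e : P.X.ι ≃ Q.X.ι}
    {φ : ∀ i, P.X.X i ⟶ Q.X.X (e i)} (hf : IsMonomial f e φ) (R : Karoubi (Mat_ C)) :
    IsMonomial (P := P ⊗ R) (Q := Q ⊗ R) (f ▷ R) (e.prodCongr (Equiv.refl R.X.ι))
      (fun p ↦ φ p.1 ▷ R.X.X p.2) := by
  have h := IsRestriction.tensor_id hf R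
  rw [tensorHom_id] at h
  exact (congrArg (IsRestriction (P := P ⊗ R) (Q := Q ⊗ R) (f ▷ R))
    ((tensorHom_id _ _).symm.trans (monomial_tensorHom_id e φ R.X))).mp h

theorem whiskerLeft {P Q : Karoubi (Mat_ C)} {f : P ⟶ Q} {e : P.X.ι ≃ Q.X.ι}
    {φ : ∀ i, P.X.X i ⟶ Q.X.X (e i)} (hf : IsMonomial f e φ) (R : Karoubi (Mat_ C)) :
    IsMonomial (P := R ⊗ P) (Q := R ⊗ Q) (R ◁ f) ((Equiv.refl R.X.ι).prodCongr e)
      (fun p ↦ R.X.X p.1 ◁ φ p.2) := by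
  have h := IsRestriction.id_tensor hf R
  rw [id_tensorHom] at h
  exact (congrArg (IsRestriction (P := R ⊗ P) (Q := R ⊗ Q) (R ◁ f))
    ((id_tensorHom _ _).symm.trans (id_tensorHom_monomial e φ R.X))).mp h

theorem associator (P Q R : Karoubi (Mat_ C)) :
    IsMonomial (α_ P Q R).hom (Equiv.prodAssoc _ _ _) (fun _ ↦ (α_ _ _ _).hom) :=
  isRestriction_associator P Q R

theorem leftUnitor (P : Karoubi (Mat_ C)) :
    IsMonomial (λ_ P).hom (Equiv.punitProd _) (fun _ ↦ (λ_ _).hom) :=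
  isRestriction_leftUnitor P

theorem rightUnitor (P : Karoubi (Mat_ C)) :
    IsMonomial (ρ_ P).hom (Equiv.prodPUnit _) (fun _ ↦ (ρ_ _).hom) :=
  isRestriction_rightUnitor P

end IsMonomial

end CategoryTheory.Idempotents.Karoubi

namespace Heis

open Idempotents Karoubi

section

variable (k : Type u) [CommRing k]

theorem isMonomial_incl_map {X Y : HeisDiag k} (f : X ⟶ Y) :
    IsMonomial ((incl k).map f) (Equiv.refl PUnit) (fun _ ↦ f) := by
  have h2 : (Mat_.embedding _).map f = Mat_.monomial (M := (Mat_.embedding _).obj X)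
      (N := (Mat_.embedding _).obj Y) (Equiv.refl PUnit) (fun _ ↦ f) :=
    Mat_.eq_monomial _ _ _ (fun _ ↦ rfl) (fun _ _ h ↦ (h rfl).elim)
  refine ⟨?_, ?_⟩
  · exact h2.trans (Category.id_comp _).symm
  · exact (Category.id_comp _).trans (Category.comp_id _).symm

theorem isMonomial_inclTensor_inv (X Y : HeisDiag k) :
    IsMonomial (inclTensor k X Y).inv (Equiv.prodPUnit PUnit) (fun _ ↦ 𝟙 (X ⊗ Y)) := by
  have h : ((incl k).obj X ⊗ (incl k).obj Y).p = 𝟙 _ := id_tensorHom_id _ _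
  refine ⟨rfl, ?_⟩
  rw [h, Category.id_comp]
  exact (Category.comp_id _).symm

theorem isMonomial_id (X : HeisDiag k) :
    IsMonomial (𝟙 ((incl k).obj X)) (Equiv.refl PUnit) (fun _ ↦ 𝟙 X) := by
  rw [← CategoryTheory.Functor.map_id]
  exact isMonomial_incl_map k (𝟙 X)

/-- The functor that sends a word to itself is monoidal. -/
noncomputable def inclCoreMonoidal : (incl k).CoreMonoidal where
  εIso := Iso.refl (𝟙_ (HeisCat k))
  μIso X Y := (inclTensor k X Y).symm
  μIso_hom_natural_left f X' :=
    ((isMonomial_incl_map k f).whiskerRight _ |>.comp (isMonomial_inclTensor_inv k _ _)).ext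
      ((isMonomial_inclTensor_inv k _ _).comp (isMonomial_incl_map k _))
      (fun _ ↦ ⟨rfl, by
        change (f ▷ X' ≫ 𝟙 _) ≫ 𝟙 _ = 𝟙 _ ≫ f ▷ X'
        simp⟩)
  μIso_hom_natural_right X' f :=
    ((isMonomial_incl_map k f).whiskerLeft _ |>.comp (isMonomial_inclTensor_inv k _ _)).ext
      ((isMonomial_inclTensor_inv k _ _).comp (isMonomial_incl_map k _))
      (fun _ ↦ ⟨rfl, by
        change (X' ◁ f ≫ 𝟙 _) ≫ 𝟙 _ = 𝟙 _ ≫ X' ◁ f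
        simp⟩)
  associativity X Y Z :=
    ((isMonomial_inclTensor_inv k X Y).whiskerRight _ |>.comp
      ((isMonomial_inclTensor_inv k _ _).comp (isMonomial_incl_map k _))).ext
      ((IsMonomial.associator _ _ _).comp ((isMonomial_inclTensor_inv k Y Z).whiskerLeft _ |>.comp
        (isMonomial_inclTensor_inv k _ _)))
      (fun _ ↦ ⟨rfl, by
        change (𝟙 (X ⊗ Y) ▷ Z ≫ 𝟙 _ ≫ (α_ X Y Z).hom) ≫ 𝟙 _ = (α_ X Y Z).hom ≫ X ◁ 𝟙 (Y ⊗ Z) ≫ 𝟙 _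
        simp⟩)
  left_unitality X :=
    (IsMonomial.leftUnitor _).ext ((isMonomial_id k (𝟙_ _)).whiskerRight _ |>.comp
      ((isMonomial_inclTensor_inv k _ _).comp (isMonomial_incl_map k _)))
      (fun _ ↦ ⟨rfl, by
        change (λ_ X).hom ≫ 𝟙 _ = 𝟙 (𝟙_ _) ▷ X ≫ 𝟙 _ ≫ (λ_ X).hom
        simp⟩)
  right_unitality X :=
    (IsMonomial.rightUnitor _).ext ((isMonomial_id k (𝟙_ _)).whiskerLeft _ |>.comp
      ((isMonomial_inclTensor_inv k _ _).comp (isMonomial_incl_map k _)))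
      (fun _ ↦ ⟨rfl, by
        change (ρ_ X).hom ≫ 𝟙 _ = X ◁ 𝟙 (𝟙_ _) ≫ 𝟙 _ ≫ (ρ_ X).hom
        simp⟩)

noncomputable instance : (incl k).Monoidal := (inclCoreMonoidal k).toMonoidal

instance : (incl k).Additive := inferInstanceAs (Mat_.embedding _ ⋙ toKaroubi _).Additive

end

instance (k : Type u) [CommRing k] : (incl k).Linear k where
  map_smul _ _ := rfl

instance (k : Type u) [CommRing k] : MonoidalLinear k (HeisCat k) where
  whiskerLeft_smul X _ _ r f := hom_ext _ _ (by
    refine Mat_.hom_ext _ _ fun p q ↦ ?_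
    exact tensorHom_smul (C := HeisDiag k) r (X.p p.1 q.1) (f.f p.2 q.2))
  smul_whiskerRight r _ _ f X := hom_ext _ _ (by
    refine Mat_.hom_ext _ _ fun p q ↦ ?_
    exact smul_tensorHom (C := HeisDiag k) r (f.f p.1 q.1) (X.p p.2 q.2))

end Heis

namespace Heis

open HeisDiag

section WordAction

universe v₁ u₁

variable {k : Type u} [CommRing k] {C : Type u₁} [Category.{v₁} C] [MonoidalCategory C]
  (F : HeisDiag k ⥤ C)

/-- Words act on the left by strictly associative tensor products. -/
def leftWord : HeisWord → C ⥤ C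
  | .unit => 𝟭 C
  | .up => tensorLeft (F.obj ⟨.up⟩)
  | .down => tensorLeft (F.obj ⟨.down⟩)
  | .tensor A B => leftWord B ⋙ leftWord A

/-- Words act on the right by strictly associative tensor products. -/
def rightWord : HeisWord → C ⥤ C
  | .unit => 𝟭 C
  | .up => tensorRight (F.obj ⟨.up⟩)
  | .down => tensorRight (F.obj ⟨.down⟩)
  | .tensor A B => rightWord A ⋙ rightWord B

variable [F.Monoidal]

open Functor.Monoidal Functor.LaxMonoidal Functor.OplaxMonoidal

/-- The action of a word on the left is the tensor product with the word. -/
def leftWordIso : ∀ (W : HeisWord) (Z : C), F.obj ⟨W⟩ ⊗ Z ≅ (leftWord F W).obj Z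
  | .unit, Z => whiskerRightIso (εIso F).symm Z ≪≫ λ_ Z
  | .up, _ => Iso.refl _
  | .down, _ => Iso.refl _
  | .tensor A B, Z => whiskerRightIso (μIso F ⟨A⟩ ⟨B⟩).symm Z ≪≫ α_ _ _ _ ≪≫
      whiskerLeftIso _ (leftWordIso B Z) ≪≫ leftWordIso A _

/-- The action of a word on the right is the tensor product with the word. -/
def rightWordIso : ∀ (W : HeisWord) (Z : C), Z ⊗ F.obj ⟨W⟩ ≅ (rightWord F W).obj Z
  | .unit, Z => whiskerLeftIso Z (εIso F).symm ≪≫ ρ_ Z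
  | .up, _ => Iso.refl _
  | .down, _ => Iso.refl _
  | .tensor A B, Z => whiskerLeftIso Z (μIso F ⟨A⟩ ⟨B⟩).symm ≪≫ (α_ _ _ _).symm ≪≫
      whiskerRightIso (rightWordIso A Z) _ ≪≫ rightWordIso B _

theorem leftWordIso_naturality (W : HeisWord) {Z Z' : C} (f : Z ⟶ Z') :
    F.obj ⟨W⟩ ◁ f ≫ (leftWordIso F W Z').hom = (leftWordIso F W Z).hom ≫ (leftWord F W).map f := by
  induction W generalizing Z Z' with
  | unit => simp [leftWordIso, leftWord, whisker_exchange_assoc]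
  | up => simp [leftWordIso, leftWord]
  | down => simp [leftWordIso, leftWord]
  | tensor A B hA hB =>
    simp only [leftWordIso, leftWord, Iso.trans_hom, whiskerRightIso_hom, Iso.symm_hom,
      whiskerLeftIso_hom, Category.assoc, Functor.comp_map, μIso_inv]
    rw [whisker_exchange_assoc, tensor_whiskerLeft_assoc, Iso.inv_hom_id_assoc,
      ← whiskerLeft_comp_assoc, hB, whiskerLeft_comp_assoc, hA]

theorem rightWordIso_naturality (W : HeisWord) {Z Z' : C} (f : Z ⟶ Z') :
    f ▷ F.obj ⟨W⟩ ≫ (rightWordIso F W Z').hom =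
      (rightWordIso F W Z).hom ≫ (rightWord F W).map f := by
  induction W generalizing Z Z' with
  | unit => simp [rightWordIso, rightWord, ← whisker_exchange_assoc]
  | up => simp [rightWordIso, rightWord]
  | down => simp [rightWordIso, rightWord]
  | tensor A B hA hB =>
    simp only [rightWordIso, rightWord, Iso.trans_hom, whiskerRightIso_hom, Iso.symm_hom,
      whiskerLeftIso_hom, Category.assoc, Functor.comp_map, μIso_inv]
    rw [← whisker_exchange_assoc, whiskerRight_tensor_assoc, Iso.hom_inv_id_assoc,
      ← comp_whiskerRight_assoc, hA, comp_whiskerRight_assoc, hB]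

variable {A B W : HeisWord}

/-- The action of a morphism on the left. -/
def leftMap (f : (⟨A⟩ : HeisDiag k) ⟶ ⟨B⟩) (Z : C) : (leftWord F A).obj Z ⟶ (leftWord F B).obj Z :=
  (leftWordIso F A Z).inv ≫ F.map f ▷ Z ≫ (leftWordIso F B Z).hom

/-- The action of a morphism on the right. -/
def rightMap (f : (⟨A⟩ : HeisDiag k) ⟶ ⟨B⟩) (Z : C) :
    (rightWord F A).obj Z ⟶ (rightWord F B).obj Z :=
  (rightWordIso F A Z).inv ≫ Z ◁ F.map f ≫ (rightWordIso F B Z).hom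

theorem leftWordIso_naturality' {Z Z' : C} (f : Z ⟶ Z') :
    (leftWordIso F W Z).inv ≫ F.obj ⟨W⟩ ◁ f =
      (leftWord F W).map f ≫ (leftWordIso F W Z').inv := by
  rw [Iso.inv_comp_eq, ← reassoc_of% leftWordIso_naturality F, Iso.hom_inv_id, Category.comp_id]

theorem rightWordIso_naturality' {Z Z' : C} (f : Z ⟶ Z') :
    (rightWordIso F W Z).inv ≫ f ▷ F.obj ⟨W⟩ =
      (rightWord F W).map f ≫ (rightWordIso F W Z').inv := by
  rw [Iso.inv_comp_eq, ← reassoc_of% rightWordIso_naturality F, Iso.hom_inv_id, Category.comp_id]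

theorem leftMap_naturality (f : (⟨A⟩ : HeisDiag k) ⟶ ⟨B⟩) {Z Z' : C} (g : Z ⟶ Z') :
    (leftWord F A).map g ≫ leftMap F f Z' = leftMap F f Z ≫ (leftWord F B).map g := by
  simp only [leftMap, Category.assoc]
  rw [← reassoc_of% leftWordIso_naturality' F, whisker_exchange_assoc, leftWordIso_naturality]

theorem rightMap_naturality (f : (⟨A⟩ : HeisDiag k) ⟶ ⟨B⟩) {Z Z' : C} (g : Z ⟶ Z') :
    (rightWord F A).map g ≫ rightMap F f Z' = rightMap F f Z ≫ (rightWord F B).map g := by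
  simp only [rightMap, Category.assoc]
  rw [← reassoc_of% rightWordIso_naturality' F, ← whisker_exchange_assoc, rightWordIso_naturality]

theorem leftMap_id (Z : C) : leftMap F (𝟙 (⟨A⟩ : HeisDiag k)) Z = 𝟙 _ := by simp [leftMap]

theorem rightMap_id (Z : C) : rightMap F (𝟙 (⟨A⟩ : HeisDiag k)) Z = 𝟙 _ := by simp [rightMap]

theorem leftMap_comp {A₁ A₂ A₃ : HeisWord} (f : (⟨A₁⟩ : HeisDiag k) ⟶ ⟨A₂⟩)
    (g : (⟨A₂⟩ : HeisDiag k) ⟶ ⟨A₃⟩) (Z : C) :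
    leftMap F (f ≫ g) Z = leftMap F f Z ≫ leftMap F g Z := by simp [leftMap]

theorem rightMap_comp {A₁ A₂ A₃ : HeisWord} (f : (⟨A₁⟩ : HeisDiag k) ⟶ ⟨A₂⟩)
    (g : (⟨A₂⟩ : HeisDiag k) ⟶ ⟨A₃⟩) (Z : C) :
    rightMap F (f ≫ g) Z = rightMap F f Z ≫ rightMap F g Z := by simp [rightMap]

theorem leftMap_eq (f : (⟨A⟩ : HeisDiag k) ⟶ ⟨B⟩) {Z : C}
    {g : (leftWord F A).obj Z ⟶ (leftWord F B).obj Z}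
    (h : (leftWordIso F A Z).hom ≫ g = F.map f ▷ Z ≫ (leftWordIso F B Z).hom) :
    leftMap F f Z = g := by
  rw [leftMap, ← h, Iso.inv_hom_id_assoc]

theorem rightMap_eq (f : (⟨A⟩ : HeisDiag k) ⟶ ⟨B⟩) {Z : C}
    {g : (rightWord F A).obj Z ⟶ (rightWord F B).obj Z}
    (h : (rightWordIso F A Z).hom ≫ g = Z ◁ F.map f ≫ (rightWordIso F B Z).hom) :
    rightMap F f Z = g := by
  rw [rightMap, ← h, Iso.inv_hom_id_assoc]

theorem leftMap_whiskerLeft (f : (⟨A⟩ : HeisDiag k) ⟶ ⟨B⟩) (Z : C) :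
    leftMap F (A := W.tensor A) (B := W.tensor B) ((⟨W⟩ : HeisDiag k) ◁ f) Z =
      (leftWord F W).map (leftMap F f Z) := by
  refine leftMap_eq F (A := W.tensor A) (B := W.tensor B) _ ?_
  change (δ F ⟨W⟩ ⟨A⟩ ▷ Z ≫ (α_ (F.obj ⟨W⟩) (F.obj ⟨A⟩) Z).hom ≫
    F.obj ⟨W⟩ ◁ (leftWordIso F A Z).hom ≫ (leftWordIso F W _).hom) ≫
      (leftWord F W).map (leftMap F f Z) = F.map ((⟨W⟩ : HeisDiag k) ◁ f) ▷ Z ≫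
    δ F ⟨W⟩ ⟨B⟩ ▷ Z ≫ (α_ (F.obj ⟨W⟩) (F.obj ⟨B⟩) Z).hom ≫
      F.obj ⟨W⟩ ◁ (leftWordIso F B Z).hom ≫ (leftWordIso F W _).hom
  simp only [Category.assoc]
  have h : (δ F ⟨W⟩ ⟨A⟩ ≫ F.obj ⟨W⟩ ◁ F.map f) ▷ Z = (_ ≫ _) ▷ Z :=
    congrArg (· ▷ Z) (δ_natural_right F _ f)
  rw [comp_whiskerRight, comp_whiskerRight] at h
  rw [← leftWordIso_naturality, leftMap, ← reassoc_of% h]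
  simp

theorem rightMap_whiskerRight (f : (⟨A⟩ : HeisDiag k) ⟶ ⟨B⟩) (Z : C) :
    rightMap F (A := A.tensor W) (B := B.tensor W) (f ▷ (⟨W⟩ : HeisDiag k)) Z =
      (rightWord F W).map (rightMap F f Z) := by
  refine rightMap_eq F (A := A.tensor W) (B := B.tensor W) _ ?_
  change (Z ◁ δ F ⟨A⟩ ⟨W⟩ ≫ (α_ Z (F.obj ⟨A⟩) (F.obj ⟨W⟩)).inv ≫
    (rightWordIso F A Z).hom ▷ F.obj ⟨W⟩ ≫ (rightWordIso F W _).hom) ≫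
      (rightWord F W).map (rightMap F f Z) = Z ◁ F.map (f ▷ (⟨W⟩ : HeisDiag k)) ≫
    Z ◁ δ F ⟨B⟩ ⟨W⟩ ≫ (α_ Z (F.obj ⟨B⟩) (F.obj ⟨W⟩)).inv ≫
      (rightWordIso F B Z).hom ▷ F.obj ⟨W⟩ ≫ (rightWordIso F W _).hom
  simp only [Category.assoc]
  have h : Z ◁ (δ F ⟨A⟩ ⟨W⟩ ≫ F.map f ▷ F.obj ⟨W⟩) = Z ◁ (_ ≫ _) :=
    congrArg (Z ◁ ·) (δ_natural_left F f _)
  rw [whiskerLeft_comp, whiskerLeft_comp] at h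
  rw [← rightWordIso_naturality, rightMap, ← reassoc_of% h]
  simp

theorem leftMap_whiskerRight (f : (⟨A⟩ : HeisDiag k) ⟶ ⟨B⟩) (Z : C) :
    leftMap F (A := A.tensor W) (B := B.tensor W) (f ▷ (⟨W⟩ : HeisDiag k)) Z =
      leftMap F f ((leftWord F W).obj Z) := by
  refine leftMap_eq F (A := A.tensor W) (B := B.tensor W) _ ?_
  change (δ F ⟨A⟩ ⟨W⟩ ▷ Z ≫ (α_ (F.obj ⟨A⟩) (F.obj ⟨W⟩) Z).hom ≫
    F.obj ⟨A⟩ ◁ (leftWordIso F W Z).hom ≫ (leftWordIso F A _).hom) ≫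
      leftMap F f ((leftWord F W).obj Z) = F.map (f ▷ (⟨W⟩ : HeisDiag k)) ▷ Z ≫
    δ F ⟨B⟩ ⟨W⟩ ▷ Z ≫ (α_ (F.obj ⟨B⟩) (F.obj ⟨W⟩) Z).hom ≫
      F.obj ⟨B⟩ ◁ (leftWordIso F W Z).hom ≫ (leftWordIso F B _).hom
  have h : (δ F ⟨A⟩ ⟨W⟩ ≫ F.map f ▷ F.obj ⟨W⟩) ▷ Z = (_ ≫ _) ▷ Z :=
    congrArg (· ▷ Z) (δ_natural_left F f _)
  rw [comp_whiskerRight, comp_whiskerRight] at h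
  rw [leftMap, ← reassoc_of% h]
  simp [whisker_exchange_assoc]

theorem rightMap_whiskerLeft (f : (⟨A⟩ : HeisDiag k) ⟶ ⟨B⟩) (Z : C) :
    rightMap F (A := W.tensor A) (B := W.tensor B) ((⟨W⟩ : HeisDiag k) ◁ f) Z =
      rightMap F f ((rightWord F W).obj Z) := by
  refine rightMap_eq F (A := W.tensor A) (B := W.tensor B) _ ?_
  change (Z ◁ δ F ⟨W⟩ ⟨A⟩ ≫ (α_ Z (F.obj ⟨W⟩) (F.obj ⟨A⟩)).inv ≫
    (rightWordIso F W Z).hom ▷ F.obj ⟨A⟩ ≫ (rightWordIso F A _).hom) ≫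
      rightMap F f ((rightWord F W).obj Z) = Z ◁ F.map ((⟨W⟩ : HeisDiag k) ◁ f) ≫
    Z ◁ δ F ⟨W⟩ ⟨B⟩ ≫ (α_ Z (F.obj ⟨W⟩) (F.obj ⟨B⟩)).inv ≫
      (rightWordIso F W Z).hom ▷ F.obj ⟨B⟩ ≫ (rightWordIso F B _).hom
  have h : Z ◁ (δ F ⟨W⟩ ⟨A⟩ ≫ F.obj ⟨W⟩ ◁ F.map f) = Z ◁ (_ ≫ _) :=
    congrArg (Z ◁ ·) (δ_natural_right F _ f)
  rw [whiskerLeft_comp, whiskerLeft_comp] at h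
  rw [rightMap, ← reassoc_of% h]
  simp [← whisker_exchange_assoc]

theorem leftMap_associator (A₁ A₂ A₃ : HeisWord) (Z : C) :
    leftMap F (A := (A₁.tensor A₂).tensor A₃) (B := A₁.tensor (A₂.tensor A₃))
      (α_ (⟨A₁⟩ : HeisDiag k) ⟨A₂⟩ ⟨A₃⟩).hom Z = 𝟙 _ := by
  refine (leftMap_eq F (A := (A₁.tensor A₂).tensor A₃) (B := A₁.tensor (A₂.tensor A₃)) _
    (g := 𝟙 _) ?_)
  refine (Category.comp_id _).trans ?_
  change δ F (⟨A₁⟩ ⊗ ⟨A₂⟩) ⟨A₃⟩ ▷ Z ≫ (α_ _ (F.obj ⟨A₃⟩) Z).hom ≫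
    F.obj (⟨A₁⟩ ⊗ ⟨A₂⟩) ◁ (leftWordIso F A₃ Z).hom ≫ δ F ⟨A₁⟩ ⟨A₂⟩ ▷ _ ≫
      (α_ (F.obj ⟨A₁⟩) (F.obj ⟨A₂⟩) _).hom ≫ F.obj ⟨A₁⟩ ◁ (leftWordIso F A₂ _).hom ≫
        (leftWordIso F A₁ _).hom = F.map (α_ (⟨A₁⟩ : HeisDiag k) ⟨A₂⟩ ⟨A₃⟩).hom ▷ Z ≫
    δ F ⟨A₁⟩ (⟨A₂⟩ ⊗ ⟨A₃⟩) ▷ Z ≫ (α_ (F.obj ⟨A₁⟩) _ Z).hom ≫ F.obj ⟨A₁⟩ ◁ (δ F ⟨A₂⟩ ⟨A₃⟩ ▷ Z ≫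
      (α_ (F.obj ⟨A₂⟩) (F.obj ⟨A₃⟩) Z).hom ≫ F.obj ⟨A₂⟩ ◁ (leftWordIso F A₃ Z).hom ≫
        (leftWordIso F A₂ _).hom) ≫ (leftWordIso F A₁ _).hom
  have h : (δ F (⟨A₁⟩ ⊗ ⟨A₂⟩) ⟨A₃⟩ ≫ δ F ⟨A₁⟩ ⟨A₂⟩ ▷ F.obj ⟨A₃⟩ ≫ (α_ _ _ _).hom) ▷ Z = _ :=
    congrArg (· ▷ Z) (associativity (F := F) (⟨A₁⟩ : HeisDiag k) ⟨A₂⟩ ⟨A₃⟩)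
  simp only [comp_whiskerRight] at h
  rw [whisker_exchange_assoc]
  simp only [whiskerLeft_comp, Category.assoc]
  rw [← associator_naturality_middle_assoc, ← reassoc_of% h]
  simp

theorem rightMap_associator (A₁ A₂ A₃ : HeisWord) (Z : C) :
    rightMap F (A := (A₁.tensor A₂).tensor A₃) (B := A₁.tensor (A₂.tensor A₃))
      (α_ (⟨A₁⟩ : HeisDiag k) ⟨A₂⟩ ⟨A₃⟩).hom Z = 𝟙 _ := by
  refine (rightMap_eq F (A := (A₁.tensor A₂).tensor A₃) (B := A₁.tensor (A₂.tensor A₃)) _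
    (g := 𝟙 _) ?_)
  refine (Category.comp_id _).trans ?_
  change Z ◁ δ F (⟨A₁⟩ ⊗ ⟨A₂⟩) ⟨A₃⟩ ≫ (α_ Z _ (F.obj ⟨A₃⟩)).inv ≫
    (Z ◁ δ F ⟨A₁⟩ ⟨A₂⟩ ≫ (α_ Z (F.obj ⟨A₁⟩) (F.obj ⟨A₂⟩)).inv ≫
      (rightWordIso F A₁ Z).hom ▷ F.obj ⟨A₂⟩ ≫ (rightWordIso F A₂ _).hom) ▷ F.obj ⟨A₃⟩ ≫
        (rightWordIso F A₃ _).hom = Z ◁ F.map (α_ (⟨A₁⟩ : HeisDiag k) ⟨A₂⟩ ⟨A₃⟩).hom ≫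
    Z ◁ δ F ⟨A₁⟩ (⟨A₂⟩ ⊗ ⟨A₃⟩) ≫ (α_ Z (F.obj ⟨A₁⟩) _).inv ≫
      (rightWordIso F A₁ Z).hom ▷ F.obj (⟨A₂⟩ ⊗ ⟨A₃⟩) ≫ _ ◁ δ F ⟨A₂⟩ ⟨A₃⟩ ≫
      (α_ _ (F.obj ⟨A₂⟩) (F.obj ⟨A₃⟩)).inv ≫ (rightWordIso F A₂ _).hom ▷ F.obj ⟨A₃⟩ ≫
        (rightWordIso F A₃ _).hom
  have h : Z ◁ (δ F (⟨A₁⟩ ⊗ ⟨A₂⟩) ⟨A₃⟩ ≫ δ F ⟨A₁⟩ ⟨A₂⟩ ▷ F.obj ⟨A₃⟩ ≫ (α_ _ _ _).hom) = _ :=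
    congrArg (Z ◁ ·) (associativity (F := F) (⟨A₁⟩ : HeisDiag k) ⟨A₂⟩ ⟨A₃⟩)
  simp only [whiskerLeft_comp] at h
  rw [← whisker_exchange_assoc, tensor_whiskerLeft_assoc, Iso.inv_hom_id_assoc, ← reassoc_of% h]
  simp

theorem leftMap_leftUnitor (A : HeisWord) (Z : C) :
    leftMap F (A := HeisWord.unit.tensor A) (λ_ (⟨A⟩ : HeisDiag k)).hom Z = 𝟙 _ := by
  refine (leftMap_eq F (A := HeisWord.unit.tensor A) (B := A) _ (g := 𝟙 _) ?_)
  refine (Category.comp_id _).trans ?_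
  change δ F (𝟙_ _) ⟨A⟩ ▷ Z ≫ (α_ (F.obj (𝟙_ _)) (F.obj ⟨A⟩) Z).hom ≫
    F.obj (𝟙_ _) ◁ (leftWordIso F A Z).hom ≫ η F ▷ _ ≫ (λ_ _).hom =
      F.map (λ_ (⟨A⟩ : HeisDiag k)).hom ▷ Z ≫ (leftWordIso F A Z).hom
  have h : (_ ≫ _ ≫ _) ▷ Z = F.map (λ_ (⟨A⟩ : HeisDiag k)).hom ▷ Z :=
    congrArg (· ▷ Z) (left_unitality_hom (F := F) (⟨A⟩ : HeisDiag k))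
  rw [comp_whiskerRight, comp_whiskerRight] at h
  rw [← h, whisker_exchange_assoc]
  simp [-Functor.LaxMonoidal.left_unitality, -Functor.LaxMonoidal.right_unitality]

theorem rightMap_leftUnitor (A : HeisWord) (Z : C) :
    rightMap F (A := HeisWord.unit.tensor A) (λ_ (⟨A⟩ : HeisDiag k)).hom Z = 𝟙 _ := by
  refine (rightMap_eq F (A := HeisWord.unit.tensor A) (B := A) _ (g := 𝟙 _) ?_)
  refine (Category.comp_id _).trans ?_
  change Z ◁ δ F (𝟙_ _) ⟨A⟩ ≫ (α_ Z (F.obj (𝟙_ _)) (F.obj ⟨A⟩)).inv ≫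
    (Z ◁ η F ≫ (ρ_ Z).hom) ▷ F.obj ⟨A⟩ ≫ (rightWordIso F A Z).hom =
      Z ◁ F.map (λ_ (⟨A⟩ : HeisDiag k)).hom ≫ (rightWordIso F A Z).hom
  have h : Z ◁ (_ ≫ _ ≫ _) = Z ◁ F.map (λ_ (⟨A⟩ : HeisDiag k)).hom :=
    congrArg (Z ◁ ·) (left_unitality_hom (F := F) (⟨A⟩ : HeisDiag k))
  rw [whiskerLeft_comp, whiskerLeft_comp] at h
  rw [← h]
  simp [-Functor.LaxMonoidal.left_unitality, -Functor.LaxMonoidal.right_unitality]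

theorem leftMap_rightUnitor (A : HeisWord) (Z : C) :
    leftMap F (A := A.tensor .unit) (ρ_ (⟨A⟩ : HeisDiag k)).hom Z = 𝟙 _ := by
  refine (leftMap_eq F (A := A.tensor .unit) (B := A) _ (g := 𝟙 _) ?_)
  refine (Category.comp_id _).trans ?_
  change δ F ⟨A⟩ (𝟙_ _) ▷ Z ≫ (α_ (F.obj ⟨A⟩) (F.obj (𝟙_ _)) Z).hom ≫
    F.obj ⟨A⟩ ◁ (η F ▷ Z ≫ (λ_ Z).hom) ≫ (leftWordIso F A Z).hom =
      F.map (ρ_ (⟨A⟩ : HeisDiag k)).hom ▷ Z ≫ (leftWordIso F A Z).hom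
  have h : (_ ≫ _ ≫ _) ▷ Z = F.map (ρ_ (⟨A⟩ : HeisDiag k)).hom ▷ Z :=
    congrArg (· ▷ Z) (right_unitality_hom (F := F) (⟨A⟩ : HeisDiag k))
  rw [comp_whiskerRight, comp_whiskerRight] at h
  rw [← h]
  simp [-Functor.LaxMonoidal.left_unitality, -Functor.LaxMonoidal.right_unitality]

theorem rightMap_rightUnitor (A : HeisWord) (Z : C) :
    rightMap F (A := A.tensor .unit) (ρ_ (⟨A⟩ : HeisDiag k)).hom Z = 𝟙 _ := by
  refine (rightMap_eq F (A := A.tensor .unit) (B := A) _ (g := 𝟙 _) ?_)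
  refine (Category.comp_id _).trans ?_
  change Z ◁ δ F ⟨A⟩ (𝟙_ _) ≫ (α_ Z (F.obj ⟨A⟩) (F.obj (𝟙_ _))).inv ≫
    (rightWordIso F A Z).hom ▷ F.obj (𝟙_ _) ≫ _ ◁ η F ≫ (ρ_ _).hom =
      Z ◁ F.map (ρ_ (⟨A⟩ : HeisDiag k)).hom ≫ (rightWordIso F A Z).hom
  have h : Z ◁ (_ ≫ _ ≫ _) = Z ◁ F.map (ρ_ (⟨A⟩ : HeisDiag k)).hom :=
    congrArg (Z ◁ ·) (right_unitality_hom (F := F) (⟨A⟩ : HeisDiag k))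
  rw [whiskerLeft_comp, whiskerLeft_comp] at h
  rw [← h, ← whisker_exchange_assoc]
  simp [-Functor.LaxMonoidal.left_unitality, -Functor.LaxMonoidal.right_unitality]

/-- The action of a diagram on the left. -/
def leftDiag (d : HeisDiagram k A B) (Z : C) : (leftWord F A).obj Z ⟶ (leftWord F B).obj Z :=
  leftMap F (ofDiagram d) Z

/-- The action of a diagram on the right. -/
def rightDiag (d : HeisDiagram k A B) (Z : C) : (rightWord F A).obj Z ⟶ (rightWord F B).obj Z :=
  rightMap F (ofDiagram d) Z

variable {F} in
theorem leftDiag_eq {d d' : HeisDiagram k A B} (h : HeisDiagram.Rel d d') (Z : C) :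
    leftDiag F d Z = leftDiag F d' Z :=
  congrArg (fun f ↦ leftMap F f Z) (Quotient.sound h : ofDiagram d = ofDiagram d')

variable {F} in
theorem rightDiag_eq {d d' : HeisDiagram k A B} (h : HeisDiagram.Rel d d') (Z : C) :
    rightDiag F d Z = rightDiag F d' Z :=
  congrArg (fun f ↦ rightMap F f Z) (Quotient.sound h : ofDiagram d = ofDiagram d')

theorem leftDiag_id (Z : C) : leftDiag F (.id A) Z = 𝟙 _ := leftMap_id F Z

theorem rightDiag_id (Z : C) : rightDiag F (.id A) Z = 𝟙 _ := rightMap_id F Z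

variable {A₁ A₂ A₃ : HeisWord}

theorem leftDiag_comp (d : HeisDiagram k A₁ A₂) (d' : HeisDiagram k A₂ A₃) (Z : C) :
    leftDiag F (d.comp d') Z = leftDiag F d Z ≫ leftDiag F d' Z := leftMap_comp F (ofDiagram d) (ofDiagram d') Z

theorem rightDiag_comp (d : HeisDiagram k A₁ A₂) (d' : HeisDiagram k A₂ A₃) (Z : C) :
    rightDiag F (d.comp d') Z = rightDiag F d Z ≫ rightDiag F d' Z := rightMap_comp F (ofDiagram d) (ofDiagram d') Z

theorem leftDiag_whiskerLeft (d : HeisDiagram k A B) (Z : C) :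
    leftDiag F (d.whiskerLeft W) Z = (leftWord F W).map (leftDiag F d Z) :=
  leftMap_whiskerLeft F (ofDiagram d) Z

theorem rightDiag_whiskerLeft (d : HeisDiagram k A B) (Z : C) :
    rightDiag F (d.whiskerLeft W) Z = rightDiag F d ((rightWord F W).obj Z) :=
  rightMap_whiskerLeft F (ofDiagram d) Z

theorem leftDiag_whiskerRight (d : HeisDiagram k A B) (Z : C) :
    leftDiag F (d.whiskerRight W) Z = leftDiag F d ((leftWord F W).obj Z) :=
  leftMap_whiskerRight F (ofDiagram d) Z

theorem rightDiag_whiskerRight (d : HeisDiagram k A B) (Z : C) :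
    rightDiag F (d.whiskerRight W) Z = (rightWord F W).map (rightDiag F d Z) :=
  rightMap_whiskerRight F (ofDiagram d) Z

theorem leftDiag_assocHom (Z : C) : leftDiag F (.assocHom A₁ A₂ A₃) Z = 𝟙 _ :=
  leftMap_associator F _ _ _ Z

theorem rightDiag_assocHom (Z : C) : rightDiag F (.assocHom A₁ A₂ A₃) Z = 𝟙 _ :=
  rightMap_associator F _ _ _ Z

theorem leftDiag_leftHom (Z : C) : leftDiag F (.leftHom A) Z = 𝟙 _ := leftMap_leftUnitor F _ Z

theorem rightDiag_leftHom (Z : C) : rightDiag F (.leftHom A) Z = 𝟙 _ := rightMap_leftUnitor F _ Z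

theorem leftDiag_rightHom (Z : C) : leftDiag F (.rightHom A) Z = 𝟙 _ := leftMap_rightUnitor F _ Z

theorem rightDiag_rightHom (Z : C) : rightDiag F (.rightHom A) Z = 𝟙 _ :=
  rightMap_rightUnitor F _ Z

theorem leftDiag_inv {d : HeisDiagram k A B} {d' : HeisDiagram k B A} {Z : C}
    (h : HeisDiagram.Rel (d'.comp d) (.id _)) {e : (leftWord F A).obj Z ⟶ (leftWord F B).obj Z}
    (h' : leftDiag F d Z = e) : leftDiag F d' Z ≫ e = 𝟙 _ := by
  rw [← h', ← leftDiag_comp, leftDiag_eq h, leftDiag_id]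

theorem rightDiag_inv {d : HeisDiagram k A B} {d' : HeisDiagram k B A} {Z : C}
    (h : HeisDiagram.Rel (d'.comp d) (.id _)) {e : (rightWord F A).obj Z ⟶ (rightWord F B).obj Z}
    (h' : rightDiag F d Z = e) : rightDiag F d' Z ≫ e = 𝟙 _ := by
  rw [← h', ← rightDiag_comp, rightDiag_eq h, rightDiag_id]

theorem leftDiag_assocInv (Z : C) : leftDiag F (.assocInv A₁ A₂ A₃) Z = 𝟙 _ :=
  (Category.comp_id _).symm.trans (leftDiag_inv F (.assoc_inv_hom _ _ _) (leftDiag_assocHom F Z))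

theorem rightDiag_assocInv (Z : C) : rightDiag F (.assocInv A₁ A₂ A₃) Z = 𝟙 _ :=
  (Category.comp_id _).symm.trans (rightDiag_inv F (.assoc_inv_hom _ _ _) (rightDiag_assocHom F Z))

theorem leftDiag_leftInv (Z : C) : leftDiag F (.leftInv A) Z = 𝟙 _ :=
  (Category.comp_id _).symm.trans (leftDiag_inv F (.left_inv_hom _) (leftDiag_leftHom F Z))

theorem rightDiag_leftInv (Z : C) : rightDiag F (.leftInv A) Z = 𝟙 _ :=
  (Category.comp_id _).symm.trans (rightDiag_inv F (.left_inv_hom _) (rightDiag_leftHom F Z))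

theorem leftDiag_rightInv (Z : C) : leftDiag F (.rightInv A) Z = 𝟙 _ :=
  (Category.comp_id _).symm.trans (leftDiag_inv F (.right_inv_hom _) (leftDiag_rightHom F Z))

theorem rightDiag_rightInv (Z : C) : rightDiag F (.rightInv A) Z = 𝟙 _ :=
  (Category.comp_id _).symm.trans (rightDiag_inv F (.right_inv_hom _) (rightDiag_rightHom F Z))

theorem leftDiag_naturality (d : HeisDiagram k A B) {Z Z' : C} (g : Z ⟶ Z') :
    (leftWord F A).map g ≫ leftDiag F d Z' = leftDiag F d Z ≫ (leftWord F B).map g :=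
  leftMap_naturality F _ g

theorem rightDiag_naturality (d : HeisDiagram k A B) {Z Z' : C} (g : Z ⟶ Z') :
    (rightWord F A).map g ≫ rightDiag F d Z' = rightDiag F d Z ≫ (rightWord F B).map g :=
  rightMap_naturality F _ g

variable [Preadditive C] [MonoidalPreadditive C]

theorem leftDiag_add [F.Additive] (d d' : HeisDiagram k A B) (Z : C) :
    leftDiag F (d.add d') Z = leftDiag F d Z + leftDiag F d' Z := by
  have h : F.map (ofDiagram (d.add d')) = F.map (ofDiagram d) + F.map (ofDiagram d') :=
    F.map_add (f := ofDiagram d) (g := ofDiagram d')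
  simp [leftDiag, leftMap, h]

theorem rightDiag_add [F.Additive] (d d' : HeisDiagram k A B) (Z : C) :
    rightDiag F (d.add d') Z = rightDiag F d Z + rightDiag F d' Z := by
  have h : F.map (ofDiagram (d.add d')) = F.map (ofDiagram d) + F.map (ofDiagram d') :=
    F.map_add (f := ofDiagram d) (g := ofDiagram d')
  simp [rightDiag, rightMap, h]

variable [Linear k C] [MonoidalLinear k C]

theorem leftDiag_smul [F.Linear k] (r : k) (d : HeisDiagram k A B) (Z : C) :
    leftDiag F (d.smul r) Z = r • leftDiag F d Z := by
  have h : F.map (ofDiagram (d.smul r)) = r • F.map (ofDiagram d) := F.map_smul r (ofDiagram d)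
  simp [leftDiag, leftMap, h]

theorem rightDiag_smul [F.Linear k] (r : k) (d : HeisDiagram k A B) (Z : C) :
    rightDiag F (d.smul r) Z = r • rightDiag F d Z := by
  have h : F.map (ofDiagram (d.smul r)) = r • F.map (ofDiagram d) := F.map_smul r (ofDiagram d)
  simp [rightDiag, rightMap, h]

end WordAction

end Heis

namespace Heis

open CoxeterRelations

theorem perm_induction {n : ℕ} {motive : Equiv.Perm (Fin n) → Prop} (σ : Equiv.Perm (Fin n))
    (one : motive 1) (mul : ∀ σ τ, motive σ → motive τ → motive (σ * τ))
    (swap : ∀ i, i + 1 < n → motive (simpleSwap n i)) : motive σ := by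
  cases n with
  | zero => rwa [Subsingleton.elim σ 1]
  | succ n =>
    have h : σ ∈ (⊤ : Submonoid (Equiv.Perm (Fin (n + 1)))) := Submonoid.mem_top σ
    rw [← Equiv.Perm.mclosure_swap_castSucc_succ] at h
    induction h using Submonoid.closure_induction with
    | one => exact one
    | mul σ τ _ _ hσ hτ => exact mul σ τ hσ hτ
    | mem σ h =>
      obtain ⟨i, rfl⟩ := h
      have h := swap i (by omega)
      rwa [simpleSwap, dif_pos (by omega)] at h

theorem fixLast_simpleSwap {n i : ℕ} (h : i + 1 < n) :
    fixLast n (simpleSwap n i) = simpleSwap (n + 1) i := by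
  ext x
  refine Fin.lastCases ?_ (fun x ↦ ?_) x
  · rw [fixLast_last, simpleSwap_apply_val _ _ (by omega), Fin.val_last]
    split_ifs <;> omega
  · rw [fixLast_castSucc, simpleSwap_apply_val _ _ (by omega), Fin.val_castSucc,
      simpleSwap_apply_val _ _ h, Fin.val_castSucc]

theorem fixFirst_simpleSwap {n i : ℕ} (h : i + 1 < n) :
    fixFirst n (simpleSwap n i) = simpleSwap (n + 1) (i + 1) := by
  ext x
  refine Fin.cases ?_ (fun x ↦ ?_) x
  · rw [fixFirst_zero, simpleSwap_apply_val _ _ (by omega), Fin.val_zero]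
    split_ifs <;> omega
  · rw [fixFirst_succ, simpleSwap_apply_val _ _ (by omega), Fin.val_succ,
      simpleSwap_apply_val _ _ h, Fin.val_succ]
    split_ifs <;> omega

/-- The permutation that reverses the order. -/
abbrev rev (n : ℕ) : Equiv.Perm (Fin n) := Fin.revPerm

theorem rev_mul_rev (n : ℕ) : rev n * rev n = 1 := by
  ext x
  simp

theorem rev_conj_fixLast {n : ℕ} (σ : Equiv.Perm (Fin n)) :
    rev (n + 1) * fixLast n σ * rev (n + 1) = fixFirst n (rev n * σ * rev n) := by
  ext x
  refine Fin.cases ?_ (fun x ↦ ?_) x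
  · rw [fixFirst_zero]
    simp only [Equiv.Perm.mul_apply, Fin.revPerm_apply, Fin.rev_zero, fixLast_last, Fin.rev_last]
  · rw [fixFirst_succ]
    simp only [Equiv.Perm.mul_apply, Fin.revPerm_apply, Fin.rev_succ, fixLast_castSucc,
      Fin.rev_castSucc]

theorem rev_conj_swapLast (n : ℕ) : rev (n + 2) * swapLast n * rev (n + 2) = simpleSwap (n + 2) 0 := by
  ext x
  simp only [Equiv.Perm.mul_apply, Fin.revPerm_apply, Fin.val_rev]
  rw [simpleSwap_apply_val _ _ (by omega), simpleSwap_apply_val _ _ (by omega), Fin.val_rev]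
  have := x.2
  split_ifs <;> omega

theorem fixLast_rev_mul_rev (n : ℕ) : fixLast n (rev n) * rev (n + 1) * lastToFirst n = 1 := by
  ext x
  refine Fin.lastCases ?_ (fun x ↦ ?_) x
  · rw [Equiv.Perm.mul_apply, lastToFirst_last, Equiv.Perm.mul_apply, Fin.revPerm_apply,
      Fin.rev_zero, fixLast_last]
    rfl
  · rw [Equiv.Perm.mul_apply, lastToFirst_castSucc, Equiv.Perm.mul_apply, Fin.revPerm_apply,
      Fin.rev_succ, fixLast_castSucc, Fin.revPerm_apply, Fin.rev_rev]
    rfl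

section TensorPow

universe v₁ u₁

variable {V : Type u₁} [Category.{v₁} V] [MonoidalCategory V] {X : V} {c : X ⊗ X ⟶ X ⊗ X}

theorem lastCross_naturality (c : X ⊗ X ⟶ X ⊗ X) {W W' : V} (f : W ⟶ W') :
    f ▷ X ▷ X ≫ lastCross c W' = lastCross c W ≫ f ▷ X ▷ X := by
  simp only [lastCross, associator_naturality_left_assoc, Category.assoc,
    ← whisker_exchange_assoc, associator_inv_naturality_left]

theorem permHom_mul (h : IsSymmetry c) (n : ℕ) (σ τ : Equiv.Perm (Fin n)) :
    (permHom h n (σ * τ) : tensorPow X n ⟶ tensorPow X n) = permHom h n τ ≫ permHom h n σ :=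
  map_mul (permHom h n) σ τ

theorem permHom_one (h : IsSymmetry c) (n : ℕ) :
    (permHom h n 1 : tensorPow X n ⟶ tensorPow X n) = 𝟙 _ :=
  map_one (permHom h n)

theorem permHom_simpleSwap (h : IsSymmetry c) (n i : ℕ) (hi : i + 1 < n) :
    (permHom h n (simpleSwap n i) : tensorPow X n ⟶ tensorPow X n) = crossAt c n i :=
  (h.crossAt_relations n).lift_simpleSwap i hi

theorem permHom_swapLast (h : IsSymmetry c) (n : ℕ) :
    (permHom h (n + 2) (swapLast n) : tensorPow X (n + 2) ⟶ tensorPow X (n + 2)) =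
      lastCross c (tensorPow X n) :=
  (permHom_simpleSwap h (n + 2) n (by omega)).trans (crossAt_last c n)

theorem permHom_fixLast (h : IsSymmetry c) {n : ℕ} (σ : Equiv.Perm (Fin n)) :
    (permHom h (n + 1) (fixLast n σ) : tensorPow X (n + 1) ⟶ tensorPow X (n + 1)) =
      permHom h n σ ▷ X := by
  induction σ using perm_induction with
  | one => rw [map_one, permHom_one, permHom_one, id_whiskerRight]; rfl
  | mul σ τ hσ hτ => rw [map_mul, permHom_mul, hσ, hτ, permHom_mul, comp_whiskerRight]; rfl
  | swap i hi =>
    rw [fixLast_simpleSwap hi, permHom_simpleSwap h _ _ (by omega), permHom_simpleSwap h _ _ hi,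
      crossAt_succ c n i hi]

theorem tensorPowShift_succ_hom (n : ℕ) : (tensorPowShift X (n + 1)).hom =
    (tensorPowShift X n).hom ▷ X ≫ (α_ X (tensorPow X n) X).hom := rfl

theorem shift_lastCross (c : X ⊗ X ⟶ X ⊗ X) {W W' : V} (s : W ⟶ X ⊗ W') :
    lastCross c W ≫ (s ▷ X ≫ (α_ X W' X).hom) ▷ X ≫ (α_ X (W' ⊗ X) X).hom =
      ((s ▷ X ≫ (α_ X W' X).hom) ▷ X ≫ (α_ X (W' ⊗ X) X).hom) ≫ X ◁ lastCross c W' := by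
  rw [comp_whiskerRight, Category.assoc, Category.assoc, Category.assoc,
    ← reassoc_of% lastCross_naturality c s]
  simp [lastCross]

theorem shift_whiskerRight {W W' : V} {f : W ⟶ W} {g : W' ⟶ W'} {s : W ⟶ X ⊗ W'}
    (h : f ≫ s = s ≫ X ◁ g) :
    f ▷ X ≫ s ▷ X ≫ (α_ X W' X).hom = (s ▷ X ≫ (α_ X W' X).hom) ≫ X ◁ g ▷ X := by
  rw [← comp_whiskerRight_assoc, h, comp_whiskerRight, Category.assoc, Category.assoc,
    associator_naturality_middle]

theorem crossAt_shift (c : X ⊗ X ⟶ X ⊗ X) (n i : ℕ) (hi : i + 1 < n) :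
    crossAt c (n + 1) (i + 1) ≫ (tensorPowShift X n).hom =
      (tensorPowShift X n).hom ≫ X ◁ crossAt c n i := by
  induction n with
  | zero => omega
  | succ n ih =>
    rcases Nat.lt_or_ge (i + 1) n with h' | h'
    · rw [crossAt_succ c (n + 1) (i + 1) (by omega), crossAt_succ c n i h', tensorPowShift_succ_hom]
      exact shift_whiskerRight (ih h')
    · obtain rfl : n = i + 1 := by omega
      rw [crossAt_last, crossAt_last]
      exact shift_lastCross c (tensorPowShift X i).hom

theorem permHom_shift (h : IsSymmetry c) {n : ℕ} (σ : Equiv.Perm (Fin n)) :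
    permHom h (n + 1) (fixFirst n σ) ≫ (tensorPowShift X n).hom =
      (tensorPowShift X n).hom ≫ X ◁ permHom h n σ := by
  induction σ using perm_induction with
  | one =>
    rw [map_one, permHom_one, permHom_one, MonoidalCategory.whiskerLeft_id, Category.id_comp,
      Category.comp_id]
  | mul σ τ hσ hτ =>
    rw [map_mul, permHom_mul, permHom_mul, MonoidalCategory.whiskerLeft_comp, Category.assoc, hσ,
      ← Category.assoc, hτ, Category.assoc]
  | swap i hi =>
    rw [fixFirst_simpleSwap hi, permHom_simpleSwap h _ _ (by omega), permHom_simpleSwap h _ _ hi,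
      crossAt_shift c n i hi]

theorem shift_shift_whiskerRight {W W' W'' : V} {f : W ⟶ W} {c : X ⊗ X ⟶ X ⊗ X} {s : W ⟶ X ⊗ W'}
    {s' : W' ⟶ X ⊗ W''}
    (h : f ≫ s ≫ X ◁ s' = s ≫ X ◁ s' ≫ (α_ X X W'').inv ≫ c ▷ W'' ≫ (α_ X X W'').hom) :
    f ▷ X ≫ (s ▷ X ≫ (α_ X W' X).hom) ≫ X ◁ (s' ▷ X ≫ (α_ X W'' X).hom) =
      (s ▷ X ≫ (α_ X W' X).hom) ≫ X ◁ (s' ▷ X ≫ (α_ X W'' X).hom) ≫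
        (α_ X X (W'' ⊗ X)).inv ≫ c ▷ (W'' ⊗ X) ≫ (α_ X X (W'' ⊗ X)).hom := by
  have h' := congrArg (· ▷ X ≫ (α_ _ _ _).hom ≫ X ◁ (α_ _ _ _).hom) h
  simp only [comp_whiskerRight, Category.assoc] at h'
  simp only [MonoidalCategory.whiskerLeft_comp, Category.assoc,
    ← associator_naturality_middle_assoc, h']
  simp

theorem crossAt_zero_shift (c : X ⊗ X ⟶ X ⊗ X) (n : ℕ) :
    crossAt c (n + 2) 0 ≫ (tensorPowShift X (n + 1)).hom ≫ X ◁ (tensorPowShift X n).hom =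
      (tensorPowShift X (n + 1)).hom ≫ X ◁ (tensorPowShift X n).hom ≫
        (α_ X X (tensorPow X n)).inv ≫ c ▷ tensorPow X n ≫ (α_ X X (tensorPow X n)).hom := by
  induction n with
  | zero =>
    rw [crossAt_last]
    change lastCross c (𝟙_ V) ≫ (((λ_ X).hom ≫ (ρ_ X).inv) ▷ X ≫ (α_ X (𝟙_ V) X).hom) ≫
      X ◁ ((λ_ X).hom ≫ (ρ_ X).inv) = (((λ_ X).hom ≫ (ρ_ X).inv) ▷ X ≫ (α_ X (𝟙_ V) X).hom) ≫
      X ◁ ((λ_ X).hom ≫ (ρ_ X).inv) ≫ (α_ X X (𝟙_ V)).inv ≫ c ▷ (𝟙_ V) ≫ (α_ X X (𝟙_ V)).hom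
    simp [lastCross]
  | succ n ih =>
    rw [crossAt_succ c (n + 2) 0 (by omega)]
    exact shift_shift_whiskerRight ih

end TensorPow

end Heis

namespace Heis

open HeisDiag

section Rotation

universe v₁ u₁

variable {C : Type u₁} [Category.{v₁} C] {X Y : C ⥤ C} {c : ∀ Z, X.obj (X.obj Z) ⟶ X.obj (X.obj Z)}
  {us : ∀ Z, Y.obj (X.obj Z) ⟶ X.obj (Y.obj Z)} {sw : ∀ Z, X.obj (Y.obj Z) ⟶ Y.obj (X.obj Z)}
  {cu : ∀ Z, Z ⟶ X.obj (Y.obj Z)} {ca : ∀ Z, X.obj (Y.obj Z) ⟶ Z}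
  {ln : ∀ Z, Y.obj (X.obj Z) ⟶ Z} {cl : ∀ Z, Z ⟶ Y.obj (X.obj Z)} (Z : C)

theorem cup_us_of_rotation
    (us_naturality : ∀ {Z W : C} (f : Z ⟶ W), Y.map (X.map f) ≫ us W = us Z ≫ X.map (Y.map f))
    (cu_naturality : ∀ {Z W : C} (f : Z ⟶ W), f ≫ cu W = cu Z ≫ X.map (Y.map f))
    (cu_ln : ∀ Z, Y.map (cu Z) ≫ ln (Y.obj Z) = 𝟙 _)
    (c_eq : ∀ Z, c Z = cu (X.obj (X.obj Z)) ≫ X.map (us (X.obj Z)) ≫ X.map (X.map (ln Z))) :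
    cu (X.obj Z) ≫ X.map (us Z) = X.map (cu Z) ≫ c (Y.obj Z) := by
  rw [c_eq, reassoc_of% (cu_naturality (X.map (cu Z))), ← X.map_comp_assoc, us_naturality,
    X.map_comp, Category.assoc, ← X.map_comp (X.map (Y.map _)), ← X.map_comp (Y.map _), cu_ln]
  simp only [CategoryTheory.Functor.map_id, Category.comp_id]

theorem sw_cap_of_rotation
    (sw_naturality : ∀ {Z W : C} (f : Z ⟶ W), X.map (Y.map f) ≫ sw W = sw Z ≫ Y.map (X.map f))
    (ca_naturality : ∀ {Z W : C} (f : Z ⟶ W), X.map (Y.map f) ≫ ca W = ca Z ≫ f)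
    (cl_ca : ∀ Z, cl (Y.obj Z) ≫ Y.map (ca Z) = 𝟙 _)
    (c_eq : ∀ Z, c Z = X.map (X.map (cl Z)) ≫ X.map (sw (X.obj Z)) ≫ ca (X.obj (X.obj Z))) :
    X.map (sw Z) ≫ ca (X.obj Z) = c (Y.obj Z) ≫ X.map (ca Z) := by
  rw [c_eq, Category.assoc, Category.assoc, ← ca_naturality, ← X.map_comp_assoc (sw _), ← sw_naturality,
    X.map_comp, Category.assoc, ← X.map_comp_assoc, ← X.map_comp, cl_ca]
  simp only [CategoryTheory.Functor.map_id, Category.id_comp]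

theorem cup_us_of_eq (cu_naturality : ∀ {Z W : C} (f : Z ⟶ W), f ≫ cu W = cu Z ≫ X.map (Y.map f))
    (cu_ln : ∀ Z, cu (X.obj Z) ≫ X.map (ln Z) = 𝟙 _)
    (us_eq : us Z = Y.map (X.map (cu Z)) ≫ Y.map (c (Y.obj Z)) ≫ ln (X.obj (Y.obj Z))) :
    cu (X.obj Z) ≫ X.map (us Z) = X.map (cu Z) ≫ c (Y.obj Z) := by
  have h := cu_naturality (X.map (cu Z) ≫ c (Y.obj Z))
  rw [Functor.map_comp, Functor.map_comp] at h
  rw [us_eq, Functor.map_comp, Functor.map_comp, ← reassoc_of% h, cu_ln, Category.comp_id]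

theorem sw_cap_of_eq (ca_naturality : ∀ {Z W : C} (f : Z ⟶ W), X.map (Y.map f) ≫ ca W = ca Z ≫ f)
    (cl_ca : ∀ Z, X.map (cl Z) ≫ ca (X.obj Z) = 𝟙 _)
    (sw_eq : sw Z = cl (X.obj (Y.obj Z)) ≫ Y.map (c (Y.obj Z)) ≫ Y.map (X.map (ca Z))) :
    X.map (sw Z) ≫ ca (X.obj Z) = c (Y.obj Z) ≫ X.map (ca Z) := by
  have h := ca_naturality (c (Y.obj Z) ≫ X.map (ca Z))
  rw [Functor.map_comp, Functor.map_comp, Category.assoc] at h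
  rw [sw_eq, Functor.map_comp, Functor.map_comp, Category.assoc, Category.assoc, h,
    reassoc_of% (cl_ca _)]

end Rotation

section WordAction

universe v₁ u₁

section

variable {k : Type u} [CommRing k] {C : Type u₁} [Category.{v₁} C] [MonoidalCategory C]
  (F : HeisDiag k ⥤ C)

theorem leftWord_tensor (A B : HeisWord) :
    leftWord F (A.tensor B) = leftWord F B ⋙ leftWord F A := rfl

theorem leftWord_unit : leftWord F .unit = 𝟭 C := rfl

theorem rightWord_tensor (A B : HeisWord) :
    rightWord F (A.tensor B) = rightWord F A ⋙ rightWord F B := rfl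

theorem rightWord_unit : rightWord F .unit = 𝟭 C := rfl

end

variable {k : Type u} [CommRing k] {C : Type u₁} [Category.{v₁} C] [MonoidalCategory C]
  (F : HeisDiag k ⥤ C) [F.Monoidal] (Z : C)

theorem leftDiag_crossUD_crossDU : leftDiag F .crossUD Z ≫ leftDiag F .crossDU Z = 𝟙 _ := by
  have h := leftDiag_eq (F := F) .up_down Z
  rwa [leftDiag_comp, leftDiag_id] at h

theorem leftDiag_bubble : leftDiag F .cupDU Z ≫ leftDiag F .capDU Z = 𝟙 _ := by
  have h := leftDiag_eq (F := F) .bubble Z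
  rwa [leftDiag_comp, leftDiag_id] at h

theorem leftDiag_cupDU_capUD : (leftWord F .up).map (leftDiag F .cupDU Z) ≫ leftDiag F .capUD ((leftWord F .up).obj Z) = 𝟙 _ := by
  have h := leftDiag_eq (F := F) .zigzag_up_right Z
  simp only [leftDiag_comp, leftDiag_whiskerLeft, leftDiag_whiskerRight, leftDiag_id, leftDiag_assocInv, leftDiag_rightInv,
    leftDiag_leftHom] at h
  dsimp only [leftWord_tensor, leftWord_unit, Functor.comp_obj, Functor.comp_map, Functor.id_obj,
    Functor.id_map] at h
  simp only [Category.id_comp] at h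
  exact (congrArg (_ ≫ ·) (Category.comp_id _)).symm.trans h

theorem leftDiag_cupUD_capDU : leftDiag F .cupUD ((leftWord F .up).obj Z) ≫ (leftWord F .up).map (leftDiag F .capDU Z) = 𝟙 _ := by
  have h := leftDiag_eq (F := F) .zigzag_up_left Z
  simp only [leftDiag_comp, leftDiag_whiskerLeft, leftDiag_whiskerRight, leftDiag_leftInv,
    leftDiag_assocHom, leftDiag_rightHom, leftDiag_id] at h
  dsimp only [leftWord_tensor, leftWord_unit, Functor.comp_obj, Functor.comp_map, Functor.id_obj,
    Functor.id_map] at h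
  simp only [Category.id_comp, Category.comp_id] at h
  exact h

theorem leftDiag_crossDown : leftDiag F HeisDiagram.crossDown Z = (leftWord F (.tensor .down .down)).map (leftDiag F .cupUD Z) ≫ (leftWord F .down).map (leftDiag F .crossDU ((leftWord F .down).obj Z)) ≫ leftDiag F .capDU ((leftWord F (.tensor .down .down)).obj Z) := by
  rw [HeisDiagram.crossDown]
  simp only [leftDiag_comp, leftDiag_whiskerLeft, leftDiag_whiskerRight, leftDiag_assocHom, leftDiag_assocInv, leftDiag_rightInv,
    leftDiag_leftHom]
  dsimp only [leftWord_tensor, leftWord_unit, Functor.comp_obj, Functor.comp_map, Functor.id_obj,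
    Functor.id_map]
  simp only [Category.id_comp, CategoryTheory.Functor.map_id]
  exact congrArg (_ ≫ ·) (congrArg (_ ≫ ·) (Category.comp_id _))

theorem leftDiag_crossDown' : leftDiag F HeisDiagram.crossDown' Z = leftDiag F .cupDU ((leftWord F (.tensor .down .down)).obj Z) ≫ (leftWord F .down).map (leftDiag F .crossUD ((leftWord F .down).obj Z)) ≫ (leftWord F (.tensor .down .down)).map (leftDiag F .capUD Z) := by
  rw [HeisDiagram.crossDown']
  simp only [leftDiag_comp, leftDiag_whiskerLeft, leftDiag_whiskerRight, leftDiag_leftInv,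
    leftDiag_assocHom, leftDiag_rightHom, leftDiag_assocInv]
  dsimp only [leftWord_tensor, leftWord_unit, Functor.comp_obj, Functor.comp_map, Functor.id_obj,
    Functor.id_map]
  simp only [Category.id_comp, Category.comp_id, CategoryTheory.Functor.map_id]

theorem rightDiag_crossUD_crossDU : rightDiag F .crossUD Z ≫ rightDiag F .crossDU Z = 𝟙 _ := by
  have h := rightDiag_eq (F := F) .up_down Z
  rwa [rightDiag_comp, rightDiag_id] at h

theorem rightDiag_bubble : rightDiag F .cupDU Z ≫ rightDiag F .capDU Z = 𝟙 _ := by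
  have h := rightDiag_eq (F := F) .bubble Z
  rwa [rightDiag_comp, rightDiag_id] at h

theorem rightDiag_cupDU_capUD : (rightWord F .down).map (rightDiag F .cupDU Z) ≫ rightDiag F .capUD ((rightWord F .down).obj Z) = 𝟙 _ := by
  have h := rightDiag_eq (F := F) .zigzag_down_left Z
  simp only [rightDiag_comp, rightDiag_whiskerLeft, rightDiag_whiskerRight, rightDiag_leftInv,
    rightDiag_assocHom, rightDiag_rightHom, rightDiag_id] at h
  dsimp only [rightWord_tensor, rightWord_unit, Functor.comp_obj, Functor.comp_map, Functor.id_obj,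
    Functor.id_map] at h
  simp only [Category.id_comp] at h
  exact (congrArg (_ ≫ ·) (Category.comp_id _)).symm.trans h

theorem rightDiag_cupUD_capDU : rightDiag F .cupUD ((rightWord F .down).obj Z) ≫ (rightWord F .down).map (rightDiag F .capDU Z) = 𝟙 _ := by
  have h := rightDiag_eq (F := F) .zigzag_down_right Z
  simp only [rightDiag_comp, rightDiag_whiskerLeft, rightDiag_whiskerRight, rightDiag_id, rightDiag_assocInv, rightDiag_rightInv,
    rightDiag_leftHom] at h
  dsimp only [rightWord_tensor, rightWord_unit, Functor.comp_obj, Functor.comp_map, Functor.id_obj,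
    Functor.id_map] at h
  simp only [Category.id_comp, Category.comp_id] at h
  exact h

theorem rightDiag_cupDU_capUD' : rightDiag F .cupDU ((rightWord F .up).obj Z) ≫ (rightWord F .up).map (rightDiag F .capUD Z) = 𝟙 _ := by
  have h := rightDiag_eq (F := F) .zigzag_up_right Z
  simp only [rightDiag_comp, rightDiag_whiskerLeft, rightDiag_whiskerRight, rightDiag_id, rightDiag_assocInv, rightDiag_rightInv,
    rightDiag_leftHom] at h
  dsimp only [rightWord_tensor, rightWord_unit, Functor.comp_obj, Functor.comp_map, Functor.id_obj,
    Functor.id_map] at h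
  simp only [Category.id_comp, Category.comp_id] at h
  exact h

theorem rightDiag_cupUD_capDU' : (rightWord F .up).map (rightDiag F .cupUD Z) ≫ rightDiag F .capDU ((rightWord F .up).obj Z) = 𝟙 _ := by
  have h := rightDiag_eq (F := F) .zigzag_up_left Z
  simp only [rightDiag_comp, rightDiag_whiskerLeft, rightDiag_whiskerRight, rightDiag_leftInv,
    rightDiag_assocHom, rightDiag_rightHom, rightDiag_id] at h
  dsimp only [rightWord_tensor, rightWord_unit, Functor.comp_obj, Functor.comp_map, Functor.id_obj,
    Functor.id_map] at h
  simp only [Category.id_comp] at h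
  exact (congrArg (_ ≫ ·) (Category.comp_id _)).symm.trans h

theorem rightDiag_crossDU : rightDiag F HeisDiagram.crossDU Z = rightDiag F .cupUD ((rightWord F (.tensor .down .up)).obj Z) ≫ (rightWord F .down).map (rightDiag F .cross ((rightWord F .down).obj Z)) ≫ (rightWord F (.tensor .up .down)).map (rightDiag F .capDU Z) := by
  rw [HeisDiagram.crossDU]
  simp only [rightDiag_comp, rightDiag_whiskerLeft, rightDiag_whiskerRight, rightDiag_assocHom, rightDiag_assocInv, rightDiag_rightInv,
    rightDiag_leftHom]
  dsimp only [rightWord_tensor, rightWord_unit, Functor.comp_obj, Functor.comp_map, Functor.id_obj,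
    Functor.id_map]
  simp only [Category.id_comp, Category.comp_id]

theorem rightDiag_crossUD : rightDiag F HeisDiagram.crossUD Z = (rightWord F (.tensor .up .down)).map (rightDiag F .cupDU Z) ≫ (rightWord F .down).map (rightDiag F .cross ((rightWord F .down).obj Z)) ≫ rightDiag F .capUD ((rightWord F (.tensor .down .up)).obj Z) := by
  rw [HeisDiagram.crossUD]
  simp only [rightDiag_comp, rightDiag_whiskerLeft, rightDiag_whiskerRight, rightDiag_leftInv,
    rightDiag_assocHom, rightDiag_rightHom, rightDiag_assocInv]
  dsimp only [rightWord_tensor, rightWord_unit, Functor.comp_obj, Functor.comp_map, Functor.id_obj,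
    Functor.id_map]
  simp only [Category.id_comp]
  exact congrArg (_ ≫ ·) (congrArg (_ ≫ ·) (Category.comp_id _))

variable [Preadditive C] [MonoidalPreadditive C] [F.Additive] [Linear k C] [MonoidalLinear k C]
  [F.Linear k]

theorem leftDiag_crossDU_crossUD : leftDiag F .crossDU Z ≫ leftDiag F .crossUD Z =
    𝟙 _ - leftDiag F .capDU Z ≫ leftDiag F .cupDU Z := by
  have h := leftDiag_eq (F := F) .down_up Z
  rw [leftDiag_comp, leftDiag_add, leftDiag_smul, leftDiag_id, leftDiag_comp, neg_one_smul] at h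
  rw [h, sub_eq_add_neg]

theorem rightDiag_crossDU_crossUD : rightDiag F .crossDU Z ≫ rightDiag F .crossUD Z =
    𝟙 _ - rightDiag F .capDU Z ≫ rightDiag F .cupDU Z := by
  have h := rightDiag_eq (F := F) .down_up Z
  rw [rightDiag_comp, rightDiag_add, rightDiag_smul, rightDiag_id, rightDiag_comp, neg_one_smul] at h
  rw [h, sub_eq_add_neg]

end WordAction

end Heis

namespace Heis

open Functor.Monoidal Functor.LaxMonoidal Functor.OplaxMonoidal

section Powers

universe v₁ u₁ v₂ u₂

variable {V : Type u₂} [Category.{v₂} V] [MonoidalCategory V] {C : Type u₁} [Category.{v₁} C]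
  [MonoidalCategory C] (F : V ⥤ C) [F.Monoidal] {x : V}

variable (x) in
/-- The left action of a power of an object is an iterate. -/
def leftPowIso : ∀ (n : ℕ) (Z : C),
    F.obj (tensorPow x n) ⊗ Z ≅ (powFunctor (tensorLeft (F.obj x)) n).obj Z
  | 0, Z => whiskerRightIso (εIso F).symm Z ≪≫ λ_ Z
  | n + 1, Z => whiskerRightIso (μIso F (tensorPow x n) x).symm Z ≪≫ α_ _ _ _ ≪≫
      leftPowIso n (F.obj x ⊗ Z)

variable (x) in
/-- The right action of a power of an object is an iterate. -/
def rightPowIso : ∀ (n : ℕ) (Z : C),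
    Z ⊗ F.obj (tensorPow x n) ≅ (powFunctor (tensorRight (F.obj x)) n).obj Z
  | 0, Z => whiskerLeftIso Z (εIso F).symm ≪≫ ρ_ Z
  | n + 1, Z => whiskerLeftIso Z (F.mapIso (tensorPowShift x n) ≪≫
      (μIso F x (tensorPow x n)).symm) ≪≫ (α_ _ _ _).symm ≪≫ rightPowIso n (Z ⊗ F.obj x)

theorem leftPowIso_naturality (n : ℕ) {Z Z' : C} (f : Z ⟶ Z') :
    F.obj (tensorPow x n) ◁ f ≫ (leftPowIso F x n Z').hom =
      (leftPowIso F x n Z).hom ≫ (powFunctor (tensorLeft (F.obj x)) n).map f := by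
  induction n generalizing Z Z' with
  | zero =>
    change F.obj (𝟙_ V) ◁ f ≫ η F ▷ Z' ≫ (λ_ Z').hom = (η F ▷ Z ≫ (λ_ Z).hom) ≫ f
    rw [whisker_exchange_assoc, leftUnitor_naturality, Category.assoc]
  | succ n ih =>
    have h := ih (F.obj x ◁ f)
    change F.obj (tensorPow x n ⊗ x) ◁ f ≫ δ F (tensorPow x n) x ▷ Z' ≫ (α_ _ _ _).hom ≫
      (leftPowIso F x n (F.obj x ⊗ Z')).hom = (δ F (tensorPow x n) x ▷ Z ≫ (α_ _ _ _).hom ≫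
      (leftPowIso F x n (F.obj x ⊗ Z)).hom) ≫ (powFunctor (tensorLeft (F.obj x)) n).map (F.obj x ◁ f)
    rw [whisker_exchange_assoc, tensor_whiskerLeft_assoc, Iso.inv_hom_id_assoc, h, Category.assoc,
      Category.assoc]

theorem rightPowIso_naturality (n : ℕ) {Z Z' : C} (f : Z ⟶ Z') :
    f ▷ F.obj (tensorPow x n) ≫ (rightPowIso F x n Z').hom =
      (rightPowIso F x n Z).hom ≫ (powFunctor (tensorRight (F.obj x)) n).map f := by
  induction n generalizing Z Z' with
  | zero =>
    change f ▷ F.obj (𝟙_ V) ≫ Z' ◁ η F ≫ (ρ_ Z').hom = (Z ◁ η F ≫ (ρ_ Z).hom) ≫ f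
    rw [← whisker_exchange_assoc, rightUnitor_naturality, Category.assoc]
  | succ n ih =>
    have h := ih (f ▷ F.obj x)
    change f ▷ F.obj (tensorPow x n ⊗ x) ≫ (Z' ◁ (F.map (tensorPowShift x n).hom ≫
      δ F x (tensorPow x n)) ≫ (α_ _ _ _).inv ≫ (rightPowIso F x n (Z' ⊗ F.obj x)).hom) =
      (Z ◁ (F.map (tensorPowShift x n).hom ≫ δ F x (tensorPow x n)) ≫ (α_ _ _ _).inv ≫
      (rightPowIso F x n (Z ⊗ F.obj x)).hom) ≫
        (powFunctor (tensorRight (F.obj x)) n).map (f ▷ F.obj x)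
    rw [← whisker_exchange_assoc, whiskerRight_tensor_assoc, Iso.hom_inv_id_assoc, h]
    simp only [Category.assoc]
    rfl

/-- The action of an endomorphism of a power on the left. -/
def leftAct {n : ℕ} (g : tensorPow x n ⟶ tensorPow x n) (Z : C) :
    End ((powFunctor (tensorLeft (F.obj x)) n).obj Z) :=
  (leftPowIso F x n Z).inv ≫ F.map g ▷ Z ≫ (leftPowIso F x n Z).hom

/-- The action of an endomorphism of a power on the right. -/
def rightAct {n : ℕ} (g : tensorPow x n ⟶ tensorPow x n) (Z : C) :
    End ((powFunctor (tensorRight (F.obj x)) n).obj Z) :=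
  (rightPowIso F x n Z).inv ≫ Z ◁ F.map g ≫ (rightPowIso F x n Z).hom

theorem leftAct_naturality {n : ℕ} (g : tensorPow x n ⟶ tensorPow x n) {Z W : C} (f : Z ⟶ W) :
    (powFunctor (tensorLeft (F.obj x)) n).map f ≫ leftAct F g W =
      leftAct F g Z ≫ (powFunctor (tensorLeft (F.obj x)) n).map f := by
  rw [leftAct, leftAct, ← cancel_epi (leftPowIso F x n Z).hom]
  simp only [Category.assoc, Iso.hom_inv_id_assoc]
  rw [← leftPowIso_naturality, ← reassoc_of% leftPowIso_naturality F n f, Iso.hom_inv_id_assoc,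
    whisker_exchange_assoc]

theorem rightAct_naturality {n : ℕ} (g : tensorPow x n ⟶ tensorPow x n) {Z W : C} (f : Z ⟶ W) :
    (powFunctor (tensorRight (F.obj x)) n).map f ≫ rightAct F g W =
      rightAct F g Z ≫ (powFunctor (tensorRight (F.obj x)) n).map f := by
  rw [rightAct, rightAct, ← cancel_epi (rightPowIso F x n Z).hom]
  simp only [Category.assoc, Iso.hom_inv_id_assoc]
  rw [← rightPowIso_naturality, ← reassoc_of% rightPowIso_naturality F n f, Iso.hom_inv_id_assoc,
    whisker_exchange_assoc]

theorem leftAct_id (n : ℕ) (Z : C) : leftAct F (𝟙 (tensorPow x n)) Z = 𝟙 _ := by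
  simp [leftAct]

theorem rightAct_id (n : ℕ) (Z : C) : rightAct F (𝟙 (tensorPow x n)) Z = 𝟙 _ := by
  simp [rightAct]

theorem leftAct_comp {n : ℕ} (f g : tensorPow x n ⟶ tensorPow x n) (Z : C) :
    leftAct F (f ≫ g) Z = leftAct F f Z ≫ leftAct F g Z := by
  simp [leftAct]

theorem rightAct_comp {n : ℕ} (f g : tensorPow x n ⟶ tensorPow x n) (Z : C) :
    rightAct F (f ≫ g) Z = rightAct F f Z ≫ rightAct F g Z := by
  simp [rightAct]

theorem leftAct_whiskerRight {n : ℕ} (g : tensorPow x n ⟶ tensorPow x n) (Z : C) :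
    leftAct F (n := n + 1) (g ▷ x) Z = leftAct F g (F.obj x ⊗ Z) := by
  refine (Iso.inv_comp_eq _).2 ?_
  have h : (leftPowIso F x n (F.obj x ⊗ Z)).hom ≫ leftAct F g (F.obj x ⊗ Z) =
      F.map g ▷ (F.obj x ⊗ Z) ≫ (leftPowIso F x n (F.obj x ⊗ Z)).hom := Iso.hom_inv_id_assoc _ _
  change F.map (g ▷ x) ▷ Z ≫ δ F (tensorPow x n) x ▷ Z ≫ (α_ _ _ _).hom ≫
    (leftPowIso F x n (F.obj x ⊗ Z)).hom = (δ F (tensorPow x n) x ▷ Z ≫ (α_ _ _ _).hom ≫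
    (leftPowIso F x n (F.obj x ⊗ Z)).hom) ≫ leftAct F g (F.obj x ⊗ Z)
  rw [Category.assoc, Category.assoc, h, ← comp_whiskerRight_assoc, ← δ_natural_left,
    comp_whiskerRight_assoc, associator_naturality_left_assoc]

theorem map_lastCross (c : x ⊗ x ⟶ x ⊗ x) (W : V) :
    F.map (lastCross c W) ≫ δ F (W ⊗ x) x ≫ δ F W x ▷ F.obj x =
      δ F (W ⊗ x) x ≫ δ F W x ▷ F.obj x ≫ (α_ _ _ _).hom ≫
        F.obj W ◁ (μ F x x ≫ F.map c ≫ δ F x x) ≫ (α_ _ _ _).inv := by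
  simp only [lastCross, F.map_comp, map_associator, map_associator_inv, map_whiskerLeft,
    Category.assoc, μ_δ_assoc, MonoidalCategory.whiskerLeft_comp, whiskerRight_μ_δ,
    Category.comp_id]

theorem map_firstCross (c : x ⊗ x ⟶ x ⊗ x) (W : V) :
    F.map ((α_ x x W).inv ≫ c ▷ W ≫ (α_ x x W).hom) ≫ δ F x (x ⊗ W) ≫ F.obj x ◁ δ F x W =
      δ F x (x ⊗ W) ≫ F.obj x ◁ δ F x W ≫ (α_ _ _ _).inv ≫
        (μ F x x ≫ F.map c ≫ δ F x x) ▷ F.obj W ≫ (α_ _ _ _).hom := by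
  simp only [F.map_comp, map_associator, map_associator_inv, map_whiskerRight,
    Category.assoc, μ_δ_assoc, comp_whiskerRight, whiskerLeft_μ_δ, Category.comp_id]

theorem map_comp_shift {W W' : V} {f : W ⟶ W} {g : W' ⟶ W'} {s : W ⟶ x ⊗ W'}
    (hf : f ≫ s = s ≫ x ◁ g) {Z R : C} {r : (Z ⊗ F.obj x) ⊗ F.obj W' ⟶ R} {a : R ⟶ R}
    (h : r ≫ a = (Z ⊗ F.obj x) ◁ F.map g ≫ r) :
    Z ◁ F.map f ≫ Z ◁ (F.map s ≫ δ F x W') ≫ (α_ _ _ _).inv ≫ r =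
      (Z ◁ (F.map s ≫ δ F x W') ≫ (α_ _ _ _).inv ≫ r) ≫ a := by
  have h1 : F.map f ≫ F.map s ≫ δ F x W' = F.map s ≫ δ F x W' ≫ F.obj x ◁ F.map g := by
    rw [← F.map_comp_assoc, hf, F.map_comp_assoc, ← δ_natural_right]
  rw [Category.assoc, Category.assoc, h, ← MonoidalCategory.whiskerLeft_comp_assoc, h1,
    ← Category.assoc (F.map s), MonoidalCategory.whiskerLeft_comp_assoc, tensor_whiskerLeft_assoc,
    Iso.inv_hom_id_assoc]

theorem map_lastCross_comp (c : x ⊗ x ⟶ x ⊗ x) {W : V} {Z R : C}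
    {r : F.obj W ⊗ F.obj x ⊗ F.obj x ⊗ Z ⟶ R} {a : R ⟶ R}
    (h : F.obj W ◁ ((α_ _ _ _).inv ≫ μ F x x ▷ Z ≫ F.map c ▷ Z ≫ δ F x x ▷ Z ≫ (α_ _ _ _).hom) ≫ r =
      r ≫ a) :
    F.map (lastCross c W) ▷ Z ≫ δ F (W ⊗ x) x ▷ Z ≫ (α_ _ _ _).hom ≫ δ F W x ▷ (F.obj x ⊗ Z) ≫
        (α_ _ _ _).hom ≫ r =
      (δ F (W ⊗ x) x ▷ Z ≫ (α_ _ _ _).hom ≫ δ F W x ▷ (F.obj x ⊗ Z) ≫ (α_ _ _ _).hom ≫ r) ≫ a := by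
  have h1 := congrArg (· ▷ Z) (map_lastCross F c W)
  simp only [comp_whiskerRight] at h1
  simp only [Category.assoc, ← h]
  rw [← associator_naturality_left_assoc, reassoc_of% h1]
  simp

theorem map_firstCross_comp {c : x ⊗ x ⟶ x ⊗ x} {W W' W'' : V} {f : W ⟶ W} {s : W ⟶ x ⊗ W'}
    {s' : W' ⟶ x ⊗ W''}
    (hf : f ≫ s ≫ x ◁ s' = s ≫ x ◁ s' ≫ (α_ x x W'').inv ≫ c ▷ W'' ≫ (α_ x x W'').hom) {Z R : C}
    {r : ((Z ⊗ F.obj x) ⊗ F.obj x) ⊗ F.obj W'' ⟶ R} {a : R ⟶ R}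
    (h : ((α_ _ _ _).hom ≫ Z ◁ μ F x x ≫ Z ◁ F.map c ≫ Z ◁ δ F x x ≫ (α_ _ _ _).inv) ▷ F.obj W'' ≫
      r = r ≫ a) :
    Z ◁ F.map f ≫ Z ◁ (F.map s ≫ δ F x W') ≫ (α_ _ _ _).inv ≫
        (Z ⊗ F.obj x) ◁ (F.map s' ≫ δ F x W'') ≫ (α_ _ _ _).inv ≫ r =
      (Z ◁ (F.map s ≫ δ F x W') ≫ (α_ _ _ _).inv ≫
        (Z ⊗ F.obj x) ◁ (F.map s' ≫ δ F x W'') ≫ (α_ _ _ _).inv ≫ r) ≫ a := by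
  have h1 : F.map f ≫ F.map s ≫ δ F x W' ≫ F.obj x ◁ (F.map s' ≫ δ F x W'') =
      F.map s ≫ δ F x W' ≫ F.obj x ◁ (F.map s' ≫ δ F x W'') ≫ (α_ _ _ _).inv ≫
        (μ F x x ≫ F.map c ≫ δ F x x) ▷ F.obj W'' ≫ (α_ _ _ _).hom := by
    have h2 := congrArg F.map hf
    rw [F.map_comp, F.map_comp, F.map_comp, F.map_comp] at h2
    rw [MonoidalCategory.whiskerLeft_comp, δ_natural_right_assoc, reassoc_of% h2, map_firstCross,
      Category.assoc, δ_natural_right_assoc]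
  have h3 := congrArg (Z ◁ ·) h1
  simp only [MonoidalCategory.whiskerLeft_comp] at h3
  simp only [Category.assoc, ← h, MonoidalCategory.whiskerLeft_comp, tensor_whiskerLeft,
    Iso.inv_hom_id_assoc]
  rw [reassoc_of% h3]
  simp

theorem map_shift_zero_right (Z : C) :
    Z ◁ (F.map ((λ_ x).hom ≫ (ρ_ x).inv) ≫ δ F x (𝟙_ V)) ≫ (α_ _ _ _).inv ≫
      (Z ⊗ F.obj x) ◁ η F ≫ (ρ_ (Z ⊗ F.obj x)).hom =
    Z ◁ δ F (𝟙_ V) x ≫ (α_ _ _ _).inv ≫ (Z ◁ η F ≫ (ρ_ Z).hom) ▷ F.obj x := by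
  have h1 : F.map (ρ_ x).inv ≫ δ F x (𝟙_ V) ≫ F.obj x ◁ η F = (ρ_ (F.obj x)).inv := by
    rw [map_rightUnitor_inv]
    simp only [Category.assoc, μ_δ_assoc, whiskerLeft_ε_η, Category.comp_id]
  have h2 := congrArg (Z ◁ ·) h1
  simp only [MonoidalCategory.whiskerLeft_comp] at h2
  rw [F.map_comp, map_leftUnitor]
  simp only [MonoidalCategory.whiskerLeft_comp, Category.assoc, tensor_whiskerLeft,
    Iso.inv_hom_id_assoc]
  rw [reassoc_of% h2]
  simp [-Functor.LaxMonoidal.left_unitality, -Functor.LaxMonoidal.right_unitality,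
    -Functor.OplaxMonoidal.left_unitality, -Functor.OplaxMonoidal.right_unitality]

theorem map_shift_zero_left (Z : C) :
    δ F (𝟙_ V) x ▷ Z ≫ (α_ _ _ _).hom ≫ η F ▷ (F.obj x ⊗ Z) ≫ (λ_ (F.obj x ⊗ Z)).hom =
      (F.map ((λ_ x).hom ≫ (ρ_ x).inv) ≫ δ F x (𝟙_ V)) ▷ Z ≫ (α_ _ _ _).hom ≫
        F.obj x ◁ (η F ▷ Z ≫ (λ_ Z).hom) := by
  have h1 : F.map (ρ_ x).inv ≫ δ F x (𝟙_ V) ≫ F.obj x ◁ η F = (ρ_ (F.obj x)).inv := by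
    rw [map_rightUnitor_inv]
    simp only [Category.assoc, μ_δ_assoc, whiskerLeft_ε_η, Category.comp_id]
  have h2 := congrArg (· ▷ Z) h1
  simp only [comp_whiskerRight] at h2
  rw [F.map_comp, map_leftUnitor]
  simp only [MonoidalCategory.whiskerLeft_comp, Category.assoc, comp_whiskerRight,
    ← associator_naturality_middle_assoc]
  rw [reassoc_of% h2]
  simp [-Functor.LaxMonoidal.left_unitality, -Functor.LaxMonoidal.right_unitality,
    -Functor.OplaxMonoidal.left_unitality, -Functor.OplaxMonoidal.right_unitality]

theorem map_shift_succ_right {W W' : V} (s : W ⟶ x ⊗ W') {Z R : C}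
    (r : (Z ⊗ F.obj x) ⊗ F.obj W' ⟶ R) :
    Z ◁ (F.map (s ▷ x ≫ (α_ x W' x).hom) ≫ δ F x (W' ⊗ x)) ≫ (α_ _ _ _).inv ≫
        (Z ⊗ F.obj x) ◁ δ F W' x ≫ (α_ _ _ _).inv ≫ r ▷ F.obj x =
      Z ◁ δ F W x ≫ (α_ _ _ _).inv ≫ (Z ◁ (F.map s ≫ δ F x W') ≫ (α_ _ _ _).inv ≫ r) ▷ F.obj x := by
  have h1 : F.map (s ▷ x ≫ (α_ x W' x).hom) ≫ δ F x (W' ⊗ x) ≫ F.obj x ◁ δ F W' x =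
      δ F W x ≫ (F.map s ≫ δ F x W') ▷ F.obj x ≫ (α_ _ _ _).hom := by
    rw [comp_whiskerRight_assoc, δ_natural_left_assoc, F.map_comp_assoc, map_associator]
    simp only [Category.assoc, μ_δ_assoc, whiskerLeft_μ_δ, Category.comp_id]
  have h2 := congrArg (Z ◁ ·) h1
  simp only [MonoidalCategory.whiskerLeft_comp] at h2
  simp only [Category.assoc, MonoidalCategory.whiskerLeft_comp, tensor_whiskerLeft,
    Iso.inv_hom_id_assoc]
  rw [reassoc_of% h2]
  simp

theorem map_shift_succ_left {W W' : V} (s : W ⟶ x ⊗ W') {Z R : C}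
    (r : F.obj W' ⊗ F.obj x ⊗ Z ⟶ R) :
    δ F W x ▷ Z ≫ (α_ _ _ _).hom ≫ (F.map s ≫ δ F x W') ▷ (F.obj x ⊗ Z) ≫ (α_ _ _ _).hom ≫
        F.obj x ◁ r =
      (F.map (s ▷ x ≫ (α_ x W' x).hom) ≫ δ F x (W' ⊗ x)) ▷ Z ≫ (α_ _ _ _).hom ≫
        F.obj x ◁ (δ F W' x ▷ Z ≫ (α_ _ _ _).hom ≫ r) := by
  have h1 : F.map (s ▷ x ≫ (α_ x W' x).hom) ≫ δ F x (W' ⊗ x) ≫ F.obj x ◁ δ F W' x =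
      δ F W x ≫ (F.map s ≫ δ F x W') ▷ F.obj x ≫ (α_ _ _ _).hom := by
    rw [comp_whiskerRight_assoc, δ_natural_left_assoc, F.map_comp_assoc, map_associator]
    simp only [Category.assoc, μ_δ_assoc, whiskerLeft_μ_δ, Category.comp_id]
  have h2 := congrArg (· ▷ Z) h1
  simp only [comp_whiskerRight, Category.assoc] at h2
  simp only [Category.assoc, MonoidalCategory.whiskerLeft_comp, comp_whiskerRight,
    ← associator_naturality_middle_assoc]
  rw [reassoc_of% h2]
  simp

theorem rightAct_of_shift {n : ℕ} {f : tensorPow x (n + 1) ⟶ tensorPow x (n + 1)}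
    {g : tensorPow x n ⟶ tensorPow x n}
    (hf : f ≫ (tensorPowShift x n).hom = (tensorPowShift x n).hom ≫ x ◁ g) (Z : C) :
    rightAct F f Z = rightAct F g (Z ⊗ F.obj x) :=
  (Iso.inv_comp_eq _).2 (map_comp_shift F hf (Iso.hom_inv_id_assoc _ _))

theorem leftAct_lastCross (c : x ⊗ x ⟶ x ⊗ x) (n : ℕ) (Z : C) :
    leftAct F (n := n + 2) (lastCross c (tensorPow x n)) Z =
      (powFunctor (tensorLeft (F.obj x)) n).map ((α_ _ _ _).inv ≫ μ F x x ▷ Z ≫ F.map c ▷ Z ≫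
        δ F x x ▷ Z ≫ (α_ _ _ _).hom) :=
  (Iso.inv_comp_eq _).2 (map_lastCross_comp F c (leftPowIso_naturality F n _))

theorem rightAct_crossAt_zero (c : x ⊗ x ⟶ x ⊗ x) (n : ℕ) (Z : C) :
    rightAct F (n := n + 2) (crossAt c (n + 2) 0) Z =
      (powFunctor (tensorRight (F.obj x)) n).map ((α_ _ _ _).hom ≫ Z ◁ μ F x x ≫ Z ◁ F.map c ≫
        Z ◁ δ F x x ≫ (α_ _ _ _).inv) :=
  (Iso.inv_comp_eq _).2 (map_firstCross_comp F (crossAt_zero_shift c n) (rightPowIso_naturality F n _))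

theorem rightPowIso_shift (n : ℕ) (Z : C) :
    (rightPowIso F x (n + 1) Z).hom ≫ (powShift (tensorRight (F.obj x)) n Z).hom =
      Z ◁ δ F (tensorPow x n) x ≫ (α_ _ _ _).inv ≫ (rightPowIso F x n Z).hom ▷ F.obj x := by
  induction n generalizing Z with
  | zero => exact (Category.comp_id _).trans (map_shift_zero_right F Z)
  | succ n ih =>
    refine Eq.trans ?_ (map_shift_succ_right F (tensorPowShift x n).hom
      (rightPowIso F x n (Z ⊗ F.obj x)).hom)
    refine (Category.assoc _ _ _).trans (congrArg (_ ≫ ·) ?_)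
    exact (Category.assoc _ _ _).trans (congrArg (_ ≫ ·) (ih (Z ⊗ F.obj x)))

theorem leftPowIso_shift (n : ℕ) (Z : C) :
    (leftPowIso F x (n + 1) Z).hom ≫ (powShift (tensorLeft (F.obj x)) n Z).hom =
      (F.map (tensorPowShift x n).hom ≫ δ F x (tensorPow x n)) ▷ Z ≫ (α_ _ _ _).hom ≫
        F.obj x ◁ (leftPowIso F x n Z).hom := by
  induction n generalizing Z with
  | zero => exact (Category.comp_id _).trans (map_shift_zero_left F Z)
  | succ n ih =>
    refine Eq.trans ?_ (map_shift_succ_left F (tensorPowShift x n).hom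
      (leftPowIso F x n (F.obj x ⊗ Z)).hom)
    refine (Category.assoc _ _ _).trans (congrArg (_ ≫ ·) ?_)
    exact (Category.assoc _ _ _).trans (congrArg (_ ≫ ·) (ih (F.obj x ⊗ Z)))

end Powers

end Heis

namespace Heis

open Functor.Monoidal Functor.LaxMonoidal Functor.OplaxMonoidal CoxeterRelations

section Actions

universe v₁ u₁

variable {k : Type u} [Field k]

section

variable {x : HeisDiag k} {c : x ⊗ x ⟶ x ⊗ x} (h : IsSymmetry c)

/-- The action of the group algebra on a power of an object. -/
noncomputable def symEnd (n : ℕ) : SymAlg k n →ₐ[k] End (tensorPow x n) :=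
  MonoidAlgebra.lift k (End (tensorPow x n)) (Equiv.Perm (Fin n)) (permHom h n)

/-- The action of the group algebra on a power of an object, with the strands in the opposite
order. -/
noncomputable def symEndRev (n : ℕ) : SymAlg k n →ₐ[k] End (tensorPow x n) :=
  MonoidAlgebra.lift k (End (tensorPow x n)) (Equiv.Perm (Fin n))
    ((permHom h n).comp (MulAut.conj (rev n)).toMonoidHom)

theorem symEnd_pm {n : ℕ} (σ : Equiv.Perm (Fin n)) : symEnd h n (pm σ) = permHom h n σ := by
  rw [symEnd, pm, MonoidAlgebra.lift_single, one_smul]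

theorem symEndRev_pm {n : ℕ} (σ : Equiv.Perm (Fin n)) :
    symEndRev h n (pm σ) = permHom h n (rev n * σ * rev n) := by
  rw [symEndRev, pm, MonoidAlgebra.lift_single, one_smul]
  rfl

theorem symEnd_embLast {n : ℕ} (a : SymAlg k n) :
    (symEnd h (n + 1) (embLast n a) : tensorPow x (n + 1) ⟶ tensorPow x (n + 1)) =
      symEnd h n a ▷ x := by
  induction a using symAlg_induction with
  | zero => rw [map_zero, map_zero, map_zero]; exact (MonoidalPreadditive.zero_whiskerRight).symm
  | add a b ha hb =>
    rw [map_add, map_add, map_add]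
    exact (congrArg₂ (· + ·) ha hb).trans (MonoidalPreadditive.add_whiskerRight _ _).symm
  | smul r a ha =>
    rw [map_smul, map_smul, map_smul]
    exact (congrArg (r • ·) ha).trans (MonoidalLinear.smul_whiskerRight r _ _).symm
  | perm σ => rw [embLast_pm, symEnd_pm, symEnd_pm, permHom_fixLast]

theorem symEndRev_embLast {n : ℕ} (a : SymAlg k n) :
    symEndRev h (n + 1) (embLast n a) ≫ (tensorPowShift x n).hom =
      (tensorPowShift x n).hom ≫ x ◁ symEndRev h n a := by
  induction a using symAlg_induction with
  | zero =>
    rw [map_zero, map_zero, map_zero]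
    exact zero_comp.trans (comp_zero.symm.trans
      (congrArg (_ ≫ ·) (MonoidalPreadditive.whiskerLeft_zero).symm))
  | add a b ha hb =>
    rw [map_add, map_add, map_add]
    refine (Preadditive.add_comp _ _ _ _ _ _).trans ((congrArg₂ (· + ·) ha hb).trans ?_)
    exact (Preadditive.comp_add _ _ _ _ _ _).symm.trans
      (congrArg (_ ≫ ·) (MonoidalPreadditive.whiskerLeft_add _ _).symm)
  | smul r a ha =>
    rw [map_smul, map_smul, map_smul]
    refine (Linear.smul_comp _ _ _ r _ _).trans ((congrArg (r • ·) ha).trans ?_)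
    exact (Linear.comp_smul _ _ _ _ r _).symm.trans
      (congrArg (_ ≫ ·) (MonoidalLinear.whiskerLeft_smul _ r _).symm)
  | perm σ =>
    rw [embLast_pm, symEndRev_pm, symEndRev_pm, rev_conj_fixLast]
    exact permHom_shift h _

theorem symEnd_embFirst {n : ℕ} (a : SymAlg k n) :
    symEnd h (n + 1) (embFirst n a) ≫ (tensorPowShift x n).hom =
      (tensorPowShift x n).hom ≫ x ◁ symEnd h n a := by
  induction a using symAlg_induction with
  | zero =>
    rw [map_zero, map_zero, map_zero]
    exact zero_comp.trans (comp_zero.symm.trans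
      (congrArg (_ ≫ ·) (MonoidalPreadditive.whiskerLeft_zero).symm))
  | add a b ha hb =>
    rw [map_add, map_add, map_add]
    refine (Preadditive.add_comp _ _ _ _ _ _).trans ((congrArg₂ (· + ·) ha hb).trans ?_)
    exact (Preadditive.comp_add _ _ _ _ _ _).symm.trans
      (congrArg (_ ≫ ·) (MonoidalPreadditive.whiskerLeft_add _ _).symm)
  | smul r a ha =>
    rw [map_smul, map_smul, map_smul]
    refine (Linear.smul_comp _ _ _ r _ _).trans ((congrArg (r • ·) ha).trans ?_)
    exact (Linear.comp_smul _ _ _ _ r _).symm.trans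
      (congrArg (_ ≫ ·) (MonoidalLinear.whiskerLeft_smul _ r _).symm)
  | perm σ =>
    rw [embFirst_pm, symEnd_pm, symEnd_pm]
    exact permHom_shift h _

theorem symEndRev_eq {n : ℕ} (a : SymAlg k n) :
    (symEndRev h n a : tensorPow x n ⟶ tensorPow x n) =
      permHom h n (rev n) ≫ symEnd h n a ≫ permHom h n (rev n) := by
  change symEndRev h n a = permHom h n (rev n) * symEnd h n a * permHom h n (rev n)
  induction a using symAlg_induction with
  | zero => rw [map_zero, map_zero, mul_zero, zero_mul]
  | add a b ha hb => rw [map_add, map_add, mul_add, add_mul, ha, hb]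
  | smul r a ha => rw [map_smul, map_smul, mul_smul_comm, smul_mul_assoc, ha]
  | perm σ => rw [symEndRev_pm, symEnd_pm, map_mul, map_mul]

end

variable {C : Type u₁} [Category.{v₁} C] [MonoidalCategory C] [Preadditive C]
  [MonoidalPreadditive C] [Linear k C] [MonoidalLinear k C]
  (F : HeisDiag k ⥤ C) [F.Monoidal] [F.Additive] [F.Linear k]

/-- The action of endomorphisms of a power on the left. -/
def leftActHom {x : HeisDiag k} (n : ℕ) (Z : C) :
    End (tensorPow x n) →ₐ[k] End ((powFunctor (tensorLeft (F.obj x)) n).obj Z) :=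
  AlgHom.ofLinearMap
    { toFun := fun g ↦ leftAct F g Z
      map_add' := fun f g ↦ by
        have hF : F.map (f + g : End (tensorPow x n)) = F.map f + F.map g := F.map_add
        simp only [leftAct, hF, MonoidalPreadditive.add_whiskerRight, Preadditive.add_comp,
          Preadditive.comp_add]
      map_smul' := fun r f ↦ by
        have hF : F.map (r • f : End (tensorPow x n)) = r • F.map f := F.map_smul r f
        simp only [leftAct, hF, MonoidalLinear.smul_whiskerRight, Linear.smul_comp,
          Linear.comp_smul]
        rfl }
    (leftAct_id F n Z) (fun f g ↦ leftAct_comp F g f Z)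

/-- The action of endomorphisms of a power on the right. -/
def rightActHom {x : HeisDiag k} (n : ℕ) (Z : C) :
    End (tensorPow x n) →ₐ[k] End ((powFunctor (tensorRight (F.obj x)) n).obj Z) :=
  AlgHom.ofLinearMap
    { toFun := fun g ↦ rightAct F g Z
      map_add' := fun f g ↦ by
        have hF : F.map (f + g : End (tensorPow x n)) = F.map f + F.map g := F.map_add
        simp only [rightAct, hF, MonoidalPreadditive.whiskerLeft_add, Preadditive.add_comp,
          Preadditive.comp_add]
      map_smul' := fun r f ↦ by
        have hF : F.map (r • f : End (tensorPow x n)) = r • F.map f := F.map_smul r f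
        simp only [rightAct, hF, MonoidalLinear.whiskerLeft_smul, Linear.smul_comp,
          Linear.comp_smul]
        rfl }
    (rightAct_id F n Z) (fun f g ↦ rightAct_comp F g f Z)

theorem leftDiag_down_down (d : HeisDiagram k (.tensor .down .down) (.tensor .down .down)) (Z : C) :
    leftDiag F d Z = (α_ _ _ _).inv ≫ μ F (down k) (down k) ▷ Z ≫ F.map (HeisDiag.ofDiagram d) ▷ Z ≫
      δ F (down k) (down k) ▷ Z ≫ (α_ _ _ _).hom := by
  refine leftMap_eq F (A := .tensor .down .down) (B := .tensor .down .down) _ ?_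
  change (δ F (down k) (down k) ▷ Z ≫ (α_ _ _ _).hom ≫ F.obj (down k) ◁ 𝟙 (F.obj (down k) ⊗ Z) ≫
    𝟙 _) ≫ _ = F.map (HeisDiag.ofDiagram d) ▷ Z ≫ δ F (down k) (down k) ▷ Z ≫ (α_ _ _ _).hom ≫
      F.obj (down k) ◁ 𝟙 (F.obj (down k) ⊗ Z) ≫ 𝟙 _
  simp
  rfl

theorem rightDiag_up_up (d : HeisDiagram k (.tensor .up .up) (.tensor .up .up)) (Z : C) :
    rightDiag F d Z = (α_ _ _ _).hom ≫ Z ◁ μ F (up k) (up k) ≫ Z ◁ F.map (HeisDiag.ofDiagram d) ≫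
      Z ◁ δ F (up k) (up k) ≫ (α_ _ _ _).inv := by
  refine rightMap_eq F (A := .tensor .up .up) (B := .tensor .up .up) _ ?_
  change (Z ◁ δ F (up k) (up k) ≫ (α_ _ _ _).inv ≫ 𝟙 (Z ⊗ F.obj (up k)) ▷ F.obj (up k) ≫
    𝟙 _) ≫ _ = Z ◁ F.map (HeisDiag.ofDiagram d) ≫ Z ◁ δ F (up k) (up k) ≫ (α_ _ _ _).inv ≫
      𝟙 (Z ⊗ F.obj (up k)) ▷ F.obj (up k) ≫ 𝟙 _
  simp
  rfl

/-- The action of the two strands by tensoring on the left, with powers of the downward strand. -/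
noncomputable def leftAction : HeisAction k C where
  X := tensorLeft (F.obj (down k))
  Y := tensorLeft (F.obj (up k))
  c := leftDiag F .crossDown
  us := leftDiag F .crossUD
  sw := leftDiag F .crossDU
  cu := leftDiag F .cupDU
  ca := leftDiag F .capDU
  ln := leftDiag F .capUD
  cl := leftDiag F .cupUD
  ln_naturality := leftDiag_naturality F .capUD
  cl_naturality := leftDiag_naturality F .cupUD
  us_sw := leftDiag_crossUD_crossDU F
  sw_us Z := leftDiag_crossDU_crossUD F Z
  cu_ca := leftDiag_bubble F
  cu_us Z := cup_us_of_rotation (X := leftWord F .down) (Y := leftWord F .up) Z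
    (leftDiag_naturality F .crossUD) (leftDiag_naturality F .cupDU) (leftDiag_cupDU_capUD F)
    (fun Z ↦ (leftDiag_eq .cyclic Z).trans (leftDiag_crossDown' F Z))
  sw_ca Z := sw_cap_of_rotation (X := leftWord F .down) (Y := leftWord F .up) Z
    (leftDiag_naturality F .crossDU) (leftDiag_naturality F .capDU) (leftDiag_cupUD_capDU F)
    (leftDiag_crossDown F)
  cu_ln := leftDiag_cupDU_capUD F
  cl_ca := leftDiag_cupUD_capDU F
  act n Z := (leftActHom F n Z).comp (symEnd (isSymmetry_crossDown k) n)
  act_naturality a := leftAct_naturality F _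
  act_embLast a Z := by
    refine Eq.trans ?_ (leftAct_whiskerRight F _ Z)
    exact congrArg (fun g ↦ leftAct F g Z) (symEnd_embLast (isSymmetry_crossDown k) a)
  act_swapLast Z := by
    refine Eq.trans ?_ ((leftAct_lastCross F (crossDown k) _ Z).trans
      (congrArg _ (leftDiag_down_down F .crossDown Z).symm))
    exact congrArg (fun g ↦ leftAct F g Z) ((symEnd_pm (isSymmetry_crossDown k) _).trans
      (permHom_swapLast _ _))

/-- The action of the two strands by tensoring on the right, with powers of the upward strand. -/
noncomputable def rightAction : HeisAction k C where
  X := tensorRight (F.obj (up k))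
  Y := tensorRight (F.obj (down k))
  c := rightDiag F .cross
  us := rightDiag F .crossUD
  sw := rightDiag F .crossDU
  cu := rightDiag F .cupDU
  ca := rightDiag F .capDU
  ln := rightDiag F .capUD
  cl := rightDiag F .cupUD
  ln_naturality := rightDiag_naturality F .capUD
  cl_naturality := rightDiag_naturality F .cupUD
  us_sw := rightDiag_crossUD_crossDU F
  sw_us Z := rightDiag_crossDU_crossUD F Z
  cu_ca := rightDiag_bubble F
  cu_us Z := cup_us_of_eq (X := rightWord F .up) (Y := rightWord F .down) Z
    (rightDiag_naturality F .cupDU) (rightDiag_cupDU_capUD' F) (rightDiag_crossUD F Z)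
  sw_ca Z := sw_cap_of_eq (X := rightWord F .up) (Y := rightWord F .down) Z
    (rightDiag_naturality F .capDU) (rightDiag_cupUD_capDU' F) (rightDiag_crossDU F Z)
  cu_ln := rightDiag_cupDU_capUD F
  cl_ca := rightDiag_cupUD_capDU F
  act n Z := (rightActHom F n Z).comp (symEndRev (isSymmetry_crossUp k) n)
  act_naturality a := rightAct_naturality F _
  act_embLast a Z := rightAct_of_shift F (symEndRev_embLast (isSymmetry_crossUp k) a) Z
  act_swapLast Z := by
    refine Eq.trans ?_ ((rightAct_crossAt_zero F (crossUp k) _ Z).trans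
      (congrArg _ (rightDiag_up_up F .cross Z).symm))
    refine congrArg (fun g ↦ rightAct F g Z) ((symEndRev_pm (isSymmetry_crossUp k) _).trans ?_)
    rw [rev_conj_swapLast]
    exact permHom_simpleSwap _ _ _ (by omega)

end Actions

end Heis

namespace Heis

open Functor.Monoidal Functor.LaxMonoidal Functor.OplaxMonoidal CoxeterRelations YoungDiagram
  YoungDiagram.OfSize Idempotents

section Young

variable {k : Type u} [Field k] {x : HeisDiag k} {c : x ⊗ x ⟶ x ⊗ x} (h : IsSymmetry c)

/-- The endomorphism of a power given by an element of the group algebra. -/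
noncomputable def symMap {n : ℕ} (a : SymAlg k n) :
    (incl k).obj (tensorPow x n) ⟶ (incl k).obj (tensorPow x n) :=
  (incl k).map (symEnd h n a)

variable {n : ℕ}

theorem symMap_mul (a b : SymAlg k n) : symMap h (a * b) = symMap h b ≫ symMap h a := by
  rw [symMap, map_mul]
  exact (incl k).map_comp _ _

theorem symMap_one : symMap h (1 : SymAlg k n) = 𝟙 _ := by
  rw [symMap, map_one]
  exact (incl k).map_id _

theorem symMap_add (a b : SymAlg k n) : symMap h (a + b) = symMap h a + symMap h b := by
  rw [symMap, map_add]
  exact (incl k).map_add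

theorem symMap_zero : symMap h (0 : SymAlg k n) = 0 := by
  rw [symMap, map_zero]
  exact (incl k).map_zero _ _

theorem symMap_sum {ι : Type*} (s : Finset ι) (a : ι → SymAlg k n) :
    symMap h (∑ i ∈ s, a i) = ∑ i ∈ s, symMap h (a i) := by
  classical
  induction s using Finset.induction_on with
  | empty => simp only [Finset.sum_empty, symMap_zero]
  | insert i s hi ih => rw [Finset.sum_insert hi, Finset.sum_insert hi, symMap_add, ih]

theorem symMap_smul (r : k) (a : SymAlg k n) : symMap h (r • a) = r • symMap h a := by
  rw [symMap, map_smul]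
  exact (incl k).map_smul r _

theorem permMap_eq (σ : Equiv.Perm (Fin n)) : permMap h σ = symMap h (pm σ) := by
  rw [permMap, symMap, symEnd_pm]

/-- The splitting of the last factor. -/
noncomputable def splitLast (x : HeisDiag k) (n : ℕ) :
    (incl k).obj (tensorPow x (n + 1)) ≅ (incl k).obj (tensorPow x n) ⊗ (incl k).obj x :=
  inclTensor k (tensorPow x n) x

/-- The splitting of the first factor. -/
noncomputable def splitFirst (x : HeisDiag k) (n : ℕ) :
    (incl k).obj (tensorPow x (n + 1)) ≅ (incl k).obj x ⊗ (incl k).obj (tensorPow x n) :=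
  (incl k).mapIso (tensorPowShift x n) ≪≫ inclTensor k x (tensorPow x n)

theorem symMap_splitLast (a : SymAlg k n) :
    symMap h (embLast n a) ≫ (splitLast x n).hom =
      (splitLast x n).hom ≫ symMap h a ▷ (incl k).obj x := by
  rw [symMap, symEnd_embLast]
  exact (δ_natural_left (incl k) (symEnd h n a) x).symm

theorem symMap_splitFirst (a : SymAlg k n) :
    symMap h (embFirst n a) ≫ (splitFirst x n).hom =
      (splitFirst x n).hom ≫ (incl k).obj x ◁ symMap h a := by
  have h1 := congrArg (fun f ↦ (incl k).map f ≫ δ (incl k) x (tensorPow x n))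
    (symEnd_embFirst h a)
  rw [(incl k).map_comp, (incl k).map_comp, Category.assoc, Category.assoc, ← δ_natural_right] at h1
  exact h1.trans (Category.assoc _ _ _).symm

variable [CharZero k] (μ : OfSize n) (ν : OfSize (n + 1))

theorem youngIncl_youngProj : youngIncl h μ ≫ youngProj h μ = 𝟙 _ :=
  (Karoubi.decompId (youngObj h μ)).symm

theorem youngProj_youngIncl : youngProj h μ ≫ youngIncl h μ = symMap h (μ.youngIdempotent k) :=
  Karoubi.hom_ext _ _ ((youngObj h μ).idem)

theorem youngIncl_symMap : youngIncl h μ ≫ symMap h (μ.youngIdempotent k) = youngIncl h μ := by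
  rw [← youngProj_youngIncl, ← Category.assoc, youngIncl_youngProj, Category.id_comp]

theorem symMap_youngProj : symMap h (μ.youngIdempotent k) ≫ youngProj h μ = youngProj h μ := by
  rw [← youngProj_youngIncl, Category.assoc, youngIncl_youngProj, Category.comp_id]

section Split

variable {G : HeisCat k ⥤ HeisCat k}
  (e : (incl k).obj (tensorPow x (n + 1)) ≅ G.obj ((incl k).obj (tensorPow x n)))

/-- Splitting off a box. -/
noncomputable def splitIn : youngObj h ν ⟶ G.obj (youngObj h μ) :=
  youngIncl h ν ≫ symMap h (branchIn k μ ν) ≫ e.hom ≫ G.map (youngProj h μ)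

/-- Merging a box. -/
noncomputable def mergeOut : G.obj (youngObj h μ) ⟶ youngObj h ν :=
  G.map (youngIncl h μ) ≫ e.inv ≫ symMap h (branchOut k μ ν) ≫ youngProj h ν

variable {e} (he : ∀ a : SymAlg k n, symMap h (embLast n a) ≫ e.hom = e.hom ≫ G.map (symMap h a))
include he

theorem splitIn_mergeOut' (ν' : OfSize (n + 1)) : splitIn h μ ν e ≫ mergeOut h μ ν' e =
    youngIncl h ν ≫ symMap h (branchOut k μ ν' * branchIn k μ ν) ≫ youngProj h ν' := by
  rw [splitIn, mergeOut]
  simp only [Category.assoc]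
  rw [← G.map_comp_assoc, youngProj_youngIncl, ← reassoc_of% he, Iso.hom_inv_id_assoc,
    ← reassoc_of% symMap_mul, emb_mul_branchIn, ← reassoc_of% symMap_mul]

theorem splitIn_mergeOut {μ : OfSize n} {ν : OfSize (n + 1)} (hμν : μ.1 ≤ ν.1) :
    splitIn h μ ν e ≫ mergeOut h μ ν e = 𝟙 _ := by
  rw [splitIn_mergeOut' h μ ν he, branchOut_mul_branchIn k hμν, symMap_youngProj, youngIncl_youngProj]

theorem splitIn_mergeOut_of_ne {ν ν' : OfSize (n + 1)} (hν : ν ≠ ν') :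
    splitIn h μ ν e ≫ mergeOut h μ ν' e = 0 := by
  rw [splitIn_mergeOut' h μ ν he, branchOut_mul_branchIn_of_ne k μ hν.symm, symMap_zero, zero_comp,
    comp_zero]

theorem mergeOut_splitIn : mergeOut h μ ν e ≫ splitIn h μ ν e =
    G.map (youngIncl h μ) ≫ e.inv ≫ symMap h (branchIn k μ ν * branchOut k μ ν) ≫ e.hom ≫
      G.map (youngProj h μ) := by
  rw [splitIn, mergeOut]
  simp only [Category.assoc]
  rw [← Category.assoc (youngProj h ν), youngProj_youngIncl, ← reassoc_of% symMap_mul,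
    ← reassoc_of% symMap_mul, mul_branchOut]

theorem splitIn_eq : splitIn h μ ν e =
    youngIncl h ν ≫ symMap h (pm (moveLast (newBox μ ν))) ≫ e.hom ≫ G.map (youngProj h μ) := by
  rw [splitIn, branchIn, symMap_mul, symMap_mul, Category.assoc, Category.assoc,
    reassoc_of% he, ← G.map_comp, symMap_youngProj, reassoc_of% youngIncl_symMap]

theorem mergeOut_eq : mergeOut h μ ν e =
    G.map (youngIncl h μ) ≫ e.inv ≫ symMap h (pm (moveLast (newBox μ ν))⁻¹) ≫ youngProj h ν := by
  have he' (a : SymAlg k n) : e.inv ≫ symMap h (embLast n a) = G.map (symMap h a) ≫ e.inv := by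
    rw [Iso.inv_comp_eq, ← reassoc_of% he, Iso.hom_inv_id, Category.comp_id]
  rw [mergeOut, branchOut, symMap_mul, symMap_mul, Category.assoc, Category.assoc, reassoc_of% he',
    ← G.map_comp_assoc, youngIncl_symMap, symMap_youngProj]

theorem sum_mergeOut_splitIn [G.Additive] :
    open scoped Classical in
    ∑ ν : OfSize (n + 1), (if μ.1 ≤ ν.1 then mergeOut h μ ν e ≫ splitIn h μ ν e else 0) = 𝟙 _ := by
  classical
  have h1 : ∑ ν : OfSize (n + 1), (if μ.1 ≤ ν.1 then mergeOut h μ ν e ≫ splitIn h μ ν e else 0) =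
      G.map (youngIncl h μ) ≫ e.inv ≫ symMap h (embLast n (μ.youngIdempotent k)) ≫ e.hom ≫
      G.map (youngProj h μ) := by
    rw [branching k n μ, symMap_sum, Preadditive.sum_comp, Preadditive.comp_sum, Preadditive.comp_sum]
    refine Finset.sum_congr rfl fun ν _ ↦ ?_
    split_ifs
    · exact mergeOut_splitIn h μ ν he
    · rw [symMap_zero, zero_comp, comp_zero, comp_zero]
  rw [h1, reassoc_of% he, Iso.inv_hom_id_assoc, ← G.map_comp, ← G.map_comp, symMap_youngProj,
    youngIncl_youngProj, CategoryTheory.Functor.map_id]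

end Split

end Young

section

variable {k : Type u} [Field k] [CharZero k] {n : ℕ} (μ : OfSize n) (ν : OfSize (n + 1))

/-- The splitting of the strand at the last position, moved to the first position. -/
noncomputable def splitFirst' (n : ℕ) : (incl k).obj (tensorPow (down k) (n + 1)) ≅
    Q k ⊗ (incl k).obj (tensorPow (down k) n) :=
  ⟨symMap (isSymmetry_crossDown k) (pm (lastToFirst n)),
    symMap (isSymmetry_crossDown k) (pm (lastToFirst n)⁻¹),
    by rw [← symMap_mul, ← pm_mul, inv_mul_cancel, pm_one, symMap_one],
    by rw [← symMap_mul, ← pm_mul, mul_inv_cancel, pm_one, symMap_one]⟩ ≪≫ splitFirst (down k) n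

theorem symMap_splitFirst' (a : SymAlg k n) :
    symMap (isSymmetry_crossDown k) (embLast n a) ≫ (splitFirst' n).hom =
      (splitFirst' n).hom ≫ Q k ◁ symMap (isSymmetry_crossDown k) a := by
  rw [splitFirst', Iso.trans_hom, ← Category.assoc, ← symMap_mul, ← embFirst_mul_lastToFirst,
    symMap_mul, Category.assoc, Category.assoc, symMap_splitFirst]

theorem iotaP_eq : iotaP k μ ν =
    splitIn (isSymmetry_crossUp k) μ ν (G := tensorRight (P k)) (splitLast (up k) n) := by
  rw [splitIn_eq _ _ _ (symMap_splitLast _), iotaP, permMap_eq]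
  rfl

theorem rhoP_eq : rhoP k μ ν =
    mergeOut (isSymmetry_crossUp k) μ ν (G := tensorRight (P k)) (splitLast (up k) n) := by
  rw [mergeOut_eq _ _ _ (symMap_splitLast _), rhoP, permMap_eq]
  rfl

theorem iotaQ_eq : iotaQ k μ ν =
    splitIn (isSymmetry_crossDown k) μ ν (G := tensorLeft (Q k)) (splitFirst' n) := by
  rw [splitIn_eq _ _ _ symMap_splitFirst', iotaQ, permMap_eq, moveFirst_eq, pm_mul, symMap_mul]
  simp only [splitFirst', splitFirst, Iso.trans_hom, Category.assoc]
  rfl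

theorem rhoQ_eq : rhoQ k μ ν =
    mergeOut (isSymmetry_crossDown k) μ ν (G := tensorLeft (Q k)) (splitFirst' n) := by
  rw [mergeOut_eq _ _ _ symMap_splitFirst', rhoQ, permMap_eq, moveFirst_eq, mul_inv_rev, pm_mul,
    symMap_mul]
  simp only [splitFirst', splitFirst, Iso.trans_inv, Category.assoc]
  exact congrArg (_ ≫ ·) (congrArg (_ ≫ ·) (congrArg (_ ≫ ·) (Category.assoc _ _ _)))

end

end Heis

namespace Heis

open Functor.Monoidal Functor.LaxMonoidal Functor.OplaxMonoidal CoxeterRelations YoungDiagram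
  YoungDiagram.OfSize Idempotents

section

universe v₁ u₁

variable {C : Type u₁} [Category.{v₁} C] [MonoidalCategory C] {A B W₁ W₀ x Z T₁ T₀ : C}

theorem left_conj (i : A ⟶ W₁) {p : W₁ ⊗ Z ≅ T₁} (a : W₁ ⟶ W₁) {l : T₁ ≅ x ⊗ T₀}
    {p₀ : W₀ ⊗ Z ≅ T₀} {s : W₁ ≅ x ⊗ W₀} (q : W₀ ⟶ B)
    (hp : p.hom ≫ l.hom = s.hom ▷ Z ≫ (α_ _ _ _).hom ≫ x ◁ p₀.hom) :
    (i ▷ Z ≫ p.hom) ≫ (p.inv ≫ a ▷ Z ≫ p.hom) ≫ l.hom ≫ x ◁ (p₀.inv ≫ q ▷ Z) =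
      (i ≫ a ≫ s.hom ≫ x ◁ q) ▷ Z ≫ (α_ _ _ _).hom := by
  simp only [Category.assoc, Iso.hom_inv_id_assoc, reassoc_of% hp, ← whiskerLeft_comp,
    comp_whiskerRight, associator_naturality_middle]

theorem left_conj_inv (r : W₁ ⟶ A) {p : W₁ ⊗ Z ≅ T₁} (a : W₁ ⟶ W₁) {l : T₁ ≅ x ⊗ T₀}
    {p₀ : W₀ ⊗ Z ≅ T₀} {s : W₁ ≅ x ⊗ W₀} (j : B ⟶ W₀)
    (hp : p.hom ≫ l.hom = s.hom ▷ Z ≫ (α_ _ _ _).hom ≫ x ◁ p₀.hom) :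
    x ◁ (j ▷ Z ≫ p₀.hom) ≫ l.inv ≫ (p.inv ≫ a ▷ Z ≫ p.hom) ≫ p.inv ≫ r ▷ Z =
      (α_ _ _ _).inv ≫ (x ◁ j ≫ s.inv ≫ a ≫ r) ▷ Z := by
  have h : x ◁ p₀.hom ≫ l.inv ≫ p.inv = (α_ _ _ _).inv ≫ s.inv ▷ Z := by
    rw [← cancel_epi (s.hom ▷ Z ≫ (α_ _ _ _).hom), Category.assoc, ← reassoc_of% hp]
    simp
  simp only [Category.assoc, Iso.hom_inv_id_assoc, reassoc_of% h, MonoidalCategory.whiskerLeft_comp,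
    comp_whiskerRight, associator_inv_naturality_middle_assoc]

theorem right_conj (i : A ⟶ W₁) {p : Z ⊗ W₁ ≅ T₁} (a : W₁ ⟶ W₁) {l : T₁ ≅ T₀ ⊗ x}
    {p₀ : Z ⊗ W₀ ≅ T₀} {s : W₁ ≅ W₀ ⊗ x} (q : W₀ ⟶ B)
    (hp : p.hom ≫ l.hom = Z ◁ s.hom ≫ (α_ _ _ _).inv ≫ p₀.hom ▷ x) :
    (Z ◁ i ≫ p.hom) ≫ (p.inv ≫ Z ◁ a ≫ p.hom) ≫ l.hom ≫ (p₀.inv ≫ Z ◁ q) ▷ x =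
      Z ◁ (i ≫ a ≫ s.hom ≫ q ▷ x) ≫ (α_ _ _ _).inv := by
  simp only [Category.assoc, Iso.hom_inv_id_assoc, reassoc_of% hp, MonoidalCategory.whiskerLeft_comp,
    ← comp_whiskerRight, associator_inv_naturality_middle]

theorem right_conj_inv (r : W₁ ⟶ A) {p : Z ⊗ W₁ ≅ T₁} (a : W₁ ⟶ W₁) {l : T₁ ≅ T₀ ⊗ x}
    {p₀ : Z ⊗ W₀ ≅ T₀} {s : W₁ ≅ W₀ ⊗ x} (j : B ⟶ W₀)
    (hp : p.hom ≫ l.hom = Z ◁ s.hom ≫ (α_ _ _ _).inv ≫ p₀.hom ▷ x) :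
    (Z ◁ j ≫ p₀.hom) ▷ x ≫ l.inv ≫ (p.inv ≫ Z ◁ a ≫ p.hom) ≫ p.inv ≫ Z ◁ r =
      (α_ _ _ _).hom ≫ Z ◁ (j ▷ x ≫ s.inv ≫ a ≫ r) := by
  have h : p₀.hom ▷ x ≫ l.inv ≫ p.inv = (α_ _ _ _).hom ≫ Z ◁ s.inv := by
    rw [← cancel_epi (Z ◁ s.hom ≫ (α_ _ _ _).inv), Category.assoc, ← reassoc_of% hp]
    simp
  simp only [Category.assoc, Iso.hom_inv_id_assoc, reassoc_of% h, MonoidalCategory.whiskerLeft_comp,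
    comp_whiskerRight, associator_naturality_middle_assoc]

theorem left_conj_id {i : A ⟶ W₁} {q : W₁ ⟶ A} (h : i ≫ q = 𝟙 A) (p : W₁ ⊗ Z ≅ T₁) :
    (i ▷ Z ≫ p.hom) ≫ p.inv ≫ q ▷ Z = 𝟙 (A ⊗ Z) := by
  rw [Category.assoc, Iso.hom_inv_id_assoc, ← comp_whiskerRight, h, id_whiskerRight]

theorem left_conj_idem {i : A ⟶ W₁} {q : W₁ ⟶ A} {e : W₁ ⟶ W₁} (h : q ≫ i = e)
    (p : W₁ ⊗ Z ≅ T₁) : (p.inv ≫ q ▷ Z) ≫ i ▷ Z ≫ p.hom = p.inv ≫ e ▷ Z ≫ p.hom := by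
  rw [Category.assoc, ← comp_whiskerRight_assoc, h]

theorem right_conj_id {i : A ⟶ W₁} {q : W₁ ⟶ A} (h : i ≫ q = 𝟙 A) (p : Z ⊗ W₁ ≅ T₁) :
    (Z ◁ i ≫ p.hom) ≫ p.inv ≫ Z ◁ q = 𝟙 (Z ⊗ A) := by
  rw [Category.assoc, Iso.hom_inv_id_assoc, ← MonoidalCategory.whiskerLeft_comp, h,
    MonoidalCategory.whiskerLeft_id]

theorem right_conj_idem {i : A ⟶ W₁} {q : W₁ ⟶ A} {e : W₁ ⟶ W₁} (h : q ≫ i = e)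
    (p : Z ⊗ W₁ ≅ T₁) : (p.inv ≫ Z ◁ q) ≫ Z ◁ i ≫ p.hom = p.inv ≫ Z ◁ e ≫ p.hom := by
  rw [Category.assoc, ← MonoidalCategory.whiskerLeft_comp_assoc, h]

theorem cap_conj_left (i : W₁ ≅ A ⊗ B) (c : W₁ ⟶ 𝟙_ C) :
    (i.hom ▷ Z ≫ (α_ _ _ _).hom ≫ A ◁ 𝟙 (B ⊗ Z) ≫ 𝟙 _) ≫ (α_ _ _ _).inv ≫
      (i.inv ≫ c) ▷ Z ≫ (λ_ Z).hom = c ▷ Z ≫ 𝟙 (𝟙_ C) ▷ Z ≫ (λ_ Z).hom := by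
  simp

theorem cup_conj_left (i : W₁ ≅ A ⊗ B) (c : 𝟙_ C ⟶ W₁) :
    (𝟙 (𝟙_ C) ▷ Z ≫ (λ_ Z).hom) ≫ (λ_ Z).inv ≫ (c ≫ i.hom) ▷ Z ≫ (α_ _ _ _).hom =
      c ▷ Z ≫ i.hom ▷ Z ≫ (α_ _ _ _).hom ≫ A ◁ 𝟙 (B ⊗ Z) ≫ 𝟙 _ := by
  simp

theorem cap_conj_right (i : W₁ ≅ A ⊗ B) (c : W₁ ⟶ 𝟙_ C) :
    (Z ◁ i.hom ≫ (α_ _ _ _).inv ≫ 𝟙 (Z ⊗ A) ▷ B ≫ 𝟙 _) ≫ (α_ _ _ _).hom ≫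
      Z ◁ (i.inv ≫ c) ≫ (ρ_ Z).hom = Z ◁ c ≫ Z ◁ 𝟙 (𝟙_ C) ≫ (ρ_ Z).hom := by
  simp

theorem cup_conj_right (i : W₁ ≅ A ⊗ B) (c : 𝟙_ C ⟶ W₁) :
    (Z ◁ 𝟙 (𝟙_ C) ≫ (ρ_ Z).hom) ≫ (ρ_ Z).inv ≫ Z ◁ (c ≫ i.hom) ≫ (α_ _ _ _).inv =
      Z ◁ c ≫ Z ◁ i.hom ≫ (α_ _ _ _).inv ≫ 𝟙 (Z ⊗ A) ▷ B ≫ 𝟙 _ := by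
  simp

end

section

universe v₁ u₁

namespace HeisAction.YoungSplitting

variable {k : Type u} [Field k] {D : Type u₁} [Category.{v₁} D] [Preadditive D] [Linear k D]
  {S : HeisAction k D} (Y : YoungSplitting S) {n : ℕ} (μ : OfSize n) (ν : OfSize (n + 1)) (Z : D)

theorem link_eq : Y.link μ ν Z = S.Y.map (Y.incS ν Z ≫
    S.actS (pm (lastToFirst n) * branchIn k μ ν) Z ≫ (S.l n Z).hom ≫ S.X.map (Y.prj μ Z)) ≫
      S.ln (Y.E μ Z) := by
  rw [link, HeisAction.link, Category.assoc, ← S.ln_naturality]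
  simp only [Functor.map_comp, Category.assoc]

theorem colink_eq : Y.colink μ ν Z = S.cl (Y.E μ Z) ≫ S.Y.map (S.X.map (Y.inc μ Z) ≫
    (S.l n Z).inv ≫ S.actS (branchOut k μ ν * pm (lastToFirst n)⁻¹) Z ≫ Y.prjS ν Z) := by
  rw [colink, HeisAction.colink, Category.assoc, reassoc_of% S.cl_naturality]
  simp only [Functor.map_comp]

end HeisAction.YoungSplitting

end

section

variable (k : Type u) [Field k] [CharZero k]

/-- The Young idempotents acting on the left. -/
noncomputable def leftSplitting : (leftAction (incl k)).YoungSplitting where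
  E μ Z := QObj k μ ⊗ Z
  inc {n} μ Z := youngIncl (isSymmetry_crossDown k) μ ▷ Z ≫ (leftPowIso (incl k) (down k) n Z).hom
  prj {n} μ Z := (leftPowIso (incl k) (down k) n Z).inv ≫ youngProj (isSymmetry_crossDown k) μ ▷ Z
  inc_prj {n} μ Z := left_conj_id (youngIncl_youngProj _ μ) (leftPowIso (incl k) (down k) n Z)
  prj_inc {n} μ Z := left_conj_idem (youngProj_youngIncl _ μ) (leftPowIso (incl k) (down k) n Z)

theorem youngIncl_rev_rev_youngProj {x : HeisDiag k} {b : x ⊗ x ⟶ x ⊗ x} (h : IsSymmetry b) {n : ℕ}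
    (μ : OfSize n) : (youngIncl h μ ≫ symMap h (pm (rev n))) ≫ symMap h (pm (rev n)) ≫
      youngProj h μ = 𝟙 _ := by
  rw [Category.assoc, ← reassoc_of% symMap_mul, ← pm_mul, rev_mul_rev, pm_one, symMap_one,
    Category.id_comp, youngIncl_youngProj]

theorem map_symEndRev {x : HeisDiag k} {b : x ⊗ x ⟶ x ⊗ x} (h : IsSymmetry b) {n : ℕ}
    (a : SymAlg k n) : (incl k).map (symEndRev h n a) =
      symMap h (pm (rev n) * a * pm (rev n)) := by
  rw [symEndRev_eq, Functor.map_comp, Functor.map_comp, symMap_mul, symMap_mul, symMap, symMap,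
    symEnd_pm]

theorem rev_youngProj_youngIncl_rev {x : HeisDiag k} {b : x ⊗ x ⟶ x ⊗ x} (h : IsSymmetry b) {n : ℕ}
    (μ : OfSize n) : (symMap h (pm (rev n)) ≫ youngProj h μ) ≫ youngIncl h μ ≫
      symMap h (pm (rev n)) = (incl k).map (symEndRev h n (μ.youngIdempotent k)) := by
  rw [symEndRev_eq, Functor.map_comp, Functor.map_comp, Category.assoc,
    ← Category.assoc (youngProj _ _), youngProj_youngIncl, symMap, symEnd_pm]
  rfl

theorem iota_rev {x : HeisDiag k} {b : x ⊗ x ⟶ x ⊗ x} (h : IsSymmetry b) {n : ℕ} (μ : OfSize n)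
    (ν : OfSize (n + 1)) : (youngIncl h ν ≫ symMap h (pm (rev (n + 1)))) ≫
      (incl k).map (symEndRev h (n + 1) (pm (lastToFirst n) * branchIn k μ ν)) ≫
      (splitLast x n).hom ≫ (symMap h (pm (rev n)) ≫ youngProj h μ) ▷ (incl k).obj x =
    youngIncl h ν ≫ symMap h (branchIn k μ ν) ≫ (splitLast x n).hom ≫
      youngProj h μ ▷ (incl k).obj x := by
  rw [map_symEndRev, Category.assoc, ← reassoc_of% symMap_mul, comp_whiskerRight,
    ← reassoc_of% symMap_splitLast, ← reassoc_of% symMap_mul, embLast_pm]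
  have e : (pm (fixLast n (rev n)) * (pm (rev (n + 1)) * (pm (lastToFirst n) * branchIn k μ ν) *
      pm (rev (n + 1)) * pm (rev (n + 1)))) = branchIn k μ ν := by
    rw [mul_assoc _ (pm (rev _)) (pm (rev _)), ← pm_mul, rev_mul_rev, pm_one, mul_one,
      ← mul_assoc, ← mul_assoc, ← pm_mul, ← pm_mul, fixLast_rev_mul_rev, pm_one, one_mul]
  rw [e]

theorem rho_rev {x : HeisDiag k} {b : x ⊗ x ⟶ x ⊗ x} (h : IsSymmetry b) {n : ℕ} (μ : OfSize n)
    (ν : OfSize (n + 1)) : (youngIncl h μ ≫ symMap h (pm (rev n))) ▷ (incl k).obj x ≫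
      (splitLast x n).inv ≫ (incl k).map (symEndRev h (n + 1)
        (branchOut k μ ν * pm (lastToFirst n)⁻¹)) ≫ symMap h (pm (rev (n + 1))) ≫ youngProj h ν =
    youngIncl h μ ▷ (incl k).obj x ≫ (splitLast x n).inv ≫ symMap h (branchOut k μ ν) ≫
      youngProj h ν := by
  have e (a : SymAlg k n) : symMap h a ▷ (incl k).obj x ≫ (splitLast x n).inv =
      (splitLast x n).inv ≫ symMap h (embLast n a) := by
    rw [Iso.comp_inv_eq, Category.assoc, symMap_splitLast, Iso.inv_hom_id_assoc]
  rw [map_symEndRev, comp_whiskerRight, Category.assoc, reassoc_of% e, ← reassoc_of% symMap_mul,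
    ← reassoc_of% symMap_mul, embLast_pm]
  have e : (pm (rev (n + 1)) * (pm (rev (n + 1)) * (branchOut k μ ν * pm (lastToFirst n)⁻¹) *
      pm (rev (n + 1)) * pm (fixLast n (rev n)))) = branchOut k μ ν := by
    have h2 : (lastToFirst n)⁻¹ * rev (n + 1) * fixLast n (rev n) = 1 := by
      have h3 := congrArg (·⁻¹) (fixLast_rev_mul_rev n)
      simp only [mul_inv_rev, inv_one, ← map_inv, ← mul_assoc] at h3
      rwa [inv_eq_of_mul_eq_one_left (rev_mul_rev n),
        inv_eq_of_mul_eq_one_left (rev_mul_rev (n + 1))] at h3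
    rw [mul_assoc _ (pm (rev _)) (pm _), ← pm_mul, mul_assoc, mul_assoc, ← pm_mul,
      ← mul_assoc (lastToFirst n)⁻¹, h2, pm_one, mul_one, ← mul_assoc, ← pm_mul, rev_mul_rev, pm_one,
      one_mul]
  rw [e]

/-- The Young idempotents acting on the right. -/
noncomputable def rightSplitting : (rightAction (incl k)).YoungSplitting where
  E μ Z := Z ⊗ PObj k μ
  inc {n} μ Z := Z ◁ (youngIncl (isSymmetry_crossUp k) μ ≫
    symMap (isSymmetry_crossUp k) (pm (rev n))) ≫ (rightPowIso (incl k) (up k) n Z).hom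
  prj {n} μ Z := (rightPowIso (incl k) (up k) n Z).inv ≫
    Z ◁ (symMap (isSymmetry_crossUp k) (pm (rev n)) ≫ youngProj (isSymmetry_crossUp k) μ)
  inc_prj {n} μ Z := right_conj_id (youngIncl_rev_rev_youngProj k _ μ)
    (rightPowIso (incl k) (up k) n Z)
  prj_inc {n} μ Z := right_conj_idem (rev_youngProj_youngIncl_rev k _ μ)
    (rightPowIso (incl k) (up k) n Z)

variable {n : ℕ} (μ : OfSize n) (ν : OfSize (n + 1)) (Z : HeisCat k)

/-- The cap next to an object. -/
noncomputable def capLeft : P k ⊗ (Q k ⊗ Z) ⟶ Z := (α_ _ _ _).inv ≫ cap k ▷ Z ≫ (λ_ Z).hom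

/-- The cup next to an object. -/
noncomputable def cupLeft : Z ⟶ P k ⊗ (Q k ⊗ Z) := (λ_ Z).inv ≫ cup k ▷ Z ≫ (α_ _ _ _).hom

/-- The cap next to an object. -/
noncomputable def capRight : (Z ⊗ P k) ⊗ Q k ⟶ Z := (α_ _ _ _).hom ≫ Z ◁ cap k ≫ (ρ_ Z).hom

/-- The cup next to an object. -/
noncomputable def cupRight : Z ⟶ (Z ⊗ P k) ⊗ Q k := (ρ_ Z).inv ≫ Z ◁ cup k ≫ (α_ _ _ _).inv

theorem leftAction_ln : (leftAction (incl k)).ln Z = capLeft k Z := by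
  refine leftMap_eq (incl k) (A := .tensor .up .down) (B := .unit) _ (cap_conj_left (inclTensor k (up k) (down k))
    ((incl k).map (HeisDiag.ofDiagram .capUD : up k ⊗ down k ⟶ 𝟙_ (HeisDiag k))))

theorem leftAction_cl : (leftAction (incl k)).cl Z = cupLeft k Z := by
  refine leftMap_eq (incl k) (A := .unit) (B := .tensor .up .down) _ (cup_conj_left (inclTensor k (up k) (down k))
    ((incl k).map (HeisDiag.ofDiagram .cupUD : 𝟙_ (HeisDiag k) ⟶ up k ⊗ down k)))

theorem rightAction_ln : (rightAction (incl k)).ln Z = capRight k Z := by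
  refine rightMap_eq (incl k) (A := .tensor .up .down) (B := .unit) _ (cap_conj_right (inclTensor k (up k) (down k))
    ((incl k).map (HeisDiag.ofDiagram .capUD : up k ⊗ down k ⟶ 𝟙_ (HeisDiag k))))

theorem rightAction_cl : (rightAction (incl k)).cl Z = cupRight k Z := by
  refine rightMap_eq (incl k) (A := .unit) (B := .tensor .up .down) _ (cup_conj_right (inclTensor k (up k) (down k))
    ((incl k).map (HeisDiag.ofDiagram .cupUD : 𝟙_ (HeisDiag k) ⟶ up k ⊗ down k)))

theorem leftSplitting_link : (leftSplitting k).link μ ν Z =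
    P k ◁ (iotaQ k μ ν ▷ Z ≫ (α_ _ _ _).hom) ≫ capLeft k (QObj k μ ⊗ Z) := by
  rw [HeisAction.YoungSplitting.link_eq, leftAction_ln]
  refine congrArg (fun f ↦ P k ◁ f ≫ _) ?_
  refine (left_conj (youngIncl _ ν) (symMap (isSymmetry_crossDown k)
    (pm (lastToFirst n) * branchIn k μ ν)) (s := splitFirst (down k) n) (youngProj _ μ)
    (leftPowIso_shift (incl k) n Z)).trans ?_
  refine congrArg (fun f ↦ f ▷ Z ≫ _) ?_
  rw [iotaQ_eq, splitIn, symMap_mul]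
  simp only [splitFirst', Iso.trans_hom, Category.assoc]
  rfl

theorem leftSplitting_colink : (leftSplitting k).colink μ ν Z =
    cupLeft k (QObj k μ ⊗ Z) ≫ P k ◁ ((α_ _ _ _).inv ≫ rhoQ k μ ν ▷ Z) := by
  rw [HeisAction.YoungSplitting.colink_eq, leftAction_cl]
  refine congrArg (fun f ↦ _ ≫ P k ◁ f) ?_
  refine (left_conj_inv (youngProj _ ν) (symMap (isSymmetry_crossDown k)
    (branchOut k μ ν * pm (lastToFirst n)⁻¹)) (s := splitFirst (down k) n) (youngIncl _ μ)
    (leftPowIso_shift (incl k) n Z)).trans ?_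
  refine congrArg (fun f ↦ _ ≫ f ▷ Z) ?_
  rw [rhoQ_eq, mergeOut, symMap_mul]
  simp only [splitFirst', Iso.trans_inv, Category.assoc]
  rfl

theorem rightSplitting_link : (rightSplitting k).link μ ν Z =
    (Z ◁ iotaP k μ ν ≫ (α_ _ _ _).inv) ▷ Q k ≫ capRight k (Z ⊗ PObj k μ) := by
  rw [HeisAction.YoungSplitting.link_eq, rightAction_ln]
  refine congrArg (fun f ↦ f ▷ Q k ≫ _) ?_
  refine (right_conj (youngIncl _ ν ≫ symMap (isSymmetry_crossUp k) (pm (rev (n + 1)))) ((incl k).map (symEndRev (isSymmetry_crossUp k) (n + 1)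
    (pm (lastToFirst n) * branchIn k μ ν))) (s := splitLast (up k) n) (symMap (isSymmetry_crossUp k) (pm (rev n)) ≫ youngProj _ μ)
    (rightPowIso_shift (incl k) n Z)).trans ?_
  refine congrArg (fun f ↦ Z ◁ f ≫ _) ?_
  rw [iotaP_eq, splitIn]
  exact iota_rev k (isSymmetry_crossUp k) μ ν

theorem rightSplitting_colink : (rightSplitting k).colink μ ν Z =
    cupRight k (Z ⊗ PObj k μ) ≫ ((α_ _ _ _).hom ≫ Z ◁ rhoP k μ ν) ▷ Q k := by
  rw [HeisAction.YoungSplitting.colink_eq, rightAction_cl]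
  refine congrArg (fun f ↦ _ ≫ f ▷ Q k) ?_
  refine (right_conj_inv (symMap (isSymmetry_crossUp k) (pm (rev (n + 1))) ≫ youngProj _ ν) ((incl k).map (symEndRev (isSymmetry_crossUp k) (n + 1)
    (branchOut k μ ν * pm (lastToFirst n)⁻¹))) (s := splitLast (up k) n) (youngIncl _ μ ≫ symMap (isSymmetry_crossUp k) (pm (rev n)))
    (rightPowIso_shift (incl k) n Z)).trans ?_
  refine congrArg (fun f ↦ _ ≫ Z ◁ f) ?_
  rw [rhoP_eq, mergeOut]
  exact rho_rev k (isSymmetry_crossUp k) μ ν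

end

end Heis

namespace Heis

open YoungDiagram YoungDiagram.OfSize

/-- Transposition of partitions. -/
def transposeEquiv {n : ℕ} : OfSize n ≃ OfSize n where
  toFun := transpose
  invFun := transpose
  left_inv μ := Subtype.ext (YoungDiagram.transpose_transpose μ.1)
  right_inv μ := Subtype.ext (YoungDiagram.transpose_transpose μ.1)

theorem transpose_le_transpose {n m : ℕ} (μ : OfSize n) (ν : OfSize m) :
    μ.transpose.1 ≤ ν.transpose.1 ↔ μ.1 ≤ ν.1 :=
  YoungDiagram.transpose_le_iff

theorem sum_transpose {n : ℕ} {M : Type*} [AddCommMonoid M] (f : OfSize n → M) :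
    ∑ ν : OfSize n, f ν.transpose = ∑ ν, f ν :=
  transposeEquiv.sum_comp f

section

universe v₁ u₁

variable {C : Type u₁} [Category.{v₁} C] [MonoidalCategory C] {A A' X x : C}

theorem outer_left_nat (i : A ⟶ X ⊗ x) {Z W : C} (f : Z ⟶ W) :
    A ◁ f ≫ i ▷ W ≫ (α_ _ _ _).hom = (i ▷ Z ≫ (α_ _ _ _).hom) ≫ X ◁ x ◁ f := by
  rw [whisker_exchange_assoc, Category.assoc, tensor_whiskerLeft, Category.assoc, Category.assoc,
    Iso.inv_hom_id, Category.comp_id]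

theorem outer_left_nat' (r : X ⊗ x ⟶ A) {Z W : C} (f : Z ⟶ W) :
    X ◁ x ◁ f ≫ (α_ _ _ _).inv ≫ r ▷ W = ((α_ _ _ _).inv ≫ r ▷ Z) ≫ A ◁ f := by
  rw [Category.assoc, ← whisker_exchange, tensor_whiskerLeft]
  simp only [Category.assoc, Iso.inv_hom_id_assoc]

theorem outer_left_comp (i : A ⟶ X ⊗ x) (r : X ⊗ x ⟶ A') (Z : C) :
    (i ▷ Z ≫ (α_ _ _ _).hom) ≫ (α_ _ _ _).inv ≫ r ▷ Z = (i ≫ r) ▷ Z := by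
  rw [Category.assoc, Iso.hom_inv_id_assoc, comp_whiskerRight]

theorem outer_right_nat (i : A ⟶ x ⊗ X) {Z W : C} (f : Z ⟶ W) :
    f ▷ A ≫ W ◁ i ≫ (α_ _ _ _).inv = (Z ◁ i ≫ (α_ _ _ _).inv) ≫ (f ▷ x) ▷ X := by
  rw [← whisker_exchange_assoc, Category.assoc, associator_inv_naturality_left]

theorem outer_right_nat' (r : x ⊗ X ⟶ A) {Z W : C} (f : Z ⟶ W) :
    (f ▷ x) ▷ X ≫ (α_ _ _ _).hom ≫ W ◁ r = ((α_ _ _ _).hom ≫ Z ◁ r) ≫ f ▷ A := by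
  rw [Category.assoc, whisker_exchange, associator_naturality_left_assoc]

theorem outer_right_comp (i : A ⟶ x ⊗ X) (r : x ⊗ X ⟶ A') (Z : C) :
    (Z ◁ i ≫ (α_ _ _ _).inv) ≫ (α_ _ _ _).hom ≫ Z ◁ r = Z ◁ (i ≫ r) := by
  rw [Category.assoc, Iso.inv_hom_id_assoc, MonoidalCategory.whiskerLeft_comp]

variable [Preadditive C] [MonoidalPreadditive C] {ι : Type*} [Fintype ι] {p : ι → Prop}
  [DecidablePred p] {B : ι → C}

theorem outer_left_sum (r : ∀ i, X ⊗ x ⟶ B i) (j : ∀ i, B i ⟶ X ⊗ x)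
    (h : ∑ i, (if p i then r i ≫ j i else 0) = 𝟙 _) (Z : C) :
    ∑ i, (if p i then ((α_ _ _ _).inv ≫ r i ▷ Z) ≫ j i ▷ Z ≫ (α_ _ _ _).hom else 0) =
      𝟙 (X ⊗ x ⊗ Z) := by
  have e (i : ι) : (if p i then ((α_ _ _ _).inv ≫ r i ▷ Z) ≫ j i ▷ Z ≫ (α_ _ _ _).hom else 0) =
      (α_ X x Z).inv ≫ (if p i then r i ≫ j i else 0) ▷ Z ≫ (α_ _ _ _).hom := by
    split_ifs <;> simp
  rw [Finset.sum_congr rfl fun i _ ↦ e i, ← Preadditive.comp_sum, ← Preadditive.sum_comp,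
    ← sum_whiskerRight, h]
  simp

theorem outer_right_sum (r : ∀ i, x ⊗ X ⟶ B i) (j : ∀ i, B i ⟶ x ⊗ X)
    (h : ∑ i, (if p i then r i ≫ j i else 0) = 𝟙 _) (Z : C) :
    ∑ i, (if p i then ((α_ _ _ _).hom ≫ Z ◁ r i) ≫ Z ◁ j i ≫ (α_ _ _ _).inv else 0) =
      𝟙 ((Z ⊗ x) ⊗ X) := by
  have e (i : ι) : (if p i then ((α_ _ _ _).hom ≫ Z ◁ r i) ≫ Z ◁ j i ≫ (α_ _ _ _).inv else 0) =
      (α_ Z x X).hom ≫ Z ◁ (if p i then r i ≫ j i else 0) ≫ (α_ _ _ _).inv := by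
    split_ifs <;> simp
  rw [Finset.sum_congr rfl fun i _ ↦ e i, ← Preadditive.comp_sum, ← Preadditive.sum_comp,
    ← whiskerLeft_sum, h]
  simp

end

section

variable (k : Type u) [Field k] [CharZero k] {n : ℕ} (μ : OfSize n) (ν ν' : OfSize (n + 1))

variable {μ ν} in
theorem iotaP_rhoP (h : μ.1 ≤ ν.1) : iotaP k μ ν ≫ rhoP k μ ν = 𝟙 _ := by
  rw [iotaP_eq, rhoP_eq]
  exact splitIn_mergeOut _ (symMap_splitLast _) h

variable {ν ν'} in
theorem iotaP_rhoP_of_ne (h : ν ≠ ν') : iotaP k μ ν ≫ rhoP k μ ν' = 0 := by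
  rw [iotaP_eq, rhoP_eq]
  exact splitIn_mergeOut_of_ne _ _ (symMap_splitLast _) h

open scoped Classical in
theorem sum_rhoP_iotaP : ∑ ν : OfSize (n + 1),
    (if μ.1 ≤ ν.1 then rhoP k μ ν ≫ iotaP k μ ν else 0) = 𝟙 _ := by
  simp only [iotaP_eq, rhoP_eq]
  exact sum_mergeOut_splitIn _ _ (symMap_splitLast _)

variable {μ ν} in
theorem iotaQ_rhoQ (h : μ.1 ≤ ν.1) : iotaQ k μ ν ≫ rhoQ k μ ν = 𝟙 _ := by
  rw [iotaQ_eq, rhoQ_eq]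
  exact splitIn_mergeOut _ symMap_splitFirst' h

variable {ν ν'} in
theorem iotaQ_rhoQ_of_ne (h : ν ≠ ν') : iotaQ k μ ν ≫ rhoQ k μ ν' = 0 := by
  rw [iotaQ_eq, rhoQ_eq]
  exact splitIn_mergeOut_of_ne _ _ symMap_splitFirst' h

open scoped Classical in
theorem sum_rhoQ_iotaQ : ∑ ν : OfSize (n + 1),
    (if μ.1 ≤ ν.1 then rhoQ k μ ν ≫ iotaQ k μ ν else 0) = 𝟙 _ := by
  simp only [iotaQ_eq, rhoQ_eq]
  exact sum_mergeOut_splitIn _ _ symMap_splitFirst'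

open scoped Classical in
theorem sum_rhoQ_iotaQ_transpose : ∑ ν : OfSize (n + 1), (if μ.1 ≤ ν.1 then
    rhoQ k μ.transpose ν.transpose ≫ iotaQ k μ.transpose ν.transpose else 0) = 𝟙 _ := by
  refine Eq.trans ?_ (sum_rhoQ_iotaQ k μ.transpose)
  rw [← sum_transpose (fun ν : OfSize (n + 1) ↦ if μ.transpose.1 ≤ ν.1 then
    rhoQ k μ.transpose ν ≫ iotaQ k μ.transpose ν else 0)]
  exact Finset.sum_congr rfl fun ν _ ↦ if_congr (transpose_le_transpose μ ν).symm rfl rfl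

open scoped Classical in
/-- Tensoring with `P^μ` on the left. -/
noncomputable def leftOuter : (leftAction (incl k)).OuterFunctors where
  t := transposeEquiv
  t_le μ ν := transpose_le_transpose μ ν
  L μ := tensorLeft (PObj k μ)
  io μ ν Z := iotaP k μ ν ▷ Z ≫ (α_ (PObj k μ) (P k) Z).hom
  ro μ ν Z := (α_ (PObj k μ) (P k) Z).inv ≫ rhoP k μ ν ▷ Z
  io_naturality μ ν _ _ f := outer_left_nat (iotaP k μ ν) f
  ro_naturality μ ν _ _ f := outer_left_nat' (rhoP k μ ν) f
  io_ro h Z := (outer_left_comp _ _ Z).trans (by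
    rw [iotaP_rhoP k h]
    exact id_whiskerRight _ _)
  io_ro_of_ne μ _ _ h Z := (outer_left_comp _ _ Z).trans
    (by rw [iotaP_rhoP_of_ne k μ h, MonoidalPreadditive.zero_whiskerRight])
  sum_ro_io μ Z := outer_left_sum (X := PObj k μ) (fun ν ↦ rhoP k μ ν) _ (sum_rhoP_iotaP k μ) Z

open scoped Classical in
/-- Tensoring with `Q^(μᵗ)` on the right. -/
noncomputable def rightOuter : (rightAction (incl k)).OuterFunctors where
  t := Equiv.refl _
  t_le μ ν := Iff.rfl
  L μ := tensorRight (QObj k μ.transpose)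
  io μ ν Z := Z ◁ iotaQ k μ.transpose ν.transpose ≫ (α_ Z (Q k) (QObj k μ.transpose)).inv
  ro μ ν Z := (α_ Z (Q k) (QObj k μ.transpose)).hom ≫ Z ◁ rhoQ k μ.transpose ν.transpose
  io_naturality {n} μ ν {Z W} f := outer_right_nat (A := QObj k ν.transpose) (x := Q k) (X := QObj k μ.transpose) (iotaQ k μ.transpose ν.transpose) f
  ro_naturality {n} μ ν {Z W} f := outer_right_nat' (A := QObj k ν.transpose) (x := Q k) (X := QObj k μ.transpose) (rhoQ k μ.transpose ν.transpose) f
  io_ro h Z := (outer_right_comp _ _ Z).trans (by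
    rw [iotaQ_rhoQ k ((transpose_le_transpose _ _).2 h)]
    exact MonoidalCategory.whiskerLeft_id _ _)
  io_ro_of_ne μ ν ν' h Z := (outer_right_comp _ _ Z).trans (by
    have e : ν.transpose ≠ ν'.transpose := transposeEquiv.injective.ne h
    rw [iotaQ_rhoQ_of_ne k _ e, MonoidalPreadditive.whiskerLeft_zero])
  sum_ro_io {n} μ Z := outer_right_sum (X := QObj k μ.transpose) (x := Q k)
    (B := fun ν : OfSize (n + 1) ↦ QObj k ν.transpose) (p := fun ν ↦ μ.1 ≤ ν.1)
    (fun ν ↦ rhoQ k μ.transpose ν.transpose)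
    (fun ν ↦ iotaQ k μ.transpose ν.transpose) (sum_rhoQ_iotaQ_transpose k μ) Z

end

end Heis

namespace Heis

open YoungDiagram YoungDiagram.OfSize

section

universe v₁ u₁

variable {C : Type u₁} [Category.{v₁} C] [MonoidalCategory C] {A A' B B' p q W W' : C}

theorem lower_whiskerRight (i : A ⟶ A' ⊗ p) (j : B ⟶ q ⊗ B') (c : p ⊗ q ⟶ 𝟙_ C) (w : W ⟶ W') :
    ((i ⊗ₘ j) ≫ (α_ A' p (q ⊗ B')).hom ≫ A' ◁ ((α_ p q B').inv ≫ c ▷ B' ≫ (λ_ B').hom)) ▷ W ≫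
      (A' ⊗ B') ◁ w ≫ (α_ A' B' W').hom =
    ((A ⊗ B) ◁ w ≫ (α_ A B W').hom) ≫ (i ▷ (B ⊗ W') ≫ (α_ A' p (B ⊗ W')).hom) ≫
      A' ◁ (p ◁ (j ▷ W' ≫ (α_ q B' W').hom) ≫
        (α_ p q (B' ⊗ W')).inv ≫ c ▷ (B' ⊗ W') ≫ (λ_ (B' ⊗ W')).hom) := by
  rw [← whisker_exchange_assoc, Category.assoc, MonoidalCategory.tensorHom_def]
  congr 1
  monoidal

theorem raise_whiskerRight (i : A' ⊗ p ⟶ A) (j : q ⊗ B' ⟶ B) (c : 𝟙_ C ⟶ p ⊗ q) (w : W ⟶ W') :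
    (A' ◁ ((λ_ B').inv ≫ c ▷ B' ≫ (α_ p q B').hom) ≫ (α_ A' p (q ⊗ B')).inv ≫ (i ⊗ₘ j)) ▷ W ≫
      (A ⊗ B) ◁ w ≫ (α_ A B W').hom =
    ((A' ⊗ B') ◁ w ≫ (α_ A' B' W').hom) ≫ A' ◁ (((λ_ (B' ⊗ W')).inv ≫ c ▷ (B' ⊗ W') ≫
      (α_ p q (B' ⊗ W')).hom) ≫ p ◁ ((α_ q B' W').inv ≫ j ▷ W')) ≫
        (α_ A' p (B ⊗ W')).inv ≫ i ▷ (B ⊗ W') := by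
  rw [← whisker_exchange_assoc, Category.assoc, tensorHom_def']
  congr 1
  monoidal

theorem lower_whiskerLeft (i : A ⟶ A' ⊗ p) (j : B ⟶ q ⊗ B') (c : p ⊗ q ⟶ 𝟙_ C) (w : W ⟶ W') :
    W ◁ ((i ⊗ₘ j) ≫ (α_ A' p (q ⊗ B')).hom ≫ A' ◁ ((α_ p q B').inv ≫ c ▷ B' ≫ (λ_ B').hom)) ≫
      w ▷ (A' ⊗ B') ≫ (α_ W' A' B').inv =
    (w ▷ (A ⊗ B) ≫ (α_ W' A B).inv) ≫ ((W' ⊗ A) ◁ j ≫ (α_ (W' ⊗ A) q B').inv) ≫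
      ((W' ◁ i ≫ (α_ W' A' p).inv) ▷ q ≫ (α_ (W' ⊗ A') p q).hom ≫ (W' ⊗ A') ◁ c ≫
        (ρ_ (W' ⊗ A')).hom) ▷ B' := by
  rw [whisker_exchange_assoc, Category.assoc, tensorHom_def']
  congr 1
  monoidal

theorem raise_whiskerLeft (i : A' ⊗ p ⟶ A) (j : q ⊗ B' ⟶ B) (c : 𝟙_ C ⟶ p ⊗ q) (w : W ⟶ W') :
    W ◁ (A' ◁ ((λ_ B').inv ≫ c ▷ B' ≫ (α_ p q B').hom) ≫ (α_ A' p (q ⊗ B')).inv ≫ (i ⊗ₘ j)) ≫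
      w ▷ (A ⊗ B) ≫ (α_ W' A B).inv =
    (w ▷ (A' ⊗ B') ≫ (α_ W' A' B').inv) ≫ (((ρ_ (W' ⊗ A')).inv ≫ (W' ⊗ A') ◁ c ≫
      (α_ (W' ⊗ A') p q).inv) ≫ ((α_ W' A' p).hom ≫ W' ◁ i) ▷ q) ▷ B' ≫
        (α_ (W' ⊗ A) q B').hom ≫ (W' ⊗ A) ◁ j := by
  rw [whisker_exchange_assoc, Category.assoc, MonoidalCategory.tensorHom_def]
  congr 1
  monoidal

end

section

variable (k : Type u) [Field k] [CharZero k] {n : ℕ} (μ : OfSize n) (ν : OfSize (n + 1))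

open HeisAction

/-- The terms of `Σ ⊗ P`. -/
noncomputable def leftTerm : PQ k μ ⊗ P k ≅ term (leftSplitting k) (leftOuter k) (𝟙_ _) μ :=
  whiskerLeftIso (PQ k μ) (ρ_ (P k)).symm ≪≫ α_ (PObj k μ) (QObj k μ.transpose) (P k ⊗ 𝟙_ _)

/-- The terms of `Q ⊗ Σ`. -/
noncomputable def rightTerm : Q k ⊗ PQ k μ ≅ term (rightSplitting k) (rightOuter k) (𝟙_ _) μ :=
  whiskerRightIso (λ_ (Q k)).symm (PQ k μ) ≪≫
    (α_ (𝟙_ _ ⊗ Q k) (PObj k μ) (QObj k μ.transpose)).symm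

theorem leftTerm_down : lower k μ ν ▷ P k ≫ (leftTerm k μ).hom =
    (leftTerm k ν).hom ≫ HeisAction.down (leftSplitting k) (leftOuter k) μ ν (𝟙_ _) := by
  rw [HeisAction.down, leftSplitting_link]
  exact lower_whiskerRight (iotaP k μ ν) (iotaQ k μ.transpose ν.transpose) (cap k) (ρ_ (P k)).inv

theorem leftTerm_raising : raise k μ ν ▷ P k ≫ (leftTerm k ν).hom =
    (leftTerm k μ).hom ≫ raising (leftSplitting k) (leftOuter k) μ ν (𝟙_ _) := by
  rw [raising, leftSplitting_colink]
  exact raise_whiskerRight (rhoP k μ ν) (rhoQ k μ.transpose ν.transpose) (cup k) (ρ_ (P k)).inv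

theorem rightTerm_down : Q k ◁ lower k μ ν ≫ (rightTerm k μ).hom =
    (rightTerm k ν).hom ≫ HeisAction.down (rightSplitting k) (rightOuter k) μ ν (𝟙_ _) := by
  rw [HeisAction.down, rightSplitting_link]
  exact lower_whiskerLeft (iotaP k μ ν) (iotaQ k μ.transpose ν.transpose) (cap k) (λ_ (Q k)).inv

theorem rightTerm_raising : Q k ◁ raise k μ ν ≫ (rightTerm k ν).hom =
    (rightTerm k μ).hom ≫ raising (rightSplitting k) (rightOuter k) μ ν (𝟙_ _) := by
  rw [raising, rightSplitting_colink]
  exact raise_whiskerLeft (rhoP k μ ν) (rhoQ k μ.transpose ν.transpose) (cup k) (λ_ (Q k)).inv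

end

end Heis

namespace Heis

universe v₁ u₁ v₂ u₂

section

variable {C : Type u₁} [Category.{v₁} C] [Preadditive C]
  {K L : HomologicalComplex C (ComplexShape.down ℤ)}

/-- A family of maps that raise the degree by one, as a family indexed by pairs of degrees. -/
def upHom (s : ∀ i : ℤ, K.X i ⟶ L.X (i + 1)) (i j : ℤ) : K.X i ⟶ L.X j :=
  if h : i + 1 = j then s i ≫ eqToHom (by rw [h]) else 0

theorem upHom_self (s : ∀ i : ℤ, K.X i ⟶ L.X (i + 1)) (i : ℤ) : upHom s i (i + 1) = s i := by
  rw [upHom, dif_pos rfl, eqToHom_refl, Category.comp_id]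

/-- The null-homotopic map given by a family of maps that raise the degree by one. -/
noncomputable def nullMap (s : ∀ i : ℤ, K.X i ⟶ L.X (i + 1)) : K ⟶ L := Homotopy.nullHomotopicMap (upHom s)

theorem nullMap_f (s : ∀ i : ℤ, K.X i ⟶ L.X (i + 1)) (i : ℤ) :
    (nullMap s).f (i + 1) = K.d (i + 1) i ≫ s i + s (i + 1) ≫ L.d (i + 1 + 1) (i + 1) := by
  rw [nullMap, Homotopy.nullHomotopicMap_f (k₂ := i + 1 + 1) (k₁ := i + 1) (k₀ := i) rfl rfl,
    upHom_self, upHom_self]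

theorem quotient_map_nullMap (s : ∀ i : ℤ, K.X i ⟶ L.X (i + 1)) :
    (HomotopyCategory.quotient C (ComplexShape.down ℤ)).map (nullMap s) = 0 := by
  rw [← (HomotopyCategory.quotient C (ComplexShape.down ℤ)).map_zero]
  exact HomotopyCategory.eq_of_homotopy _ _ (Homotopy.nullHomotopy _ fun i j h ↦ dif_neg h)

theorem exists_eq_nullMap {f : K ⟶ L}
    (h : (HomotopyCategory.quotient C (ComplexShape.down ℤ)).map f = 0) :
    ∃ s : ∀ i : ℤ, K.X i ⟶ L.X (i + 1), f = nullMap s := by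
  rw [← (HomotopyCategory.quotient C (ComplexShape.down ℤ)).map_zero] at h
  let e := HomotopyCategory.homotopyOfEq _ _ h
  refine ⟨fun i ↦ e.hom i (i + 1), ?_⟩
  ext i
  obtain ⟨i, rfl⟩ : ∃ j, i = j + 1 := ⟨i - 1, by lia⟩
  rw [nullMap_f, e.comm, dNext_eq e.hom (i := i + 1) (i' := i) rfl,
    prevD_eq e.hom (j := i + 1) (j' := i + 1 + 1) rfl]
  exact add_zero _

theorem isZero_of_partial_contraction (p : ∀ i, K.X i ⟶ K.X i) (s : ∀ i, K.X i ⟶ K.X (i + 1))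
    (h₁ : ∀ i, p i ≫ s i = s i) (h₂ : ∀ i, s i ≫ p (i + 1) = 0)
    (h₃ : ∀ i, s i ≫ K.d (i + 1) i ≫ p i = p i)
    (h₄ : ∀ i, (𝟙 _ - p (i + 1)) ≫ K.d (i + 1) i ≫ s i = 𝟙 _ - p (i + 1)) :
    IsZero ((HomotopyCategory.quotient C (ComplexShape.down ℤ)).obj K) := by
  have h : (𝟙 K - nullMap s) ≫ (𝟙 K - nullMap s) = 0 := by
    ext i
    obtain ⟨i, rfl⟩ : ∃ j, i = j + 1 := ⟨i - 1, by lia⟩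
    have hp : (𝟙 K - nullMap s).f (i + 1) ≫ p (i + 1) = 0 := by
      rw [HomologicalComplex.sub_f_apply, nullMap_f, Preadditive.sub_comp, Preadditive.add_comp,
        Category.assoc, Category.assoc, h₂, comp_zero, zero_add, h₃, HomologicalComplex.id_f,
        Category.id_comp, sub_self]
    have hq : (𝟙 _ - p (i + 1)) ≫ (𝟙 K - nullMap s).f (i + 1) = 0 := by
      rw [HomologicalComplex.sub_f_apply, nullMap_f, Preadditive.comp_sub, Preadditive.comp_add, h₄,
        Preadditive.sub_comp _ _ (s (i + 1) ≫ _), reassoc_of% h₁, Category.id_comp, sub_self,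
        add_zero, HomologicalComplex.id_f, Category.comp_id, sub_self]
    rw [HomologicalComplex.comp_f]
    calc _ = (𝟙 K - nullMap s).f (i + 1) ≫ (p (i + 1) + (𝟙 _ - p (i + 1))) ≫
          (𝟙 K - nullMap s).f (i + 1) := by rw [add_sub_cancel, Category.id_comp]
      _ = 0 := by rw [Preadditive.add_comp, Preadditive.comp_add, hq, comp_zero, add_zero,
          reassoc_of% hp, zero_comp]
  have h' : 𝟙 K = nullMap s ≫ (𝟙 K + (𝟙 K - nullMap s)) := by
    have : nullMap s = 𝟙 K - (𝟙 K - nullMap s) := (sub_sub_cancel _ _).symm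
    conv_rhs => enter [1]; rw [this]
    rw [Preadditive.sub_comp, Category.id_comp, Preadditive.comp_add, h, add_zero, Category.comp_id,
      add_sub_cancel_right]
  rw [IsZero.iff_id_eq_zero, ← (HomotopyCategory.quotient C (ComplexShape.down ℤ)).map_id, h',
    Functor.map_comp, quotient_map_nullMap, zero_comp]

end

section

variable {C : Type u₁} [Category.{v₁} C] [Preadditive C] [HasZeroObject C] {X T : ℕ → C}

theorem conj_one_sub {A B : C} (e : A ≅ B) (p : B ⟶ B) :
    e.hom ≫ (𝟙 B - p) ≫ e.inv = 𝟙 A - e.hom ≫ p ≫ e.inv := by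
  rw [Preadditive.sub_comp, Preadditive.comp_sub, Category.id_comp, Iso.hom_inv_id]

theorem nonnegComplex_d (d : ∀ n, X (n + 1) ⟶ X n) (h : ∀ n, d (n + 1) ≫ d n = 0) (i : ℤ) :
    (nonnegComplex X d h).d (i + 1) i = nonnegMap X d i :=
  ChainComplex.of_d _ _ _

theorem nonposComplex_d (d : ∀ n, X n ⟶ X (n + 1)) (h : ∀ n, d n ≫ d (n + 1) = 0) (i : ℤ) :
    (nonposComplex X d h).d (i + 1) i = nonposMap X d i :=
  ChainComplex.of_d _ _ _

variable (F : C ⥤ C) [F.Additive] (e : ∀ n, F.obj (X n) ≅ T n) (p : ∀ n, T n ⟶ T n)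

theorem isZero_map_nonnegComplex (d : ∀ n, X (n + 1) ⟶ X n) (h : ∀ n, d (n + 1) ≫ d n = 0)
    (d' : ∀ n, T (n + 1) ⟶ T n) (hd : ∀ n, F.map (d n) ≫ (e n).hom = (e (n + 1)).hom ≫ d' n)
    (s : ∀ n, T n ⟶ T (n + 1)) (h₀ : p 0 = 𝟙 _)
    (h₁ : ∀ n, p n ≫ s n = s n) (h₂ : ∀ n, s n ≫ p (n + 1) = 0)
    (h₃ : ∀ n, s n ≫ d' n ≫ p n = p n)
    (h₄ : ∀ n, (𝟙 _ - p (n + 1)) ≫ d' n ≫ s n = 𝟙 _ - p (n + 1)) :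
    IsZero ((HomotopyCategory.quotient C (ComplexShape.down ℤ)).obj
      ((F.mapHomologicalComplex _).obj (nonnegComplex X d h))) := by
  have hd' (n : ℕ) : F.map (d n) = (e (n + 1)).hom ≫ d' n ≫ (e n).inv := by
    rw [← Category.assoc, ← hd, Category.assoc, Iso.hom_inv_id, Category.comp_id]
  have hz (n : ℕ) : IsZero (F.obj (nonnegObj X (.negSucc n))) := F.map_isZero (isZero_zero C)
  let P : ∀ i : ℤ, F.obj (nonnegObj X i) ⟶ F.obj (nonnegObj X i)
    | .ofNat n => (e n).hom ≫ p n ≫ (e n).inv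
    | .negSucc _ => 0
  let S : ∀ i : ℤ, F.obj (nonnegObj X i) ⟶ F.obj (nonnegObj X (i + 1))
    | .ofNat n => (e n).hom ≫ s n ≫ (e (n + 1)).inv
    | .negSucc _ => 0
  refine isZero_of_partial_contraction P S ?_ ?_ ?_ ?_
  · rintro (n | n)
    · change ((e n).hom ≫ p n ≫ (e n).inv) ≫ (e n).hom ≫ s n ≫ (e (n + 1)).inv =
        (e n).hom ≫ s n ≫ (e (n + 1)).inv
      simp [reassoc_of% h₁]
    · exact (hz n).eq_of_src _ _
  · rintro (n | n)
    · change ((e n).hom ≫ s n ≫ (e (n + 1)).inv) ≫ (e (n + 1)).hom ≫ p (n + 1) ≫ (e (n + 1)).inv = 0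
      simp [reassoc_of% h₂]
    · exact (hz n).eq_of_src _ _
  · intro i
    rw [Functor.mapHomologicalComplex_obj_d, nonnegComplex_d]
    obtain n | n := i
    · change ((e n).hom ≫ s n ≫ (e (n + 1)).inv) ≫ F.map (d n) ≫ (e n).hom ≫ p n ≫ (e n).inv =
        (e n).hom ≫ p n ≫ (e n).inv
      simp [hd', reassoc_of% h₃]
    · exact (hz n).eq_of_src _ _
  · intro i
    rw [Functor.mapHomologicalComplex_obj_d, nonnegComplex_d]
    obtain n | _ | n := i
    · change (𝟙 (F.obj (X (n + 1))) - (e (n + 1)).hom ≫ p (n + 1) ≫ (e (n + 1)).inv) ≫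
        F.map (d n) ≫ (e n).hom ≫ s n ≫ (e (n + 1)).inv =
          𝟙 (F.obj (X (n + 1))) - (e (n + 1)).hom ≫ p (n + 1) ≫ (e (n + 1)).inv
      rw [hd', ← conj_one_sub]
      simp only [Category.assoc, Iso.inv_hom_id_assoc, reassoc_of% h₄]
    · have h5 : (𝟙 (F.obj (X 0)) - (e 0).hom ≫ p 0 ≫ (e 0).inv) = 0 := by simp [h₀]
      change (𝟙 (F.obj (X 0)) - (e 0).hom ≫ p 0 ≫ (e 0).inv) ≫ _ =
        (𝟙 (F.obj (X 0)) - (e 0).hom ≫ p 0 ≫ (e 0).inv)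
      exact ((congrArg (· ≫ _) h5).trans zero_comp).trans h5.symm
    · exact (hz n).eq_of_src _ _

theorem isZero_map_nonposComplex (d : ∀ n, X n ⟶ X (n + 1)) (h : ∀ n, d n ≫ d (n + 1) = 0)
    (d' : ∀ n, T n ⟶ T (n + 1)) (hd : ∀ n, F.map (d n) ≫ (e (n + 1)).hom = (e n).hom ≫ d' n)
    (s : ∀ n, T (n + 1) ⟶ T n) (h₀ : p 0 = 𝟙 _)
    (h₁ : ∀ n, s n ≫ p n = s n) (h₂ : ∀ n, p (n + 1) ≫ s n = 0)
    (h₃ : ∀ n, p n ≫ d' n ≫ s n = p n)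
    (h₄ : ∀ n, s n ≫ d' n ≫ (𝟙 _ - p (n + 1)) = 𝟙 _ - p (n + 1)) :
    IsZero ((HomotopyCategory.quotient C (ComplexShape.down ℤ)).obj
      ((F.mapHomologicalComplex _).obj (nonposComplex X d h))) := by
  have hd' (n : ℕ) : F.map (d n) = (e n).hom ≫ d' n ≫ (e (n + 1)).inv := by
    rw [← Category.assoc, ← hd, Category.assoc, Iso.hom_inv_id, Category.comp_id]
  have hz (n : ℕ) : IsZero (F.obj (nonposObj X (.ofNat (n + 1)))) := F.map_isZero (isZero_zero C)
  let P : ∀ i : ℤ, F.obj (nonposObj X i) ⟶ F.obj (nonposObj X i)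
    | .ofNat 0 => (e 0).hom ≫ (𝟙 _ - p 0) ≫ (e 0).inv
    | .ofNat (_ + 1) => 0
    | .negSucc n => (e (n + 1)).hom ≫ (𝟙 _ - p (n + 1)) ≫ (e (n + 1)).inv
  let S : ∀ i : ℤ, F.obj (nonposObj X i) ⟶ F.obj (nonposObj X (i + 1))
    | .ofNat _ => 0
    | .negSucc 0 => (e 1).hom ≫ s 0 ≫ (e 0).inv
    | .negSucc (n + 1) => (e (n + 2)).hom ≫ s (n + 1) ≫ (e (n + 1)).inv
  have g₁ (n : ℕ) : ((e (n + 1)).hom ≫ (𝟙 _ - p (n + 1)) ≫ (e (n + 1)).inv) ≫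
      (e (n + 1)).hom ≫ s n ≫ (e n).inv = (e (n + 1)).hom ≫ s n ≫ (e n).inv := by
    simp [Preadditive.sub_comp, reassoc_of% h₂]
  have g₂ (n : ℕ) : ((e (n + 1)).hom ≫ s n ≫ (e n).inv) ≫
      (e n).hom ≫ (𝟙 _ - p n) ≫ (e n).inv = 0 := by
    simp [Preadditive.sub_comp, Preadditive.comp_sub, reassoc_of% h₁]
  have g₃ (n : ℕ) : ((e (n + 1)).hom ≫ s n ≫ (e n).inv) ≫ F.map (d n) ≫
      (e (n + 1)).hom ≫ (𝟙 _ - p (n + 1)) ≫ (e (n + 1)).inv =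
        (e (n + 1)).hom ≫ (𝟙 _ - p (n + 1)) ≫ (e (n + 1)).inv := by
    simp only [hd', Category.assoc, Iso.inv_hom_id_assoc, reassoc_of% h₄]
  have g₄ (n : ℕ) : (𝟙 (F.obj (X n)) - (e n).hom ≫ (𝟙 _ - p n) ≫ (e n).inv) ≫ F.map (d n) ≫
      (e (n + 1)).hom ≫ s n ≫ (e n).inv =
        𝟙 (F.obj (X n)) - (e n).hom ≫ (𝟙 _ - p n) ≫ (e n).inv := by
    simp only [conj_one_sub, sub_sub_cancel, hd', Category.assoc, Iso.inv_hom_id_assoc,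
      reassoc_of% h₃]
  have g₅ : (e 0).hom ≫ (𝟙 _ - p 0) ≫ (e 0).inv = 0 := by
    rw [h₀, sub_self, zero_comp, comp_zero]
  refine isZero_of_partial_contraction P S ?_ ?_ ?_ ?_
  · rintro ((_ | n) | _ | n)
    · exact comp_zero
    · exact comp_zero
    · exact g₁ 0
    · exact g₁ (n + 1)
  · rintro ((_ | n) | _ | n)
    · exact zero_comp
    · exact zero_comp
    · exact g₂ 0
    · exact g₂ (n + 1)
  · intro i
    rw [Functor.mapHomologicalComplex_obj_d, nonposComplex_d]
    obtain (_ | n) | _ | n := i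
    · exact zero_comp.trans g₅.symm
    · exact zero_comp
    · exact g₃ 0
    · exact g₃ (n + 1)
  · intro i
    rw [Functor.mapHomologicalComplex_obj_d, nonposComplex_d]
    obtain (_ | n) | _ | n := i
    · exact (hz 0).eq_of_src _ _
    · exact (hz (n + 1)).eq_of_src _ _
    · exact g₄ 0
    · exact g₄ (n + 1)

end

end Heis

namespace Heis

open YoungDiagram YoungDiagram.OfSize

section

universe v₁ u₁ v₂ u₂

variable {C : Type u₁} [Category.{v₁} C] [Preadditive C] [HasFiniteBiproducts C]
  {I J K : Type} [Fintype I] [Fintype J] [Fintype K] {f : I → C} {g : J → C} {h : K → C}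

theorem matrix_comp_matrix (m : ∀ i j, f i ⟶ g j) (m' : ∀ j l, g j ⟶ h l) :
    biproduct.matrix m ≫ biproduct.matrix m' =
      biproduct.matrix fun i l ↦ ∑ j, m i j ≫ m' j l := by
  ext i l
  rw [biproduct.matrix_π, biproduct.ι_desc, Category.assoc, biproduct.matrix_π,
    biproduct.ι_matrix_assoc, biproduct.lift_desc]

theorem matrix_zero : (biproduct.matrix fun i j ↦ (0 : f i ⟶ g j)) = 0 := by
  ext i j
  rw [biproduct.matrix_π, biproduct.ι_desc, zero_comp, comp_zero]

theorem map_eq_matrix [DecidableEq I] (p : ∀ i, f i ⟶ f i) : biproduct.map p =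
    biproduct.matrix fun i j ↦ if h : i = j then p i ≫ eqToHom (by rw [h]) else 0 := by
  ext i l
  classical
  simp only [biproduct.ι_map_assoc, biproduct.ι_π, biproduct.ι_matrix_assoc, biproduct.lift_π]
  split_ifs with h
  · rfl
  · exact comp_zero

theorem one_sub_map (p : ∀ i, f i ⟶ f i) :
    𝟙 (⨁ f) - biproduct.map p = biproduct.map fun i ↦ 𝟙 (f i) - p i := by
  ext i
  simp [Preadditive.comp_sub, Preadditive.sub_comp]

variable {D : Type u₂} [Category.{v₂} D] [Preadditive D] [HasFiniteBiproducts D] (F : C ⥤ D)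
  [F.Additive] {f' : I → D} {g' : J → D}

/-- An additive functor applied to a direct sum. -/
noncomputable def mapSumIso (t : ∀ i, F.obj (f i) ≅ f' i) : F.obj (⨁ f) ≅ ⨁ f' where
  hom := biproduct.lift fun i ↦ F.map (biproduct.π f i) ≫ (t i).hom
  inv := biproduct.desc fun i ↦ (t i).inv ≫ F.map (biproduct.ι f i)
  hom_inv_id := by
    rw [biproduct.lift_desc, ← F.map_id, ← biproduct.total, F.map_sum]
    exact Finset.sum_congr rfl fun i _ ↦ by
      rw [Category.assoc, Iso.hom_inv_id_assoc, F.map_comp]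
  inv_hom_id := by
    classical
    ext i j
    rw [Category.assoc, biproduct.lift_π, biproduct.ι_desc_assoc, Category.id_comp, biproduct.ι_π,
      Category.assoc, ← F.map_comp_assoc, biproduct.ι_π]
    split_ifs with h
    · subst h
      simp
    · rw [F.map_zero, zero_comp, comp_zero]

theorem map_matrix_mapSumIso (m : ∀ i j, f i ⟶ g j) (m' : ∀ i j, f' i ⟶ g' j)
    (t : ∀ i, F.obj (f i) ≅ f' i) (t' : ∀ j, F.obj (g j) ≅ g' j)
    (hm : ∀ i j, F.map (m i j) ≫ (t' j).hom = (t i).hom ≫ m' i j) :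
    F.map (biproduct.matrix m) ≫ (mapSumIso F t').hom =
      (mapSumIso F t).hom ≫ biproduct.matrix m' := by
  rw [← cancel_epi (mapSumIso F t).inv, Iso.inv_hom_id_assoc]
  ext i j
  dsimp only [mapSumIso]
  rw [Category.assoc, Category.assoc, biproduct.ι_desc_assoc, biproduct.lift_π, Category.assoc, ← F.map_comp_assoc, ← F.map_comp_assoc, Category.assoc,
    biproduct.matrix_π, biproduct.ι_desc, hm, Iso.inv_hom_id_assoc,
    biproduct.matrix_π, biproduct.ι_desc]

end

section

variable (k : Type u) [Field k] [CharZero k] {S : HeisAction k (HeisCat k)} (Y : S.YoungSplitting)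
  (O : S.OuterFunctors) (Z : HeisCat k) (F : HeisCat k ⥤ HeisCat k) [F.Additive] [F.Linear k]
  (t : ∀ {n : ℕ} (μ : OfSize n), F.obj (PQ k μ) ≅ HeisAction.term Y O Z μ)
  (ε : YoungDiagram → YoungDiagram → kˣ)

open HeisAction

theorem isZero_map_sigmaMinus (ht : ∀ {n : ℕ} (μ : OfSize n) (ν : OfSize (n + 1)),
    F.map (lower k μ ν) ≫ (t μ).hom = (t ν).hom ≫ HeisAction.down Y O μ ν Z)
    (h : ∀ n, dMinus k ε (n + 1) ≫ dMinus k ε n = 0) :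
    IsZero ((toHomotopy k).obj ((F.mapHomologicalComplex _).obj (sigmaMinus k ε h))) := by
  classical
  refine isZero_map_nonnegComplex F (T := fun n ↦ ⨁ fun μ : OfSize n ↦ HeisAction.term Y O Z μ)
    (fun n ↦ mapSumIso F fun μ ↦ t μ) (fun n ↦ biproduct.map fun μ ↦ pass Y O Z μ) _ h
    (fun n ↦ biproduct.matrix fun ν μ ↦ downEntry Y O μ ν Z fun μ ν ↦ ε μ.1 ν.1) (fun n ↦ ?_)
    (fun n ↦ biproduct.matrix fun μ ν ↦ hupEntry Y O μ ν Z fun μ ν ↦ ε μ.1 ν.1) ?_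
    (fun n ↦ ?_) (fun n ↦ ?_) (fun n ↦ ?_) (fun n ↦ ?_)
  · refine map_matrix_mapSumIso F _ _ _ _ fun ν μ ↦ ?_
    rw [downEntry]
    split_ifs
    · rw [F.map_smul, Linear.smul_comp, ht, Linear.comp_smul]
    · rw [F.map_zero, zero_comp, comp_zero]
  · refine biproduct.hom_ext' _ _ fun μ ↦ ?_
    rw [biproduct.ι_map, pass_zero, Category.id_comp, Category.comp_id]
  · rw [biproduct.map_matrix]
    simp only [pass_hupEntry]
  · rw [biproduct.matrix_map]
    simp only [hupEntry_pass]
    exact matrix_zero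
  · rw [biproduct.matrix_map, matrix_comp_matrix, map_eq_matrix]
    simp only [sum_hupEntry_downEntry_pass]
  · rw [one_sub_map, ← Category.assoc, biproduct.map_matrix, matrix_comp_matrix, map_eq_matrix]
    simp only [Category.assoc, sum_downEntry_hupEntry]

theorem isZero_map_sigmaPlus (ht : ∀ {n : ℕ} (μ : OfSize n) (ν : OfSize (n + 1)),
    F.map (raise k μ ν) ≫ (t ν).hom = (t μ).hom ≫ HeisAction.raising Y O μ ν Z)
    (h : ∀ n, dPlus k ε n ≫ dPlus k ε (n + 1) = 0) :
    IsZero ((toHomotopy k).obj ((F.mapHomologicalComplex _).obj (sigmaPlus k ε h))) := by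
  classical
  refine isZero_map_nonposComplex F (T := fun n ↦ ⨁ fun μ : OfSize n ↦ HeisAction.term Y O Z μ)
    (fun n ↦ mapSumIso F fun μ ↦ t μ) (fun n ↦ biproduct.map fun μ ↦ pass Y O Z μ) _ h
    (fun n ↦ biproduct.matrix fun μ ν ↦ raisingEntry Y O μ ν Z fun μ ν ↦ ε μ.1 ν.1) (fun n ↦ ?_)
    (fun n ↦ biproduct.matrix fun ν μ ↦ hdownEntry Y O μ ν Z fun μ ν ↦ ε μ.1 ν.1) ?_
    (fun n ↦ ?_) (fun n ↦ ?_) (fun n ↦ ?_) (fun n ↦ ?_)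
  · refine map_matrix_mapSumIso F _ _ _ _ fun μ ν ↦ ?_
    rw [raisingEntry]
    split_ifs
    · rw [F.map_smul, Linear.smul_comp, ht, Linear.comp_smul]
    · rw [F.map_zero, zero_comp, comp_zero]
  · refine biproduct.hom_ext' _ _ fun μ ↦ ?_
    rw [biproduct.ι_map, pass_zero, Category.id_comp, Category.comp_id]
  · rw [biproduct.matrix_map]
    simp only [hdownEntry_pass]
  · rw [biproduct.map_matrix]
    simp only [pass_hdownEntry]
    exact matrix_zero
  · rw [← Category.assoc, biproduct.map_matrix, matrix_comp_matrix, map_eq_matrix]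
    simp only [Category.assoc, sum_pass_raisingEntry_hdownEntry]
  · rw [one_sub_map, biproduct.matrix_map, matrix_comp_matrix, map_eq_matrix]
    simp only [sum_hdownEntry_raisingEntry]

variable {k} {ε}

theorem isContractible_sigmaMinus_P (h : ∀ n, dMinus k ε (n + 1) ≫ dMinus k ε n = 0) :
    IsContractible (tensorObjRight (sigmaMinus k ε h) (P k)) :=
  isZero_map_sigmaMinus k (leftSplitting k) (leftOuter k) (𝟙_ _) (tensorRight (P k)) (leftTerm k) ε
    (leftTerm_down k) h

theorem isContractible_Q_sigmaMinus (h : ∀ n, dMinus k ε (n + 1) ≫ dMinus k ε n = 0) :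
    IsContractible (tensorObjLeft (Q k) (sigmaMinus k ε h)) :=
  isZero_map_sigmaMinus k (rightSplitting k) (rightOuter k) (𝟙_ _) (tensorLeft (Q k)) (rightTerm k)
    ε (rightTerm_down k) h

theorem isContractible_sigmaPlus_P (h : ∀ n, dPlus k ε n ≫ dPlus k ε (n + 1) = 0) :
    IsContractible (tensorObjRight (sigmaPlus k ε h) (P k)) :=
  isZero_map_sigmaPlus k (leftSplitting k) (leftOuter k) (𝟙_ _) (tensorRight (P k)) (leftTerm k) ε
    (leftTerm_raising k) h

theorem isContractible_Q_sigmaPlus (h : ∀ n, dPlus k ε n ≫ dPlus k ε (n + 1) = 0) :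
    IsContractible (tensorObjLeft (Q k) (sigmaPlus k ε h)) :=
  isZero_map_sigmaPlus k (rightSplitting k) (rightOuter k) (𝟙_ _) (tensorLeft (Q k)) (rightTerm k)
    ε (rightTerm_raising k) h

end

end Heis

namespace Heis

open YoungDiagram YoungDiagram.OfSize

section

universe v₁ u₁

variable {C : Type u₁} [Category.{v₁} C] [Preadditive C]
  {K : HomologicalComplex C (ComplexShape.down ℤ)} {F G E : C ⥤ C} [F.Additive] [G.Additive]
  [E.Additive]

theorem isZero_map_of_retract (i : F ⟶ G ⋙ E) (r : G ⋙ E ⟶ F) (h : i ≫ r = 𝟙 F)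
    (hG : IsZero ((HomotopyCategory.quotient _ _).obj ((G.mapHomologicalComplex _).obj K))) :
    IsZero ((HomotopyCategory.quotient _ _).obj ((F.mapHomologicalComplex _).obj K)) := by
  obtain ⟨s, hs⟩ := exists_eq_nullMap (((HomotopyCategory.quotient _ _).map_id _).trans
    ((IsZero.iff_id_eq_zero _).1 hG))
  let s' (j : ℤ) : G.obj (K.X j) ⟶ G.obj (K.X (j + 1)) := s j
  let t (j : ℤ) : F.obj (K.X j) ⟶ F.obj (K.X (j + 1)) :=
    i.app (K.X j) ≫ E.map (s' j) ≫ r.app (K.X (j + 1))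
  have e : 𝟙 ((F.mapHomologicalComplex (ComplexShape.down ℤ)).obj K) =
      nullMap (K := (F.mapHomologicalComplex _).obj K) (L := (F.mapHomologicalComplex _).obj K) t := by
    refine HomologicalComplex.hom_ext _ _ fun j ↦ ?_
    obtain ⟨j, rfl⟩ : ∃ l, j = l + 1 := ⟨j - 1, by lia⟩
    have hj : 𝟙 (G.obj (K.X (j + 1))) = G.map (K.d (j + 1) j) ≫ s' j +
        s' (j + 1) ≫ G.map (K.d (j + 1 + 1) (j + 1)) :=
      (congrArg (fun f ↦ HomologicalComplex.Hom.f f (j + 1)) hs).trans (nullMap_f s j)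
    have h₁ : F.map (K.d (j + 1) j) ≫ i.app _ = i.app _ ≫ E.map (G.map (K.d (j + 1) j)) :=
      i.naturality _
    have h₂ : E.map (G.map (K.d (j + 1 + 1) (j + 1))) ≫ r.app _ = r.app _ ≫ F.map _ :=
      r.naturality _
    have h₃ : i.app (K.X (j + 1)) ≫ r.app (K.X (j + 1)) = 𝟙 _ :=
      congrArg (fun t : F ⟶ F ↦ t.app (K.X (j + 1))) h
    refine Eq.trans ?_ (nullMap_f (K := (F.mapHomologicalComplex _).obj K)
      (L := (F.mapHomologicalComplex _).obj K) t j).symm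
    change 𝟙 (F.obj (K.X (j + 1))) = F.map (K.d (j + 1) j) ≫ t j +
      t (j + 1) ≫ F.map (K.d (j + 1 + 1) (j + 1))
    dsimp only [t]
    rw [reassoc_of% h₁, Category.assoc, Category.assoc, ← h₂, ← Preadditive.comp_add,
      ← E.map_comp_assoc, ← E.map_comp_assoc, ← Preadditive.add_comp, ← E.map_add, ← hj, E.map_id,
      ← h₃]
    exact congrArg (i.app _ ≫ ·) (Category.id_comp _).symm
  refine (IsZero.iff_id_eq_zero _).2 (((HomotopyCategory.quotient _ _).map_id _).symm.trans ?_)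
  rw [e]
  exact quotient_map_nullMap _

end

section

variable {k : Type u} [Field k] {K : Complex k}

variable {A B Y : HeisCat k}

theorem isContractible_tensorObjRight (i : A ⟶ B ⊗ Y) (r : B ⊗ Y ⟶ A) (h : i ≫ r = 𝟙 A)
    (hB : IsContractible (tensorObjRight K B)) : IsContractible (tensorObjRight K A) :=
  isZero_map_of_retract (F := tensorRight A) (G := tensorRight B) (E := tensorRight Y)
    { app := fun X ↦ X ◁ i ≫ (α_ _ _ _).inv
      naturality := fun X X' f ↦ by simp [← whisker_exchange_assoc] }
    { app := fun X ↦ (α_ _ _ _).hom ≫ X ◁ r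
      naturality := fun X X' f ↦ by simp [whisker_exchange] }
    (by ext X : 2; simp [← MonoidalCategory.whiskerLeft_comp, h]) hB

theorem isContractible_tensorObjLeft (i : A ⟶ Y ⊗ B) (r : Y ⊗ B ⟶ A) (h : i ≫ r = 𝟙 A)
    (hB : IsContractible (tensorObjLeft B K)) : IsContractible (tensorObjLeft A K) :=
  isZero_map_of_retract (F := tensorLeft A) (G := tensorLeft B) (E := tensorLeft Y)
    { app := fun X ↦ i ▷ X ≫ (α_ _ _ _).hom
      naturality := fun X X' f ↦ by simp [whisker_exchange_assoc] }
    { app := fun X ↦ (α_ _ _ _).inv ≫ r ▷ X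
      naturality := fun X X' f ↦ by simp [← whisker_exchange] }
    (by ext X : 2; simp [← comp_whiskerRight, h]) hB

theorem retract_comp_iso {i : A ⟶ B} {r : B ⟶ A} (h : i ≫ r = 𝟙 A) (e : B ≅ Y) :
    (i ≫ e.hom) ≫ e.inv ≫ r = 𝟙 A := by
  rw [Category.assoc, Iso.hom_inv_id_assoc, h]

variable [CharZero k] {n : ℕ} (l : OfSize n)

theorem exists_retract_PObj (hn : 0 < n) : ∃ (Y : HeisCat k) (i : PObj k l ⟶ P k ⊗ Y)
    (r : P k ⊗ Y ⟶ PObj k l), i ≫ r = 𝟙 _ := by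
  obtain ⟨n, rfl⟩ := Nat.exists_eq_succ_of_ne_zero hn.ne'
  refine ⟨_, youngIncl _ l ≫ (splitFirst (up k) n).hom, (splitFirst (up k) n).inv ≫ youngProj _ l,
    retract_comp_iso (youngIncl_youngProj _ l) (splitFirst (up k) n)⟩

theorem exists_retract_QObj (hn : 0 < n) : ∃ (Y : HeisCat k) (i : QObj k l ⟶ Y ⊗ Q k)
    (r : Y ⊗ Q k ⟶ QObj k l), i ≫ r = 𝟙 _ := by
  obtain ⟨n, rfl⟩ := Nat.exists_eq_succ_of_ne_zero hn.ne'
  refine ⟨_, youngIncl _ l ≫ (splitLast (down k) n).hom, (splitLast (down k) n).inv ≫ youngProj _ l,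
    retract_comp_iso (youngIncl_youngProj _ l) (splitLast (down k) n)⟩

theorem isContractible_PObj (hK : IsContractible (tensorObjRight K (P k))) (hn : 0 < n) :
    IsContractible (tensorObjRight K (PObj k l)) := by
  obtain ⟨Y, i, r, h⟩ := exists_retract_PObj (k := k) l hn
  exact isContractible_tensorObjRight i r h hK

theorem isContractible_QObj (hK : IsContractible (tensorObjLeft (Q k) K)) (hn : 0 < n) :
    IsContractible (tensorObjLeft (QObj k l) K) := by
  obtain ⟨Y, i, r, h⟩ := exists_retract_QObj (k := k) l hn
  exact isContractible_tensorObjLeft i r h hK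

end

end Heis

namespace Heis

section

variable (k : Type u) [Field k] (n : ℕ)

/-- The anti-automorphism `σ ↦ sign σ • σ⁻¹`, as a homomorphism to the opposite algebra. -/
noncomputable def signInv : SymAlg k n →ₐ[k] (SymAlg k n)ᵐᵒᵖ :=
  MonoidAlgebra.lift k (SymAlg k n)ᵐᵒᵖ (Equiv.Perm (Fin n))
    { toFun := fun σ ↦ .op (((Equiv.Perm.sign σ : ℤ) : k) • pm σ⁻¹)
      map_one' := by
        rw [Equiv.Perm.sign_one, Units.val_one, Int.cast_one, one_smul, inv_one, pm_one]
        rfl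
      map_mul' := fun σ τ ↦ by
        rw [← MulOpposite.op_mul, smul_mul_smul_comm, mul_inv_rev, pm_mul, Equiv.Perm.sign_mul,
          Units.val_mul, Int.cast_mul, mul_comm ((Equiv.Perm.sign σ : ℤ) : k)] }

variable {k n}

/-- The anti-automorphism `σ ↦ sign σ • σ⁻¹`. -/
noncomputable def twist : SymAlg k n →ₗ[k] SymAlg k n :=
  (MulOpposite.opLinearEquiv k).symm.toLinearMap ∘ₗ (signInv k n).toLinearMap

theorem twist_mul (a b : SymAlg k n) : twist (a * b) = twist b * twist a :=
  congrArg MulOpposite.unop (map_mul (signInv k n) a b)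

theorem twist_pm (σ : Equiv.Perm (Fin n)) :
    twist (pm σ : SymAlg k n) = ((Equiv.Perm.sign σ : ℤ) : k) • pm σ⁻¹ := by
  refine congrArg MulOpposite.unop ((MonoidAlgebra.lift_single _ _ _).trans (one_smul _ _))

theorem twist_embLast (a : SymAlg k n) : twist (embLast n a) = embLast n (twist a) := by
  induction a using symAlg_induction with
  | zero => simp
  | add a b ha hb => simp [ha, hb]
  | smul r a ha => simp [ha]
  | perm σ =>
    rw [embLast_pm, twist_pm, twist_pm, map_smul, embLast_pm, YoungDiagram.OfSize.sign_fixLast,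
      map_inv]

theorem cast_sign_mul_self (σ : Equiv.Perm (Fin n)) :
    ((Equiv.Perm.sign σ : ℤ) : k) * ((Equiv.Perm.sign σ : ℤ) : k) = 1 := by
  rw [← Int.cast_mul, ← Units.val_mul, Int.units_mul_self, Units.val_one, Int.cast_one]

theorem pm_inv_mul_pm (σ : Equiv.Perm (Fin n)) : (pm σ⁻¹ * pm σ : SymAlg k n) = 1 := by
  rw [← pm_mul, inv_mul_cancel, pm_one]

end

end Heis

namespace YoungDiagram.OfSize

open Heis

section

variable {n : ℕ}

theorem swap_mem_transpose (μ : OfSize n) {c : ℕ × ℕ} : c.swap ∈ μ.transpose.1 ↔ c ∈ μ.1 := by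
  rw [transpose, YoungDiagram.mem_transpose, Prod.swap_swap]

theorem exists_transposePerm (μ : OfSize n) :
    ∃ τ : Equiv.Perm (Fin n), ∀ p, μ.cellAt (τ p) = (μ.transpose.cellAt p).swap := by
  have h (p : Fin n) : ∃ q, μ.cellAt q = (μ.transpose.cellAt p).swap :=
    μ.exists_cellAt_eq (μ.swap_mem_transpose.1 (by
      rw [Prod.swap_swap]
      exact μ.transpose.cellAt_mem p))
  choose f hf using h
  have hinj : Function.Injective f := fun p q h ↦ μ.transpose.cellAt_injective
    (Prod.swap_injective ((hf p).symm.trans ((congrArg μ.cellAt h).trans (hf q))))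
  exact ⟨Equiv.ofBijective f (Finite.injective_iff_bijective.1 hinj), hf⟩

/-- The permutation that compares the row reading with the column reading. -/
noncomputable def transposePerm (μ : OfSize n) : Equiv.Perm (Fin n) := μ.exists_transposePerm.choose

theorem cellAt_transposePerm (μ : OfSize n) (p : Fin n) :
    μ.cellAt (μ.transposePerm p) = (μ.transpose.cellAt p).swap :=
  μ.exists_transposePerm.choose_spec p

theorem mem_rowGroup_transpose (μ : OfSize n) (σ : Equiv.Perm (Fin n)) :
    σ ∈ μ.transpose.rowGroup ↔ μ.transposePerm * σ * μ.transposePerm⁻¹ ∈ μ.colGroup := by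
  refine ⟨fun h p ↦ ?_, fun h p ↦ ?_⟩
  · obtain ⟨p, rfl⟩ := μ.transposePerm.surjective p
    simpa [cellAt_transposePerm] using h p
  · simpa [cellAt_transposePerm] using h (μ.transposePerm p)

theorem mem_colGroup_transpose (μ : OfSize n) (σ : Equiv.Perm (Fin n)) :
    σ ∈ μ.transpose.colGroup ↔ μ.transposePerm * σ * μ.transposePerm⁻¹ ∈ μ.rowGroup := by
  refine ⟨fun h p ↦ ?_, fun h p ↦ ?_⟩
  · obtain ⟨p, rfl⟩ := μ.transposePerm.surjective p
    simpa [cellAt_transposePerm] using h p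
  · simpa [cellAt_transposePerm] using h (μ.transposePerm p)

theorem moveLast_transpose {μ : OfSize n} {ν : OfSize (n + 1)} (h : μ.1 ≤ ν.1) :
    (moveLast (newBox μ ν))⁻¹ * fixLast n μ.transposePerm =
      ν.transposePerm * (moveLast (newBox μ.transpose ν.transpose))⁻¹ := by
  have h' := (transpose_le_transpose μ ν).2 h
  refine Equiv.ext fun x ↦ ν.cellAt_injective ?_
  rw [Equiv.Perm.mul_apply, Equiv.Perm.mul_apply, cellAt_transposePerm]
  refine Fin.lastCases ?_ (fun i ↦ ?_) x
  · have h1 := (mem_iff_ne_newBox h (ν.transposePerm (newBox μ.transpose ν.transpose))).not.1 (by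
      rw [cellAt_transposePerm, ← swap_mem_transpose, Prod.swap_swap]
      exact cellAt_newBox_notMem _ _)
    rw [fixLast_last, moveLast_inv_last, moveLast_inv_last, ← cellAt_transposePerm, not_not.1 h1]
  · rw [fixLast_castSucc, cellAt_moveLast_inv_castSucc h, cellAt_moveLast_inv_castSucc h',
      cellAt_transposePerm]

end

section

variable (k : Type u) [Field k] [CharZero k] {n : ℕ} (μ : OfSize n) (ν : OfSize (n + 1))

theorem pm_conj_sum (τ : Equiv.Perm (Fin n)) (f : Equiv.Perm (Fin n) → k) :
    pm τ * (∑ σ, f σ • pm σ) * pm τ⁻¹ = ∑ σ, f (τ⁻¹ * σ⁻¹ * τ) • (pm σ⁻¹ : SymAlg k n) := by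
  rw [Finset.mul_sum, Finset.sum_mul, ← ((Equiv.inv _).trans (MulAut.conj τ⁻¹).toEquiv).sum_comp]
  refine Finset.sum_congr rfl fun σ _ ↦ ?_
  rw [mul_smul_comm, smul_mul_assoc, ← pm_mul, ← pm_mul]
  congr 2
  simp [mul_assoc]

theorem twist_colAntisymmetrizer : twist (μ.colAntisymmetrizer k) =
    pm μ.transposePerm * μ.transpose.rowSymmetrizer k * pm μ.transposePerm⁻¹ := by
  rw [rowSymmetrizer_eq, colAntisymmetrizer_eq, map_sum, pm_conj_sum]
  refine Finset.sum_congr rfl fun σ _ ↦ ?_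
  have h : μ.transposePerm⁻¹ * σ⁻¹ * μ.transposePerm ∈ μ.transpose.rowGroup ↔ σ ∈ μ.colGroup := by
    rw [mem_rowGroup_transpose, ← inv_mem_iff (x := σ)]
    simp [mul_assoc]
  rw [map_smul, twist_pm, smul_smul, if_congr h rfl rfl]
  split_ifs
  · rw [cast_sign_mul_self]
  · rw [zero_mul]

theorem twist_rowSymmetrizer : twist (μ.rowSymmetrizer k) =
    pm μ.transposePerm * μ.transpose.colAntisymmetrizer k * pm μ.transposePerm⁻¹ := by
  rw [rowSymmetrizer_eq, colAntisymmetrizer_eq, map_sum, pm_conj_sum]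
  refine Finset.sum_congr rfl fun σ _ ↦ ?_
  have h : μ.transposePerm⁻¹ * σ⁻¹ * μ.transposePerm ∈ μ.transpose.colGroup ↔ σ ∈ μ.rowGroup := by
    rw [mem_colGroup_transpose, ← inv_mem_iff (x := σ)]
    simp [mul_assoc]
  have hs : Equiv.Perm.sign (μ.transposePerm⁻¹ * σ⁻¹ * μ.transposePerm) = Equiv.Perm.sign σ := by
    simp only [Equiv.Perm.sign_mul, Equiv.Perm.sign_inv]
    rw [mul_right_comm, Int.units_mul_self, one_mul]
  rw [map_smul, twist_pm, smul_smul, if_congr h rfl rfl, hs]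
  split_ifs
  · rw [one_mul]
  · rw [zero_mul]

theorem twist_youngSymmetrizer : twist (μ.youngSymmetrizer k) =
    pm μ.transposePerm * μ.transpose.youngSymmetrizer k * pm μ.transposePerm⁻¹ := by
  rw [youngSymmetrizer, twist_mul, twist_colAntisymmetrizer, twist_rowSymmetrizer, youngSymmetrizer]
  simp only [mul_assoc]
  rw [← mul_assoc (pm _⁻¹) (pm _), pm_inv_mul_pm, one_mul]

theorem youngScalar_transpose : μ.transpose.youngScalar k = μ.youngScalar k := by
  have h := congrArg twist (μ.youngSymmetrizer_mul_self k)
  rw [twist_mul, map_smul, twist_youngSymmetrizer] at h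
  have h2 := congrArg (fun a ↦ (pm μ.transposePerm⁻¹ * a * pm μ.transposePerm).coeff 1) h
  have e (a : SymAlg k n) : pm μ.transposePerm⁻¹ * (pm μ.transposePerm * a * pm μ.transposePerm⁻¹) *
      pm μ.transposePerm = a := by
    rw [mul_assoc _ a, ← mul_assoc, pm_inv_mul_pm, one_mul, mul_assoc, pm_inv_mul_pm, mul_one]
  have e2 (a : SymAlg k n) : pm μ.transposePerm * a * pm μ.transposePerm⁻¹ *
      (pm μ.transposePerm * a * pm μ.transposePerm⁻¹) =
      pm μ.transposePerm * (a * a) * pm μ.transposePerm⁻¹ := by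
    simp only [mul_assoc]
    rw [← mul_assoc (pm _⁻¹) (pm _), pm_inv_mul_pm, one_mul]
  simp only [e2, mul_smul_comm, smul_mul_assoc, e] at h2
  rw [youngSymmetrizer_mul_self, MonoidAlgebra.coeff_smul_apply, MonoidAlgebra.coeff_smul_apply,
    youngSymmetrizer_coeff_one, smul_eq_mul, smul_eq_mul, mul_one, mul_one] at h2
  exact h2

theorem twist_youngIdempotent : twist (μ.youngIdempotent k) =
    pm μ.transposePerm * μ.transpose.youngIdempotent k * pm μ.transposePerm⁻¹ := by
  rw [youngIdempotent, map_smul, twist_youngSymmetrizer, youngIdempotent, youngScalar_transpose,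
    mul_smul_comm, smul_mul_assoc]

variable {μ ν}

theorem twist_branchIn (h : μ.1 ≤ ν.1) : twist (branchIn k μ ν) =
    ((Equiv.Perm.sign (moveLast (newBox μ ν)) : ℤ) : k) • (pm ν.transposePerm *
      branchOut k μ.transpose ν.transpose * pm (fixLast n μ.transposePerm)⁻¹) := by
  have h1 : (pm ν.transposePerm⁻¹ * (pm (moveLast (newBox μ ν))⁻¹ * pm (fixLast n μ.transposePerm)) :
      SymAlg k (n + 1)) = pm (moveLast (newBox μ.transpose ν.transpose))⁻¹ := by
    rw [← pm_mul, moveLast_transpose h, ← pm_mul, inv_mul_cancel_left]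
  rw [branchIn, twist_mul, twist_mul, twist_embLast, twist_pm, twist_youngIdempotent,
    twist_youngIdempotent, map_mul, map_mul, embLast_pm, embLast_pm, branchOut, ← h1, map_inv]
  simp only [mul_smul_comm, smul_mul_assoc, mul_assoc]

theorem twist_branchOut (h : μ.1 ≤ ν.1) : twist (branchOut k μ ν) =
    ((Equiv.Perm.sign (moveLast (newBox μ ν)) : ℤ) : k) • (pm (fixLast n μ.transposePerm) *
      branchIn k μ.transpose ν.transpose * pm ν.transposePerm⁻¹) := by
  have h1 : (pm (fixLast n μ.transposePerm)⁻¹ * (pm (moveLast (newBox μ ν)) * pm ν.transposePerm) :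
      SymAlg k (n + 1)) = pm (moveLast (newBox μ.transpose ν.transpose)) := by
    have := congrArg (·⁻¹) (moveLast_transpose h)
    simp only [mul_inv_rev, inv_inv] at this
    rw [← mul_assoc, ← pm_mul, this, ← pm_mul, inv_mul_cancel_right]
  rw [branchOut, twist_mul, twist_mul, twist_embLast, twist_pm, twist_youngIdempotent,
    twist_youngIdempotent, map_mul, map_mul, embLast_pm, embLast_pm, branchIn, ← h1, map_inv,
    inv_inv, Equiv.Perm.sign_inv]
  simp only [mul_smul_comm, smul_mul_assoc, mul_assoc]

end

end YoungDiagram.OfSize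

namespace Heis

theorem sum_eq_zero_of_skew {k V W M ι : Type*} [Field k] [CharZero k] [AddCommGroup V]
    [Module k V] [AddCommGroup W] [Module k W] [AddCommGroup M] [Module k M] [Fintype ι]
    {v : ι → V} {w : ι → W} {s : V →ₗ[k] V} {t : W →ₗ[k] W} (X : V →ₗ[k] W →ₗ[k] M)
    (hX : ∀ x y, X (s x) y = X x (t y)) (hs : ∀ x, s (s x) = x) (ht : ∀ y, t (t y) = y)
    {σ : ι → k} (hσ : ∀ i, σ i * σ i = 1) {a : ι → ι → k} (hv : ∀ i, s (v i) = ∑ j, a j i • v j)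
    (hw : ∀ j, t (w j) = ∑ i, (-(σ i * σ j * a j i)) • w i) : ∑ i, σ i • X (v i) (w i) = 0 := by
  have h : ∑ i, σ i • X (s (s (v i))) (w i) = -∑ j, σ j • X (s (v j)) (t (w j)) := by
    have h1 (i : ι) : σ i • X (s (s (v i))) (w i) = ∑ j, (σ i * a j i) • X (s (v j)) (w i) := by
      rw [hv i, map_sum, map_sum, LinearMap.sum_apply, Finset.smul_sum]
      simp only [map_smul, LinearMap.smul_apply, smul_smul]
    have h2 (j : ι) : -(σ j • X (s (v j)) (t (w j))) = ∑ i, (σ i * a j i) • X (s (v j)) (w i) := by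
      rw [hw j, map_sum, Finset.smul_sum, ← Finset.sum_neg_distrib]
      refine Finset.sum_congr rfl fun i _ ↦ ?_
      rw [map_smul, smul_smul, ← neg_smul]
      congr 1
      linear_combination σ i * a j i * hσ j
    rw [← Finset.sum_neg_distrib, Finset.sum_congr rfl fun i _ ↦ h1 i,
      Finset.sum_congr rfl fun i _ ↦ h2 i, Finset.sum_comm]
  simp only [hX, hs, ht] at h
  have h2 : (2 : k) • ∑ i, σ i • X (v i) (w i) = 0 := by
    rw [two_smul]
    nth_rw 1 [h]
    exact neg_add_cancel _
  exact (smul_eq_zero.1 h2).resolve_left two_ne_zero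

theorem eq_neg_smul_of_smul {k V : Type*} [Field k] [AddCommGroup V] [Module k V] {a b c : k}
    {x y : V} (ha : a * a = 1) (hb : b * b = 1) (h : b • -(a • x) = c • y) :
    x = (-(a * (b * c))) • y := by
  have e : a * (b * (b * a)) = 1 := by rw [← mul_assoc b, hb, one_mul, ha]
  rw [neg_smul, mul_smul, mul_smul, ← h, smul_neg, smul_neg, smul_neg, neg_neg, smul_smul,
    smul_smul, smul_smul, mul_assoc, mul_assoc, e, one_smul]

end Heis

namespace YoungDiagram.OfSize

open Heis

section

variable (k : Type u) [Field k] [CharZero k] {n : ℕ} (μ : OfSize n) (l l' : OfSize (n + 1))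
  (ν ν' : OfSize (n + 2))

open scoped Classical in
/-- The element of the group algebra that splits off two boxes. -/
noncomputable def chainIn : SymAlg k (n + 2) :=
  if μ.1 ≤ l.1 ∧ l.1 ≤ ν.1 then embLast (n + 1) (branchIn k μ l) * branchIn k l ν else 0

open scoped Classical in
/-- The element of the group algebra that merges two boxes. -/
noncomputable def chainOut : SymAlg k (n + 2) :=
  if μ.1 ≤ l.1 ∧ l.1 ≤ ν.1 then branchOut k l ν * embLast (n + 1) (branchOut k μ l) else 0

/-- The Young idempotent on the first positions. -/
noncomputable def emb₂ : SymAlg k (n + 2) := embLast (n + 1) (embLast n (μ.youngIdempotent k))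

theorem emb₂_mul_chainIn : emb₂ k μ * chainIn k μ l ν = chainIn k μ l ν := by
  rw [chainIn, mul_ite, mul_zero, emb₂, ← mul_assoc, ← map_mul, emb_mul_branchIn]

theorem chainIn_mul : chainIn k μ l ν * ν.youngIdempotent k = chainIn k μ l ν := by
  rw [chainIn, ite_mul, zero_mul, mul_assoc, branchIn_mul]

theorem chainOut_mul_emb₂ : chainOut k μ l ν * emb₂ k μ = chainOut k μ l ν := by
  rw [chainOut, ite_mul, zero_mul, emb₂, mul_assoc, ← map_mul, branchOut_mul_emb]

theorem mul_chainOut : ν.youngIdempotent k * chainOut k μ l ν = chainOut k μ l ν := by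
  rw [chainOut, mul_ite, mul_zero, ← mul_assoc, mul_branchOut]

theorem emb₂_eq_sum : emb₂ k μ = ∑ ν, ∑ l, chainIn k μ l ν * chainOut k μ l ν := by
  classical
  rw [emb₂, branching k n μ, map_sum, Finset.sum_comm]
  refine Finset.sum_congr rfl fun l _ ↦ ?_
  by_cases h : μ.1 ≤ l.1
  · have h1 : branchIn k μ l * branchOut k μ l =
        branchIn k μ l * (l.youngIdempotent k * branchOut k μ l) := by rw [mul_branchOut]
    rw [if_pos h, h1, map_mul, map_mul, branching k (n + 1) l, Finset.sum_mul, Finset.mul_sum]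
    refine Finset.sum_congr rfl fun ν _ ↦ ?_
    rw [chainIn, chainOut]
    by_cases h' : l.1 ≤ ν.1
    · rw [if_pos h', if_pos ⟨h, h'⟩, if_pos ⟨h, h'⟩]
      simp only [mul_assoc]
    · rw [if_neg h', if_neg fun e ↦ h' e.2, zero_mul, mul_zero, zero_mul]
  · rw [if_neg h, map_zero]
    refine (Finset.sum_eq_zero fun ν _ ↦ ?_).symm
    rw [chainIn, if_neg fun e ↦ h e.1, zero_mul]

variable {k μ ν}

theorem emb₂_mul_eq_sum {a : SymAlg k (n + 2)} (ha : a * ν.youngIdempotent k = a) :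
    emb₂ k μ * a = ∑ l, chainIn k μ l ν * (chainOut k μ l ν * a) := by
  rw [emb₂_eq_sum, Finset.sum_mul, Finset.sum_eq_single ν]
  · rw [Finset.sum_mul]
    exact Finset.sum_congr rfl fun l _ ↦ mul_assoc _ _ _
  · intro ν' _ hν
    rw [Finset.sum_mul]
    refine Finset.sum_eq_zero fun l _ ↦ ?_
    rw [← mul_chainOut, ← ha, mul_assoc, mul_assoc, ← mul_assoc (chainOut _ _ _ _),
      ← mul_assoc (youngIdempotent _ _), youngIdempotent_mul_mul_of_ne k hν, mul_zero]
  · exact fun h ↦ absurd (Finset.mem_univ ν) h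

theorem mul_emb₂_eq_sum {a : SymAlg k (n + 2)} (ha : ν.youngIdempotent k * a = a) :
    a * emb₂ k μ = ∑ l, a * chainIn k μ l ν * chainOut k μ l ν := by
  rw [emb₂_eq_sum, Finset.mul_sum, Finset.sum_eq_single ν]
  · rw [Finset.mul_sum]
    exact Finset.sum_congr rfl fun l _ ↦ (mul_assoc _ _ _).symm
  · intro ν' _ hν
    rw [Finset.mul_sum]
    refine Finset.sum_eq_zero fun l _ ↦ ?_
    rw [← chainIn_mul, ← ha, ← mul_assoc, ← mul_assoc, mul_assoc _ a,
      youngIdempotent_mul_mul_of_ne k hν.symm, zero_mul]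
  · exact fun h ↦ absurd (Finset.mem_univ ν) h

theorem swapLast_mul_emb₂ : pm (swapLast n) * emb₂ k μ = emb₂ k μ * pm (swapLast n) :=
  swapLast_mul_embLast_embLast _

theorem swapLast_mul_chainIn : pm (swapLast n) * chainIn k μ l ν =
    ∑ l', chainIn k μ l' ν * (chainOut k μ l' ν * pm (swapLast n) * chainIn k μ l ν) := by
  have h : pm (swapLast n) * chainIn k μ l ν * ν.youngIdempotent k =
      pm (swapLast n) * chainIn k μ l ν := by rw [mul_assoc, chainIn_mul]
  simp only [mul_assoc (chainOut _ _ _ _)]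
  rw [← emb₂_mul_eq_sum h, ← mul_assoc, ← swapLast_mul_emb₂, mul_assoc, emb₂_mul_chainIn]

theorem chainOut_mul_swapLast : chainOut k μ l ν * pm (swapLast n) =
    ∑ l', chainOut k μ l ν * pm (swapLast n) * chainIn k μ l' ν * chainOut k μ l' ν := by
  have h : ν.youngIdempotent k * (chainOut k μ l ν * pm (swapLast n)) =
      chainOut k μ l ν * pm (swapLast n) := by rw [← mul_assoc, mul_chainOut]
  rw [← mul_emb₂_eq_sum h, mul_assoc, swapLast_mul_emb₂, ← mul_assoc, chainOut_mul_emb₂]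

variable (k μ ν) in
/-- The sign of a chain of partitions. -/
noncomputable def chainSign : k :=
  ((Equiv.Perm.sign (moveLast (newBox μ l)) : ℤ) : k) *
    ((Equiv.Perm.sign (moveLast (newBox l ν)) : ℤ) : k)

theorem chainSign_eq : chainSign k μ l ν = ((Equiv.Perm.sign (moveLast (newBox l ν)) : ℤ) : k) *
    ((Equiv.Perm.sign (moveLast (newBox μ l)) : ℤ) : k) :=
  mul_comm _ _

theorem chainSign_mul_self : chainSign k μ l ν * chainSign k μ l ν = 1 := by
  rw [chainSign, mul_mul_mul_comm, cast_sign_mul_self, cast_sign_mul_self, one_mul]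

theorem twist_chainIn : twist (chainIn k μ l ν) = chainSign k μ l ν • (pm ν.transposePerm *
    chainOut k μ.transpose l.transpose ν.transpose *
      pm (fixLast (n + 1) (fixLast n μ.transposePerm))⁻¹) := by
  rw [chainIn, chainOut, transpose_le_transpose, transpose_le_transpose]
  split_ifs with h
  · rw [twist_mul, twist_embLast, twist_branchIn k h.1, twist_branchIn k h.2, map_smul,
      smul_mul_smul_comm, chainSign_eq]
    refine congrArg (HSMul.hSMul _) ?_
    rw [map_mul, map_mul, embLast_pm, embLast_pm, map_inv]
    simp only [mul_assoc]
    rw [← mul_assoc (pm _⁻¹) (pm _), pm_inv_mul_pm, one_mul]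
  · simp

theorem twist_chainOut : twist (chainOut k μ l ν) = chainSign k μ l ν •
    (pm (fixLast (n + 1) (fixLast n μ.transposePerm)) *
      chainIn k μ.transpose l.transpose ν.transpose * pm ν.transposePerm⁻¹) := by
  rw [chainIn, chainOut, transpose_le_transpose, transpose_le_transpose]
  split_ifs with h
  · rw [twist_mul, twist_embLast, twist_branchOut k h.1, twist_branchOut k h.2, map_smul,
      smul_mul_smul_comm, chainSign]
    congr 1
    rw [map_mul, map_mul, embLast_pm, embLast_pm, map_inv]
    simp only [mul_assoc]
    rw [← mul_assoc (pm _⁻¹) (pm _), pm_inv_mul_pm, one_mul]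
  · simp

variable (k μ ν) in
theorem exists_chain_coeff : ∃ a : OfSize (n + 1) → OfSize (n + 1) → k, ∀ l' l,
    chainOut k μ l' ν * pm (swapLast n) * chainIn k μ l ν = a l' l • ν.youngIdempotent k ∧
    chainOut k μ.transpose l.transpose ν.transpose * pm (swapLast n) *
      chainIn k μ.transpose l'.transpose ν.transpose =
        (-(chainSign k μ l ν * chainSign k μ l' ν * a l' l)) • ν.transpose.youngIdempotent k := by
  have h (l' l) := exists_youngIdempotent_mul_mul k ν
    (chainOut k μ l' ν * pm (swapLast n) * chainIn k μ l ν)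
  choose a ha using h
  have ha' (l' l) : chainOut k μ l' ν * pm (swapLast n) * chainIn k μ l ν =
      a l' l • ν.youngIdempotent k := by
    rw [← ha, ← mul_assoc, ← mul_assoc, mul_chainOut, mul_assoc _ (chainIn _ _ _ _), chainIn_mul]
  refine ⟨a, fun l' l ↦ ⟨ha' l' l, ?_⟩⟩
  have h := congrArg twist (ha' l' l)
  have hs : twist (pm (swapLast n) : SymAlg k (n + 2)) = -pm (swapLast n) := by
    have h1 : Equiv.Perm.sign (swapLast n) = -1 := by
      rw [swapLast_eq, Equiv.Perm.sign_swap (Fin.castSucc_lt_last _).ne]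
    rw [twist_pm, h1, inv_eq_of_mul_eq_one_left (swapLast_mul_self n)]
    simp
  have hc : (pm (swapLast n) * pm (fixLast (n + 1) (fixLast n μ.transposePerm)) : SymAlg k _) =
      pm (fixLast (n + 1) (fixLast n μ.transposePerm)) * pm (swapLast n) := by
    rw [← pm_mul, swapLast_comm, pm_mul]
  rw [twist_mul, twist_mul, hs, twist_chainIn, twist_chainOut, map_smul, twist_youngIdempotent] at h
  have h2 := congrArg (fun x ↦ pm ν.transposePerm⁻¹ * x * pm ν.transposePerm) h
  simp only [neg_mul, mul_neg, mul_smul_comm, smul_mul_assoc, mul_assoc, pm_inv_mul_pm, mul_one] at h2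
  rw [← mul_assoc (pm _) (pm (fixLast _ _)), hc] at h2
  simp only [mul_assoc] at h2
  rw [← mul_assoc (pm _⁻¹) (pm (fixLast _ _)), pm_inv_mul_pm, one_mul, ← mul_assoc (pm _⁻¹) (pm _),
    pm_inv_mul_pm, one_mul, ← mul_assoc (pm _⁻¹) (pm _), pm_inv_mul_pm, one_mul] at h2
  rw [mul_assoc, mul_assoc (chainSign k μ l ν)]
  exact eq_neg_smul_of_smul (chainSign_mul_self l) (chainSign_mul_self l') h2

end

end YoungDiagram.OfSize

namespace Heis

section Slide

universe v₁ u₁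

variable {C : Type u₁} [Category.{v₁} C] {X Y A B : C ⥤ C}

theorem slide_cap {ca : ∀ Z, X.obj (Y.obj Z) ⟶ Z} {cu : ∀ Z, Z ⟶ Y.obj (X.obj Z)}
    (ca_naturality : ∀ {Z W : C} (f : Z ⟶ W), X.map (Y.map f) ≫ ca W = ca Z ≫ f)
    (zigzag : ∀ Z, X.map (cu Z) ≫ ca (X.obj Z) = 𝟙 _) {g : ∀ Z, X.obj (A.obj Z) ⟶ B.obj (X.obj Z)}
    {r : ∀ Z, A.obj (Y.obj Z) ⟶ Y.obj (B.obj Z)}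
    (hr : ∀ Z, r Z = cu (A.obj (Y.obj Z)) ≫ Y.map (g (Y.obj Z)) ≫ Y.map (B.map (ca Z))) (Z : C) :
    X.map (r Z) ≫ ca (B.obj Z) = g (Y.obj Z) ≫ B.map (ca Z) := by
  rw [hr, X.map_comp, X.map_comp, Category.assoc, Category.assoc, ca_naturality,
    ← Category.assoc (X.map (Y.map _)), ca_naturality, Category.assoc, reassoc_of% zigzag]

theorem slide_cup {ca : ∀ Z, Y.obj (X.obj Z) ⟶ Z} {cu : ∀ Z, Z ⟶ X.obj (Y.obj Z)}
    (cu_naturality : ∀ {Z W : C} (f : Z ⟶ W), f ≫ cu W = cu Z ≫ X.map (Y.map f))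
    (zigzag : ∀ Z, cu (X.obj Z) ≫ X.map (ca Z) = 𝟙 _) {g : ∀ Z, B.obj (X.obj Z) ⟶ X.obj (A.obj Z)}
    {r : ∀ Z, Y.obj (B.obj Z) ⟶ A.obj (Y.obj Z)}
    (hr : ∀ Z, r Z = Y.map (B.map (cu Z)) ≫ Y.map (g (Y.obj Z)) ≫ ca (A.obj (Y.obj Z))) (Z : C) :
    cu (B.obj Z) ≫ X.map (r Z) = B.map (cu Z) ≫ g (Y.obj Z) := by
  rw [hr, X.map_comp, X.map_comp, ← reassoc_of% cu_naturality, ← reassoc_of% cu_naturality, zigzag,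
    Category.comp_id]

theorem nested_caps {ca ca' : ∀ Z, X.obj (Y.obj Z) ⟶ Z} {cu : ∀ Z, Z ⟶ Y.obj (X.obj Z)}
    (ca_naturality : ∀ {Z W : C} (f : Z ⟶ W), X.map (Y.map f) ≫ ca W = ca Z ≫ f)
    (zigzag : ∀ Z, X.map (cu Z) ≫ ca (X.obj Z) = 𝟙 _)
    {c c' : ∀ Z, X.obj (X.obj Z) ⟶ X.obj (X.obj Z)} {r : ∀ Z, X.obj (Y.obj Z) ⟶ Y.obj (X.obj Z)}
    {d d' : ∀ Z, Y.obj (Y.obj Z) ⟶ Y.obj (Y.obj Z)}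
    (hr : ∀ Z, r Z = cu (X.obj (Y.obj Z)) ≫ Y.map (c (Y.obj Z)) ≫ Y.map (X.map (ca Z)))
    (hd : ∀ Z, d Z = cu (Y.obj (Y.obj Z)) ≫ Y.map (r (Y.obj Z)) ≫ Y.map (Y.map (ca Z)))
    (hca : ∀ Z, ca Z = ca' Z) (hc : ∀ Z, c Z = c' Z) (hdd : ∀ Z, d Z = d' Z) (Z : C) :
    c' (Y.obj (Y.obj Z)) ≫ X.map (ca' (Y.obj Z)) ≫ ca' Z =
      X.map (X.map (d' Z)) ≫ X.map (ca' (Y.obj Z)) ≫ ca' Z := by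
  obtain rfl := funext hca
  obtain rfl := funext hc
  obtain rfl := funext hdd
  have h2 := congrArg X.map (slide_cap ca_naturality zigzag hd Z)
  rw [X.map_comp, X.map_comp] at h2
  rw [reassoc_of% h2, ca_naturality, reassoc_of% slide_cap ca_naturality zigzag hr (Y.obj Z)]

theorem nested_cups {ca : ∀ Z, Y.obj (X.obj Z) ⟶ Z} {cu cu' : ∀ Z, Z ⟶ X.obj (Y.obj Z)}
    (cu_naturality : ∀ {Z W : C} (f : Z ⟶ W), f ≫ cu W = cu Z ≫ X.map (Y.map f))
    (zigzag : ∀ Z, cu (X.obj Z) ≫ X.map (ca Z) = 𝟙 _)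
    {c c' : ∀ Z, X.obj (X.obj Z) ⟶ X.obj (X.obj Z)} {r : ∀ Z, Y.obj (X.obj Z) ⟶ X.obj (Y.obj Z)}
    {d d' : ∀ Z, Y.obj (Y.obj Z) ⟶ Y.obj (Y.obj Z)}
    (hr : ∀ Z, r Z = Y.map (X.map (cu Z)) ≫ Y.map (c (Y.obj Z)) ≫ ca (X.obj (Y.obj Z)))
    (hd : ∀ Z, d Z = Y.map (Y.map (cu Z)) ≫ Y.map (r (Y.obj Z)) ≫ ca (Y.obj (Y.obj Z)))
    (hcu : ∀ Z, cu Z = cu' Z) (hc : ∀ Z, c Z = c' Z) (hdd : ∀ Z, d Z = d' Z) (Z : C) :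
    cu' Z ≫ X.map (cu' (Y.obj Z)) ≫ c' (Y.obj (Y.obj Z)) =
      cu' Z ≫ X.map (cu' (Y.obj Z)) ≫ X.map (X.map (d' Z)) := by
  obtain rfl := funext hcu
  obtain rfl := funext hc
  obtain rfl := funext hdd
  have h2 := congrArg X.map (slide_cup cu_naturality zigzag hd Z)
  rw [X.map_comp, X.map_comp] at h2
  rw [h2, ← slide_cup cu_naturality zigzag hr (Y.obj Z), reassoc_of% cu_naturality]

variable {k : Type u} [CommRing k] {C : Type u₁} [Category.{v₁} C] [MonoidalCategory C]
  (F : HeisDiag k ⥤ C) [F.Monoidal] (Z : C)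

theorem leftDiag_crossDU : leftDiag F HeisDiagram.crossDU Z =
    (leftWord F (.tensor .down .up)).map (leftDiag F .cupUD Z) ≫
      (leftWord F .down).map (leftDiag F .cross ((leftWord F .down).obj Z)) ≫
      leftDiag F .capDU ((leftWord F (.tensor .up .down)).obj Z) := by
  rw [HeisDiagram.crossDU]
  simp only [leftDiag_comp, leftDiag_whiskerLeft, leftDiag_whiskerRight, leftDiag_assocHom, leftDiag_assocInv, leftDiag_rightInv,
    leftDiag_leftHom]
  dsimp only [leftWord_tensor, leftWord_unit, Functor.comp_obj, Functor.comp_map, Functor.id_obj,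
    Functor.id_map]
  simp only [Category.id_comp, CategoryTheory.Functor.map_id]
  exact congrArg (_ ≫ ·) (congrArg (_ ≫ ·) (Category.comp_id _))

theorem leftDiag_crossUD : leftDiag F HeisDiagram.crossUD Z =
    leftDiag F .cupDU ((leftWord F (.tensor .up .down)).obj Z) ≫
      (leftWord F .down).map (leftDiag F .cross ((leftWord F .down).obj Z)) ≫
      (leftWord F (.tensor .down .up)).map (leftDiag F .capUD Z) := by
  rw [HeisDiagram.crossUD]
  simp only [leftDiag_comp, leftDiag_whiskerLeft, leftDiag_whiskerRight, leftDiag_leftInv,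
    leftDiag_assocHom, leftDiag_rightHom, leftDiag_assocInv]
  dsimp only [leftWord_tensor, leftWord_unit, Functor.comp_obj, Functor.comp_map, Functor.id_obj,
    Functor.id_map]
  simp only [Category.id_comp, Category.comp_id, CategoryTheory.Functor.map_id]

end Slide

open Functor.LaxMonoidal Functor.OplaxMonoidal

section

variable (k : Type u) [Field k] [CharZero k]

/-- The crossing of two upward strands. -/
noncomputable def crossP : P k ⊗ P k ⟶ P k ⊗ P k :=
  (inclTensor k (up k) (up k)).inv ≫ (incl k).map (crossUp k) ≫ (inclTensor k (up k) (up k)).hom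

/-- The crossing of two downward strands. -/
noncomputable def crossQ : Q k ⊗ Q k ⟶ Q k ⊗ Q k :=
  (inclTensor k (down k) (down k)).inv ≫ (incl k).map (crossDown k) ≫
    (inclTensor k (down k) (down k)).hom

variable {C : Type*} [Category C] [MonoidalCategory C] in
/-- A map of the first two factors. -/
def onFirst {X : C} (c : X ⊗ X ⟶ X ⊗ X) (Z : C) : X ⊗ (X ⊗ Z) ⟶ X ⊗ (X ⊗ Z) :=
  (α_ X X Z).inv ≫ c ▷ Z ≫ (α_ X X Z).hom

theorem cross_conj_left {C : Type*} [Category C] [MonoidalCategory C] {W₁ A Z : C} (i : W₁ ≅ A ⊗ A)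
    (c : W₁ ⟶ W₁) :
    (i.hom ▷ Z ≫ (α_ _ _ _).hom ≫ A ◁ 𝟙 (A ⊗ Z) ≫ 𝟙 _) ≫ onFirst (i.inv ≫ c ≫ i.hom) Z =
      c ▷ Z ≫ i.hom ▷ Z ≫ (α_ _ _ _).hom ≫ A ◁ 𝟙 (A ⊗ Z) ≫ 𝟙 _ := by
  simp [onFirst]

variable (Z : HeisCat k)

theorem leftDiag_cross_eq : leftDiag (incl k) .cross Z = onFirst (crossP k) Z :=
  leftMap_eq (incl k) (A := .tensor .up .up) (B := .tensor .up .up) _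
    (cross_conj_left (inclTensor k (up k) (up k)) ((incl k).map (crossUp k)))

theorem leftDiag_crossDown_eq : leftDiag (incl k) .crossDown Z = onFirst (crossQ k) Z :=
  leftMap_eq (incl k) (A := .tensor .down .down) (B := .tensor .down .down) _
    (cross_conj_left (inclTensor k (down k) (down k)) ((incl k).map (crossDown k)))

theorem cross_capLeft : onFirst (crossP k) (Q k ⊗ (Q k ⊗ Z)) ≫
      P k ◁ capLeft k (Q k ⊗ Z) ≫ capLeft k Z =
    P k ◁ (P k ◁ onFirst (crossQ k) Z) ≫ P k ◁ capLeft k (Q k ⊗ Z) ≫ capLeft k Z :=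
  nested_caps (X := tensorLeft (P k)) (Y := tensorLeft (Q k)) (leftDiag_naturality (incl k) .capUD)
    (leftDiag_cupDU_capUD (incl k)) (leftDiag_crossUD (incl k))
    (fun Z ↦ (leftDiag_eq .cyclic Z).trans (leftDiag_crossDown' (incl k) Z)) (leftAction_ln k)
    (leftDiag_cross_eq k) (leftDiag_crossDown_eq k) Z

theorem cupLeft_cross : cupLeft k Z ≫ P k ◁ cupLeft k (Q k ⊗ Z) ≫
      onFirst (crossP k) (Q k ⊗ (Q k ⊗ Z)) =
    cupLeft k Z ≫ P k ◁ cupLeft k (Q k ⊗ Z) ≫ P k ◁ (P k ◁ onFirst (crossQ k) Z) :=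
  nested_cups (X := tensorLeft (P k)) (Y := tensorLeft (Q k)) (leftDiag_naturality (incl k) .cupUD)
    (leftDiag_cupUD_capDU (incl k)) (leftDiag_crossDU (incl k)) (leftDiag_crossDown (incl k))
    (leftAction_cl k) (leftDiag_cross_eq k) (leftDiag_crossDown_eq k) Z

end

end Heis

namespace Heis

open YoungDiagram YoungDiagram.OfSize CoxeterRelations

section Young

variable {k : Type u} [Field k] [CharZero k] {x : HeisDiag k} {c : x ⊗ x ⟶ x ⊗ x}
  (h : IsSymmetry c) {n : ℕ} (μ : OfSize n) (l : OfSize (n + 1)) (ν : OfSize (n + 2))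
  {G : HeisCat k ⥤ HeisCat k}
  {e : (incl k).obj (tensorPow x (n + 2)) ≅ G.obj ((incl k).obj (tensorPow x (n + 1)))}
  {e' : (incl k).obj (tensorPow x (n + 1)) ≅ G.obj ((incl k).obj (tensorPow x n))}
  (he : ∀ a : SymAlg k (n + 1), symMap h (embLast (n + 1) a) ≫ e.hom = e.hom ≫ G.map (symMap h a))
include he

theorem splitIn_splitIn : splitIn h l ν e ≫ G.map (splitIn h μ l e') =
    youngIncl h ν ≫ symMap h (embLast (n + 1) (branchIn k μ l) * branchIn k l ν) ≫
      (e.hom ≫ G.map e'.hom) ≫ G.map (G.map (youngProj h μ)) := by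
  have h1 : symMap h (l.youngIdempotent k) ≫ symMap h (branchIn k μ l) =
      symMap h (branchIn k μ l) := by rw [← symMap_mul, branchIn_mul]
  rw [splitIn, splitIn]
  simp only [Category.assoc]
  rw [← G.map_comp, ← Category.assoc (youngProj h l), youngProj_youngIncl, reassoc_of% h1,
    symMap_mul, G.map_comp, G.map_comp, Category.assoc, reassoc_of% he]

theorem mergeOut_mergeOut : G.map (mergeOut h μ l e') ≫ mergeOut h l ν e =
    G.map (G.map (youngIncl h μ)) ≫ (G.map e'.inv ≫ e.inv) ≫
      symMap h (branchOut k l ν * embLast (n + 1) (branchOut k μ l)) ≫ youngProj h ν := by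
  have he' (a : SymAlg k (n + 1)) : e.inv ≫ symMap h (embLast (n + 1) a) =
      G.map (symMap h a) ≫ e.inv := by
    rw [Iso.inv_comp_eq, ← reassoc_of% he, Iso.hom_inv_id, Category.comp_id]
  have h1 : symMap h (branchOut k μ l) ≫ symMap h (l.youngIdempotent k) =
      symMap h (branchOut k μ l) := by rw [← symMap_mul, mul_branchOut]
  rw [mergeOut, mergeOut, ← G.map_comp_assoc]
  simp only [Category.assoc]
  rw [youngProj_youngIncl, h1, symMap_mul, G.map_comp, G.map_comp]
  simp only [Category.assoc]
  rw [reassoc_of% he']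

end Young

section

variable (k : Type u) [Field k] [CharZero k] (n : ℕ)

open Functor.LaxMonoidal Functor.OplaxMonoidal

/-- The splitting of the last two upward strands. -/
noncomputable def splitLast₂ : (incl k).obj (tensorPow (up k) (n + 2)) ≅
    ((incl k).obj (tensorPow (up k) n) ⊗ P k) ⊗ P k :=
  splitLast (up k) (n + 1) ≪≫ (tensorRight (P k)).mapIso (splitLast (up k) n)

/-- The splitting of two downward strands. -/
noncomputable def splitFirst₂ : (incl k).obj (tensorPow (down k) (n + 2)) ≅
    Q k ⊗ (Q k ⊗ (incl k).obj (tensorPow (down k) n)) :=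
  splitFirst' (n + 1) ≪≫ (tensorLeft (Q k)).mapIso (splitFirst' n)

theorem swapLast_splitLast₂ : symMap (isSymmetry_crossUp k) (pm (swapLast n)) ≫
    (splitLast₂ k n).hom = (splitLast₂ k n).hom ≫ lastCross (crossP k) _ := by
  rw [symMap, symEnd_pm, permHom_swapLast]
  exact (map_lastCross (incl k) (crossUp k) (tensorPow (up k) n)).trans (Category.assoc _ _ _).symm

variable {k n} in
theorem cycles_mul_swapLast : fixFirst (n + 1) (lastToFirst n) * lastToFirst (n + 1) * swapLast n =
    simpleSwap (n + 2) 0 * (fixFirst (n + 1) (lastToFirst n) * lastToFirst (n + 1)) := by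
  ext x
  simp only [Equiv.Perm.mul_apply]
  rw [simpleSwap_apply_val _ _ (by omega)]
  refine Fin.lastCases ?_ (fun i ↦ Fin.lastCases ?_ (fun i ↦ ?_) i) x
  · rw [swapLast_last, lastToFirst_last, lastToFirst_castSucc, fixFirst_succ, lastToFirst_last,
      fixFirst_zero]
    simp
  · rw [swapLast_castSucc_last, lastToFirst_last, lastToFirst_castSucc, fixFirst_succ,
      lastToFirst_last, fixFirst_zero]
    simp
  · rw [swapLast_castSucc_castSucc, lastToFirst_castSucc, fixFirst_succ, lastToFirst_castSucc]
    simp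

theorem map_firstCross_shift {V C : Type*} [Category V] [MonoidalCategory V] [Category C]
    [MonoidalCategory C] (F : V ⥤ C) [F.Monoidal] {x W W' W'' : V} {c : x ⊗ x ⟶ x ⊗ x} {f : W ⟶ W}
    {s : W ⟶ x ⊗ W'} {s' : W' ⟶ x ⊗ W''}
    (hf : f ≫ s ≫ x ◁ s' = s ≫ x ◁ s' ≫ (α_ x x W'').inv ≫ c ▷ W'' ≫ (α_ x x W'').hom) :
    F.map f ≫ (F.map s ≫ δ F x W') ≫ F.obj x ◁ (F.map s' ≫ δ F x W'') =
      ((F.map s ≫ δ F x W') ≫ F.obj x ◁ (F.map s' ≫ δ F x W'')) ≫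
        onFirst (μ F x x ≫ F.map c ≫ δ F x x) (F.obj W'') := by
  have h := congrArg F.map hf
  rw [F.map_comp, F.map_comp, F.map_comp, F.map_comp] at h
  simp only [Category.assoc, onFirst]
  rw [MonoidalCategory.whiskerLeft_comp, δ_natural_right_assoc, reassoc_of% h, map_firstCross,
    Category.assoc, δ_natural_right_assoc]

theorem simpleSwap_splitFirst : symMap (isSymmetry_crossDown k) (pm (simpleSwap (n + 2) 0)) ≫
    (splitFirst (down k) (n + 1)).hom ≫ Q k ◁ (splitFirst (down k) n).hom =
      ((splitFirst (down k) (n + 1)).hom ≫ Q k ◁ (splitFirst (down k) n).hom) ≫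
        onFirst (crossQ k) _ := by
  rw [symMap, symEnd_pm, permHom_simpleSwap _ _ _ (by omega)]
  exact map_firstCross_shift (incl k) (crossAt_zero_shift (crossDown k) n)

theorem splitFirst₂_eq : (splitFirst₂ k n).hom = symMap (isSymmetry_crossDown k)
    (pm (fixFirst (n + 1) (lastToFirst n) * lastToFirst (n + 1))) ≫
      (splitFirst (down k) (n + 1)).hom ≫ Q k ◁ (splitFirst (down k) n).hom := by
  rw [pm_mul, symMap_mul, ← embFirst_pm, Category.assoc, reassoc_of% symMap_splitFirst,
    ← MonoidalCategory.whiskerLeft_comp]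
  exact Category.assoc _ _ _

theorem swapLast_splitFirst₂ : symMap (isSymmetry_crossDown k) (pm (swapLast n)) ≫
    (splitFirst₂ k n).hom = (splitFirst₂ k n).hom ≫ onFirst (crossQ k) _ := by
  rw [splitFirst₂_eq, ← Category.assoc, ← symMap_mul, ← pm_mul, cycles_mul_swapLast, pm_mul,
    symMap_mul, Category.assoc, Category.assoc, simpleSwap_splitFirst]

theorem lastCross_splitLast₂_inv : (splitLast₂ k n).inv ≫
    symMap (isSymmetry_crossUp k) (pm (swapLast n)) =
      lastCross (crossP k) _ ≫ (splitLast₂ k n).inv := by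
  rw [Iso.inv_comp_eq, ← reassoc_of% swapLast_splitLast₂, Iso.hom_inv_id, Category.comp_id]

theorem onFirst_splitFirst₂_inv : (splitFirst₂ k n).inv ≫
    symMap (isSymmetry_crossDown k) (pm (swapLast n)) =
      onFirst (crossQ k) _ ≫ (splitFirst₂ k n).inv := by
  rw [Iso.inv_comp_eq, ← reassoc_of% swapLast_splitFirst₂, Iso.hom_inv_id, Category.comp_id]

end

section

variable (k : Type u) [Field k] [CharZero k]

/-- Two nested caps between two objects. -/
noncomputable def caps (B D : HeisCat k) : ((B ⊗ P k) ⊗ P k) ⊗ (Q k ⊗ (Q k ⊗ D)) ⟶ B ⊗ D :=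
  (α_ _ _ _).hom ≫ (α_ _ _ _).hom ≫ B ◁ (P k ◁ capLeft k (Q k ⊗ D) ≫ capLeft k D)

/-- Two nested cups between two objects. -/
noncomputable def cups (B D : HeisCat k) : B ⊗ D ⟶ ((B ⊗ P k) ⊗ P k) ⊗ (Q k ⊗ (Q k ⊗ D)) :=
  B ◁ (cupLeft k D ≫ P k ◁ cupLeft k (Q k ⊗ D)) ≫ (α_ _ _ _).inv ≫ (α_ _ _ _).inv

variable {k} {B D : HeisCat k}

theorem lastCross_caps : lastCross (crossP k) B ▷ (Q k ⊗ (Q k ⊗ D)) ≫ caps k B D =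
    ((B ⊗ P k) ⊗ P k) ◁ onFirst (crossQ k) D ≫ caps k B D := by
  have h := congrArg (fun f ↦ (α_ (B ⊗ P k) (P k) _).hom ≫ (α_ _ _ _).hom ≫ B ◁ f)
    (cross_capLeft k D)
  simp only [MonoidalCategory.whiskerLeft_comp] at h
  rw [caps, lastCross]
  simp only [onFirst, MonoidalCategory.whiskerLeft_comp] at h ⊢
  refine Eq.trans ?_ (h.trans ?_)
  · monoidal
  · monoidal

theorem cups_lastCross : cups k B D ≫ lastCross (crossP k) B ▷ (Q k ⊗ (Q k ⊗ D)) =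
    cups k B D ≫ ((B ⊗ P k) ⊗ P k) ◁ onFirst (crossQ k) D := by
  have h := congrArg (fun f ↦ B ◁ f ≫ (α_ _ _ _).inv ≫ (α_ (B ⊗ P k) (P k) _).inv)
    (cupLeft_cross k D)
  rw [cups, lastCross]
  simp only [onFirst, MonoidalCategory.whiskerLeft_comp] at h ⊢
  refine Eq.trans ?_ (h.trans ?_)
  · monoidal
  · monoidal

theorem lower_lower_aux {A A₁ C C₁ : HeisCat k} (f₁ : A ⟶ A₁ ⊗ P k) (f₂ : A₁ ⟶ B ⊗ P k)
    (g₁ : C ⟶ Q k ⊗ C₁) (g₂ : C₁ ⟶ Q k ⊗ D) :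
    ((f₁ ⊗ₘ g₁) ≫ (α_ _ _ _).hom ≫ A₁ ◁ capLeft k C₁) ≫ (f₂ ⊗ₘ g₂) ≫ (α_ _ _ _).hom ≫
      B ◁ capLeft k D = ((f₁ ≫ f₂ ▷ P k) ⊗ₘ (g₁ ≫ Q k ◁ g₂)) ≫ caps k B D := by
  have h1 : capLeft k C₁ ≫ g₂ = P k ◁ Q k ◁ g₂ ≫ capLeft k (Q k ⊗ D) := by
    rw [capLeft, capLeft, Category.assoc, Category.assoc, ← leftUnitor_naturality,
      ← whisker_exchange_assoc]
    monoidal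
  have h2 : (f₂ ▷ P k ⊗ₘ Q k ◁ g₂) ≫ (α_ _ _ _).hom =
      (α_ _ _ _).hom ≫ A₁ ◁ P k ◁ Q k ◁ g₂ ≫ f₂ ▷ (P k ⊗ Q k ⊗ Q k ⊗ D) := by
    rw [MonoidalCategory.tensorHom_def']
    monoidal
  rw [← tensorHom_comp_tensorHom, caps, MonoidalCategory.whiskerLeft_comp]
  simp only [Category.assoc]
  rw [reassoc_of% h2, MonoidalCategory.tensorHom_def' f₂, ← associator_naturality_right_assoc,
    Category.assoc, ← MonoidalCategory.whiskerLeft_comp_assoc, h1,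
    MonoidalCategory.whiskerLeft_comp_assoc, whisker_exchange_assoc]
  simp only [associator_naturality_right_assoc]

theorem raise_raise_aux {A A₁ C C₁ : HeisCat k} (f₁ : A₁ ⊗ P k ⟶ A) (f₂ : B ⊗ P k ⟶ A₁)
    (g₁ : Q k ⊗ C₁ ⟶ C) (g₂ : Q k ⊗ D ⟶ C₁) :
    (B ◁ cupLeft k D ≫ (α_ _ _ _).inv ≫ (f₂ ⊗ₘ g₂)) ≫ A₁ ◁ cupLeft k C₁ ≫ (α_ _ _ _).inv ≫
      (f₁ ⊗ₘ g₁) = cups k B D ≫ ((f₂ ▷ P k ≫ f₁) ⊗ₘ (Q k ◁ g₂ ≫ g₁)) := by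
  have h1 : g₂ ≫ cupLeft k C₁ = cupLeft k (Q k ⊗ D) ≫ P k ◁ Q k ◁ g₂ := by
    rw [cupLeft, cupLeft, leftUnitor_inv_naturality_assoc, whisker_exchange_assoc]
    monoidal
  have h2 : (α_ _ _ _).inv ≫ (f₂ ▷ P k ⊗ₘ Q k ◁ g₂) =
      f₂ ▷ (P k ⊗ Q k ⊗ Q k ⊗ D) ≫ A₁ ◁ P k ◁ Q k ◁ g₂ ≫ (α_ _ _ _).inv := by
    rw [MonoidalCategory.tensorHom_def]
    monoidal
  rw [← tensorHom_comp_tensorHom, cups, MonoidalCategory.whiskerLeft_comp]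
  simp only [Category.assoc]
  rw [reassoc_of% h2, MonoidalCategory.tensorHom_def f₂, Category.assoc,
    ← MonoidalCategory.whiskerLeft_comp_assoc A₁, h1, MonoidalCategory.whiskerLeft_comp_assoc,
    ← whisker_exchange_assoc]
  simp only [associator_inv_naturality_right_assoc]

end

end Heis

namespace Heis

open YoungDiagram YoungDiagram.OfSize

section

variable {k : Type u} [Field k] {C : Type*} [Category C] [Preadditive C] [Linear k C]
  [MonoidalCategory C] [MonoidalPreadditive C] [MonoidalLinear k C]

/-- Composing the tensor product of two families of morphisms with fixed morphisms. -/
def tensorBilin {V W : Type*} [AddCommGroup V] [Module k V] [AddCommGroup W] [Module k W]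
    {A A' B B' C₀ C₁ : C} (f : V →ₗ[k] (A ⟶ B)) (g : W →ₗ[k] (A' ⟶ B')) (i : C₀ ⟶ A ⊗ A')
    (p : B ⊗ B' ⟶ C₁) : V →ₗ[k] W →ₗ[k] (C₀ ⟶ C₁) :=
  LinearMap.mk₂ k (fun a b ↦ i ≫ (f a ⊗ₘ g b) ≫ p)
    (fun a a' b ↦ by rw [map_add, MonoidalPreadditive.add_tensor, Preadditive.add_comp,
      Preadditive.comp_add])
    (fun r a b ↦ by rw [map_smul, smul_tensorHom, Linear.smul_comp, Linear.comp_smul])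
    (fun a b b' ↦ by rw [map_add, MonoidalPreadditive.tensor_add, Preadditive.add_comp,
      Preadditive.comp_add])
    (fun r a b ↦ by rw [map_smul, tensorHom_smul, Linear.smul_comp, Linear.comp_smul])

variable {V W : Type*} [AddCommGroup V] [Module k V] [AddCommGroup W] [Module k W]
  {A A' B B' C₀ C₁ : C} {f : V →ₗ[k] (A ⟶ B)} {g : W →ₗ[k] (A' ⟶ B')}

theorem tensorBilin_slide_right (i : C₀ ⟶ A ⊗ A') {p : B ⊗ B' ⟶ C₁} {t : B ⟶ B} {t' : B' ⟶ B'}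
    (h : t ▷ B' ≫ p = B ◁ t' ≫ p) {a a' : V} {b b' : W} (ha : f a' = f a ≫ t)
    (hb : g b' = g b ≫ t') : tensorBilin f g i p a' b = tensorBilin f g i p a b' := by
  change i ≫ (f a' ⊗ₘ g b) ≫ p = i ≫ (f a ⊗ₘ g b') ≫ p
  rw [ha, hb, MonoidalCategory.tensorHom_def', comp_whiskerRight, MonoidalCategory.tensorHom_def,
    MonoidalCategory.whiskerLeft_comp, Category.assoc, Category.assoc, Category.assoc,
    Category.assoc, h]
  simp only [whisker_exchange_assoc]

theorem tensorBilin_slide_left {i : C₀ ⟶ A ⊗ A'} (p : B ⊗ B' ⟶ C₁) {t : A ⟶ A} {t' : A' ⟶ A'}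
    (h : i ≫ t ▷ A' = i ≫ A ◁ t') {a a' : V} {b b' : W} (ha : f a' = t ≫ f a)
    (hb : g b' = t' ≫ g b) : tensorBilin f g i p a' b = tensorBilin f g i p a b' := by
  change i ≫ (f a' ⊗ₘ g b) ≫ p = i ≫ (f a ⊗ₘ g b') ≫ p
  rw [ha, hb, MonoidalCategory.tensorHom_def, comp_whiskerRight, MonoidalCategory.tensorHom_def',
    MonoidalCategory.whiskerLeft_comp, Category.assoc, Category.assoc, Category.assoc,
    Category.assoc, reassoc_of% h]
  simp only [whisker_exchange_assoc]

end

section Young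

variable {k : Type u} [Field k] {x : HeisDiag k} {c : x ⊗ x ⟶ x ⊗ x} (h : IsSymmetry c) {n : ℕ}

/-- The action of the group algebra, between two fixed morphisms. -/
noncomputable def symLin {A B : HeisCat k} (i : A ⟶ (incl k).obj (tensorPow x n))
    (p : (incl k).obj (tensorPow x n) ⟶ B) : SymAlg k n →ₗ[k] (A ⟶ B) where
  toFun a := i ≫ symMap h a ≫ p
  map_add' a b := by rw [symMap_add, Preadditive.add_comp, Preadditive.comp_add]
  map_smul' r a := by rw [symMap_smul, Linear.smul_comp, Linear.comp_smul, RingHom.id_apply]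

theorem conj_left {C : Type*} [Category C] {A B D : C} {s : A ⟶ A} {e : A ⟶ B} {t : B ⟶ B}
    (he : s ≫ e = e ≫ t) {p : B ⟶ D} {t' : D ⟶ D} (hp : p ≫ t' = t ≫ p) :
    s ≫ e ≫ p = (e ≫ p) ≫ t' := by
  rw [reassoc_of% he, Category.assoc, hp]

theorem conj_right {C : Type*} [Category C] {A B D : C} {s : A ⟶ A} {e : B ⟶ A} {t : B ⟶ B}
    (he : e ≫ s = t ≫ e) {p : D ⟶ B} {t' : D ⟶ D} (hp : p ≫ t = t' ≫ p) :
    (p ≫ e) ≫ s = t' ≫ p ≫ e := by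
  rw [Category.assoc, he, reassoc_of% hp]

theorem symLin_mul_left {A B : HeisCat k} (i : A ⟶ (incl k).obj (tensorPow x n))
    (p : (incl k).obj (tensorPow x n) ⟶ B) {s : SymAlg k n} {t : B ⟶ B}
    (hs : symMap h s ≫ p = p ≫ t) (a : SymAlg k n) : symLin h i p (s * a) = symLin h i p a ≫ t := by
  change i ≫ symMap h (s * a) ≫ p = (i ≫ symMap h a ≫ p) ≫ t
  rw [symMap_mul, Category.assoc, Category.assoc, Category.assoc, hs]

theorem symLin_mul_right {A B : HeisCat k} (i : A ⟶ (incl k).obj (tensorPow x n))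
    (p : (incl k).obj (tensorPow x n) ⟶ B) {s : SymAlg k n} {t : A ⟶ A}
    (hs : i ≫ symMap h s = t ≫ i) (a : SymAlg k n) : symLin h i p (a * s) = t ≫ symLin h i p a := by
  change i ≫ symMap h (a * s) ≫ p = t ≫ i ≫ symMap h a ≫ p
  rw [symMap_mul, Category.assoc, reassoc_of% hs]

end Young

section

universe v₁ u₁

variable {C : Type u₁} [Category.{v₁} C] [MonoidalCategory C] {X : C} (c : X ⊗ X ⟶ X ⊗ X)

theorem onFirst_naturality {Z W : C} (f : Z ⟶ W) :
    X ◁ X ◁ f ≫ onFirst c W = onFirst c Z ≫ X ◁ X ◁ f := by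
  simp only [onFirst]
  rw [associator_inv_naturality_right_assoc, whisker_exchange_assoc, Category.assoc, Category.assoc,
    associator_naturality_right]

end

section

variable {k : Type u} [Field k] [CharZero k] {n : ℕ} (μ : OfSize n) (ν : OfSize (n + 2))

/-- The compositions of two components of the first differential, in terms of group algebras. -/
noncomputable def lowerBilin : SymAlg k (n + 2) →ₗ[k] SymAlg k (n + 2) →ₗ[k] (PQ k ν ⟶ PQ k μ) :=
  tensorBilin
    (symLin (isSymmetry_crossUp k) (youngIncl _ ν)
      ((splitLast₂ k n).hom ≫ (youngProj (isSymmetry_crossUp k) μ ▷ P k) ▷ P k))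
    (symLin (isSymmetry_crossDown k) (youngIncl _ ν.transpose)
      ((splitFirst₂ k n).hom ≫ Q k ◁ Q k ◁ youngProj (isSymmetry_crossDown k) μ.transpose))
    (𝟙 _) (caps k (PObj k μ) (QObj k μ.transpose))

/-- The compositions of two components of the second differential, in terms of group algebras. -/
noncomputable def raiseBilin : SymAlg k (n + 2) →ₗ[k] SymAlg k (n + 2) →ₗ[k] (PQ k μ ⟶ PQ k ν) :=
  tensorBilin
    (symLin (isSymmetry_crossUp k)
      ((youngIncl (isSymmetry_crossUp k) μ ▷ P k) ▷ P k ≫ (splitLast₂ k n).inv) (youngProj _ ν))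
    (symLin (isSymmetry_crossDown k)
      (Q k ◁ Q k ◁ youngIncl (isSymmetry_crossDown k) μ.transpose ≫ (splitFirst₂ k n).inv)
      (youngProj _ ν.transpose))
    (cups k (PObj k μ) (QObj k μ.transpose)) (𝟙 _)

theorem lowerBilin_swapLast (a b : SymAlg k (n + 2)) :
    lowerBilin μ ν (pm (swapLast n) * a) b = lowerBilin μ ν a (pm (swapLast n) * b) :=
  tensorBilin_slide_right _ lastCross_caps
    (symLin_mul_left _ _ _ (conj_left (swapLast_splitLast₂ k n)
      (lastCross_naturality (crossP k) (youngProj (isSymmetry_crossUp k) μ))) a)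
    (symLin_mul_left _ _ _ (conj_left (swapLast_splitFirst₂ k n)
      (onFirst_naturality (crossQ k) (youngProj (isSymmetry_crossDown k) μ.transpose))) b)

theorem raiseBilin_swapLast (a b : SymAlg k (n + 2)) :
    raiseBilin μ ν (a * pm (swapLast n)) b = raiseBilin μ ν a (b * pm (swapLast n)) :=
  tensorBilin_slide_left _ cups_lastCross
    (symLin_mul_right _ _ _ (conj_right (lastCross_splitLast₂_inv k n)
      (lastCross_naturality (crossP k) (youngIncl (isSymmetry_crossUp k) μ))) a)
    (symLin_mul_right _ _ _ (conj_right (onFirst_splitFirst₂_inv k n)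
      (onFirst_naturality (crossQ k) (youngIncl (isSymmetry_crossDown k) μ.transpose))) b)

theorem lower_lower (l : OfSize (n + 1)) : lower k l ν ≫ lower k μ l =
    lowerBilin μ ν (embLast (n + 1) (branchIn k μ l) * branchIn k l ν)
      (embLast (n + 1) (branchIn k μ.transpose l.transpose) *
        branchIn k l.transpose ν.transpose) := by
  refine (lower_lower_aux (iotaP k l ν) (iotaP k μ l) (iotaQ k l.transpose ν.transpose)
    (iotaQ k μ.transpose l.transpose)).trans (Eq.trans ?_ (Category.id_comp _).symm)
  refine congrArg₂ (fun f g ↦ (f ⊗ₘ g) ≫ caps k (PObj k μ) (QObj k μ.transpose)) ?_ ?_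
  · rw [iotaP_eq, iotaP_eq]
    exact splitIn_splitIn (isSymmetry_crossUp k) μ l ν (symMap_splitLast _)
  · rw [iotaQ_eq, iotaQ_eq]
    exact splitIn_splitIn (isSymmetry_crossDown k) μ.transpose l.transpose ν.transpose
      symMap_splitFirst'

theorem raise_raise (l : OfSize (n + 1)) : raise k μ l ≫ raise k l ν =
    raiseBilin μ ν (branchOut k l ν * embLast (n + 1) (branchOut k μ l))
      (branchOut k l.transpose ν.transpose *
        embLast (n + 1) (branchOut k μ.transpose l.transpose)) := by
  refine (raise_raise_aux (rhoP k l ν) (rhoP k μ l) (rhoQ k l.transpose ν.transpose)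
    (rhoQ k μ.transpose l.transpose)).trans (Eq.trans ?_ (congrArg (_ ≫ ·)
      (Category.comp_id _)).symm)
  refine congrArg₂ (fun f g ↦ cups k (PObj k μ) (QObj k μ.transpose) ≫ (f ⊗ₘ g)) ?_ ?_
  · rw [rhoP_eq, rhoP_eq]
    exact (mergeOut_mergeOut (isSymmetry_crossUp k) μ l ν (G := tensorRight (P k))
      (symMap_splitLast _)).trans (Category.assoc _ _ _).symm
  · rw [rhoQ_eq, rhoQ_eq]
    exact (mergeOut_mergeOut (isSymmetry_crossDown k) μ.transpose l.transpose ν.transpose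
      (G := tensorLeft (Q k)) symMap_splitFirst').trans (Category.assoc _ _ _).symm

theorem sum_chainSign_lower : ∑ l, chainSign k μ l ν • lowerBilin μ ν (chainIn k μ l ν)
    (chainIn k μ.transpose l.transpose ν.transpose) = 0 := by
  obtain ⟨a, ha⟩ := exists_chain_coeff k μ ν
  have hs (x : SymAlg k (n + 2)) : pm (swapLast n) * (pm (swapLast n) * x) = x := by
    rw [← mul_assoc, ← pm_mul, swapLast_mul_self, pm_one, one_mul]
  refine sum_eq_zero_of_skew (s := LinearMap.mulLeft k (pm (swapLast n)))
    (t := LinearMap.mulLeft k (pm (swapLast n))) (lowerBilin μ ν) (lowerBilin_swapLast μ ν) hs hs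
    (fun l ↦ chainSign_mul_self l) (a := a) (fun l ↦ ?_) (fun l' ↦ ?_)
  · refine (swapLast_mul_chainIn _).trans (Finset.sum_congr rfl fun l' _ ↦ ?_)
    rw [(ha l' l).1, mul_smul_comm, chainIn_mul]
  · refine (swapLast_mul_chainIn _).trans ((sum_transpose _).symm.trans
      (Finset.sum_congr rfl fun l _ ↦ ?_))
    rw [(ha l' l).2, mul_smul_comm, chainIn_mul]

theorem sum_chainSign_raise : ∑ l, chainSign k μ l ν • raiseBilin μ ν (chainOut k μ l ν)
    (chainOut k μ.transpose l.transpose ν.transpose) = 0 := by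
  obtain ⟨a, ha⟩ := exists_chain_coeff k μ ν
  have hs (x : SymAlg k (n + 2)) : x * pm (swapLast n) * pm (swapLast n) = x := by
    rw [mul_assoc, ← pm_mul, swapLast_mul_self, pm_one, mul_one]
  refine sum_eq_zero_of_skew (s := LinearMap.mulRight k (pm (swapLast n)))
    (t := LinearMap.mulRight k (pm (swapLast n))) (raiseBilin μ ν) (raiseBilin_swapLast μ ν) hs hs
    (fun l ↦ chainSign_mul_self l) (a := fun l' l ↦ a l l') (fun l ↦ ?_) (fun l' ↦ ?_)
  · refine (chainOut_mul_swapLast _).trans (Finset.sum_congr rfl fun l' _ ↦ ?_)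
    rw [(ha l l').1, smul_mul_assoc, mul_chainOut]
  · refine (chainOut_mul_swapLast _).trans ((sum_transpose _).symm.trans
      (Finset.sum_congr rfl fun l _ ↦ ?_))
    rw [(ha l l').2, smul_mul_assoc, mul_chainOut, mul_comm (chainSign k μ l' ν)]

variable (k) in
open scoped Classical in
/-- The sign of the permutation that moves the new box of `ν` to the end. -/
noncomputable def boxSign (μ ν : YoungDiagram) : kˣ :=
  if h : ν.card = μ.card + 1 then Units.map (Int.castRingHom k).toMonoidHom
    (Equiv.Perm.sign (moveLast (newBox (⟨μ, rfl⟩ : OfSize μ.card) ⟨ν, h⟩))) else 1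

theorem boxSign_eq_or (μ ν : YoungDiagram) : boxSign k μ ν = 1 ∨ boxSign k μ ν = -1 := by
  rw [boxSign]
  split_ifs with h
  · rcases Int.units_eq_one_or (Equiv.Perm.sign (moveLast (newBox (⟨μ, rfl⟩ : OfSize μ.card)
      ⟨ν, h⟩))) with h | h
    · rw [h, map_one]
      exact Or.inl rfl
    · rw [h]
      exact Or.inr (Units.ext (by simp))
  · exact Or.inl rfl

theorem coe_boxSign (μ : OfSize n) (ν : OfSize (n + 1)) : (boxSign k μ.1 ν.1 : k) =
    ((Equiv.Perm.sign (moveLast (newBox μ ν)) : ℤ) : k) := by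
  obtain ⟨μ, rfl⟩ := μ
  obtain ⟨ν, h⟩ := ν
  rw [boxSign, dif_pos h]
  rfl

variable (k n) in
theorem dMinus_boxSign : dMinus k (boxSign k) (n + 1) ≫ dMinus k (boxSign k) n = 0 := by
  classical
  refine (matrix_comp_matrix _ _).trans (Eq.trans ?_ matrix_zero)
  congr 1
  funext ν μ
  refine Eq.trans (Finset.sum_congr rfl fun l _ ↦ ?_) (sum_chainSign_lower μ ν)
  by_cases h : l.1 ≤ ν.1
  · by_cases h' : μ.1 ≤ l.1
    · rw [if_pos h, if_pos h', chainIn, chainIn, if_pos ⟨h', h⟩, if_pos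
        ⟨(transpose_le_transpose _ _).2 h', (transpose_le_transpose _ _).2 h⟩, ← lower_lower,
        Linear.smul_comp, Linear.comp_smul, smul_smul, coe_boxSign, coe_boxSign, chainSign_eq]
    · rw [if_neg h', comp_zero, chainIn, if_neg fun e ↦ h' e.1, map_zero, LinearMap.zero_apply,
        smul_zero]
  · rw [if_neg h, zero_comp, chainIn, if_neg fun e ↦ h e.2, map_zero, LinearMap.zero_apply,
      smul_zero]

variable (k n) in
theorem dPlus_boxSign : dPlus k (boxSign k) n ≫ dPlus k (boxSign k) (n + 1) = 0 := by
  classical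
  refine (matrix_comp_matrix _ _).trans (Eq.trans ?_ matrix_zero)
  congr 1
  funext μ ν
  refine Eq.trans (Finset.sum_congr rfl fun l _ ↦ ?_) (sum_chainSign_raise μ ν)
  by_cases h : l.1 ≤ ν.1
  · by_cases h' : μ.1 ≤ l.1
    · rw [if_pos h, if_pos h', chainOut, chainOut, if_pos ⟨h', h⟩, if_pos
        ⟨(transpose_le_transpose _ _).2 h', (transpose_le_transpose _ _).2 h⟩, ← raise_raise,
        Linear.smul_comp, Linear.comp_smul, smul_smul, coe_boxSign, coe_boxSign, chainSign]
    · rw [if_neg h', zero_comp, chainOut, if_neg fun e ↦ h' e.1, map_zero, LinearMap.zero_apply,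
        smul_zero]
  · rw [if_neg h, comp_zero, chainOut, if_neg fun e ↦ h e.2, map_zero, LinearMap.zero_apply,
      smul_zero]

variable (k) in
theorem exists_signs : ∃ ε : YoungDiagram → YoungDiagram → kˣ, (∀ μ ν, ε μ ν = 1 ∨ ε μ ν = -1) ∧
    (∀ n, dMinus k ε (n + 1) ≫ dMinus k ε n = 0) ∧ (∀ n, dPlus k ε n ≫ dPlus k ε (n + 1) = 0) :=
  ⟨boxSign k, boxSign_eq_or, dMinus_boxSign k, dPlus_boxSign k⟩

end

end Heis

namespace Heis

universe v₁ u₁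

variable {C : Type u₁} [Category.{v₁} C] [Preadditive C]

section

variable {K L M : HomologicalComplex C (ComplexShape.down ℤ)}

theorem comp_nullMap (g : K ⟶ L) (s : ∀ i : ℤ, L.X i ⟶ M.X (i + 1)) :
    g ≫ nullMap s = nullMap fun i ↦ g.f i ≫ s i := by
  refine HomologicalComplex.hom_ext _ _ fun j ↦ ?_
  obtain ⟨j, rfl⟩ : ∃ l, j = l + 1 := ⟨j - 1, by lia⟩
  rw [HomologicalComplex.comp_f, nullMap_f, nullMap_f, Preadditive.comp_add, g.comm_assoc,
    Category.assoc]

theorem nullMap_comp (s : ∀ i : ℤ, K.X i ⟶ L.X (i + 1)) (g : L ⟶ M) :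
    nullMap s ≫ g = nullMap fun i ↦ s i ≫ g.f (i + 1) := by
  refine HomologicalComplex.hom_ext _ _ fun j ↦ ?_
  obtain ⟨j, rfl⟩ : ∃ l, j = l + 1 := ⟨j - 1, by lia⟩
  rw [HomologicalComplex.comp_f, nullMap_f, nullMap_f, Preadditive.add_comp, Category.assoc,
    Category.assoc, Category.assoc, g.comm]

variable (G : End K)

theorem pow_succ_comp (n : ℕ) : (G ^ (n + 1) : End K) = G ≫ (G ^ n : End K) := pow_succ G n

theorem pow_succ_comp' (n : ℕ) : (G ^ (n + 1) : End K) = (G ^ n : End K) ≫ G := pow_succ' G n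

variable {G} in
/-- If the powers of an endomorphism differ by null-homotopic maps that vanish locally, then the
limit of the powers is homotopic to the identity. -/
theorem exists_limit (s : ℕ → ∀ i : ℤ, K.X i ⟶ K.X (i + 1))
    (hs : ∀ n, nullMap (s n) = (G ^ n : End K) - (G ^ (n + 1) : End K))
    (h : ∀ j, ∃ N, ∀ n ≥ N, s n j = 0) :
    ∃ E : K ⟶ K, (HomotopyCategory.quotient C (ComplexShape.down ℤ)).map E = 𝟙 _ ∧
      ∀ j, ∃ N, ∀ n ≥ N, E.f j = ((G ^ n : End K) : K ⟶ K).f j := by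
  choose N hN using h
  let t (n : ℕ) (j : ℤ) : K.X j ⟶ K.X (j + 1) := ∑ i ∈ Finset.range n, s i j
  have ht (n : ℕ) : 𝟙 K - nullMap (t n) = (G ^ n : End K) := by
    induction n with
    | zero =>
      refine HomologicalComplex.hom_ext _ _ fun j ↦ ?_
      obtain ⟨j, rfl⟩ : ∃ l, j = l + 1 := ⟨j - 1, by lia⟩
      rw [HomologicalComplex.sub_f_apply, nullMap_f]
      simp [t, pow_zero, End.one_def]
    | succ n ih =>
      have : nullMap (t (n + 1)) = nullMap (t n) + nullMap (s n) := by
        refine HomologicalComplex.hom_ext _ _ fun j ↦ ?_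
        obtain ⟨j, rfl⟩ : ∃ l, j = l + 1 := ⟨j - 1, by lia⟩
        rw [HomologicalComplex.add_f_apply, nullMap_f, nullMap_f, nullMap_f]
        simp only [t, Finset.sum_range_succ, Preadditive.comp_add, Preadditive.add_comp]
        abel
      rw [this, ← sub_sub, ih, hs, sub_sub_cancel]
  have hc (j : ℤ) (n : ℕ) (hn : N j ≤ n) : t n j = t (N j) j :=
    (Finset.sum_subset (Finset.range_mono hn) fun i _ hi ↦
      hN j i (not_lt.1 fun h ↦ hi (Finset.mem_range.2 h))).symm
  refine ⟨𝟙 K - nullMap fun j ↦ t (N j) j, ?_, fun j ↦ ?_⟩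
  · rw [Functor.map_sub, quotient_map_nullMap, sub_zero, CategoryTheory.Functor.map_id]
  · obtain ⟨j, rfl⟩ : ∃ l, j = l + 1 := ⟨j - 1, by lia⟩
    refine ⟨max (N j) (N (j + 1)), fun n hn ↦ ?_⟩
    rw [← ht, HomologicalComplex.sub_f_apply, HomologicalComplex.sub_f_apply, nullMap_f, nullMap_f,
      hc j n (le_trans (le_max_left _ _) hn), hc (j + 1) n (le_trans (le_max_right _ _) hn)]

end

section

variable {A B : HomologicalComplex C (ComplexShape.down ℤ)} {H : ∀ i : ℤ, B.X i ⟶ B.X (i + 1)}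
  {G : End B}

theorem isIso_of_inclusion (hG : 𝟙 B - nullMap H = G) (f : A ⟶ B) (r : ∀ j, B.X j ⟶ A.X j)
    (hr : ∀ j, f.f j ≫ r j = 𝟙 _) (hH : ∀ j, f.f j ≫ H j = 0)
    (h : ∀ j, ∃ N, ∀ n ≥ N, ((G ^ n : End B) : B ⟶ B).f j ≫ r j ≫ f.f j =
      ((G ^ n : End B) : B ⟶ B).f j) :
    IsIso ((HomotopyCategory.quotient C (ComplexShape.down ℤ)).map f) := by
  obtain ⟨E, hE, hE'⟩ := exists_limit (G := G) (fun n i ↦ ((G ^ n : End B) : B ⟶ B).f i ≫ H i)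
    (fun n ↦ by
      rw [← comp_nullMap, pow_succ_comp', ← hG, Preadditive.comp_sub, Category.comp_id,
        sub_sub_cancel])
    fun j ↦ by
      obtain ⟨N, hN⟩ := h j
      exact ⟨N, fun n hn ↦ by
        rw [← hN n hn, Category.assoc, Category.assoc, hH, comp_zero, comp_zero]⟩
  have hf : f ≫ G = f := by
    refine HomologicalComplex.hom_ext _ _ fun j ↦ ?_
    obtain ⟨j, rfl⟩ : ∃ l, j = l + 1 := ⟨j - 1, by lia⟩
    rw [← hG, HomologicalComplex.comp_f, HomologicalComplex.sub_f_apply, nullMap_f,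
      Preadditive.comp_sub, Preadditive.comp_add, f.comm_assoc, hH, reassoc_of% hH, comp_zero,
      zero_comp, add_zero, sub_zero]
    exact Category.comp_id _
  have hfn (n : ℕ) : f ≫ (G ^ n : End B) = f := by
    induction n with
    | zero => exact Category.comp_id f
    | succ n ih => rw [pow_succ_comp, reassoc_of% hf, ih]
  have hg (j : ℤ) : (E.f j ≫ r j) ≫ f.f j = E.f j := by
    obtain ⟨N, hN⟩ := h j
    obtain ⟨N', hN'⟩ := hE' j
    rw [hN' _ (le_max_right N N'), Category.assoc, hN _ (le_max_left N N')]
  let g : B ⟶ A :=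
    { f := fun j ↦ E.f j ≫ r j
      comm' := fun i j _ ↦ by
        have : IsSplitMono (f.f j) := ⟨⟨⟨r j, hr j⟩⟩⟩
        rw [← cancel_mono (f.f j), Category.assoc, ← f.comm, ← Category.assoc (E.f i ≫ r i), hg,
          E.comm, Category.assoc, hg] }
  have h₁ : g ≫ f = E := HomologicalComplex.hom_ext _ _ hg
  have h₂ : f ≫ g = 𝟙 A := by
    refine HomologicalComplex.hom_ext _ _ fun j ↦ ?_
    obtain ⟨N, hN⟩ := hE' j
    change f.f j ≫ E.f j ≫ r j = 𝟙 _
    rw [hN N le_rfl, ← HomologicalComplex.comp_f_assoc, hfn, hr]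
  exact ⟨⟨(HomotopyCategory.quotient _ _).map g,
    by rw [← Functor.map_comp, h₂, CategoryTheory.Functor.map_id],
    by rw [← Functor.map_comp, h₁, hE]⟩⟩

theorem isIso_of_projection (hG : 𝟙 B - nullMap H = G) (f : B ⟶ A) (r : ∀ j, A.X j ⟶ B.X j)
    (hr : ∀ j, r j ≫ f.f j = 𝟙 _) (hH : ∀ j, H j ≫ f.f (j + 1) = 0)
    (h : ∀ j, ∃ N, ∀ n ≥ N, f.f j ≫ r j ≫ ((G ^ n : End B) : B ⟶ B).f j =
      ((G ^ n : End B) : B ⟶ B).f j) :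
    IsIso ((HomotopyCategory.quotient C (ComplexShape.down ℤ)).map f) := by
  obtain ⟨E, hE, hE'⟩ := exists_limit (G := G) (fun n i ↦ H i ≫ ((G ^ n : End B) : B ⟶ B).f (i + 1))
    (fun n ↦ by
      rw [← nullMap_comp, pow_succ_comp, ← hG, Preadditive.sub_comp, Category.id_comp,
        sub_sub_cancel])
    fun j ↦ by
      obtain ⟨N, hN⟩ := h (j + 1)
      exact ⟨N, fun n hn ↦ by rw [← hN n hn, reassoc_of% hH, zero_comp]⟩
  have hf : G ≫ f = f := by
    refine HomologicalComplex.hom_ext _ _ fun j ↦ ?_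
    obtain ⟨j, rfl⟩ : ∃ l, j = l + 1 := ⟨j - 1, by lia⟩
    rw [← hG, HomologicalComplex.comp_f, HomologicalComplex.sub_f_apply, nullMap_f,
      Preadditive.sub_comp, Preadditive.add_comp, Category.assoc, Category.assoc, hH, ← f.comm,
      reassoc_of% hH, comp_zero, zero_comp, add_zero, sub_zero]
    exact Category.id_comp _
  have hfn (n : ℕ) : (G ^ n : End B) ≫ f = f := by
    induction n with
    | zero => exact Category.id_comp f
    | succ n ih => rw [pow_succ_comp', Category.assoc, hf, ih]
  have hg (j : ℤ) : f.f j ≫ r j ≫ E.f j = E.f j := by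
    obtain ⟨N, hN⟩ := h j
    obtain ⟨N', hN'⟩ := hE' j
    rw [hN' _ (le_max_right N N'), hN _ (le_max_left N N')]
  let g : A ⟶ B :=
    { f := fun j ↦ r j ≫ E.f j
      comm' := fun i j _ ↦ by
        have : IsSplitEpi (f.f i) := ⟨⟨⟨r i, hr i⟩⟩⟩
        rw [← cancel_epi (f.f i), f.comm_assoc, hg, Category.assoc, reassoc_of% hg, E.comm] }
  have h₁ : f ≫ g = E := HomologicalComplex.hom_ext _ _ hg
  have h₂ : g ≫ f = 𝟙 A := by
    refine HomologicalComplex.hom_ext _ _ fun j ↦ ?_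
    obtain ⟨N, hN⟩ := hE' j
    change (r j ≫ E.f j) ≫ f.f j = 𝟙 _
    rw [hN N le_rfl, Category.assoc, ← HomologicalComplex.comp_f, hfn, hr]
  exact ⟨⟨(HomotopyCategory.quotient _ _).map g,
    by rw [← Functor.map_comp, h₁, hE],
    by rw [← Functor.map_comp, h₂, CategoryTheory.Functor.map_id]⟩⟩

end

/-- A complex presented as the total complex of a double complex. -/
structure Splitting (B : HomologicalComplex C (ComplexShape.down ℤ)) where
  /-- The terms of the double complex. -/
  X : ℤ → ℤ → C
  /-- The inclusions of the terms. -/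
  ι : ∀ s t j, s + t = j → (X s t ⟶ B.X j)
  /-- The morphism that is given on all terms. -/
  desc : ∀ {j : ℤ} {Z : C}, (∀ s t, s + t = j → (X s t ⟶ Z)) → (B.X j ⟶ Z)
  ι_desc : ∀ {j : ℤ} {Z : C} (f : ∀ s t, s + t = j → (X s t ⟶ Z)) s t h,
    ι s t j h ≫ desc f = f s t h
  hom_ext : ∀ {j : ℤ} {Z : C} {f g : B.X j ⟶ Z}, (∀ s t h, ι s t j h ≫ f = ι s t j h ≫ g) → f = g
  /-- The first differential. -/
  a : ∀ s t, X (s + 1) t ⟶ X s t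
  /-- The second differential. -/
  b : ∀ s t, X s (t + 1) ⟶ X s t
  ι_d : ∀ s t j (h : s + 1 + (t + 1) = j + 1), ι (s + 1) (t + 1) (j + 1) h ≫ B.d (j + 1) j =
    a s (t + 1) ≫ ι s (t + 1) j (by lia) + b (s + 1) t ≫ ι (s + 1) t j (by lia)

namespace Splitting

variable {A B : HomologicalComplex C (ComplexShape.down ℤ)} (S : Splitting B)
  (σ : ∀ s t, S.X s t ⟶ S.X s (t + 1))

/-- The map of degree one given by maps in the second direction. -/
def lift (i : ℤ) : B.X i ⟶ B.X (i + 1) :=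
  S.desc fun s t h ↦ σ s t ≫ S.ι s (t + 1) (i + 1) (by lia)

theorem ι_lift (s t i : ℤ) (h : s + t = i) :
    S.ι s t i h ≫ S.lift σ i = σ s t ≫ S.ι s (t + 1) (i + 1) (by lia) := S.ι_desc _ _ _ _

/-- The defect of a partial contraction. -/
noncomputable def defect : End B := 𝟙 B - nullMap (S.lift σ)

theorem ι_defect (s t j : ℤ) (h : s + 1 + (t + 1) = j + 1) :
    S.ι (s + 1) (t + 1) (j + 1) h ≫ HomologicalComplex.Hom.f (S.defect σ) (j + 1) =
      S.ι (s + 1) (t + 1) (j + 1) h -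
      (S.b (s + 1) t ≫ σ (s + 1) t + σ (s + 1) (t + 1) ≫ S.b (s + 1) (t + 1)) ≫
          S.ι (s + 1) (t + 1) (j + 1) h -
        (S.a s (t + 1) ≫ σ s (t + 1) + σ (s + 1) (t + 1) ≫ S.a s (t + 1 + 1)) ≫
          S.ι s (t + 1 + 1) (j + 1) (by lia) := by
  rw [defect, HomologicalComplex.sub_f_apply, HomologicalComplex.id_f, nullMap_f,
    Preadditive.comp_sub, Preadditive.comp_add, ← Category.assoc (S.ι _ _ _ _), S.ι_d,
    ← Category.assoc (S.ι _ _ _ _) (S.lift σ (j + 1)), S.ι_lift, Category.assoc, S.ι_d,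
    Preadditive.add_comp, Category.assoc, Category.assoc, S.ι_lift, S.ι_lift]
  simp only [Preadditive.add_comp, Preadditive.comp_add, Category.assoc, Category.comp_id]
  abel

variable {S σ} (h₀ : ∀ t, σ 0 t = 0)
  (h₁ : ∀ s t, s ≠ 0 → S.b s t ≫ σ s t + σ s (t + 1) ≫ S.b s (t + 1) = 𝟙 _)

include h₁ in
theorem exists_ι_defect (s t j : ℤ) (h : s + t = j) (hs : s ≠ 0) :
    ∃ u : S.X s t ⟶ S.X (s - 1) (t + 1), S.ι s t j h ≫ HomologicalComplex.Hom.f (S.defect σ) j =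
      u ≫ S.ι (s - 1) (t + 1) j (by lia) := by
  obtain ⟨s, rfl⟩ : ∃ l, s = l + 1 := ⟨s - 1, by lia⟩
  obtain ⟨t, rfl⟩ : ∃ l, t = l + 1 := ⟨t - 1, by lia⟩
  obtain ⟨j, rfl⟩ : ∃ l, j = l + 1 := ⟨j - 1, by lia⟩
  rw [ι_defect, h₁ _ _ hs, Category.id_comp, sub_self, zero_sub, ← Preadditive.neg_comp]
  obtain ⟨s', e, hs'⟩ : ∃ s', s' = s ∧ s + 1 - 1 = s' := ⟨s, rfl, by lia⟩
  subst e
  generalize_proofs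
  generalize s' + 1 - 1 = s'' at *
  subst hs'
  exact ⟨_, rfl⟩

include h₀ in
theorem ι_zero_defect (t j : ℤ) (h : 0 + t = j) (hS : ∀ t, IsZero (S.X (-1) t)) :
    S.ι 0 t j h ≫ HomologicalComplex.Hom.f (S.defect σ) j = S.ι 0 t j h := by
  obtain ⟨s, hs⟩ : ∃ s : ℤ, s = -1 := ⟨_, rfl⟩
  obtain ⟨z, hz⟩ : ∃ z, z = s + 1 := ⟨_, rfl⟩
  have hz' : z = 0 := by lia
  have key (h : z + t = j) : S.ι z t j h ≫ HomologicalComplex.Hom.f (S.defect σ) j = S.ι z t j h := by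
    have h₀' : ∀ t, σ z t = 0 := by rwa [hz']
    subst hz
    obtain ⟨t, rfl⟩ : ∃ l, t = l + 1 := ⟨t - 1, by lia⟩
    obtain ⟨j, rfl⟩ : ∃ l, j = l + 1 := ⟨j - 1, by lia⟩
    have hs' : IsZero (S.X s (t + 1 + 1)) := by rw [hs]; exact hS _
    rw [ι_defect, h₀', h₀', comp_zero, zero_comp, add_zero, zero_comp, sub_zero,
      hs'.eq_of_src (S.ι s _ _ _) 0, comp_zero, sub_zero]
  subst hz'
  exact key h

theorem ι_pow_defect {s t j : ℤ} {h : s + t = j} {s' t' : ℤ} {h' : s' + t' = j}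
    {u : S.X s t ⟶ S.X s' t'}
    (e : S.ι s t j h ≫ HomologicalComplex.Hom.f (S.defect σ) j = u ≫ S.ι s' t' j h') (n : ℕ) :
    S.ι s t j h ≫ HomologicalComplex.Hom.f (S.defect σ ^ (n + 1)) j =
      u ≫ S.ι s' t' j h' ≫ HomologicalComplex.Hom.f (S.defect σ ^ n) j := by
  rw [pow_succ_comp]
  exact (congrArg (S.ι s t j h ≫ ·) (HomologicalComplex.comp_f _ _ _)).trans (by
    rw [← Category.assoc, ← Category.assoc]
    exact congrArg (· ≫ _) e)

variable (T : Splitting A)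

include h₀ h₁ in
theorem isIso_map_inclusion (f : A ⟶ B) (φ : ∀ s t, T.X s t ⟶ S.X s t)
    (hf : ∀ s t j h, T.ι s t j h ≫ f.f j = φ s t ≫ S.ι s t j h)
    (hT : ∀ s t, s ≠ 0 → IsZero (T.X s t)) (hS : ∀ s t, s < 0 → IsZero (S.X s t))
    (hS' : ∀ s t, t < 0 → IsZero (S.X s t)) (hφ : ∀ t, IsIso (φ 0 t)) :
    IsIso ((HomotopyCategory.quotient C (ComplexShape.down ℤ)).map f) := by
  choose ψ hψ hψ' using fun t ↦ (hφ t).out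
  let r (j : ℤ) : B.X j ⟶ A.X j := S.desc fun s t h ↦
    if hs : s = 0 then eqToHom (by rw [hs]) ≫ ψ t ≫ T.ι 0 t j (by lia) else 0
  have hr (t j : ℤ) (h : 0 + t = j) : S.ι 0 t j h ≫ r j = ψ t ≫ T.ι 0 t j h := by
    dsimp only [r]
    rw [S.ι_desc, dif_pos rfl, eqToHom_refl, Category.id_comp]
  refine isIso_of_inclusion (G := S.defect σ) rfl f r (fun j ↦ T.hom_ext fun s t h ↦ ?_)
    (fun j ↦ T.hom_ext fun s t h ↦ ?_) fun j ↦ ⟨j.toNat, fun n hn ↦ S.hom_ext fun s t h ↦ ?_⟩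
  · by_cases hs : s = 0
    · subst hs
      rw [← Category.assoc, hf, Category.assoc, hr, reassoc_of% hψ, Category.comp_id]
    · exact (hT s t hs).eq_of_src _ _
  · by_cases hs : s = 0
    · subst hs
      rw [← Category.assoc, hf, Category.assoc, ι_lift, h₀, zero_comp, comp_zero, comp_zero]
    · exact (hT s t hs).eq_of_src _ _
  · by_cases ht : t < 0
    · exact (hS' s t ht).eq_of_src _ _
    have hs : s ≤ n := by lia
    clear hn ht
    induction n generalizing s t with
    | zero =>
      obtain hs | rfl := lt_or_eq_of_le hs
      · exact (hS s t hs).eq_of_src _ _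
      · change S.ι _ _ _ _ ≫ 𝟙 _ ≫ r j ≫ f.f j = S.ι _ _ _ _ ≫ 𝟙 _
        rw [Category.id_comp, Category.comp_id, ← Category.assoc]
        exact (congrArg (· ≫ f.f j) (hr t j h)).trans (by
          rw [Category.assoc, hf, reassoc_of% hψ']; rfl)
    | succ n ih =>
      obtain hs' | rfl | hs' := lt_trichotomy s 0
      · exact (hS s t hs').eq_of_src _ _
      · have e := ι_zero_defect h₀ t j h fun t ↦ hS _ t (by lia)
        rw [← Category.assoc, ι_pow_defect (e.trans (Category.id_comp _).symm), Category.assoc, Category.assoc, ih 0 t h (by lia)]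
      · obtain ⟨u, hu⟩ := exists_ι_defect h₁ s t j h hs'.ne'
        rw [← Category.assoc, ι_pow_defect hu, Category.assoc, Category.assoc,
          ih (s - 1) (t + 1) (by lia) (by lia)]

include h₀ h₁ in
theorem isIso_map_projection (f : B ⟶ A) (φ : ∀ s t, S.X s t ⟶ T.X s t)
    (hf : ∀ s t j h, S.ι s t j h ≫ f.f j = φ s t ≫ T.ι s t j h)
    (hT : ∀ s t, s ≠ 0 → IsZero (T.X s t)) (hS : ∀ s t, 0 < s → IsZero (S.X s t))
    (hS' : ∀ s t, 0 < t → IsZero (S.X s t)) (hφ : ∀ t, IsIso (φ 0 t)) :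
    IsIso ((HomotopyCategory.quotient C (ComplexShape.down ℤ)).map f) := by
  choose ψ hψ hψ' using fun t ↦ (hφ t).out
  let r (j : ℤ) : A.X j ⟶ B.X j := T.desc fun s t h ↦
    if hs : s = 0 then eqToHom (by rw [hs]) ≫ ψ t ≫ S.ι 0 t j (by lia) else 0
  have hr (t j : ℤ) (h : 0 + t = j) : T.ι 0 t j h ≫ r j = ψ t ≫ S.ι 0 t j h := by
    dsimp only [r]
    rw [T.ι_desc, dif_pos rfl, eqToHom_refl, Category.id_comp]
  refine isIso_of_projection (G := S.defect σ) rfl f r (fun j ↦ T.hom_ext fun s t h ↦ ?_)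
    (fun j ↦ S.hom_ext fun s t h ↦ ?_) fun j ↦ ⟨(1 - j).toNat, fun n hn ↦ S.hom_ext fun s t h ↦ ?_⟩
  · by_cases hs : s = 0
    · subst hs
      rw [← Category.assoc, hr, Category.assoc, hf, reassoc_of% hψ', Category.comp_id]
    · exact (hT s t hs).eq_of_src _ _
  · rw [← Category.assoc, ι_lift, Category.assoc, hf, comp_zero]
    by_cases hs : s = 0
    · subst hs
      rw [h₀, zero_comp]
    · rw [(hT s (t + 1) hs).eq_of_tgt (φ s (t + 1)) 0, zero_comp, comp_zero]
  · by_cases hs : s = 0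
    · subst hs
      rw [← Category.assoc, hf, Category.assoc, ← Category.assoc (T.ι 0 t j h), hr, Category.assoc,
        reassoc_of% hψ]
    by_cases hs' : 0 < s
    · exact (hS s t hs').eq_of_src _ _
    rw [← Category.assoc, hf, (hT s t hs).eq_of_src (T.ι s t j h) 0, comp_zero, zero_comp]
    have ht : 0 < t + n := by lia
    clear hn
    induction n generalizing s t with
    | zero => exact (hS' s t (by simpa using ht)).eq_of_src _ _
    | succ n ih =>
      obtain ⟨u, hu⟩ := exists_ι_defect h₁ s t j h hs
      rw [ι_pow_defect hu, ← ih (s - 1) (t + 1) (by lia) (by lia) (by lia) (by lia), comp_zero]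

end Splitting

end Heis

namespace Heis

open HomologicalComplex

variable {k : Type u} [Field k] (K L : Complex k) [HasTensor K L]

theorem ιTensorObj_d (s t j : ℤ) (h : s + 1 + (t + 1) = j + 1) :
    ιTensorObj K L (s + 1) (t + 1) (j + 1) h ≫ (tensorObj K L).d (j + 1) j =
      K.d (s + 1) s ▷ L.X (t + 1) ≫ ιTensorObj K L s (t + 1) j (by lia) +
        ((s + 1).negOnePow • K.X (s + 1) ◁ L.d (t + 1) t) ≫
          ιTensorObj K L (s + 1) t j (by lia) := by
  rw [mapBifunctor.d_eq, Preadditive.comp_add, mapBifunctor.ι_D₁, mapBifunctor.ι_D₂,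
    mapBifunctor.d₁_eq (c₁ := ComplexShape.down ℤ) _ _ _ _ (i₁ := s + 1) (i₁' := s) rfl _ _
      (show s + (t + 1) = j by lia),
    mapBifunctor.d₂_eq (c₂ := ComplexShape.down ℤ) _ _ _ _ _ (i₂ := t + 1) (i₂' := t) rfl _
      (show s + 1 + t = j by lia)]
  congr 1
  · exact one_smul _ _
  · rw [Linear.units_smul_comp]
    rfl

/-- The tensor product of two complexes as a double complex. -/
noncomputable def rowTotal : Splitting (tensorObj K L) where
  X s t := K.X s ⊗ L.X t
  ι s t j h := ιTensorObj K L s t j h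
  desc f := mapBifunctorDesc f
  ι_desc f s t h := ι_mapBifunctorDesc _ s t _
  hom_ext h := mapBifunctor.hom_ext h
  a s t := K.d (s + 1) s ▷ L.X t
  b s t := s.negOnePow • K.X s ◁ L.d (t + 1) t
  ι_d s t j h := ιTensorObj_d K L s t j h

/-- The tensor product of two complexes as a double complex, with the second factor first. -/
noncomputable def columnTotal : Splitting (tensorObj K L) where
  X s t := K.X t ⊗ L.X s
  ι s t j h := ιTensorObj K L t s j (by rw [← h]; exact add_comm t s)
  desc f := mapBifunctorDesc fun s t h ↦ f t s (by rw [← h]; exact add_comm t s)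
  ι_desc f s t h := ι_mapBifunctorDesc _ t s _
  hom_ext h := mapBifunctor.hom_ext fun s t h' ↦ h t s (by rw [← h']; exact add_comm t s)
  a s t := t.negOnePow • K.X t ◁ L.d (s + 1) s
  b s t := K.d (t + 1) t ▷ L.X s
  ι_d s t j h := (ιTensorObj_d K L t s j (by lia)).trans (add_comm _ _)

theorem exists_contraction {D : Type*} [Category D] [Preadditive D]
    {M : HomologicalComplex D (ComplexShape.down ℤ)}
    (h : IsZero ((HomotopyCategory.quotient _ _).obj M)) :
    ∃ s : ∀ i : ℤ, M.X i ⟶ M.X (i + 1),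
      ∀ j, M.d (j + 1) j ≫ s j + s (j + 1) ≫ M.d (j + 1 + 1) (j + 1) = 𝟙 (M.X (j + 1)) := by
  obtain ⟨s, hs⟩ := exists_eq_nullMap (((HomotopyCategory.quotient _ _).map_id _).trans
    ((IsZero.iff_id_eq_zero _).1 h))
  exact ⟨s, fun j ↦ ((congrArg (fun f ↦ HomologicalComplex.Hom.f f (j + 1)) hs).trans
    (nullMap_f s j)).symm⟩

variable {K L}

theorem Splitting.exists_contraction {B : Complex k} (S : Splitting B)
    (h : ∀ s, s ≠ 0 → ∃ τ : ∀ t, S.X s t ⟶ S.X s (t + 1),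
      ∀ t, S.b s t ≫ τ t + τ (t + 1) ≫ S.b s (t + 1) = 𝟙 _) :
    ∃ σ : ∀ s t, S.X s t ⟶ S.X s (t + 1), (∀ t, σ 0 t = 0) ∧
      ∀ s t, s ≠ 0 → S.b s t ≫ σ s t + σ s (t + 1) ≫ S.b s (t + 1) = 𝟙 _ := by
  choose! τ hτ using h
  refine ⟨fun s t ↦ if s = 0 then 0 else τ s t, fun t ↦ if_pos rfl, fun s t hs ↦ ?_⟩
  simpa only [if_neg hs] using hτ s hs t

theorem exists_left_contraction (h : ∀ s, s ≠ 0 → IsContractible (tensorObjLeft (K.X s) L)) :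
    ∃ σ : ∀ s t, (rowTotal K L).X s t ⟶ (rowTotal K L).X s (t + 1), (∀ t, σ 0 t = 0) ∧
      ∀ s t, s ≠ 0 → (rowTotal K L).b s t ≫ σ s t +
        σ s (t + 1) ≫ (rowTotal K L).b s (t + 1) = 𝟙 _ := by
  refine (rowTotal K L).exists_contraction fun s hs ↦ ?_
  obtain ⟨τ, hτ⟩ := exists_contraction (h s hs)
  let τ' (t : ℤ) : K.X s ⊗ L.X t ⟶ K.X s ⊗ L.X (t + 1) := τ t
  have hτ' (t : ℤ) : K.X s ◁ L.d (t + 1) t ≫ τ' t +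
    τ' (t + 1) ≫ K.X s ◁ L.d (t + 1 + 1) (t + 1) = 𝟙 _ := hτ t
  refine ⟨fun t ↦ s.negOnePow • τ' t, fun t ↦ Eq.trans ?_ (hτ' t)⟩
  change (s.negOnePow • K.X s ◁ L.d (t + 1) t) ≫ (s.negOnePow • τ' t) +
    (s.negOnePow • τ' (t + 1)) ≫ (s.negOnePow • K.X s ◁ L.d (t + 1 + 1) (t + 1)) = _
  simp only [Linear.units_smul_comp, Linear.comp_units_smul, smul_smul, Int.units_mul_self,
    one_smul]

theorem exists_right_contraction (h : ∀ s, s ≠ 0 → IsContractible (tensorObjRight K (L.X s))) :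
    ∃ σ : ∀ s t, (columnTotal K L).X s t ⟶ (columnTotal K L).X s (t + 1), (∀ t, σ 0 t = 0) ∧
      ∀ s t, s ≠ 0 → (columnTotal K L).b s t ≫ σ s t +
        σ s (t + 1) ≫ (columnTotal K L).b s (t + 1) = 𝟙 _ :=
  (columnTotal K L).exists_contraction fun s hs ↦ exists_contraction (h s hs)

theorem ι_tensorHom_id {K' : Complex k} [HasTensor K' L] (f : K ⟶ K') (s t j : ℤ)
    (h : s + t = j) : ιTensorObj K L s t j h ≫ (tensorHom f (𝟙 L)).f j =
      f.f s ▷ L.X t ≫ ιTensorObj K' L s t j h :=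
  (ι_mapBifunctorMap ..).trans (congrArg (f.f s ▷ L.X t ≫ ·)
    ((congrArg (· ≫ _) (CategoryTheory.Functor.map_id _ _)).trans (Category.id_comp _)))

theorem ι_id_tensorHom {L' : Complex k} [HasTensor K L'] (f : L ⟶ L') (s t j : ℤ)
    (h : s + t = j) : ιTensorObj K L s t j h ≫ (tensorHom (𝟙 K) f).f j =
      K.X s ◁ f.f t ≫ ιTensorObj K L' s t j h := by
  refine (ι_mapBifunctorMap ..).trans (Eq.trans ?_ (Category.id_comp _))
  exact congrArg (· ≫ _) (congrArg (fun t ↦ NatTrans.app t _)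
    ((curriedTensor (HeisCat k)).map_id (K.X s)))

section

variable {U : Complex k} (hU : ∀ s, s ≠ 0 → IsZero (U.X s)) [HasTensor U K] [HasTensor K U]
  [HasTensor K K]

include hU

section

variable [IsNonneg K] (η : U ⟶ K) [IsIso (η.f 0)]

theorem isHomotopyEquivalence_inclusion_tensor
    (h : ∀ s, s ≠ 0 → IsContractible (tensorObjLeft (K.X s) K)) :
    IsHomotopyEquivalence (tensorHom η (𝟙 K)) := by
  obtain ⟨σ, h₀, h₁⟩ := exists_left_contraction h
  exact Splitting.isIso_map_inclusion h₀ h₁ (rowTotal U K) _ (fun s t ↦ η.f s ▷ K.X t)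
    (ι_tensorHom_id η) (fun s t hs ↦ isZero_tensor _ _ (.inl (hU s hs)))
    (fun s t hs ↦ isZero_tensor _ _ (.inl (IsNonneg.isZero s hs)))
    (fun s t ht ↦ isZero_tensor _ _ (.inr (IsNonneg.isZero t ht)))
    fun t ↦ inferInstanceAs (IsIso (η.f 0 ▷ K.X t))

theorem isHomotopyEquivalence_tensor_inclusion
    (h : ∀ s, s ≠ 0 → IsContractible (tensorObjRight K (K.X s))) :
    IsHomotopyEquivalence (tensorHom (𝟙 K) η) := by
  obtain ⟨σ, h₀, h₁⟩ := exists_right_contraction h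
  exact Splitting.isIso_map_inclusion h₀ h₁ (columnTotal K U) _ (fun s t ↦ K.X t ◁ η.f s)
    (fun s t j h ↦ ι_id_tensorHom η t s j _) (fun s t hs ↦ isZero_tensor _ _ (.inr (hU s hs)))
    (fun s t hs ↦ isZero_tensor _ _ (.inr (IsNonneg.isZero s hs)))
    (fun s t ht ↦ isZero_tensor _ _ (.inl (IsNonneg.isZero t ht)))
    fun t ↦ inferInstanceAs (IsIso (K.X t ◁ η.f 0))

end

section

variable [IsNonpos K] (η : K ⟶ U) [IsIso (η.f 0)]

theorem isHomotopyEquivalence_projection_tensor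
    (h : ∀ s, s ≠ 0 → IsContractible (tensorObjLeft (K.X s) K)) :
    IsHomotopyEquivalence (tensorHom η (𝟙 K)) := by
  obtain ⟨σ, h₀, h₁⟩ := exists_left_contraction h
  exact Splitting.isIso_map_projection h₀ h₁ (rowTotal U K) _ (fun s t ↦ η.f s ▷ K.X t)
    (ι_tensorHom_id η) (fun s t hs ↦ isZero_tensor _ _ (.inl (hU s hs)))
    (fun s t hs ↦ isZero_tensor _ _ (.inl (IsNonpos.isZero s hs)))
    (fun s t ht ↦ isZero_tensor _ _ (.inr (IsNonpos.isZero t ht)))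
    fun t ↦ inferInstanceAs (IsIso (η.f 0 ▷ K.X t))

theorem isHomotopyEquivalence_tensor_projection
    (h : ∀ s, s ≠ 0 → IsContractible (tensorObjRight K (K.X s))) :
    IsHomotopyEquivalence (tensorHom (𝟙 K) η) := by
  obtain ⟨σ, h₀, h₁⟩ := exists_right_contraction h
  exact Splitting.isIso_map_projection h₀ h₁ (columnTotal K U) _ (fun s t ↦ K.X t ◁ η.f s)
    (fun s t j h ↦ ι_id_tensorHom η t s j _) (fun s t hs ↦ isZero_tensor _ _ (.inr (hU s hs)))
    (fun s t hs ↦ isZero_tensor _ _ (.inr (IsNonpos.isZero s hs)))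
    (fun s t ht ↦ isZero_tensor _ _ (.inl (IsNonpos.isZero t ht)))
    fun t ↦ inferInstanceAs (IsIso (K.X t ◁ η.f 0))

end

end

end Heis

namespace Heis

open HomologicalComplex YoungDiagram YoungDiagram.OfSize

section

universe v₁ u₁

variable {C : Type u₁} [Category.{v₁} C] [Preadditive C]
  {K : HomologicalComplex C (ComplexShape.down ℤ)} {F : C ⥤ C} [F.Additive]

theorem isZero_map_of_sum {I : Type*} [Fintype I] {G : I → C ⥤ C} [∀ μ, (G μ).Additive]
    (i : ∀ μ, F ⟶ G μ) (r : ∀ μ, G μ ⟶ F)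
    (h : ∀ X, ∑ μ, (i μ).app X ≫ (r μ).app X = 𝟙 (F.obj X))
    (hG : ∀ μ, IsZero ((HomotopyCategory.quotient _ _).obj
      (((G μ).mapHomologicalComplex _).obj K))) :
    IsZero ((HomotopyCategory.quotient _ _).obj ((F.mapHomologicalComplex _).obj K)) := by
  choose τ hτ using fun μ ↦ exists_contraction (hG μ)
  let τ' (μ : I) (j : ℤ) : (G μ).obj (K.X j) ⟶ (G μ).obj (K.X (j + 1)) := τ μ j
  have hτ' (μ : I) (j : ℤ) : (G μ).map (K.d (j + 1) j) ≫ τ' μ j +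
    τ' μ (j + 1) ≫ (G μ).map (K.d (j + 1 + 1) (j + 1)) = 𝟙 _ := hτ μ j
  let s (j : ℤ) : F.obj (K.X j) ⟶ F.obj (K.X (j + 1)) := ∑ μ, (i μ).app _ ≫ τ' μ j ≫ (r μ).app _
  have e : 𝟙 ((F.mapHomologicalComplex (ComplexShape.down ℤ)).obj K) =
      nullMap (K := (F.mapHomologicalComplex _).obj K) (L := (F.mapHomologicalComplex _).obj K) s := by
    refine HomologicalComplex.hom_ext _ _ fun j ↦ ?_
    obtain ⟨j, rfl⟩ : ∃ l, j = l + 1 := ⟨j - 1, by lia⟩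
    refine Eq.trans ?_ (nullMap_f (K := (F.mapHomologicalComplex _).obj K)
      (L := (F.mapHomologicalComplex _).obj K) s j).symm
    change 𝟙 (F.obj (K.X (j + 1))) = F.map (K.d (j + 1) j) ≫ s j +
      s (j + 1) ≫ F.map (K.d (j + 1 + 1) (j + 1))
    rw [Preadditive.comp_sum, Preadditive.sum_comp, ← Finset.sum_add_distrib, ← h]
    refine Finset.sum_congr rfl fun μ _ ↦ ?_
    rw [NatTrans.naturality_assoc, Category.assoc, Category.assoc, ← NatTrans.naturality,
      ← Preadditive.comp_add, ← Category.assoc, ← Category.assoc (τ' μ (j + 1)),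
      ← Preadditive.add_comp, hτ', Category.id_comp]
  refine (IsZero.iff_id_eq_zero _).2 (((HomotopyCategory.quotient _ _).map_id _).symm.trans ?_)
  rw [e]
  exact quotient_map_nullMap _

end

variable {k : Type u} [Field k] [CharZero k]

section

variable {K : Complex k}

theorem isContractible_tensorObjLeft_sigmaObj (hK : IsContractible (tensorObjLeft (Q k) K)) {n : ℕ}
    (hn : 0 < n) : IsContractible (tensorObjLeft (sigmaObj k n) K) := by
  refine isZero_map_of_sum (F := tensorLeft (sigmaObj k n)) (G := fun μ ↦ tensorLeft (PQ k μ))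
    (fun μ ↦ { app := fun X ↦ biproduct.π (PQ k (n := n)) μ ▷ X
               naturality := fun X X' f ↦ whisker_exchange _ _ })
    (fun μ ↦ { app := fun X ↦ biproduct.ι (PQ k (n := n)) μ ▷ X
               naturality := fun X X' f ↦ whisker_exchange _ _ }) (fun X ↦ ?_)
    fun μ ↦ isContractible_tensorObjLeft (𝟙 (PQ k μ)) (𝟙 _) (Category.comp_id _)
      (isContractible_QObj μ.transpose hK hn)
  refine Eq.trans ?_ (congrArg (· ▷ X) (biproduct.total (f := PQ k (n := n))))
  simp only [sum_whiskerRight, comp_whiskerRight]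
  rfl

theorem isContractible_tensorObjRight_sigmaObj (hK : IsContractible (tensorObjRight K (P k)))
    {n : ℕ} (hn : 0 < n) : IsContractible (tensorObjRight K (sigmaObj k n)) := by
  refine isZero_map_of_sum (F := tensorRight (sigmaObj k n)) (G := fun μ ↦ tensorRight (PQ k μ))
    (fun μ ↦ { app := fun X ↦ X ◁ biproduct.π (PQ k (n := n)) μ
               naturality := fun X X' f ↦ (whisker_exchange _ _).symm })
    (fun μ ↦ { app := fun X ↦ X ◁ biproduct.ι (PQ k (n := n)) μ
               naturality := fun X X' f ↦ (whisker_exchange _ _).symm }) (fun X ↦ ?_)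
    fun μ ↦ isContractible_tensorObjRight (𝟙 (PQ k μ)) (𝟙 _) (Category.comp_id _)
      (isContractible_PObj μ hK hn)
  refine Eq.trans ?_ (congrArg (X ◁ ·) (biproduct.total (f := PQ k (n := n))))
  simp only [whiskerLeft_sum, MonoidalCategory.whiskerLeft_comp]
  rfl

variable {A : HeisCat k} (hA : IsZero A)

include hA

theorem isContractible_tensorObjLeft_of_isZero (hK : IsContractible (tensorObjLeft (Q k) K)) :
    IsContractible (tensorObjLeft A K) :=
  isContractible_tensorObjLeft (Y := 𝟙_ _) 0 0 (hA.eq_of_src _ _) hK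

theorem isContractible_tensorObjRight_of_isZero (hK : IsContractible (tensorObjRight K (P k))) :
    IsContractible (tensorObjRight K A) :=
  isContractible_tensorObjRight (Y := 𝟙_ _) 0 0 (hA.eq_of_src _ _) hK

end

section Unit

/-- The direct summand for the empty diagram is the unit object. -/
noncomputable def youngObjZero {x : HeisDiag k} {c : x ⊗ x ⟶ x ⊗ x} (h : IsSymmetry c)
    (μ : OfSize 0) : youngObj h μ ≅ 𝟙_ (HeisCat k) where
  hom := youngIncl h μ
  inv := youngProj h μ
  hom_inv_id := youngIncl_youngProj h μ
  inv_hom_id := (youngProj_youngIncl h μ).trans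
    ((congrArg (symMap h) (youngIdempotent_zero μ)).trans (symMap_one h))

instance : Unique (OfSize 0) where
  default := OfSize.empty
  uniq := eq_empty

variable (k) in
/-- The term in degree zero of `Σ` is the unit object. -/
noncomputable def sigmaObjZero : sigmaObj k 0 ≅ 𝟙_ (HeisCat k) :=
  biproductUniqueIso _ ≪≫ (youngObjZero _ _ ⊗ᵢ youngObjZero _ _) ≪≫ λ_ _

end Unit

section Fock

theorem fock_map_eq_zero {X Z A B Y : HeisCat k} (f : X ⟶ A ⊗ B) (g : A ⊗ B ⟶ Z)
    {i : B ⟶ Y ⊗ Q k} {r : Y ⊗ Q k ⟶ B} (h : i ≫ r = 𝟙 B) : (fock k).map (f ≫ g) = 0 := by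
  rw [← (fock k).map_zero]
  refine CategoryTheory.Quotient.sound _ ⟨A ⊗ Y, f ≫ A ◁ i ≫ (α_ _ _ _).inv,
    (α_ _ _ _).hom ≫ A ◁ r ≫ g, ?_⟩
  rw [sub_zero, Category.assoc, Category.assoc, Iso.inv_hom_id_assoc,
    ← MonoidalCategory.whiskerLeft_comp_assoc, h, MonoidalCategory.whiskerLeft_id,
    Category.id_comp]

theorem isZero_fock_obj_sigmaObj {n : ℕ} (hn : 0 < n) : IsZero ((fock k).obj (sigmaObj k n)) := by
  have h : ∑ μ : OfSize n, biproduct.π (PQ k) μ ≫ biproduct.ι (PQ k) μ = 𝟙 (⨁ PQ k (n := n)) :=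
    biproduct.total
  change IsZero ((fock k).obj (⨁ PQ k (n := n)))
  rw [IsZero.iff_id_eq_zero, ← CategoryTheory.Functor.map_id, ← h, Functor.map_sum]
  refine Finset.sum_eq_zero fun μ _ ↦ ?_
  obtain ⟨Y, i, r, hir⟩ := exists_retract_QObj (k := k) μ.transpose hn
  exact fock_map_eq_zero _ _ hir

theorem isFockEquivalence {K L : Complex k} (η : K ⟶ L) [IsIso (η.f 0)]
    (hK : ∀ s, s ≠ 0 → IsZero ((fock k).obj (K.X s)))
    (hL : ∀ s, s ≠ 0 → IsZero ((fock k).obj (L.X s))) : IsFockEquivalence η := by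
  have (s : ℤ) : IsIso ((((fock k).mapHomologicalComplex _).map η).f s) := by
    by_cases hs : s = 0
    · subst hs
      exact inferInstanceAs (IsIso ((fock k).map (η.f 0)))
    · exact ⟨⟨0, (hK s hs).eq_of_src _ _, (hL s hs).eq_of_src _ _⟩⟩
  have := HomologicalComplex.Hom.isIso_of_components (((fock k).mapHomologicalComplex _).map η)
  exact inferInstanceAs (IsIso ((HomotopyCategory.quotient _ _).map
    (((fock k).mapHomologicalComplex _).map η)))

end Fock

section Unitor

instance (X : HeisCat k) :
    PreservesColimit (Functor.empty.{0} (HeisCat k)) ((curriedTensor (HeisCat k)).flip.obj X) :=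
  have : ((curriedTensor (HeisCat k)).flip.obj X).PreservesZeroMorphisms :=
    inferInstanceAs (tensorRight X).PreservesZeroMorphisms
  inferInstance

theorem unitComplex_isZero (s : ℤ) (hs : s ≠ 0) : IsZero ((unitComplex k).X s) :=
  isZero_single_obj_X _ _ _ _ hs

/-- The unit complex acts trivially, up to homotopy. -/
noncomputable def unitorHomotopy (K : Complex k) [HasTensor (unitComplex k) K] :
    (toHomotopy k).obj (tensorObj (unitComplex k) K) ≅ (toHomotopy k).obj K :=
  (toHomotopy k).mapIso (leftUnitor K)

end Unitor

end Heis

namespace Heis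

open HomologicalComplex YoungDiagram YoungDiagram.OfSize

variable {k : Type u} [Field k] [CharZero k] {ε : YoungDiagram → YoungDiagram → kˣ}

theorem isIso_mkHomFromSingle {A : HeisCat k} {K : Complex k} {j : ℤ} (φ : A ⟶ K.X j) (hφ)
    (_ : IsIso φ) : IsIso ((mkHomFromSingle φ hφ).f j) := by
  rw [mkHomFromSingle_f]
  infer_instance

theorem isIso_mkHomToSingle {A : HeisCat k} {K : Complex k} {j : ℤ} (φ : K.X j ⟶ A) (hφ)
    (_ : IsIso φ) : IsIso ((mkHomToSingle φ hφ).f j) := by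
  rw [mkHomToSingle_f]
  infer_instance

section Minus

variable (h : ∀ n, dMinus k ε (n + 1) ≫ dMinus k ε n = 0)

theorem sigmaMinus_X_cases (s : ℤ) (hs : s ≠ 0) :
    (∃ n, 0 < n ∧ (sigmaMinus k ε h).X s = sigmaObj k n) ∨ IsZero ((sigmaMinus k ε h).X s) := by
  obtain (_ | n) | n := s
  · exact absurd rfl hs
  · exact .inl ⟨n + 1, n.succ_pos, rfl⟩
  · exact .inr (isZero_zero _)

/-- The unit map of `Σ⁻`. -/
noncomputable def unitMinus : unitComplex k ⟶ sigmaMinus k ε h :=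
  mkHomFromSingle (K := sigmaMinus k ε h) (j := 0) (sigmaObjZero k).inv fun i hi ↦
    (IsNonneg.isZero i (by have : i + 1 = 0 := hi; lia)).eq_of_tgt _ _

instance : IsIso ((unitMinus h).f 0) :=
  isIso_mkHomFromSingle _ _ (Iso.isIso_inv (sigmaObjZero k))

end Minus

section Plus

variable (h : ∀ n, dPlus k ε n ≫ dPlus k ε (n + 1) = 0)

theorem sigmaPlus_X_cases (s : ℤ) (hs : s ≠ 0) :
    (∃ n, 0 < n ∧ (sigmaPlus k ε h).X s = sigmaObj k n) ∨ IsZero ((sigmaPlus k ε h).X s) := by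
  obtain (_ | n) | n := s
  · exact absurd rfl hs
  · exact .inr (isZero_zero _)
  · exact .inl ⟨n + 1, n.succ_pos, rfl⟩

/-- The counit map of `Σ⁺`. -/
noncomputable def counitPlus : sigmaPlus k ε h ⟶ unitComplex k :=
  mkHomToSingle (K := sigmaPlus k ε h) (j := 0) (sigmaObjZero k).hom fun i hi ↦
    (IsNonpos.isZero i (by have : 0 + 1 = i := hi; lia)).eq_of_src _ _

instance : IsIso ((counitPlus h).f 0) :=
  isIso_mkHomToSingle _ _ (Iso.isIso_hom (sigmaObjZero k))

end Plus

section

variable {K : Complex k}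
  (hX : ∀ s, s ≠ 0 → (∃ n, 0 < n ∧ K.X s = sigmaObj k n) ∨ IsZero (K.X s))

include hX

theorem isZero_fock_obj (s : ℤ) (hs : s ≠ 0) : IsZero ((fock k).obj (K.X s)) := by
  obtain ⟨n, hn, e⟩ | h := hX s hs
  · rw [e]
    exact isZero_fock_obj_sigmaObj hn
  · exact (fock k).map_isZero h

theorem isContractible_tensorObjLeft_X (hQ : IsContractible (tensorObjLeft (Q k) K)) (s : ℤ)
    (hs : s ≠ 0) : IsContractible (tensorObjLeft (K.X s) K) := by
  obtain ⟨n, hn, e⟩ | h := hX s hs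
  · rw [e]
    exact isContractible_tensorObjLeft_sigmaObj hQ hn
  · exact isContractible_tensorObjLeft_of_isZero h hQ

theorem isContractible_tensorObjRight_X (hP : IsContractible (tensorObjRight K (P k))) (s : ℤ)
    (hs : s ≠ 0) : IsContractible (tensorObjRight K (K.X s)) := by
  obtain ⟨n, hn, e⟩ | h := hX s hs
  · rw [e]
    exact isContractible_tensorObjRight_sigmaObj hP hn
  · exact isContractible_tensorObjRight_of_isZero h hP

end

end Heis

/-- `Σ⁻` and `Σ⁺` annihilate all `P^λ` from the left and are annihilated by all `Q^λ` from the left,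
and they are the idempotents that project onto categorical Fock space. -/
theorem mainTheorem6 (k : Type u) [Field k] [CharZero k] :
    -- the coefficients can be chosen to be signs
    (∃ ε : YoungDiagram → YoungDiagram → kˣ, (∀ μ ν, ε μ ν = 1 ∨ ε μ ν = -1) ∧
      (∀ n, dMinus k ε (n + 1) ≫ dMinus k ε n = 0) ∧
      (∀ n, dPlus k ε n ≫ dPlus k ε (n + 1) = 0)) ∧
    (∀ (ε : YoungDiagram → YoungDiagram → kˣ)
      (h : ∀ n, dMinus k ε (n + 1) ≫ dMinus k ε n = 0),
      (∀ (m : ℕ) (l : YoungDiagram.OfSize m), 0 < m →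
        IsContractible (tensorObjRight (sigmaMinus k ε h) (PObj k l)) ∧
        IsContractible (tensorObjLeft (QObj k l) (sigmaMinus k ε h))) ∧
      (∃ η : unitComplex k ⟶ sigmaMinus k ε h, IsIso (η.f 0) ∧
        IsHomotopyEquivalence (HomologicalComplex.tensorHom η (𝟙 (sigmaMinus k ε h))) ∧
        IsHomotopyEquivalence (HomologicalComplex.tensorHom (𝟙 (sigmaMinus k ε h)) η) ∧
        IsFockEquivalence η) ∧
      Nonempty ((toHomotopy k).obj
          (HomologicalComplex.tensorObj (sigmaMinus k ε h) (sigmaMinus k ε h)) ≅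
        (toHomotopy k).obj (sigmaMinus k ε h))) ∧
    (∀ (ε : YoungDiagram → YoungDiagram → kˣ)
      (h : ∀ n, dPlus k ε n ≫ dPlus k ε (n + 1) = 0),
      (∀ (m : ℕ) (l : YoungDiagram.OfSize m), 0 < m →
        IsContractible (tensorObjRight (sigmaPlus k ε h) (PObj k l)) ∧
        IsContractible (tensorObjLeft (QObj k l) (sigmaPlus k ε h))) ∧
      (∃ η : sigmaPlus k ε h ⟶ unitComplex k, IsIso (η.f 0) ∧
        IsHomotopyEquivalence (HomologicalComplex.tensorHom η (𝟙 (sigmaPlus k ε h))) ∧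
        IsHomotopyEquivalence (HomologicalComplex.tensorHom (𝟙 (sigmaPlus k ε h)) η) ∧
        IsFockEquivalence η) ∧
      Nonempty ((toHomotopy k).obj
          (HomologicalComplex.tensorObj (sigmaPlus k ε h) (sigmaPlus k ε h)) ≅
        (toHomotopy k).obj (sigmaPlus k ε h))) := by
  refine ⟨exists_signs k, fun ε h ↦ ?_, fun ε h ↦ ?_⟩
  · have hX := sigmaMinus_X_cases h
    have hP := isContractible_sigmaMinus_P h
    have hQ := isContractible_Q_sigmaMinus h
    have hη := isHomotopyEquivalence_inclusion_tensor unitComplex_isZero (unitMinus h)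
      (isContractible_tensorObjLeft_X hX hQ)
    refine ⟨fun m l hm ↦ ⟨isContractible_PObj l hP hm, isContractible_QObj l hQ hm⟩,
      ⟨unitMinus h, inferInstance, hη, isHomotopyEquivalence_tensor_inclusion unitComplex_isZero _
        (isContractible_tensorObjRight_X hX hP), isFockEquivalence _
          (fun s hs ↦ (fock k).map_isZero (unitComplex_isZero s hs)) (isZero_fock_obj hX)⟩, ?_⟩
    have : IsIso _ := hη
    exact ⟨(asIso ((toHomotopy k).map (HomologicalComplex.tensorHom (unitMinus h) (𝟙 _)))).symm ≪≫ unitorHomotopy _⟩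
  · have hX := sigmaPlus_X_cases h
    have hP := isContractible_sigmaPlus_P h
    have hQ := isContractible_Q_sigmaPlus h
    have hη := isHomotopyEquivalence_projection_tensor unitComplex_isZero (counitPlus h)
      (isContractible_tensorObjLeft_X hX hQ)
    refine ⟨fun m l hm ↦ ⟨isContractible_PObj l hP hm, isContractible_QObj l hQ hm⟩,
      ⟨counitPlus h, inferInstance, hη, isHomotopyEquivalence_tensor_projection unitComplex_isZero _
        (isContractible_tensorObjRight_X hX hP), isFockEquivalence _ (isZero_fock_obj hX)
          fun s hs ↦ (fock k).map_isZero (unitComplex_isZero s hs)⟩, ?_⟩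
    have : IsIso _ := hη
    exact ⟨asIso ((toHomotopy k).map (HomologicalComplex.tensorHom (counitPlus h) (𝟙 _))) ≪≫ unitorHomotopy _⟩
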